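/- **Theorem.** Let $\mathcal C$ be a fusion category over $\mathbb C$ (a $\mathbb C$-linear abelian rigid monoidal category with bilinear tensor product, finite-dimensional Hom spaces, simple unit, finitely many isomorphism classes of simple objects, and every object a finite direct sum of simple objects). Let $Q$ be a finite quiver with vertex set $V$, let $n\ge 2$, and let $A=\mathbb CQ/I_n$ be the truncated path algebra, where $I_n$ is spanned by the paths of length at least $n$ (paths are composed from left to right). *Basic actions.* Equip $A$ with the quiver data $\delta^1:A/\operatorname{rad}A\to A$, $\delta^2:\operatorname{rad}A/\operatorname{rad}^2A\to\operatorname{rad}A$ that send the class of a vertex to the vertex and the class of an arrow to the arrow. Let $\mathbf{BSA}(A,\delta^1,\delta^2)$ be the monoidal category (under $\otimes_A$) of dualizable $A$-$A$-bimodules $M$ with $\operatorname{rad}A\cdot M=M\cdot\operatorname{rad}A=:\operatorname{rad}M$ and linear sections $\delta^1_M:M/\operatorname{rad}M\to M$, $\delta^2_M:\operatorname{rad}M/\operatorname{rad}^2M\to\operatorname{rad}M$ of the projections that are bilinear over $\delta^1(A/\operatorname{rad}A)$ and satisfy $\delta^2(x)\delta^1_M(m)=\delta^2_M(xm)$ and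 $\delta^1_M(m)\delta^2(y)=\delta^2_M(my)$; morphisms are the bimodule maps $f$ with $f\delta^1_M=\delta^1_N\tilde f$. A basic action of $\mathcal C$ on $A$ is a $\mathbb C$-linear monoidal functor $\Phi:\mathcal C\to\mathbf{BSA}(A,\delta^1,\delta^2)$. Write $\Gamma_X(i,j)=e_i\,\delta^1(\Phi(X)/\operatorname{rad}\Phi(X))\,e_j$ for vertices $i,j$. *Parameters.* Let $\mathrm{Vec}(V)$ be the category of $V$-indexed families of finite-dimensional vector spaces, with simple objects $\delta_i$, $i\in V$. Consider pairs $(\mathcal M,F)$ where $\mathcal M$ is a ($\mathbb C$-bilinear, left) $\mathcal C$-module category structure on $\mathrm{Vec}(V)$, with action $\odot$, and $F$ is an object of the dual category $\mathcal C^*_{\mathcal M}$, i.e. a $\mathbb C$-linear $\mathcal C$-module endofunctor of $\mathcal M$. The fusion graph of $F$ has vertex set $V$ and $\dim\operatorname{Hom}(\delta_i,F\delta_j)$ edges from $i$ to $j$. A framing of $(\mathcal M,F)$ by $Q$ is a family of bases of the spaces $\operatorname{Hom}(\delta_i,F\delta_j)$ indexed by the arrows $i\to j$ of $Q$. An isomorphism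 of framed pairs is a $\mathcal C$-module functor structure $\mathcal M\to\mathcal M'$ on the identity functor of $\mathrm{Vec}(V)$ together with a compatible isomorphism $F\cong F'$ of module functors that carries one framing to the other. Two pairs are equivalent if there is a $\mathbb C$-linear equivalence $\Psi:\mathcal M\to\mathcal M'$ of module categories with $\Psi F\cong F'\Psi$ as module functors. *Relation.* Say that $\Phi$ realizes the framed pair $(\mathcal M,F,\varphi)$ if there are linear isomorphisms $\Gamma_X(i,j)\cong\operatorname{Hom}(\delta_i,X\odot\delta_j)$, natural in $X\in\mathcal C$, that identify the monoidal structure of $\Phi$ with the associativity and unit isomorphisms of $\mathcal M$ and such that, when $\varphi$ identifies arrows of $Q$ with elements of $\operatorname{Hom}(\delta_i,F\delta_j)$, rewriting an arrow times an element of $\Gamma_X$ as a sum of elements of $\Gamma_X$ times arrows, inside $\Phi(X)$, corresponds to the module functor isomorphism $F(X\odot\delta_j)\cong X\odot F\delta_j$. Then: 1. Monoidal natural isomorphism of basic actions and isomorphism of framed pairs are equivalence relations, and there is a bijection from the isomorphism classes of basic actions of $\mathcal C$ on $A$ to the isomorphism classes of pairs $(\mathcal M,F)$ framed by $Q$, under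 which $[\Phi]$ corresponds to $[(\mathcal M,F,\varphi)]$ if and only if $\Phi$ realizes $(\mathcal M,F,\varphi)$. 2. Call two basic actions isomorphic up to an automorphism if, for some algebra automorphism $\tau$ of $A$ commuting with $\delta^1$ and $\delta^2$, there are natural, monoidal, $\tau$-semilinear linear bijections $\Phi(X)\to\Phi'(X)$ compatible with $\delta^1$. This and equivalence of pairs are equivalence relations, and there is a bijection from the classes of basic actions of $\mathcal C$ on $A$ up to isomorphism and automorphisms of $(A,\delta^1,\delta^2)$ to the equivalence classes of pairs $(\mathcal M,F)$ such that the fusion graph of $F$ is isomorphic to $Q$. Under it $[\Phi]$ corresponds to $[(\mathcal M,F)]$ if and only if $\Phi$ realizes, with some framing, a pair equivalent to $(\mathcal M,F)$. -/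

import Mathlib

open CategoryTheory MonoidalCategory MulOpposite
open scoped TensorProduct

universe u v w

namespace BasicAction

/-! ### Fusion categories -/

/-- A fusion category over `k`: a `k`-linear abelian rigid monoidal category with bilinear tensor
product and finite dimensional Hom spaces, in which every object is a finite direct sum of simple
objects, there are finitely many simple objects up to isomorphism, and the unit is simple. -/
class IsFusionCategory (k : Type*) [Field k] (C : Type*) [Category* C] [Abelian C] [Linear k C]
    [MonoidalCategory C] [MonoidalPreadditive C] [MonoidalLinear k C] [RigidCategory C] :
    Prop where
  finite_hom : ∀ X Y : C, Module.Finite k (X ⟶ Y)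
  semisimple : ∀ X : C, ∃ (n : ℕ) (S : Fin n → C) (b : Limits.Bicone S),
    (∀ i, Simple (S i)) ∧ Nonempty b.IsBilimit ∧ Nonempty (X ≅ b.pt)
  finite_simples : ∃ (n : ℕ) (S : Fin n → C), ∀ X : C, Simple X → ∃ i, Nonempty (X ≅ S i)
  simple_unit : Simple (𝟙_ C)

/-! ### Quiver data on an algebra -/

section Algebra

variable (k A : Type u) [Field k] [Ring A] [Algebra k A]

/-- The Jacobson radical of `A`, as a `k`-subspace. -/
def rad : Submodule k A := (Ring.jacobson A).restrictScalars k

/-- Quiver data `(δ₁, δ₂)` on an algebra `A`: a multiplicative linear section `δ₁` of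
`A → A / rad A` and a section `δ₂` of `rad A → rad A / rad² A` that is bilinear over the image of
`δ₁` (which acts on `rad A / rad² A` through representatives). -/
structure QuiverData where
  δ₁ : (A ⧸ Ring.jacobson A) →ₗ[k] A
  δ₂ : (rad k A ⧸ ((rad k A) ^ 2).submoduleOf (rad k A)) →ₗ[k] rad k A
  π₁_δ₁ : ∀ x, Ideal.Quotient.mk (Ring.jacobson A) (δ₁ x) = x
  π₂_δ₂ : ∀ z, (((rad k A) ^ 2).submoduleOf (rad k A)).mkQ (δ₂ z) = z
  δ₁_mul : ∀ x y, δ₁ (x * y) = δ₁ x * δ₁ y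
  δ₂_bilin : ∀ (x y : A ⧸ Ring.jacobson A) (z z' : rad k A), (z' : A) = δ₁ x * z * δ₁ y →
    (δ₂ (Submodule.Quotient.mk z') : A) = δ₁ x * δ₂ (Submodule.Quotient.mk z) * δ₁ y

end Algebra

namespace QuiverData

variable {k A : Type u} [Field k] [Ring A] [Algebra k A] (D : QuiverData k A)

lemma mem_rad {a : A} : a ∈ rad k A ↔ a ∈ Ring.jacobson A := Iff.rfl

lemma mul_mem_rad_left (a : A) {b : A} (hb : b ∈ rad k A) : a * b ∈ rad k A :=
  (Ring.jacobson A).mul_mem_left a hb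

lemma mul_mem_rad_right {a : A} (b : A) (ha : a ∈ rad k A) : a * b ∈ rad k A :=
  (Ring.jacobson A).mul_mem_right b ha

lemma δ₁_one : D.δ₁ 1 = 1 := by
  have h1 : D.δ₁ 1 * D.δ₁ 1 = D.δ₁ 1 := by rw [← D.δ₁_mul, one_mul]
  have h2 : D.δ₁ 1 - 1 ∈ Ring.jacobson A := by
    rw [← Ideal.Quotient.mk_eq_mk_iff_sub_mem, D.π₁_δ₁]; rfl
  obtain ⟨s, hs⟩ := Ideal.exists_mul_sub_mem_of_sub_one_mem_jacobson (I := ⊥) (D.δ₁ 1)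
    (by rwa [Ideal.jacobson_bot])
  have h3 : s * D.δ₁ 1 = 1 := by
    rw [Ideal.mem_bot, sub_eq_zero] at hs; exact hs
  calc D.δ₁ 1 = (s * D.δ₁ 1) * D.δ₁ 1 := by rw [h3, one_mul]
    _ = s * D.δ₁ 1 := by rw [mul_assoc, h1]
    _ = 1 := h3

/-- The projection `δ₁ ∘ π₁` of `A` onto the lift of `A / rad A`. -/
def p : A →ₗ[k] A := D.δ₁ ∘ₗ (Ideal.Quotient.mkₐ k (Ring.jacobson A)).toLinearMap

lemma p_apply (a : A) : D.p a = D.δ₁ (Ideal.Quotient.mk _ a) := rfl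

lemma sub_p_mem (a : A) : a - D.p a ∈ rad k A := by
  rw [mem_rad, ← Ideal.Quotient.mk_eq_mk_iff_sub_mem, p_apply, D.π₁_δ₁]

/-- The degree one component `a ↦ δ₂ [a - δ₁ [a]]` of an element of `A`. -/
def d : A →ₗ[k] A := (rad k A).subtype ∘ₗ D.δ₂ ∘ₗ
  (((rad k A) ^ 2).submoduleOf (rad k A)).mkQ ∘ₗ
    (LinearMap.id - D.p).codRestrict (rad k A) (fun a => D.sub_p_mem a)

lemma d_apply (a : A) : D.d a = D.δ₂ (Submodule.Quotient.mk ⟨a - D.p a, D.sub_p_mem a⟩) := rfl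

lemma d_mem (a : A) : D.d a ∈ rad k A := Subtype.property _

lemma p_one : D.p 1 = 1 := by rw [p_apply, map_one, δ₁_one]

lemma p_mul (a b : A) : D.p (a * b) = D.p a * D.p b := by
  rw [p_apply, map_mul, D.δ₁_mul]; rfl

lemma p_rad {a : A} (ha : a ∈ rad k A) : D.p a = 0 := by
  rw [p_apply, Ideal.Quotient.eq_zero_iff_mem.2 ha, map_zero]

lemma p_p (a : A) : D.p (D.p a) = D.p a := by
  rw [p_apply, p_apply, D.π₁_δ₁]

lemma d_p (a : A) : D.d (D.p a) = 0 := by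
  have : (⟨D.p a - D.p (D.p a), D.sub_p_mem (D.p a)⟩ : rad k A) = 0 := by
    ext; simp [p_p]
  rw [d_apply, this, Submodule.Quotient.mk_zero, map_zero]; rfl

lemma mk_rad_eq {x y : rad k A} (h : (x : A) - y ∈ (rad k A) ^ 2) :
    (Submodule.Quotient.mk x : rad k A ⧸ ((rad k A) ^ 2).submoduleOf (rad k A)) =
      Submodule.Quotient.mk y := by
  rw [Submodule.Quotient.eq]; exact h

lemma d_of_mem {a : A} (ha : a ∈ rad k A) : D.d a = D.δ₂ (Submodule.Quotient.mk ⟨a, ha⟩) := by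
  rw [d_apply]; congr 3; simp [D.p_rad ha]

lemma sub_d_mem {a : A} (ha : a ∈ rad k A) : a - D.d a ∈ (rad k A) ^ 2 := by
  have := D.π₂_δ₂ (Submodule.Quotient.mk ⟨a, ha⟩)
  rw [Submodule.mkQ_apply, eq_comm, Submodule.Quotient.eq] at this
  rw [d_of_mem D ha]; exact this

lemma d_mul (a b : A) : D.d (a * b) = D.p a * D.d b + D.d a * D.p b := by
  have hn := D.sub_p_mem b
  have hr := D.sub_p_mem a
  have hm : ∀ x y : A, D.δ₁ (Ideal.Quotient.mk _ x) * y * D.δ₁ 1 = D.p x * y := by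
    intro x y; rw [D.δ₁_one, mul_one]; rfl
  have hm' : ∀ x y : A, D.δ₁ 1 * y * D.δ₁ (Ideal.Quotient.mk _ x) = y * D.p x := by
    intro x y; rw [D.δ₁_one, one_mul]; rfl
  have e1 := D.δ₂_bilin (Ideal.Quotient.mk _ a) 1 ⟨_, hn⟩
    ⟨D.p a * (b - D.p b), mul_mem_rad_left _ hn⟩ (hm _ _).symm
  have e2 := D.δ₂_bilin 1 (Ideal.Quotient.mk _ b) ⟨_, hr⟩
    ⟨(a - D.p a) * D.p b, mul_mem_rad_right _ hr⟩ (hm' _ _).symm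
  rw [hm] at e1
  rw [hm'] at e2
  rw [d_apply D b, d_apply D a, ← e1, ← e2, ← Submodule.coe_add, ← map_add,
    ← Submodule.Quotient.mk_add, d_apply]
  congr 2
  apply mk_rad_eq
  have : (a * b - D.p (a * b)) - (D.p a * (b - D.p b) + (a - D.p a) * D.p b) =
      (a - D.p a) * (b - D.p b) := by rw [p_mul]; noncomm_ring
  change (a * b - D.p (a * b)) - (D.p a * (b - D.p b) + (a - D.p a) * D.p b) ∈ _
  rw [this, pow_two]
  exact Submodule.mul_mem_mul hr hn

end QuiverData

/-! ### Bimodules with quiver data -/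

/-- An `A`-`A`-bimodule over `k` (on which `k` acts centrally): a `k`-vector space with a left
action `l` and a right action `r` of `A` that commute. -/
structure Bimodule (k A : Type u) [Field k] [Ring A] [Algebra k A] where
  carrier : Type u
  [addCommGroup : AddCommGroup carrier]
  [module : Module k carrier]
  l : A →ₐ[k] Module.End k carrier
  r : Aᵐᵒᵖ →ₐ[k] Module.End k carrier
  comm : ∀ (a b : A) (m : carrier), l a (r (op b) m) = r (op b) (l a m)

attribute [instance] Bimodule.addCommGroup Bimodule.module

namespace Bimodule

variable {k A : Type u} [Field k] [Ring A] [Algebra k A] (M : Bimodule k A)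

/-- `rad A · N`, the span of the products `a n` with `a ∈ rad A` and `n ∈ N`. -/
def radMul (N : Submodule k M.carrier) : Submodule k M.carrier :=
  Submodule.span k {x | ∃ a ∈ rad k A, ∃ n ∈ N, x = M.l a n}

/-- `N · rad A`, the span of the products `n a` with `a ∈ rad A` and `n ∈ N`. -/
def mulRad (N : Submodule k M.carrier) : Submodule k M.carrier :=
  Submodule.span k {x | ∃ a ∈ rad k A, ∃ n ∈ N, x = M.r (op a) n}

/-- `M` is radically symmetric if `rad A · M = M · rad A`. -/
def RadSymm : Prop := M.radMul ⊤ = M.mulRad ⊤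

/-- `rad M = rad A · M`. -/
def radM : Submodule k M.carrier := M.radMul ⊤

/-- `rad² M = rad A · rad M`. -/
def radSq : Submodule k M.carrier := M.radMul M.radM

/-- `rad² M`, as a subspace of `rad M`. -/
abbrev radSq' : Submodule k M.radM := M.radSq.submoduleOf M.radM

variable {M}

lemma l_mem_radM {a : A} (ha : a ∈ rad k A) (m : M.carrier) : M.l a m ∈ M.radM :=
  Submodule.subset_span ⟨a, ha, m, trivial, rfl⟩

lemma l_mem_radSq {a : A} (ha : a ∈ rad k A) {m : M.carrier} (hm : m ∈ M.radM) :
    M.l a m ∈ M.radSq :=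
  Submodule.subset_span ⟨a, ha, m, hm, rfl⟩

lemma l_l (a b : A) (m : M.carrier) : M.l a (M.l b m) = M.l (a * b) m := by
  rw [map_mul]; rfl

lemma r_r (a b : A) (m : M.carrier) : M.r (op b) (M.r (op a) m) = M.r (op (a * b)) m := by
  rw [op_mul, map_mul]; rfl

@[simp] lemma l_one (m : M.carrier) : M.l 1 m = m := by rw [map_one]; rfl

@[simp] lemma r_one (m : M.carrier) : M.r (op 1) m = m := by rw [op_one, map_one]; rfl

lemma l_add (a b : A) (m : M.carrier) : M.l (a + b) m = M.l a m + M.l b m := by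
  rw [map_add]; rfl

lemma l_sub (a b : A) (m : M.carrier) : M.l (a - b) m = M.l a m - M.l b m := by
  rw [map_sub]; rfl

lemma r_sub (a b : A) (m : M.carrier) :
    M.r (op (a - b)) m = M.r (op a) m - M.r (op b) m := by
  rw [MulOpposite.op_sub, map_sub]; rfl

lemma radMul_le {N P : Submodule k M.carrier}
    (h : ∀ a ∈ rad k A, ∀ n ∈ N, M.l a n ∈ P) : M.radMul N ≤ P := by
  refine Submodule.span_le.2 ?_
  rintro x ⟨a, ha, n, hn, rfl⟩
  exact h a ha n hn

lemma mulRad_le {N P : Submodule k M.carrier}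
    (h : ∀ a ∈ rad k A, ∀ n ∈ N, M.r (op a) n ∈ P) : M.mulRad N ≤ P := by
  refine Submodule.span_le.2 ?_
  rintro x ⟨a, ha, n, hn, rfl⟩
  exact h a ha n hn

lemma l_mem_radM' (a : A) {m : M.carrier} (hm : m ∈ M.radM) : M.l a m ∈ M.radM := by
  have : M.radM ≤ M.radM.comap (M.l a) := radMul_le fun b hb n _ => by
    rw [Submodule.mem_comap, l_l]
    exact l_mem_radM (QuiverData.mul_mem_rad_left _ hb) _
  exact this hm

lemma r_mem_radM' (a : A) {m : M.carrier} (hm : m ∈ M.radM) : M.r (op a) m ∈ M.radM := by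
  have : M.radM ≤ M.radM.comap (M.r (op a)) := radMul_le fun b hb n _ => by
    rw [Submodule.mem_comap, ← M.comm]
    exact l_mem_radM hb _
  exact this hm

lemma r_mem_radM (hM : M.RadSymm) {a : A} (ha : a ∈ rad k A) (m : M.carrier) :
    M.r (op a) m ∈ M.radM := by
  rw [radM, hM]; exact Submodule.subset_span ⟨a, ha, m, trivial, rfl⟩

lemma r_mem_radSq (hM : M.RadSymm) {a : A} (ha : a ∈ rad k A) {m : M.carrier}
    (hm : m ∈ M.radM) : M.r (op a) m ∈ M.radSq := by
  have : M.radM ≤ M.radSq.comap (M.r (op a)) := radMul_le fun b hb n _ => by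
    rw [Submodule.mem_comap, ← M.comm]
    exact l_mem_radSq hb (r_mem_radM hM ha _)
  exact this hm

lemma radSq_le : M.radSq ≤ M.radM := radMul_le fun _ ha _ _ => l_mem_radM ha _

lemma mk_rad_eq {x y : M.radM} (h : (x : M.carrier) - y ∈ M.radSq) :
    (Submodule.Quotient.mk x : M.radM ⧸ M.radSq') = Submodule.Quotient.mk y := by
  rw [Submodule.Quotient.eq]; exact h

end Bimodule

/-- A radically symmetric bimodule with quiver data `(δ₁, δ₂)`, over an algebra with quiver data
`D`: linear sections of `M → M / rad M` and `rad M → rad M / rad² M`, bilinear over the image of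
`D.δ₁` and compatible with `D.δ₂`. The actions on `M / rad M` and `rad M / rad² M`, and the
products `rad A / rad² A × M / rad M → rad M / rad² M` and
`M / rad M × rad A / rad² A → rad M / rad² M`, are expressed on representatives. -/
structure QBimodule {k A : Type u} [Field k] [Ring A] [Algebra k A] (D : QuiverData k A)
    extends Bimodule k A where
  radSymm : toBimodule.RadSymm
  δ₁ : (carrier ⧸ toBimodule.radM) →ₗ[k] carrier
  δ₂ : (toBimodule.radM ⧸ toBimodule.radSq') →ₗ[k] toBimodule.radM
  π₁_δ₁ : ∀ u, toBimodule.radM.mkQ (δ₁ u) = u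
  π₂_δ₂ : ∀ w, toBimodule.radSq'.mkQ (δ₂ w) = w
  δ₁_bilin : ∀ (x y : A ⧸ Ring.jacobson A) (m : carrier),
    δ₁ (Submodule.Quotient.mk (l (D.δ₁ x) (r (op (D.δ₁ y)) m))) =
      l (D.δ₁ x) (r (op (D.δ₁ y)) (δ₁ (Submodule.Quotient.mk m)))
  δ₂_bilin : ∀ (x y : A ⧸ Ring.jacobson A) (w w' : toBimodule.radM),
    (w' : carrier) = l (D.δ₁ x) (r (op (D.δ₁ y)) w) →
    (δ₂ (Submodule.Quotient.mk w') : carrier) =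
      l (D.δ₁ x) (r (op (D.δ₁ y)) (δ₂ (Submodule.Quotient.mk w)))
  compat_left : ∀ (x : rad k A) (m : carrier) (w : toBimodule.radM), (w : carrier) = l x m →
    l (D.δ₂ (Submodule.Quotient.mk x)) (δ₁ (Submodule.Quotient.mk m)) =
      δ₂ (Submodule.Quotient.mk w)
  compat_right : ∀ (y : rad k A) (m : carrier) (w : toBimodule.radM),
    (w : carrier) = r (op y) m →
    r (op (D.δ₂ (Submodule.Quotient.mk y) : A)) (δ₁ (Submodule.Quotient.mk m)) =
      δ₂ (Submodule.Quotient.mk w)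

namespace QBimodule

variable {k A : Type u} [Field k] [Ring A] [Algebra k A] {D : QuiverData k A}

section Projections

variable (M : QBimodule D)

/-- The projection `δ₁ ∘ π₁` of `M` onto the lift of `M / rad M`. -/
def p : M.carrier →ₗ[k] M.carrier := M.δ₁ ∘ₗ M.radM.mkQ

lemma p_apply (m : M.carrier) : M.p m = M.δ₁ (Submodule.Quotient.mk m) := rfl

lemma sub_p_mem (m : M.carrier) : m - M.p m ∈ M.radM := by
  rw [← Submodule.Quotient.eq]
  exact (M.π₁_δ₁ _).symm

/-- The degree one component `m ↦ δ₂ [m - δ₁ [m]]` of an element of `M`. -/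
def d : M.carrier →ₗ[k] M.carrier := M.radM.subtype ∘ₗ M.δ₂ ∘ₗ M.radSq'.mkQ ∘ₗ
    (LinearMap.id - M.p).codRestrict M.radM (fun m => M.sub_p_mem m)

lemma d_apply (m : M.carrier) :
    M.d m = M.δ₂ (Submodule.Quotient.mk ⟨m - M.p m, M.sub_p_mem m⟩) := rfl

lemma d_mem (m : M.carrier) : M.d m ∈ M.radM := Subtype.property _

lemma p_rad {m : M.carrier} (hm : m ∈ M.radM) : M.p m = 0 := by
  rw [p_apply, (Submodule.Quotient.mk_eq_zero _).2 hm, map_zero]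

lemma p_p (m : M.carrier) : M.p (M.p m) = M.p m := by
  have := M.p_rad (M.sub_p_mem m)
  rw [map_sub, sub_eq_zero] at this; exact this.symm

lemma d_p (m : M.carrier) : M.d (M.p m) = 0 := by
  have : (⟨M.p m - M.p (M.p m), M.sub_p_mem (M.p m)⟩ : M.radM) = 0 := by
    ext; simp [p_p]
  rw [d_apply, this, Submodule.Quotient.mk_zero, map_zero]; rfl

lemma d_of_mem {m : M.carrier} (hm : m ∈ M.radM) :
    M.d m = M.δ₂ (Submodule.Quotient.mk ⟨m, hm⟩) := by
  rw [d_apply]; congr 3; simp [M.p_rad hm]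

lemma sub_d_mem {m : M.carrier} (hm : m ∈ M.radM) : m - M.d m ∈ M.radSq := by
  have := M.π₂_δ₂ (Submodule.Quotient.mk ⟨m, hm⟩)
  rw [Submodule.mkQ_apply, eq_comm, Submodule.Quotient.eq] at this
  rw [d_of_mem M hm]; exact this

lemma p_l (a : A) (m : M.carrier) : M.p (M.l a m) = M.l (D.p a) (M.p m) := by
  have h1 : M.p (M.l (a - D.p a) m) = 0 := M.p_rad (Bimodule.l_mem_radM (D.sub_p_mem a) _)
  have h2 := M.δ₁_bilin (Ideal.Quotient.mk _ a) 1 m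
  simp only [D.δ₁_one, Bimodule.r_one] at h2
  rw [Bimodule.l_sub, map_sub, sub_eq_zero] at h1
  rw [h1]; exact h2

lemma p_r (a : A) (m : M.carrier) : M.p (M.r (op a) m) = M.r (op (D.p a)) (M.p m) := by
  have h1 : M.p (M.r (op (a - D.p a)) m) = 0 :=
    M.p_rad (Bimodule.r_mem_radM M.radSymm (D.sub_p_mem a) _)
  have h2 := M.δ₁_bilin 1 (Ideal.Quotient.mk _ a) m
  simp only [D.δ₁_one, Bimodule.l_one] at h2
  rw [Bimodule.r_sub, map_sub, sub_eq_zero] at h1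
  rw [h1]; exact h2

lemma d_l (a : A) (m : M.carrier) :
    M.d (M.l a m) = M.l (D.p a) (M.d m) + M.l (D.d a) (M.p m) := by
  have hn := M.sub_p_mem m
  have hr := D.sub_p_mem a
  have e1 := M.δ₂_bilin (Ideal.Quotient.mk _ a) 1 ⟨_, hn⟩
    ⟨M.l (D.p a) (m - M.p m), Bimodule.l_mem_radM' _ hn⟩ (by
      rw [D.δ₁_one, Bimodule.r_one]; rfl)
  have e2 := M.compat_left ⟨_, hr⟩ (M.p m)
    ⟨M.l (a - D.p a) (M.p m), Bimodule.l_mem_radM hr _⟩ rfl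
  rw [D.δ₁_one, Bimodule.r_one] at e1
  have e3 : M.δ₁ (Submodule.Quotient.mk (M.p m)) = M.p m := M.p_p m
  rw [e3] at e2
  rw [d_apply M m, D.d_apply a, e2]
  refine Eq.trans ?_ (congrArg (· + _) e1)
  rw [← Submodule.coe_add, ← map_add, ← Submodule.Quotient.mk_add, d_apply]
  congr 2
  apply Bimodule.mk_rad_eq
  change (M.l a m - M.p (M.l a m)) -
    (M.l (D.p a) (m - M.p m) + M.l (a - D.p a) (M.p m)) ∈ M.radSq
  have : (M.l a m - M.p (M.l a m)) - (M.l (D.p a) (m - M.p m) + M.l (a - D.p a) (M.p m)) =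
      M.l (a - D.p a) (m - M.p m) := by
    rw [p_l]; simp only [Bimodule.l_sub]; simp only [map_sub]; abel
  rw [this]
  exact Bimodule.l_mem_radSq hr hn

lemma d_r (a : A) (m : M.carrier) :
    M.d (M.r (op a) m) = M.r (op (D.p a)) (M.d m) + M.r (op (D.d a)) (M.p m) := by
  have hn := M.sub_p_mem m
  have hr := D.sub_p_mem a
  have e1 := M.δ₂_bilin 1 (Ideal.Quotient.mk _ a) ⟨_, hn⟩
    ⟨M.r (op (D.p a)) (m - M.p m), Bimodule.r_mem_radM' _ hn⟩ (by
      rw [D.δ₁_one, Bimodule.l_one]; rfl)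
  have e2 := M.compat_right ⟨_, hr⟩ (M.p m)
    ⟨M.r (op (a - D.p a)) (M.p m), Bimodule.r_mem_radM M.radSymm hr _⟩ rfl
  rw [D.δ₁_one, Bimodule.l_one] at e1
  have e3 : M.δ₁ (Submodule.Quotient.mk (M.p m)) = M.p m := M.p_p m
  rw [e3] at e2
  rw [d_apply M m, D.d_apply a, e2]
  refine Eq.trans ?_ (congrArg (· + _) e1)
  rw [← Submodule.coe_add, ← map_add, ← Submodule.Quotient.mk_add, d_apply]
  congr 2
  apply Bimodule.mk_rad_eq
  change (M.r (op a) m - M.p (M.r (op a) m)) -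
    (M.r (op (D.p a)) (m - M.p m) + M.r (op (a - D.p a)) (M.p m)) ∈ M.radSq
  have : (M.r (op a) m - M.p (M.r (op a) m)) -
      (M.r (op (D.p a)) (m - M.p m) + M.r (op (a - D.p a)) (M.p m)) =
      M.r (op (a - D.p a)) (m - M.p m) := by
    rw [p_r]; simp only [Bimodule.r_sub]; simp only [map_sub]; abel
  rw [this]
  exact Bimodule.r_mem_radSq M.radSymm hr hn

end Projections

/-- Quiver data on a radically symmetric bimodule, from its degree zero projection `p` and its
degree one component `d`. -/
@[reducible] def ofProj (D : QuiverData k A) (M : Bimodule k A) (hM : M.RadSymm)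
    (p d : M.carrier →ₗ[k] M.carrier)
    (hp : ∀ m, m - p m ∈ M.radM) (hd : ∀ m, d m ∈ M.radM)
    (hdr : ∀ m ∈ M.radM, m - d m ∈ M.radSq)
    (hpl : ∀ a m, p (M.l a m) = M.l (D.p a) (p m))
    (hpr : ∀ a m, p (M.r (op a) m) = M.r (op (D.p a)) (p m))
    (hdl : ∀ a m, d (M.l a m) = M.l (D.p a) (d m) + M.l (D.d a) (p m))
    (hdR : ∀ a m, d (M.r (op a) m) = M.r (op (D.p a)) (d m) + M.r (op (D.d a)) (p m)) :
    QBimodule D :=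
  have hp0 : ∀ m ∈ M.radM, p m = 0 := fun m hm => by
    have : M.radM ≤ LinearMap.ker p := Bimodule.radMul_le fun a ha n _ => by
      rw [LinearMap.mem_ker, hpl, D.p_rad ha, map_zero]; rfl
    exact this hm
  have hd0 : ∀ m ∈ M.radSq, d m = 0 := fun m hm => by
    have : M.radSq ≤ LinearMap.ker d := Bimodule.radMul_le fun a ha n hn => by
      rw [LinearMap.mem_ker, hdl, D.p_rad ha, map_zero, hp0 n hn, map_zero]; simp
    exact this hm
  have hpp : ∀ x, D.p (D.δ₁ x) = D.δ₁ x := fun x => by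
    rw [D.p_apply, D.π₁_δ₁]
  have hdp : ∀ x, D.d (D.δ₁ x) = 0 := fun x => by rw [← hpp, D.d_p]
  { M with
    radSymm := hM
    δ₁ := M.radM.liftQ p hp0
    δ₂ := M.radSq'.liftQ ((d ∘ₗ M.radM.subtype).codRestrict M.radM fun m => hd m)
      (fun m hm => by
        rw [LinearMap.mem_ker]; ext
        exact hd0 m hm)
    π₁_δ₁ := fun u => by
      induction u using Submodule.Quotient.induction_on with | H m => ?_
      exact ((Submodule.Quotient.eq _).2 (hp m)).symm
    π₂_δ₂ := fun w => by
      induction w using Submodule.Quotient.induction_on with | H m => ?_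
      exact ((Submodule.Quotient.eq M.radSq').2 (hdr m m.2)).symm
    δ₁_bilin := fun x y m => by
      change p _ = M.l _ (M.r _ (p m))
      rw [hpl, hpr, hpp, hpp]
    δ₂_bilin := fun x y w w' h => by
      change d w' = M.l _ (M.r _ (d w))
      rw [h, hdl, hdR, hpp, hpp, hdp, hdp, op_zero, map_zero, map_zero]; simp
    compat_left := fun x m w h => by
      change M.l (D.δ₂ (Submodule.Quotient.mk x)) (p m) = d w
      rw [h, hdl, D.p_rad x.2, map_zero, D.d_of_mem x.2]; simp
    compat_right := fun x m w h => by
      change M.r (op (D.δ₂ (Submodule.Quotient.mk x) : A)) (p m) = d w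
      rw [h, hdR, D.p_rad x.2, op_zero, map_zero, D.d_of_mem x.2]; simp }

/-! ### The category of bimodules with quiver data -/

/-- Bimodule intertwiners `f` with `f ∘ δ₁ = δ₁ ∘ f̃`, where `f̃` is induced by `f` on the
quotients by the radicals. -/
def homSubmodule (M N : QBimodule D) : Submodule k (M.carrier →ₗ[k] N.carrier) where
  carrier := {f | (∀ a m, f (M.l a m) = N.l a (f m)) ∧
    (∀ a m, f (M.r (op a) m) = N.r (op a) (f m)) ∧
    (∀ m, f (M.δ₁ (Submodule.Quotient.mk m)) = N.δ₁ (Submodule.Quotient.mk (f m)))}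
  zero_mem' := by simp
  add_mem' := by
    rintro f g ⟨h1, h2, h3⟩ ⟨h1', h2', h3'⟩
    refine ⟨fun a m => ?_, fun a m => ?_, fun m => ?_⟩ <;> simp [*]
  smul_mem' := by
    rintro c f ⟨h1, h2, h3⟩
    refine ⟨fun a m => ?_, fun a m => ?_, fun m => ?_⟩ <;> simp [*]

instance : Category (QBimodule D) where
  Hom M N := homSubmodule M N
  id M := ⟨LinearMap.id, by simp [homSubmodule]⟩
  comp f g := ⟨g.1 ∘ₗ f.1,
    fun a m => by simp [f.2.1, g.2.1], fun a m => by simp [f.2.2.1, g.2.2.1],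
    fun m => by simp [f.2.2.2, g.2.2.2]⟩

/-- The linear map underlying a morphism. -/
def Hom.lin {M N : QBimodule D} (f : M ⟶ N) : M.carrier →ₗ[k] N.carrier := f.1

@[ext] lemma hom_ext {M N : QBimodule D} {f g : M ⟶ N} (h : ∀ m, Hom.lin f m = Hom.lin g m) :
    f = g := Subtype.ext (LinearMap.ext h)

@[simp] lemma lin_id (M : QBimodule D) (m : M.carrier) : Hom.lin (𝟙 M) m = m := rfl

@[simp] lemma lin_comp {M N P : QBimodule D} (f : M ⟶ N) (g : N ⟶ P) (m : M.carrier) :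
    Hom.lin (f ≫ g) m = Hom.lin g (Hom.lin f m) := rfl

lemma lin_l {M N : QBimodule D} (f : M ⟶ N) (a : A) (m : M.carrier) :
    Hom.lin f (M.l a m) = N.l a (Hom.lin f m) := f.2.1 a m

lemma lin_r {M N : QBimodule D} (f : M ⟶ N) (a : A) (m : M.carrier) :
    Hom.lin f (M.r (op a) m) = N.r (op a) (Hom.lin f m) := f.2.2.1 a m

lemma lin_p {M N : QBimodule D} (f : M ⟶ N) (m : M.carrier) :
    Hom.lin f (M.p m) = N.p (Hom.lin f m) := f.2.2.2 m

/-- A morphism from a linear map. -/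
def homMk {M N : QBimodule D} (f : M.carrier →ₗ[k] N.carrier)
    (hl : ∀ a m, f (M.l a m) = N.l a (f m)) (hr : ∀ a m, f (M.r (op a) m) = N.r (op a) (f m))
    (hp : ∀ m, f (M.p m) = N.p (f m)) : M ⟶ N := ⟨f, hl, hr, hp⟩

@[simp] lemma lin_homMk {M N : QBimodule D} (f : M.carrier →ₗ[k] N.carrier) (hl hr hp)
    (m : M.carrier) : Hom.lin (homMk (M := M) (N := N) f hl hr hp) m = f m := rfl

instance (M N : QBimodule D) : AddCommGroup (M ⟶ N) :=
  inferInstanceAs (AddCommGroup (homSubmodule M N))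

instance (M N : QBimodule D) : Module k (M ⟶ N) :=
  inferInstanceAs (Module k (homSubmodule M N))

instance : Preadditive (QBimodule D) where
  homGroup _ _ := inferInstance
  add_comp _ _ _ _ _ g := Subtype.ext (LinearMap.comp_add _ _ g.1)
  comp_add _ _ _ f g g' := Subtype.ext (LinearMap.add_comp f.1 g'.1 g.1)

instance : Linear k (QBimodule D) where
  homModule _ _ := inferInstance
  smul_comp _ _ _ c f g := Subtype.ext (LinearMap.comp_smul g.1 c f.1)
  comp_smul _ _ _ f c g := Subtype.ext (LinearMap.smul_comp c g.1 f.1)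

end QBimodule

/-! ### The tensor product over `A` -/

namespace Bimodule

variable {k A : Type u} [Field k] [Ring A] [Algebra k A]

/-- The span of the elements `m a ⊗ n - m ⊗ a n` in `M ⊗ₖ N`. -/
def balanced (M N : Bimodule k A) : Submodule k (M.carrier ⊗[k] N.carrier) :=
  Submodule.span k {x | ∃ m a n, x = M.r (op a) m ⊗ₜ[k] n - m ⊗ₜ[k] N.l a n}

/-- The vector space `M ⊗_A N`. -/
abbrev TensorSpace (M N : Bimodule k A) : Type u := (M.carrier ⊗[k] N.carrier) ⧸ balanced M N

variable {M N P : Bimodule k A}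

/-- The element `m ⊗ n` of `M ⊗_A N`. -/
def tmk (m : M.carrier) (n : N.carrier) : TensorSpace M N := Submodule.Quotient.mk (m ⊗ₜ[k] n)

/-- `m ⊗ n` as a bilinear map. -/
def tmkₗ (M N : Bimodule k A) : M.carrier →ₗ[k] N.carrier →ₗ[k] TensorSpace M N :=
  (TensorProduct.mk k M.carrier N.carrier).compr₂ (balanced M N).mkQ

@[simp] lemma tmkₗ_apply (m : M.carrier) (n : N.carrier) : tmkₗ M N m n = tmk m n := rfl

lemma tmk_r (m : M.carrier) (a : A) (n : N.carrier) :
    tmk (M.r (op a) m) n = tmk m (N.l a n) :=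
  (Submodule.Quotient.eq _).2 (Submodule.subset_span ⟨m, a, n, rfl⟩)

lemma tmk_add_left (m m' : M.carrier) (n : N.carrier) :
    tmk (m + m') n = tmk m n + tmk m' n := by
  rw [← tmkₗ_apply, map_add]; rfl

lemma tmk_add_right (m : M.carrier) (n n' : N.carrier) :
    tmk m (n + n') = tmk m n + tmk m n' := by
  rw [← tmkₗ_apply, map_add]; rfl

lemma tmk_sub_left (m m' : M.carrier) (n : N.carrier) :
    tmk (m - m') n = tmk m n - tmk m' n := by
  rw [← tmkₗ_apply, map_sub]; rfl

lemma tmk_sub_right (m : M.carrier) (n n' : N.carrier) :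
    tmk m (n - n') = tmk m n - tmk m n' := by
  rw [← tmkₗ_apply, map_sub]; rfl

@[simp] lemma tmk_zero_left (n : N.carrier) : tmk (0 : M.carrier) n = 0 := by
  rw [← tmkₗ_apply, map_zero]; rfl

@[simp] lemma tmk_zero_right (m : M.carrier) : tmk m (0 : N.carrier) = 0 := by
  rw [← tmkₗ_apply, map_zero]

lemma tensor_span (M N : Bimodule k A) (S : Submodule k (TensorSpace M N))
    (h : ∀ m n, tmk m n ∈ S) (t : TensorSpace M N) : t ∈ S := by
  induction t using Submodule.Quotient.induction_on with | H t => ?_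
  induction t with
  | zero => exact S.zero_mem
  | tmul m n => exact h m n
  | add x y hx hy => exact S.add_mem hx hy

lemma tensor_ind {Q : TensorSpace M N → Prop} (h : ∀ m n, Q (tmk m n))
    (hadd : ∀ s t, Q s → Q t → Q (s + t)) (t : TensorSpace M N) : Q t := by
  induction t using Submodule.Quotient.induction_on with | H t => ?_
  induction t with
  | zero =>
    have := h 0 0
    rwa [tmk_zero_left] at this
  | tmul m n => exact h m n
  | add x y hx hy => exact hadd _ _ hx hy

/-- The linear map out of `M ⊗_A N` given by a balanced bilinear map. -/
def tlift {W : Type u} [AddCommGroup W] [Module k W]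
    (φ : M.carrier →ₗ[k] N.carrier →ₗ[k] W)
    (h : ∀ m a n, φ (M.r (op a) m) n = φ m (N.l a n)) : TensorSpace M N →ₗ[k] W :=
  (balanced M N).liftQ (TensorProduct.lift φ) (Submodule.span_le.2 (by
    rintro x ⟨m, a, n, rfl⟩
    simp [h]))

@[simp] lemma tlift_tmk {W : Type u} [AddCommGroup W] [Module k W]
    (φ : M.carrier →ₗ[k] N.carrier →ₗ[k] W) (h) (m : M.carrier) (n : N.carrier) :
    tlift φ h (tmk m n) = φ m n := rfl

lemma text {W : Type u} [AddCommGroup W] [Module k W] {f g : TensorSpace M N →ₗ[k] W}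
    (h : ∀ m n, f (tmk m n) = g (tmk m n)) : f = g :=
  LinearMap.ext (fun t => tensor_span M N (LinearMap.eqLocus f g) h t)

/-- The map `m ⊗ n ↦ f m ⊗ g n`. -/
def tmap {M' N' : Bimodule k A} (f : M.carrier →ₗ[k] M'.carrier) (g : N.carrier →ₗ[k] N'.carrier)
    (h : ∀ m a n, tmk (f (M.r (op a) m)) (g n) = tmk (f m) (g (N.l a n))) :
    TensorSpace M N →ₗ[k] TensorSpace M' N' :=
  tlift ((tmkₗ M' N').compl₁₂ f g) h

@[simp] lemma tmap_tmk {M' N' : Bimodule k A} (f : M.carrier →ₗ[k] M'.carrier)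
    (g : N.carrier →ₗ[k] N'.carrier) (h) (m : M.carrier) (n : N.carrier) :
    tmap f g h (tmk m n) = tmk (f m) (g n) := rfl

/-- The left action on `M ⊗_A N`. -/
def tensorL (M N : Bimodule k A) : A →ₐ[k] Module.End k (TensorSpace M N) :=
  AlgHom.ofLinearMap
    { toFun := fun a => tmap (M.l a) LinearMap.id (fun m b n => by
        rw [M.comm, LinearMap.id_apply, LinearMap.id_apply, tmk_r])
      map_add' := fun a b => text fun m n => by
        simp [tmk_add_left]
      map_smul' := fun c a => text fun m n => by
        simp only [tmap_tmk, map_smul, LinearMap.smul_apply]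
        rw [← tmkₗ_apply, map_smul]; rfl }
    (text fun m n => by simp)
    (fun a b => text fun m n => by simp)

/-- The right action on `M ⊗_A N`. -/
def tensorR (M N : Bimodule k A) : Aᵐᵒᵖ →ₐ[k] Module.End k (TensorSpace M N) :=
  AlgHom.ofLinearMap
    { toFun := fun a => tmap LinearMap.id (N.r a) (fun m b n => by
        obtain ⟨a, rfl⟩ := op_surjective a
        rw [← N.comm, LinearMap.id_apply, LinearMap.id_apply, tmk_r])
      map_add' := fun a b => text fun m n => by
        simp [tmk_add_right]
      map_smul' := fun c a => text fun m n => by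
        simp only [tmap_tmk, map_smul, LinearMap.smul_apply]
        rw [← tmkₗ_apply, map_smul]; rfl }
    (text fun m n => by simp)
    (fun a b => text fun m n => by simp)

lemma tensor_comm (M N : Bimodule k A) (a b : A) (t : TensorSpace M N) :
    tensorL M N a (tensorR M N (op b) t) = tensorR M N (op b) (tensorL M N a t) :=
  tensor_ind (Q := fun t => tensorL M N a (tensorR M N (op b) t) =
      tensorR M N (op b) (tensorL M N a t)) (fun m n => rfl)
    (fun s t hs ht => by rw [map_add, map_add, map_add, map_add, hs, ht]) t

/-- The bimodule `M ⊗_A N`. -/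
@[reducible] def tensor (M N : Bimodule k A) : Bimodule k A where
  carrier := TensorSpace M N
  l := tensorL M N
  r := tensorR M N
  comm := tensor_comm M N

@[simp] lemma tensor_l (a : A) (m : M.carrier) (n : N.carrier) :
    (tensor M N).l a (tmk m n) = tmk (M.l a m) n := rfl

@[simp] lemma tensor_r (a : Aᵐᵒᵖ) (m : M.carrier) (n : N.carrier) :
    (tensor M N).r a (tmk m n) = tmk m (N.r a n) := rfl

lemma tmk_mem_radM_left {m : M.carrier} (hm : m ∈ M.radM) (n : N.carrier) :
    (tmk m n : (tensor M N).carrier) ∈ (tensor M N).radM := by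
  have : M.radM ≤ (tensor M N).radM.comap ((tmkₗ M N).flip n) := radMul_le fun a ha m _ => by
    exact l_mem_radM (M := tensor M N) ha (tmk m n)
  exact this hm

lemma tmk_mem_radM_right (hM : M.RadSymm) (m : M.carrier) {n : N.carrier}
    (hn : n ∈ N.radM) : (tmk m n : (tensor M N).carrier) ∈ (tensor M N).radM := by
  have : N.radM ≤ (tensor M N).radM.comap (tmkₗ M N m) := radMul_le fun a ha n _ => by
    rw [Submodule.mem_comap, tmkₗ_apply, ← tmk_r]
    exact tmk_mem_radM_left (r_mem_radM hM ha m) n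
  exact this hn

lemma tensor_radSymm (hM : M.RadSymm) (hN : N.RadSymm) : (tensor M N).RadSymm := by
  apply le_antisymm
  · refine radMul_le fun a ha t _ => ?_
    refine tensor_span M N (Submodule.comap ((tensor M N).l a) ((tensor M N).mulRad ⊤)) ?_ t
    intro m n
    rw [Submodule.mem_comap, tensor_l]
    have h1 : M.radM ≤ ((tensor M N).mulRad ⊤).comap ((tmkₗ M N).flip n) := by
      rw [radM, hM]
      refine mulRad_le fun b hb m' _ => ?_
      rw [Submodule.mem_comap, LinearMap.flip_apply, tmkₗ_apply, tmk_r]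
      have h2 : N.radM ≤ ((tensor M N).mulRad ⊤).comap (tmkₗ M N m') := by
        rw [radM, hN]
        refine mulRad_le fun c hc n' _ => ?_
        exact Submodule.subset_span ⟨c, hc, tmk m' n', trivial, rfl⟩
      exact h2 (l_mem_radM hb _)
    exact h1 (l_mem_radM ha _)
  · refine mulRad_le fun a ha t _ => ?_
    refine tensor_span M N (Submodule.comap ((tensor M N).r (op a)) ((tensor M N).radMul ⊤)) ?_ t
    intro m n
    exact tmk_mem_radM_right hM m (r_mem_radM hN ha n)

lemma tmk_mem_radSq_left {m : M.carrier} (hm : m ∈ M.radSq) (n : N.carrier) :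
    (tmk m n : (tensor M N).carrier) ∈ (tensor M N).radSq := by
  have : M.radSq ≤ (tensor M N).radSq.comap ((tmkₗ M N).flip n) := radMul_le fun a ha m hm => by
    exact l_mem_radSq (M := tensor M N) ha (tmk_mem_radM_left hm n)
  exact this hm

lemma tmk_mem_radSq_mid (hM : M.RadSymm) {m : M.carrier} (hm : m ∈ M.radM)
    {n : N.carrier} (hn : n ∈ N.radM) :
    (tmk m n : (tensor M N).carrier) ∈ (tensor M N).radSq := by
  have : M.radM ≤ (tensor M N).radSq.comap ((tmkₗ M N).flip n) := radMul_le fun a ha m _ => by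
    exact l_mem_radSq (M := tensor M N) ha (tmk_mem_radM_right hM m hn)
  exact this hm

end Bimodule

namespace QBimodule

open Bimodule

variable {k A : Type u} [Field k] [Ring A] [Algebra k A] {D : QuiverData k A}

/-- The map `m ⊗ n ↦ δ₁ [m] ⊗ δ₁ [n]`. -/
def tensorP (M N : QBimodule D) :
    TensorSpace M.toBimodule N.toBimodule →ₗ[k] TensorSpace M.toBimodule N.toBimodule :=
  tmap M.p N.p fun m a n => by rw [M.p_r, N.p_l, tmk_r]

/-- The map `m ⊗ n ↦ d m ⊗ p n + p m ⊗ d n`. -/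
def tensorD (M N : QBimodule D) :
    TensorSpace M.toBimodule N.toBimodule →ₗ[k] TensorSpace M.toBimodule N.toBimodule :=
  tlift ((tmkₗ _ _).compl₁₂ M.d N.p + (tmkₗ _ _).compl₁₂ M.p N.d) fun m a n => by
    change tmk (M.d (M.r (op a) m)) (N.p n) + tmk (M.p (M.r (op a) m)) (N.d n) =
      tmk (M.d m) (N.p (N.l a n)) + tmk (M.p m) (N.d (N.l a n))
    rw [M.p_r, M.d_r, N.p_l, N.d_l, tmk_add_left, tmk_add_right, tmk_r, tmk_r, tmk_r]; abel

section

variable (M N : QBimodule D)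

lemma tensorP_tmk (m : M.carrier) (n : N.carrier) :
    tensorP M N (tmk m n) = tmk (M.p m) (N.p n) := rfl

lemma tensorD_tmk (m : M.carrier) (n : N.carrier) :
    tensorD M N (tmk m n) = tmk (M.d m) (N.p n) + tmk (M.p m) (N.d n) := rfl

lemma tensor_hp (t : (M.toBimodule.tensor N.toBimodule).carrier) :
    t - tensorP M N t ∈ (M.toBimodule.tensor N.toBimodule).radM := by
  refine tensor_ind (Q := fun t => t - tensorP M N t ∈ (M.toBimodule.tensor N.toBimodule).radM)
    (fun m n => ?_) (fun s t hs ht => ?_) t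
  · have : tmk m n - tensorP M N (tmk m n) = tmk (m - M.p m) n + tmk (M.p m) (n - N.p n) := by
      rw [tensorP_tmk, tmk_sub_left, tmk_sub_right]; abel
    rw [this]
    exact Submodule.add_mem _ (tmk_mem_radM_left (M.sub_p_mem m) _)
      (tmk_mem_radM_right M.radSymm _ (N.sub_p_mem n))
  · have := Submodule.add_mem _ hs ht
    rwa [← add_sub_add_comm, ← map_add] at this

lemma tensor_hd (t : (M.toBimodule.tensor N.toBimodule).carrier) :
    tensorD M N t ∈ (M.toBimodule.tensor N.toBimodule).radM := by
  refine tensor_ind (Q := fun t => tensorD M N t ∈ (M.toBimodule.tensor N.toBimodule).radM)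
    (fun m n => ?_) (fun s t hs ht => ?_) t
  · exact Submodule.add_mem _ (tmk_mem_radM_left (M.d_mem m) _)
      (tmk_mem_radM_right M.radSymm _ (N.d_mem n))
  · rw [map_add]; exact Submodule.add_mem _ hs ht

lemma tensor_hdr (t : (M.toBimodule.tensor N.toBimodule).carrier)
    (ht : t ∈ (M.toBimodule.tensor N.toBimodule).radM) :
    t - tensorD M N t ∈ (M.toBimodule.tensor N.toBimodule).radSq := by
  have : (M.toBimodule.tensor N.toBimodule).radM ≤
      Submodule.comap (LinearMap.id - tensorD M N)
        (M.toBimodule.tensor N.toBimodule).radSq := by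
    refine radMul_le fun a ha s _ => ?_
    refine tensor_ind (Q := fun s => (M.toBimodule.tensor N.toBimodule).l a s -
      tensorD M N ((M.toBimodule.tensor N.toBimodule).l a s) ∈
        (M.toBimodule.tensor N.toBimodule).radSq) (fun m n => ?_) (fun s t hs ht => ?_) s
    · have hx : M.l a m ∈ M.radM := l_mem_radM ha m
      have e : tmk (M.l a m) n - tensorD M N (tmk (M.l a m) n) =
          tmk (M.l a m - M.d (M.l a m)) n + tmk (M.d (M.l a m)) (n - N.p n) := by
        rw [tensorD_tmk, M.p_rad hx, tmk_zero_left, tmk_sub_left, tmk_sub_right]; abel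
      rw [tensor_l, e]
      exact Submodule.add_mem _ (tmk_mem_radSq_left (M.sub_d_mem hx) n)
        (tmk_mem_radSq_mid M.radSymm (M.d_mem _) (N.sub_p_mem n))
    · rw [map_add, map_add, add_sub_add_comm]
      exact Submodule.add_mem _ hs ht
  exact this ht

lemma tensor_hpl (a : A) (t : (M.toBimodule.tensor N.toBimodule).carrier) :
    tensorP M N ((M.toBimodule.tensor N.toBimodule).l a t) =
      (M.toBimodule.tensor N.toBimodule).l (D.p a) (tensorP M N t) := by
  refine tensor_ind (Q := fun t => tensorP M N ((M.toBimodule.tensor N.toBimodule).l a t) =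
    (M.toBimodule.tensor N.toBimodule).l (D.p a) (tensorP M N t))
    (fun m n => ?_) (fun s t hs ht => ?_) t
  · rw [tensor_l, tensorP_tmk, tensorP_tmk, tensor_l, M.p_l]
  · simp only [map_add, hs, ht]

lemma tensor_hpr (a : A) (t : (M.toBimodule.tensor N.toBimodule).carrier) :
    tensorP M N ((M.toBimodule.tensor N.toBimodule).r (op a) t) =
      (M.toBimodule.tensor N.toBimodule).r (op (D.p a)) (tensorP M N t) := by
  refine tensor_ind (Q := fun t => tensorP M N ((M.toBimodule.tensor N.toBimodule).r (op a) t) =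
    (M.toBimodule.tensor N.toBimodule).r (op (D.p a)) (tensorP M N t))
    (fun m n => ?_) (fun s t hs ht => ?_) t
  · rw [tensor_r, tensorP_tmk, tensorP_tmk, tensor_r, N.p_r]
  · simp only [map_add, hs, ht]

lemma tensor_hdl (a : A) (t : (M.toBimodule.tensor N.toBimodule).carrier) :
    tensorD M N ((M.toBimodule.tensor N.toBimodule).l a t) =
      (M.toBimodule.tensor N.toBimodule).l (D.p a) (tensorD M N t) +
        (M.toBimodule.tensor N.toBimodule).l (D.d a) (tensorP M N t) := by
  refine tensor_ind (Q := fun t => tensorD M N ((M.toBimodule.tensor N.toBimodule).l a t) =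
    (M.toBimodule.tensor N.toBimodule).l (D.p a) (tensorD M N t) +
      (M.toBimodule.tensor N.toBimodule).l (D.d a) (tensorP M N t))
    (fun m n => ?_) (fun s t hs ht => ?_) t
  · rw [tensor_l, tensorD_tmk, tensorD_tmk, tensorP_tmk, map_add, tensor_l, tensor_l, tensor_l,
      M.p_l, M.d_l, tmk_add_left]
    abel
  · simp only [map_add, hs, ht]; abel

lemma tensor_hdR (a : A) (t : (M.toBimodule.tensor N.toBimodule).carrier) :
    tensorD M N ((M.toBimodule.tensor N.toBimodule).r (op a) t) =
      (M.toBimodule.tensor N.toBimodule).r (op (D.p a)) (tensorD M N t) +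
        (M.toBimodule.tensor N.toBimodule).r (op (D.d a)) (tensorP M N t) := by
  refine tensor_ind (Q := fun t => tensorD M N ((M.toBimodule.tensor N.toBimodule).r (op a) t) =
    (M.toBimodule.tensor N.toBimodule).r (op (D.p a)) (tensorD M N t) +
      (M.toBimodule.tensor N.toBimodule).r (op (D.d a)) (tensorP M N t))
    (fun m n => ?_) (fun s t hs ht => ?_) t
  · rw [tensor_r, tensorD_tmk, tensorD_tmk, tensorP_tmk, map_add, tensor_r, tensor_r, tensor_r,
      N.p_r, N.d_r, tmk_add_right]
    abel
  · simp only [map_add, hs, ht]; abel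

end

/-- The tensor product over `A` of bimodules with quiver data: `δ₁` is induced by
`m ⊗ n ↦ δ₁ [m] ⊗ δ₁ [n]`, and `δ₂` is induced on `rad (M ⊗ N)` by
`m ⊗ n ↦ d m ⊗ p n + p m ⊗ d n`, that is by `m ⊗ n ↦ δ₁ [m] ⊗ δ₂ [n]` for `n ∈ rad N`. -/
@[reducible] def tensor (M N : QBimodule D) : QBimodule D :=
  ofProj D (M.toBimodule.tensor N.toBimodule) (tensor_radSymm M.radSymm N.radSymm)
    (tensorP M N) (tensorD M N) (tensor_hp M N) (tensor_hd M N) (tensor_hdr M N)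
    (tensor_hpl M N) (tensor_hpr M N) (tensor_hdl M N) (tensor_hdR M N)

/-- `A` as a bimodule over itself. -/
@[reducible] def unitBimodule (k A : Type u) [Field k] [Ring A] [Algebra k A] : Bimodule k A where
  carrier := A
  l := Algebra.lmul k A
  r := AlgHom.ofLinearMap ((LinearMap.mul k A).flip ∘ₗ (opLinearEquiv k).symm.toLinearMap)
    (by ext; simp) (by intro a b; ext; simp [mul_assoc])
  comm a b m := by simp [mul_assoc]

@[simp] lemma unit_l (a b : A) : (unitBimodule k A).l a b = (a * b : A) := rfl

@[simp] lemma unit_r (a b : A) : (unitBimodule k A).r (op a) b = (b * a : A) := rfl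

lemma unit_radM : (unitBimodule k A).radM = rad k A := by
  apply le_antisymm
  · exact radMul_le fun a ha b _ => QuiverData.mul_mem_rad_right _ ha
  · intro a ha
    exact Submodule.subset_span ⟨a, ha, (1 : A), trivial, (mul_one a).symm⟩

lemma unit_radSymm : (unitBimodule k A).RadSymm := by
  change (unitBimodule k A).radM = _
  rw [unit_radM]
  apply le_antisymm
  · intro a ha
    exact Submodule.subset_span ⟨a, ha, (1 : A), trivial, (one_mul a).symm⟩
  · exact mulRad_le fun a ha b _ => QuiverData.mul_mem_rad_left _ ha

lemma unit_radSq : (rad k A) ^ 2 ≤ (unitBimodule k A).radSq := by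
  rw [pow_two]
  refine Submodule.mul_le.2 fun a ha b hb => ?_
  exact l_mem_radSq (M := unitBimodule k A) ha (by rw [unit_radM]; exact hb)

/-- `A` with its own quiver data, as a bimodule over itself. -/
@[reducible] def unit (D : QuiverData k A) : QBimodule D :=
  ofProj D (unitBimodule k A) unit_radSymm D.p D.d
    (fun m => by rw [unit_radM]; exact D.sub_p_mem m)
    (fun m => by rw [unit_radM]; exact D.d_mem m)
    (fun m hm => by rw [unit_radM] at hm; exact unit_radSq (D.sub_d_mem hm))
    (fun a m => D.p_mul a m) (fun a m => D.p_mul m a)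
    (fun a m => D.d_mul a m) (fun a m => (D.d_mul m a).trans (add_comm _ _))

lemma tensor_p (M N : QBimodule D) (m : M.carrier) (n : N.carrier) :
    (tensor M N).p (tmk m n) = tmk (M.p m) (N.p n) := rfl

lemma tensor_ext {M N P : QBimodule D} {f g : tensor M N ⟶ P}
    (h : ∀ (m : M.carrier) (n : N.carrier),
      Hom.lin f (tmk m n) = Hom.lin g (tmk m n)) : f = g :=
  Subtype.ext (text h)

/-- A morphism out of `M ⊗_A N` from a balanced bilinear map compatible with all structure. -/
def tensorHomMk {M N P : QBimodule D} (φ : M.carrier →ₗ[k] N.carrier →ₗ[k] P.carrier)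
    (h : ∀ m a n, φ (M.r (op a) m) n = φ m (N.l a n))
    (hl : ∀ a m n, φ (M.l a m) n = P.l a (φ m n))
    (hr : ∀ a m n, φ m (N.r (op a) n) = P.r (op a) (φ m n))
    (hp : ∀ m n, φ (M.p m) (N.p n) = P.p (φ m n)) : tensor M N ⟶ P :=
  homMk (M := tensor M N) (tlift φ h)
    (fun a t => tensor_ind (Q := fun t => tlift φ h ((tensor M N).l a t) = P.l a (tlift φ h t))
      (fun m n => hl a m n) (fun s t hs ht => by simp only [map_add, hs, ht]) t)
    (fun a t => tensor_ind
      (Q := fun t => tlift φ h ((tensor M N).r (op a) t) = P.r (op a) (tlift φ h t))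
      (fun m n => hr a m n) (fun s t hs ht => by simp only [map_add, hs, ht]) t)
    (fun t => tensor_ind (Q := fun t => tlift φ h ((tensor M N).p t) = P.p (tlift φ h t))
      (fun m n => hp m n) (fun s t hs ht => by simp only [map_add, hs, ht]) t)

@[simp] lemma lin_tensorHomMk {M N P : QBimodule D}
    (φ : M.carrier →ₗ[k] N.carrier →ₗ[k] P.carrier) (h hl hr hp)
    (m : M.carrier) (n : N.carrier) :
    Hom.lin (tensorHomMk (M := M) (N := N) (P := P) φ h hl hr hp) (tmk m n) = φ m n := rfl

/-- The tensor product of two morphisms. -/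
def tensorMap {M M' N N' : QBimodule D} (f : M ⟶ M') (g : N ⟶ N') :
    tensor M N ⟶ tensor M' N' :=
  tensorHomMk (P := tensor M' N') ((tmkₗ _ _).compl₁₂ (Hom.lin f) (Hom.lin g))
    (fun m a n => by
      change tmk (Hom.lin f _) (Hom.lin g _) = tmk (Hom.lin f _) (Hom.lin g _)
      rw [lin_r, lin_l, tmk_r])
    (fun a m n => by
      change tmk (Hom.lin f _) (Hom.lin g _) = tmk (M'.l a (Hom.lin f _)) (Hom.lin g _)
      rw [lin_l])
    (fun a m n => by
      change tmk (Hom.lin f _) (Hom.lin g _) = tmk (Hom.lin f _) (N'.r (op a) (Hom.lin g _))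
      rw [lin_r])
    (fun m n => by
      change tmk (Hom.lin f _) (Hom.lin g _) = tmk (M'.p (Hom.lin f _)) (N'.p (Hom.lin g _))
      rw [lin_p, lin_p])

@[simp] lemma tensorMap_tmk {M M' N N' : QBimodule D} (f : M ⟶ M') (g : N ⟶ N')
    (m : M.carrier) (n : N.carrier) :
    Hom.lin (tensorMap f g) (tmk m n) = tmk (Hom.lin f m) (Hom.lin g n) := rfl

/-- For fixed `m` and `n`, the map `p ↦ m ⊗ (n ⊗ p)`. -/
def assocAux (M N P : QBimodule D) : TensorSpace M.toBimodule N.toBimodule →ₗ[k]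
    P.carrier →ₗ[k] (tensor M (tensor N P)).carrier :=
  tlift (W := P.carrier →ₗ[k] (tensor M (tensor N P)).carrier)
    (LinearMap.mk₂ k (fun m n => tmkₗ M.toBimodule (tensor N P).toBimodule m ∘ₗ
        tmkₗ N.toBimodule P.toBimodule n)
      (fun m m' n => by ext p; exact tmk_add_left _ _ _)
      (fun c m n => by ext p; simp only [map_smul]; rfl)
      (fun m n n' => by rw [map_add, LinearMap.comp_add])
      (fun c m n => by rw [map_smul, LinearMap.comp_smul]))
    (fun m a n => by
      ext p; exact tmk_r (N := (tensor N P).toBimodule) m a (tmk n p))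

lemma assocAux_tmk (M N P : QBimodule D) (m : M.carrier) (n : N.carrier) (p : P.carrier) :
    assocAux M N P (tmk m n) p = tmk (N := (tensor N P).toBimodule) m (tmk n p) := rfl

/-- The associator `(M ⊗ N) ⊗ P → M ⊗ (N ⊗ P)`. -/
def assocHom (M N P : QBimodule D) : tensor (tensor M N) P ⟶ tensor M (tensor N P) :=
  tensorHomMk (M := tensor M N) (P := tensor M (tensor N P)) (assocAux M N P)
    (fun t a p => tensor_ind (Q := fun t => assocAux M N P ((tensor M N).r (op a) t) p =
        assocAux M N P t (P.l a p))
      (fun m n => congrArg (tmkₗ M.toBimodule (tensor N P).toBimodule m) (tmk_r n a p))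
      (fun s t hs ht => by
        rw [map_add, map_add, map_add, LinearMap.add_apply, LinearMap.add_apply, hs, ht]) t)
    (fun a t p => tensor_ind (Q := fun t => assocAux M N P ((tensor M N).l a t) p =
        (tensor M (tensor N P)).l a (assocAux M N P t p))
      (fun m n => rfl)
      (fun s t hs ht => by
        rw [map_add, map_add, map_add, LinearMap.add_apply, LinearMap.add_apply, hs, ht,
          map_add]) t)
    (fun a t p => tensor_ind (Q := fun t => assocAux M N P t (P.r (op a) p) =
        (tensor M (tensor N P)).r (op a) (assocAux M N P t p))
      (fun m n => rfl)
      (fun s t hs ht => by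
        rw [map_add, LinearMap.add_apply, LinearMap.add_apply, hs, ht, map_add]) t)
    (fun t p => tensor_ind (Q := fun t => assocAux M N P ((tensor M N).p t) (P.p p) =
        (tensor M (tensor N P)).p (assocAux M N P t p))
      (fun m n => rfl)
      (fun s t hs ht => by
        rw [map_add, map_add, map_add, LinearMap.add_apply, LinearMap.add_apply, hs, ht,
          map_add]) t)

/-- For fixed `n` and `p`, the map `m ↦ (m ⊗ n) ⊗ p`. -/
def assocInvAux (M N P : QBimodule D) : TensorSpace N.toBimodule P.toBimodule →ₗ[k]
    M.carrier →ₗ[k] (tensor (tensor M N) P).carrier :=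
  tlift (W := M.carrier →ₗ[k] (tensor (tensor M N) P).carrier)
    (LinearMap.mk₂ k (fun n p => (tmkₗ (tensor M N).toBimodule P.toBimodule).flip p ∘ₗ
        (tmkₗ M.toBimodule N.toBimodule).flip n)
      (fun n n' p => by rw [map_add, LinearMap.comp_add])
      (fun c n p => by ext m; simp only [map_smul]; rfl)
      (fun n p p' => by ext m; simp only [map_add]; rfl)
      (fun c n p => by ext m; simp only [map_smul]; rfl))
    (fun n a p => by
      ext m; exact tmk_r (M := (tensor M N).toBimodule) (tmk m n) a p)

lemma assocInvAux_tmk (M N P : QBimodule D) (m : M.carrier) (n : N.carrier) (p : P.carrier) :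
    assocInvAux M N P (tmk n p) m = tmk (M := (tensor M N).toBimodule) (tmk m n) p := rfl

/-- The inverse associator. -/
def assocInv (M N P : QBimodule D) : tensor M (tensor N P) ⟶ tensor (tensor M N) P :=
  tensorHomMk (N := tensor N P) (P := tensor (tensor M N) P) (assocInvAux M N P).flip
    (fun m a t => tensor_ind (Q := fun t => assocInvAux M N P t (M.r (op a) m) =
        assocInvAux M N P ((tensor N P).l a t) m)
      (fun n p => congrArg ((tmkₗ (tensor M N).toBimodule P.toBimodule).flip p) (tmk_r m a n))
      (fun s t hs ht => by
        rw [map_add, map_add, map_add, LinearMap.add_apply, LinearMap.add_apply, hs, ht]) t)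
    (fun a m t => tensor_ind (Q := fun t => assocInvAux M N P t (M.l a m) =
        (tensor (tensor M N) P).l a (assocInvAux M N P t m))
      (fun n p => rfl)
      (fun s t hs ht => by
        rw [map_add, LinearMap.add_apply, LinearMap.add_apply, hs, ht, map_add]) t)
    (fun a m t => tensor_ind (Q := fun t => assocInvAux M N P ((tensor N P).r (op a) t) m =
        (tensor (tensor M N) P).r (op a) (assocInvAux M N P t m))
      (fun n p => rfl)
      (fun s t hs ht => by
        rw [map_add, map_add, map_add, LinearMap.add_apply, LinearMap.add_apply, hs, ht,
          map_add]) t)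
    (fun m t => tensor_ind (Q := fun t => assocInvAux M N P ((tensor N P).p t) (M.p m) =
        (tensor (tensor M N) P).p (assocInvAux M N P t m))
      (fun n p => rfl)
      (fun s t hs ht => by
        rw [map_add, map_add, map_add, LinearMap.add_apply, LinearMap.add_apply, hs, ht,
          map_add]) t)

@[simp] lemma assocHom_tmk (M N P : QBimodule D) (m : M.carrier) (n : N.carrier)
    (p : P.carrier) : Hom.lin (assocHom M N P) (tmk (M := (tensor M N).toBimodule) (tmk m n) p) =
      tmk (N := (tensor N P).toBimodule) m (tmk n p) := rfl

@[simp] lemma assocInv_tmk (M N P : QBimodule D) (m : M.carrier) (n : N.carrier)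
    (p : P.carrier) : Hom.lin (assocInv M N P) (tmk (N := (tensor N P).toBimodule) m (tmk n p)) =
      tmk (M := (tensor M N).toBimodule) (tmk m n) p := rfl

lemma tensor_ext₃ {M N P R : QBimodule D} {f g : tensor (tensor M N) P ⟶ R}
    (h : ∀ (m : M.carrier) (n : N.carrier) (p : P.carrier),
      Hom.lin f (tmk (M := (tensor M N).toBimodule) (tmk m n) p) =
        Hom.lin g (tmk (M := (tensor M N).toBimodule) (tmk m n) p)) : f = g :=
  tensor_ext fun t p => tensor_ind
    (Q := fun t => Hom.lin f (tmk (M := (tensor M N).toBimodule) t p) =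
        Hom.lin g (tmk (M := (tensor M N).toBimodule) t p))
    (fun m n => h m n p)
    (fun s t hs ht => by
      rw [tmk_add_left (M := (tensor M N).toBimodule), map_add, map_add, hs, ht]) t

lemma tensor_ext₃' {M N P R : QBimodule D} {f g : tensor M (tensor N P) ⟶ R}
    (h : ∀ (m : M.carrier) (n : N.carrier) (p : P.carrier),
      Hom.lin f (tmk (N := (tensor N P).toBimodule) m (tmk n p)) =
        Hom.lin g (tmk (N := (tensor N P).toBimodule) m (tmk n p))) : f = g :=
  tensor_ext fun m t => tensor_ind
    (Q := fun t => Hom.lin f (tmk (N := (tensor N P).toBimodule) m t) =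
        Hom.lin g (tmk (N := (tensor N P).toBimodule) m t))
    (fun n p => h m n p)
    (fun s t hs ht => by
      rw [tmk_add_right (N := (tensor N P).toBimodule), map_add, map_add, hs, ht]) t

lemma tensor_ext₄ {M N P R S : QBimodule D} {f g : tensor (tensor (tensor M N) P) R ⟶ S}
    (h : ∀ (m : M.carrier) (n : N.carrier) (p : P.carrier) (r : R.carrier),
      Hom.lin f (tmk (M := (tensor (tensor M N) P).toBimodule)
        (tmk (M := (tensor M N).toBimodule) (tmk m n) p) r) =
      Hom.lin g (tmk (M := (tensor (tensor M N) P).toBimodule)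
        (tmk (M := (tensor M N).toBimodule) (tmk m n) p) r)) : f = g :=
  tensor_ext₃ fun t p r => tensor_ind
    (Q := fun t => Hom.lin f (tmk (M := (tensor (tensor M N) P).toBimodule)
        (tmk (M := (tensor M N).toBimodule) t p) r) =
      Hom.lin g (tmk (M := (tensor (tensor M N) P).toBimodule)
        (tmk (M := (tensor M N).toBimodule) t p) r))
    (fun m n => h m n p r)
    (fun s t hs ht => by
      rw [tmk_add_left (M := (tensor M N).toBimodule),
        tmk_add_left (M := (tensor (tensor M N) P).toBimodule), map_add, map_add, hs, ht]) t

/-- The left unitor `A ⊗ M ≅ M`. -/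
def leftUnit (M : QBimodule D) : tensor (unit D) M ≅ M where
  hom := tensorHomMk (M := unit D) M.l.toLinearMap
    (fun a b m => (l_l a b m).symm) (fun a b m => (l_l a b m).symm)
    (fun a b m => M.comm b a m) (fun a m => (M.p_l a m).symm)
  inv := homMk (N := tensor (unit D) M) (tmkₗ (unitBimodule k A) M.toBimodule (1 : A))
    (fun a m => by
      refine (tmk_r (M := unitBimodule k A) (1 : A) a m).symm.trans ?_
      change tmk (M := unitBimodule k A) (1 * a : A) m = tmk (M := unitBimodule k A) (a * 1 : A) m
      rw [one_mul, mul_one])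
    (fun a m => rfl)
    (fun m => by
      change tmk (M := unitBimodule k A) (1 : A) (M.p m) =
        tmk (M := unitBimodule k A) (D.p 1) (M.p m)
      rw [D.p_one])
  hom_inv_id := tensor_ext fun a m => by
    refine (tmk_r (M := unitBimodule k A) (1 : A) a m).symm.trans ?_
    change tmk (M := unitBimodule k A) (1 * a : A) m = tmk (M := unitBimodule k A) a m
    rw [one_mul]
  inv_hom_id := hom_ext fun m => l_one m

/-- The right unitor `M ⊗ A ≅ M`. -/
def rightUnit (M : QBimodule D) : tensor M (unit D) ≅ M where
  hom := tensorHomMk (N := unit D) (M.r.toLinearMap ∘ₗ (opLinearEquiv k).toLinearMap).flip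
    (fun m b a => r_r b a m) (fun a m b => (M.comm a b m).symm)
    (fun a m b => (r_r b a m).symm) (fun m a => (M.p_r a m).symm)
  inv := homMk (N := tensor M (unit D)) ((tmkₗ M.toBimodule (unitBimodule k A)).flip (1 : A))
    (fun a m => rfl)
    (fun a m => by
      refine (tmk_r (N := unitBimodule k A) m a (1 : A)).trans ?_
      change tmk (N := unitBimodule k A) m (a * 1 : A) = tmk (N := unitBimodule k A) m (1 * a : A)
      rw [one_mul, mul_one])
    (fun m => by
      change tmk (N := unitBimodule k A) (M.p m) (1 : A) =
        tmk (N := unitBimodule k A) (M.p m) (D.p 1)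
      rw [D.p_one])
  hom_inv_id := tensor_ext fun m a => by
    refine (tmk_r (N := unitBimodule k A) m a (1 : A)).trans ?_
    change tmk (N := unitBimodule k A) m (a * 1 : A) = tmk (N := unitBimodule k A) m a
    rw [mul_one]
  inv_hom_id := hom_ext fun m => r_one m

instance : MonoidalCategoryStruct (QBimodule D) where
  tensorObj := tensor
  whiskerLeft M _ _ f := tensorMap (𝟙 M) f
  whiskerRight f M := tensorMap f (𝟙 M)
  tensorHom f g := tensorMap f g
  tensorUnit := unit D
  associator M N P := ⟨assocHom M N P, assocInv M N P,
    tensor_ext₃ fun _ _ _ => rfl, tensor_ext₃' fun _ _ _ => rfl⟩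
  leftUnitor := leftUnit
  rightUnitor := rightUnit

/-- Radically symmetric `A`-`A`-bimodules with quiver data form a monoidal category under `⊗_A`. -/
instance : MonoidalCategory (QBimodule D) := MonoidalCategory.ofTensorHom
  (id_tensorHom_id := fun _ _ => tensor_ext fun _ _ => rfl)
  (id_tensorHom := fun _ _ _ _ => rfl)
  (tensorHom_id := fun _ _ => rfl)
  (tensorHom_comp_tensorHom := fun _ _ _ _ => tensor_ext fun _ _ => rfl)
  (associator_naturality := fun _ _ _ => tensor_ext₃ fun _ _ _ => rfl)
  (leftUnitor_naturality := fun f => tensor_ext fun a m => (lin_l f a m).symm)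
  (rightUnitor_naturality := fun f => tensor_ext fun m a => (lin_r f a m).symm)
  (pentagon := fun _ _ _ _ => tensor_ext₄ fun _ _ _ _ => rfl)
  (triangle := fun _ _ => tensor_ext₃ fun m a n => (tmk_r m a n).symm)

/-- `M` is dualizable: it has a left dual and a right dual. -/
def dualizable (D : QuiverData k A) : ObjectProperty (QBimodule D) := fun M =>
  Nonempty (HasLeftDual M) ∧ Nonempty (HasRightDual M)

instance : (dualizable D).IsMonoidal where
  prop_unit := ⟨⟨hasLeftDualUnit⟩, ⟨hasRightDualUnit⟩⟩
  prop_tensor _ _ := by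
    rintro ⟨⟨_⟩, ⟨_⟩⟩ ⟨⟨_⟩, ⟨_⟩⟩
    exact ⟨⟨hasLeftDualTensor⟩, ⟨hasRightDualTensor⟩⟩

end QBimodule

/-- The monoidal category `BSA(A, δ₁, δ₂)` of dualizable bimodules with quiver data over the
algebra `A` with quiver data `D = (δ₁, δ₂)`. -/
abbrev BSA {k A : Type u} [Field k] [Ring A] [Algebra k A] (D : QuiverData k A) :=
  (QBimodule.dualizable D).FullSubcategory


/-! ### Path algebras and truncated path algebras -/

section PathAlgebra

/-- The paths of a quiver, of any length (including zero), as triples (source, target, path). -/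
abbrev QPath (V : Type u) [Quiver.{u} V] : Type u := Σ a b : V, Quiver.Path a b

/-- The path algebra `kQ`: formal `k`-linear combinations of paths. -/
def PathAlgebra (k V : Type u) [Field k] [Quiver.{u} V] : Type u := QPath V →₀ k

variable (k V : Type u) [Field k] [Quiver.{u} V]

namespace PathAlgebra

noncomputable instance instAddCommGroup : AddCommGroup (PathAlgebra k V) :=
  inferInstanceAs (AddCommGroup (QPath V →₀ k))

noncomputable instance instModule : Module k (PathAlgebra k V) :=
  inferInstanceAs (Module k (QPath V →₀ k))

variable {V}

/-- A path, as an element of the path algebra. -/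
noncomputable def of (p : QPath V) : PathAlgebra k V := Finsupp.single p 1

/-- The linear map out of the path algebra with given values on paths. -/
noncomputable def lift {k : Type u} [Field k] {W : Type u} [AddCommGroup W] [Module k W]
    (f : QPath V → W) : PathAlgebra k V →ₗ[k] W := Finsupp.linearCombination k f

variable {k}

@[simp] lemma lift_of {W : Type u} [AddCommGroup W] [Module k W] (f : QPath V → W) (p : QPath V) :
    lift f (of k p) = f p :=
  (Finsupp.linearCombination_single k 1 p).trans (one_smul k _)

lemma hom_ext {W : Type*} [AddCommGroup W] [Module k W] {f g : PathAlgebra k V →ₗ[k] W}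
    (h : ∀ p, f (of k p) = g (of k p)) : f = g :=
  Finsupp.lhom_ext' fun p => LinearMap.ext_ring (h p)

lemma span_of (S : Submodule k (PathAlgebra k V)) (h : ∀ p, of k p ∈ S) (x : PathAlgebra k V) :
    x ∈ S := by
  induction x using Finsupp.induction_linear with
  | zero => exact S.zero_mem
  | add x y hx hy => exact S.add_mem hx hy
  | single p c =>
    have := S.smul_mem c (h p)
    have h2 : c • of k p = (Finsupp.single p c : QPath V →₀ k) :=
      (Finsupp.smul_single c p (1 : k)).trans (by rw [smul_eq_mul, mul_one])
    exact h2 ▸ this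

/-- The length of a path. -/
abbrev len (p : QPath V) : ℕ := p.2.2.length

variable (k)

open Classical in
/-- The product of two paths: their concatenation if the first one ends where the second one
starts, and zero otherwise. -/
noncomputable def pathMul (p q : QPath V) : PathAlgebra k V :=
  if h : p.2.1 = q.1 then of k ⟨p.1, q.2.1, p.2.2.comp (q.2.2.cast h.symm rfl)⟩ else 0

variable {k}

lemma pathMul_comp {a b c : V} (p : Quiver.Path a b) (q : Quiver.Path b c) :
    pathMul k ⟨a, b, p⟩ ⟨b, c, q⟩ = of k ⟨a, c, p.comp q⟩ := by
  simp [pathMul]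

lemma pathMul_ne {p q : QPath V} (h : p.2.1 ≠ q.1) : pathMul k p q = 0 := by
  simp [pathMul, h]

/-- A product of paths is zero or a path whose length is the sum of the lengths. -/
lemma pathMul_cases (p q : QPath V) : pathMul k p q = 0 ∨
    ∃ r : QPath V, pathMul k p q = of k r ∧ len r = len p + len q := by
  obtain ⟨a, b, p⟩ := p
  obtain ⟨b', c, q⟩ := q
  by_cases h : b = b'
  · subst h
    exact Or.inr ⟨_, pathMul_comp p q, Quiver.Path.length_comp p q⟩
  · exact Or.inl (pathMul_ne h)

/-- Multiplication as a bilinear map. -/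
noncomputable def mulₗ : PathAlgebra k V →ₗ[k] PathAlgebra k V →ₗ[k] PathAlgebra k V :=
  lift fun p => lift fun q => pathMul k p q

noncomputable instance : Mul (PathAlgebra k V) := ⟨fun x y => mulₗ x y⟩

lemma mul_def (x y : PathAlgebra k V) : x * y = mulₗ x y := rfl

@[simp] lemma of_mul_of (p q : QPath V) : of k p * of k q = pathMul k p q := by
  rw [mul_def, mulₗ, lift_of, lift_of]

lemma assoc_aux : (mulₗ (k := k) (V := V)).compr₂ mulₗ =
    (LinearMap.llcomp k _ _ _ ∘ₗ mulₗ).compl₂ mulₗ := by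
  refine hom_ext fun p => hom_ext fun q => hom_ext fun r => ?_
  change (of k p * of k q) * of k r = of k p * (of k q * of k r)
  rw [of_mul_of, of_mul_of]
  obtain ⟨a, b, p⟩ := p
  obtain ⟨b', c, q⟩ := q
  obtain ⟨c', d, r⟩ := r
  by_cases h : b = b' <;> by_cases h' : c = c'
  · subst h h'
    simp only [pathMul_comp, of_mul_of, Quiver.Path.comp_assoc]
  · subst h
    rw [pathMul_comp, pathMul_ne (p := ⟨b, c, q⟩) h', of_mul_of, pathMul_ne (by exact h')]
    exact (map_zero (mulₗ _)).symm
  · subst h'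
    rw [pathMul_ne (p := ⟨a, b, p⟩) h, pathMul_comp, of_mul_of, pathMul_ne (by exact h)]
    exact LinearMap.congr_fun (map_zero (mulₗ (k := k) (V := V))) _
  · rw [pathMul_ne (p := ⟨a, b, p⟩) h, pathMul_ne (p := ⟨b', c, q⟩) h']
    exact (LinearMap.congr_fun (map_zero (mulₗ (k := k) (V := V))) _).trans
      (map_zero (mulₗ _)).symm

variable [Fintype V]

noncomputable instance : One (PathAlgebra k V) := ⟨∑ v : V, of k ⟨v, v, Quiver.Path.nil⟩⟩

lemma one_def : (1 : PathAlgebra k V) = ∑ v : V, of k ⟨v, v, Quiver.Path.nil⟩ := rfl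

lemma one_mul_aux : mulₗ (1 : PathAlgebra k V) = LinearMap.id := by
  classical
  refine hom_ext fun p => ?_
  obtain ⟨a, b, p⟩ := p
  rw [one_def, map_sum, LinearMap.sum_apply, Finset.sum_eq_single a]
  · rw [← mul_def, of_mul_of, pathMul_comp, Quiver.Path.nil_comp]; rfl
  · intro v _ hv
    rw [← mul_def, of_mul_of, pathMul_ne (by exact hv)]
  · simp

lemma mul_one_aux : mulₗ.flip (1 : PathAlgebra k V) = LinearMap.id := by
  classical
  refine hom_ext fun p => ?_
  obtain ⟨a, b, p⟩ := p
  rw [one_def, map_sum, LinearMap.sum_apply, Finset.sum_eq_single b]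
  · rw [LinearMap.flip_apply, ← mul_def, of_mul_of, pathMul_comp, Quiver.Path.comp_nil]; rfl
  · intro v _ hv
    rw [LinearMap.flip_apply, ← mul_def, of_mul_of, pathMul_ne (by exact hv.symm)]
  · simp

noncomputable instance : Ring (PathAlgebra k V) :=
  { instAddCommGroup k V with
    mul := (· * ·)
    one := 1
    left_distrib := fun x y z => map_add (mulₗ x) y z
    right_distrib := fun x y z => by rw [mul_def, map_add]; rfl
    zero_mul := fun x => by rw [mul_def, map_zero]; rfl
    mul_zero := fun x => map_zero (mulₗ x)
    mul_assoc := fun x y z => LinearMap.congr_fun (LinearMap.congr_fun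
      (LinearMap.congr_fun assoc_aux x) y) z
    one_mul := fun x => LinearMap.congr_fun one_mul_aux x
    mul_one := fun x => LinearMap.congr_fun mul_one_aux x }

noncomputable instance : Algebra k (PathAlgebra k V) := Algebra.ofModule
  (fun c x y => by rw [mul_def, map_smul]; rfl)
  (fun c x y => map_smul (mulₗ x) c y)

/-- The ideal `I_n` of `kQ` spanned by the paths of length at least `n`. -/
noncomputable def pathIdeal (k V : Type u) [Field k] [Quiver.{u} V] [Fintype V] (n : ℕ) :
    Ideal (PathAlgebra k V) :=
  { Submodule.span k {x : PathAlgebra k V | ∃ p : QPath V, n ≤ len p ∧ x = of k p} with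
    smul_mem' := fun a x hx => by
      change a * x ∈ Submodule.span k _
      have h1 : Submodule.span k {x : PathAlgebra k V | ∃ p : QPath V, n ≤ len p ∧ x = of k p} ≤
          Submodule.comap (mulₗ a) (Submodule.span k
            {x : PathAlgebra k V | ∃ p : QPath V, n ≤ len p ∧ x = of k p}) := by
        refine Submodule.span_le.2 ?_
        rintro _ ⟨p, hp, rfl⟩
        refine span_of (Submodule.comap (mulₗ.flip (of k p)) _) (fun q => ?_) a
        change of k q * of k p ∈ Submodule.span k _
        rw [of_mul_of]
        rcases pathMul_cases (k := k) q p with h | ⟨r, h, hr⟩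
        · rw [h]; exact Submodule.zero_mem _
        · rw [h]; exact Submodule.subset_span ⟨r, by omega, rfl⟩
      exact h1 hx }

variable {n : ℕ}

lemma of_mem {p : QPath V} (h : n ≤ len p) : of k p ∈ pathIdeal k V n :=
  Submodule.subset_span ⟨p, h, rfl⟩

lemma smul_mem (c : k) {x : PathAlgebra k V} (h : x ∈ pathIdeal k V n) :
    c • x ∈ pathIdeal k V n :=
  Submodule.smul_mem (Submodule.span k _) c h

lemma le_of {S : Submodule k (PathAlgebra k V)} (h : ∀ p : QPath V, n ≤ len p → of k p ∈ S)
    {x : PathAlgebra k V} (hx : x ∈ pathIdeal k V n) : x ∈ S := by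
  have : Submodule.span k {x : PathAlgebra k V | ∃ p : QPath V, n ≤ len p ∧ x = of k p} ≤ S := by
    refine Submodule.span_le.2 ?_
    rintro _ ⟨p, hp, rfl⟩
    exact h p hp
  exact this hx

lemma mul_mem_add {m : ℕ} {x y : PathAlgebra k V} (hx : x ∈ pathIdeal k V m)
    (hy : y ∈ pathIdeal k V n) : x * y ∈ pathIdeal k V (m + n) := by
  refine le_of (S := Submodule.comap (mulₗ.flip y)
    ((pathIdeal k V (m + n)).restrictScalars k)) (fun p hp => ?_) hx
  refine le_of (S := Submodule.comap (mulₗ (of k p))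
    ((pathIdeal k V (m + n)).restrictScalars k)) (fun q hq => ?_) hy
  change of k p * of k q ∈ pathIdeal k V (m + n)
  rw [of_mul_of]
  rcases pathMul_cases (k := k) p q with h | ⟨r, h, hr⟩
  · rw [h]; exact Submodule.zero_mem _
  · rw [h]; exact of_mem (by omega)

lemma mem_zero (x : PathAlgebra k V) : x ∈ pathIdeal k V 0 :=
  span_of ((pathIdeal k V 0).restrictScalars k) (fun _ => of_mem (Nat.zero_le _)) x

lemma pathIdeal_anti {m n : ℕ} (h : m ≤ n) {x : PathAlgebra k V} (hx : x ∈ pathIdeal k V n) :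
    x ∈ pathIdeal k V m :=
  le_of (S := (pathIdeal k V m).restrictScalars k) (fun _ hp => of_mem (h.trans hp)) hx

instance (n : ℕ) : (pathIdeal k V n).IsTwoSided :=
  ⟨fun b ha => by simpa using mul_mem_add ha (mem_zero b)⟩

open Classical in
/-- The homogeneous component of degree `i` with respect to the length of paths. -/
noncomputable def comp (i : ℕ) : PathAlgebra k V →ₗ[k] PathAlgebra k V :=
  lift fun p => if len p = i then of k p else 0

lemma comp_of (i : ℕ) (p : QPath V) [Decidable (len p = i)] :
    comp i (of k p) = if len p = i then of k p else 0 := by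
  rw [comp, lift_of]; congr 1

lemma comp_mem (i : ℕ) (x : PathAlgebra k V) : comp i x ∈ pathIdeal k V i := by
  classical
  refine span_of (Submodule.comap (comp i) ((pathIdeal k V i).restrictScalars k)) (fun p => ?_) x
  change comp i (of k p) ∈ pathIdeal k V i
  rw [comp_of]
  split_ifs with h
  · exact of_mem h.ge
  · exact Submodule.zero_mem _

lemma comp_eq_zero {i : ℕ} (hi : i < n) {x : PathAlgebra k V} (hx : x ∈ pathIdeal k V n) :
    comp i x = 0 := by
  classical
  refine le_of (S := LinearMap.ker (comp i)) (fun p hp => ?_) hx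
  rw [LinearMap.mem_ker, comp_of, if_neg (by omega)]

/-- `comp i` preserves every ideal `I_n`. -/
lemma comp_mem' (i : ℕ) {x : PathAlgebra k V} (hx : x ∈ pathIdeal k V n) :
    comp i x ∈ pathIdeal k V n := by
  by_cases h : i < n
  · rw [comp_eq_zero h hx]; exact Submodule.zero_mem _
  · exact pathIdeal_anti (not_lt.1 h) (comp_mem i x)

lemma sub_comp_zero_mem (x : PathAlgebra k V) : x - comp 0 x ∈ pathIdeal k V 1 := by
  classical
  refine span_of (Submodule.comap (LinearMap.id - comp 0)
    ((pathIdeal k V 1).restrictScalars k)) (fun p => ?_) x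
  change of k p - comp 0 (of k p) ∈ pathIdeal k V 1
  rw [comp_of]
  split_ifs with h
  · rw [sub_self]; exact Submodule.zero_mem _
  · rw [sub_zero]; exact of_mem (by omega)

lemma sub_comp_one_mem {x : PathAlgebra k V} (hx : x ∈ pathIdeal k V 1) :
    x - comp 1 x ∈ pathIdeal k V 2 := by
  classical
  refine le_of (S := Submodule.comap (LinearMap.id - comp 1)
    ((pathIdeal k V 2).restrictScalars k)) (fun p hp => ?_) hx
  change of k p - comp 1 (of k p) ∈ pathIdeal k V 2
  rw [comp_of]
  split_ifs with h
  · rw [sub_self]; exact Submodule.zero_mem _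
  · rw [sub_zero]; exact of_mem (by omega)

lemma comp_zero_mul (x y : PathAlgebra k V) : comp 0 (x * y) = comp 0 x * comp 0 y := by
  classical
  have : mulₗ.compr₂ (comp 0) = mulₗ.compl₁₂ (comp (k := k) (V := V) 0) (comp 0) := by
    refine hom_ext fun p => hom_ext fun q => ?_
    change comp 0 (of k p * of k q) = comp 0 (of k p) * comp 0 (of k q)
    rw [comp_of, comp_of, of_mul_of]
    rcases pathMul_cases (k := k) p q with h | ⟨r, h, hr⟩
    · rw [h, map_zero]; split_ifs <;> simp [h]
    · rw [h, comp_of]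
      by_cases h1 : len p = 0 <;> by_cases h2 : len q = 0 <;> simp [h1, h2, hr, h]
  exact LinearMap.congr_fun (LinearMap.congr_fun this x) y

lemma comp_one_mul (x y : PathAlgebra k V) :
    comp 1 (x * y) = comp 0 x * comp 1 y + comp 1 x * comp 0 y := by
  classical
  have : mulₗ.compr₂ (comp 1) = mulₗ.compl₁₂ (comp (k := k) (V := V) 0) (comp 1) +
      mulₗ.compl₁₂ (comp 1) (comp 0) := by
    refine hom_ext fun p => hom_ext fun q => ?_
    change comp 1 (of k p * of k q) = comp 0 (of k p) * comp 1 (of k q) +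
      comp 1 (of k p) * comp 0 (of k q)
    simp only [comp_of, of_mul_of]
    rcases pathMul_cases (k := k) p q with h | ⟨r, h, hr⟩
    · rw [h, map_zero]; split_ifs <;> simp [h]
    · rw [h, comp_of, hr]
      by_cases h1 : len p = 0
      · by_cases h2 : len q = 1
        · simp [h1, h2, h]
        · simp [h1, h2]
      · by_cases h1' : len p = 1
        · by_cases h2 : len q = 0
          · simp [h1', h2, h]
          · simp [h1', h2]
        · have : len p + len q ≠ 1 := by omega
          simp [h1, h1', this]
  exact LinearMap.congr_fun (LinearMap.congr_fun this x) y

/-- The trivial path at a vertex. -/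
noncomputable def nilPath (v : V) : PathAlgebra k V := of k ⟨v, v, Quiver.Path.nil⟩

open Classical in
/-- The coefficient of the trivial path at `v`. -/
noncomputable def coeff (v : V) : PathAlgebra k V →ₗ[k] k :=
  lift fun p => if len p = 0 ∧ p.1 = v then 1 else 0

lemma coeff_of (v : V) (p : QPath V) [Decidable (len p = 0 ∧ p.1 = v)] :
    coeff v (of k p) = if len p = 0 ∧ p.1 = v then 1 else 0 := by
  rw [coeff, lift_of]; congr 1

lemma coeff_mul (v : V) (x y : PathAlgebra k V) : coeff v (x * y) = coeff v x * coeff v y := by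
  classical
  have : mulₗ.compr₂ (coeff v) = (LinearMap.mul k k).compl₁₂ (coeff (k := k) v) (coeff v) := by
    refine hom_ext fun p => hom_ext fun q => ?_
    change coeff v (of k p * of k q) = coeff v (of k p) * coeff v (of k q)
    rw [coeff_of, coeff_of, of_mul_of]
    obtain ⟨a, b, p⟩ := p
    obtain ⟨b', c, q⟩ := q
    by_cases h : b = b'
    · subst h
      rw [pathMul_comp, coeff_of]
      cases p with
      | nil => simp [len]; split_ifs <;> simp_all
      | cons p e => simp [len]
    · rw [pathMul_ne (by exact h), map_zero]
      cases p with
      | nil =>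
        by_cases h1 : a = v
        · subst h1; simp [Ne.symm h]
        · simp [h1]
      | cons p e => simp [len]
  exact LinearMap.congr_fun (LinearMap.congr_fun this x) y

lemma coeff_one (v : V) : coeff v (1 : PathAlgebra k V) = 1 := by
  classical
  rw [one_def, map_sum, Finset.sum_eq_single v]
  · simp [coeff_of]
  · intro w _ hw; simp [coeff_of, hw]
  · simp

lemma coeff_eq_zero {v : V} {x : PathAlgebra k V} (hx : x ∈ pathIdeal k V 1) :
    coeff v x = 0 := by
  classical
  refine le_of (S := LinearMap.ker (coeff v)) (fun p hp => ?_) hx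
  rw [LinearMap.mem_ker, coeff_of, if_neg (by omega)]

lemma comp_zero_eq (x : PathAlgebra k V) : comp 0 x = ∑ v : V, coeff v x • nilPath v := by
  classical
  have : comp 0 = ∑ v : V, (coeff (k := k) v).smulRight (nilPath v) := by
    refine hom_ext fun p => ?_
    rw [comp_of, LinearMap.sum_apply]
    obtain ⟨a, b, p⟩ := p
    cases p with
    | nil =>
      rw [Finset.sum_eq_single a]
      · rw [LinearMap.smulRight_apply, coeff_of, if_pos (by simp [len]), if_pos (by simp [len]), one_smul]; rfl
      · intro w _ hw
        rw [LinearMap.smulRight_apply, coeff_of, if_neg (by simp [len, hw.symm]), zero_smul]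
      · simp
    | cons p e =>
      rw [if_neg (by simp [len])]
      refine (Finset.sum_eq_zero fun w _ => ?_).symm
      rw [LinearMap.smulRight_apply, coeff_of, if_neg (by simp [len]), zero_smul]
  rw [this, LinearMap.sum_apply]; rfl

/-- The coefficient of the trivial path at `v`, as a ring homomorphism. -/
noncomputable def coeffHom (k : Type u) [Field k] (v : V) : PathAlgebra k V →+* k where
  toFun := coeff v
  map_one' := coeff_one v
  map_mul' := coeff_mul v
  map_zero' := map_zero _
  map_add' := map_add _

end PathAlgebra

open PathAlgebra

variable [Fintype V]

/-- The truncated path algebra `kQ / I_n`. -/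
abbrev TruncatedPathAlgebra (n : ℕ) : Type u := PathAlgebra k V ⧸ pathIdeal k V n

namespace TruncatedPathAlgebra

variable {k V} {n : ℕ}

/-- The class of an element of the path algebra. -/
noncomputable abbrev mk (n : ℕ) : PathAlgebra k V →+* TruncatedPathAlgebra k V n :=
  Ideal.Quotient.mk (pathIdeal k V n)

lemma mk_surjective (a : TruncatedPathAlgebra k V n) : ∃ x, mk n x = a :=
  Ideal.Quotient.mk_surjective a

lemma mk_mem_jacobson (hn : 1 ≤ n) {x : PathAlgebra k V} :
    mk n x ∈ Ring.jacobson (TruncatedPathAlgebra k V n) ↔ x ∈ pathIdeal k V 1 := by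
  constructor
  · intro h
    have h0 : ∀ v : V, coeff v x = 0 := fun v => by
      have hle : ∀ a ∈ pathIdeal k V n, coeffHom k v a = 0 := fun a ha =>
        coeff_eq_zero (pathIdeal_anti hn ha)
      have hs : Function.Surjective (Ideal.Quotient.lift (pathIdeal k V n) (coeffHom k v) hle) :=
        fun c => ⟨mk n (c • 1), by
          rw [Ideal.Quotient.lift_mk]
          exact (map_smul (coeff v) c 1).trans (by rw [coeff_one, smul_eq_mul, mul_one])⟩
      have := RingHom.ker_isMaximal_of_surjective _ hs
      have h1 := Ring.jacobson_le_of_isMaximal (RingHom.ker (Ideal.Quotient.lift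
        (pathIdeal k V n) (coeffHom k v) hle)) h
      rw [RingHom.mem_ker, Ideal.Quotient.lift_mk] at h1
      exact h1
    have h1 := sub_comp_zero_mem x
    rw [comp_zero_eq, Finset.sum_eq_zero (fun v _ => by rw [h0, zero_smul]), sub_zero] at h1
    exact h1
  · intro h
    rw [← Ideal.jacobson_bot, Ideal.mem_jacobson_iff]
    intro y
    obtain ⟨y, rfl⟩ := mk_surjective y
    have h1 : y * x ∈ pathIdeal k V 1 := (pathIdeal k V 1).mul_mem_left y h
    have h2 : ∀ m : ℕ, (y * x) ^ m ∈ pathIdeal k V m := by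
      intro m
      induction m with
      | zero => exact mem_zero _
      | succ m ih => rw [pow_succ]; exact mul_mem_add ih h1
    have h3 : IsNilpotent (mk n (y * x)) :=
      ⟨n, by rw [← map_pow]; exact Ideal.Quotient.eq_zero_iff_mem.2 (h2 n)⟩
    obtain ⟨z, hz⟩ := h3.isUnit_one_add.exists_left_inv
    refine ⟨z, ?_⟩
    rw [Ideal.mem_bot, mul_assoc, ← map_mul, sub_eq_zero, ← hz]
    noncomm_ring

/-- The linear endomorphism of `kQ / I_n` induced by the projection of `kQ` onto the span of the
paths of length `i`. -/
noncomputable def degree (i : ℕ) : TruncatedPathAlgebra k V n →ₗ[k] TruncatedPathAlgebra k V n :=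
  (Submodule.Quotient.restrictScalarsEquiv k (pathIdeal k V n)).toLinearMap ∘ₗ
    (((pathIdeal k V n).restrictScalars k).mapQ ((pathIdeal k V n).restrictScalars k) (comp i)
      (fun _ hx => comp_mem' i hx)) ∘ₗ
    (Submodule.Quotient.restrictScalarsEquiv k (pathIdeal k V n)).symm.toLinearMap

@[simp] lemma degree_mk (i : ℕ) (x : PathAlgebra k V) : degree i (mk n x) = mk n (comp i x) := rfl

lemma degree_eq_zero (hn : 1 ≤ n) {a : TruncatedPathAlgebra k V n}
    (ha : a ∈ Ring.jacobson (TruncatedPathAlgebra k V n)) : degree 0 a = 0 := by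
  obtain ⟨x, rfl⟩ := mk_surjective a
  rw [degree_mk, comp_eq_zero one_pos ((mk_mem_jacobson hn).1 ha), map_zero]

lemma degree_one_mem (hn : 1 ≤ n) (a : TruncatedPathAlgebra k V n) :
    degree 1 a ∈ rad k (TruncatedPathAlgebra k V n) := by
  obtain ⟨x, rfl⟩ := mk_surjective a
  rw [degree_mk]
  exact (mk_mem_jacobson hn).2 (comp_mem 1 x)

lemma mk_mem_radSq (hn : 1 ≤ n) {x : PathAlgebra k V} (hx : x ∈ pathIdeal k V 2) :
    mk n x ∈ (rad k (TruncatedPathAlgebra k V n)) ^ 2 := by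
  refine le_of (S := Submodule.comap (Ideal.Quotient.mkₐ k (pathIdeal k V n)).toLinearMap
    ((rad k (TruncatedPathAlgebra k V n)) ^ 2)) (fun p hp => ?_) hx
  obtain ⟨a, b, p⟩ := p
  cases p with
  | nil => simp [len] at hp
  | @cons c _ p e =>
    have h1 : of k ⟨a, b, p.cons e⟩ = of k ⟨a, c, p⟩ * of k ⟨c, b, Quiver.Hom.toPath e⟩ := by
      rw [of_mul_of, pathMul_comp]; rfl
    change mk n (of k ⟨a, b, p.cons e⟩) ∈ (rad k (TruncatedPathAlgebra k V n)) ^ 2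
    rw [h1, map_mul, pow_two]
    refine Submodule.mul_mem_mul ((mk_mem_jacobson hn).2 (of_mem ?_))
      ((mk_mem_jacobson hn).2 (of_mem ?_))
    · simp [len] at hp ⊢; omega
    · simp [len]

lemma comp_radSq (hn : 2 ≤ n) {a : TruncatedPathAlgebra k V n}
    (ha : a ∈ (rad k (TruncatedPathAlgebra k V n)) ^ 2) : degree 1 a = 0 := by
  have h : (rad k (TruncatedPathAlgebra k V n)) ^ 2 ≤ LinearMap.ker (degree 1) := by
    rw [pow_two, Submodule.mul_le]
    intro a ha b hb
    obtain ⟨x, rfl⟩ := mk_surjective a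
    obtain ⟨y, rfl⟩ := mk_surjective b
    have hx := (mk_mem_jacobson (by omega)).1 ha
    have hy := (mk_mem_jacobson (by omega)).1 hb
    have hxy : comp 1 (x * y) = 0 := comp_eq_zero one_lt_two (mul_mem_add (m := 1) (n := 1) hx hy)
    have h2 : degree 1 (mk n x * mk n y) = 0 := by
      rw [← map_mul, degree_mk, hxy, map_zero]
    exact h2
  exact h ha

/-- The quiver data of a truncated path algebra, `n ≥ 2`: `δ₁` sends the class of a vertex to the
vertex and `δ₂` sends the class of an arrow to the arrow. -/
noncomputable def quiverData (k V : Type u) [Field k] [Quiver.{u} V] [Fintype V] {n : ℕ}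
    (hn : 2 ≤ n) : QuiverData k (TruncatedPathAlgebra k V n) where
  δ₁ := ((Ring.jacobson (TruncatedPathAlgebra k V n)).restrictScalars k).liftQ (degree 0)
      (fun _ ha => degree_eq_zero (by omega) ha) ∘ₗ
    (Submodule.Quotient.restrictScalarsEquiv k
      (Ring.jacobson (TruncatedPathAlgebra k V n))).symm.toLinearMap
  δ₂ := Submodule.liftQ _ ((degree 1 ∘ₗ (rad k (TruncatedPathAlgebra k V n)).subtype).codRestrict _
      fun a => degree_one_mem (by omega) a.1) (fun a ha => by
        rw [LinearMap.mem_ker]; ext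
        exact comp_radSq hn ha)
  π₁_δ₁ u := by
    obtain ⟨a, rfl⟩ := Ideal.Quotient.mk_surjective u
    obtain ⟨x, rfl⟩ := mk_surjective a
    change Ideal.Quotient.mk _ (mk n (comp 0 x)) = _
    rw [eq_comm, Ideal.Quotient.mk_eq_mk_iff_sub_mem, ← map_sub, mk_mem_jacobson (by omega)]
    exact sub_comp_zero_mem x
  π₂_δ₂ z := by
    induction z using Submodule.Quotient.induction_on with | H a => ?_
    obtain ⟨a, ha⟩ := a
    obtain ⟨x, rfl⟩ := mk_surjective a
    refine (QuiverData.mk_rad_eq (x := ⟨mk n x, ha⟩) (y := ⟨mk n (comp 1 x), _⟩) ?_).symm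
    change mk n x - mk n (comp 1 x) ∈ _
    rw [← map_sub]
    exact mk_mem_radSq (by omega) (sub_comp_one_mem ((mk_mem_jacobson (by omega)).1 ha))
  δ₁_mul u u' := by
    obtain ⟨a, rfl⟩ := Ideal.Quotient.mk_surjective u
    obtain ⟨x, rfl⟩ := mk_surjective a
    obtain ⟨a', rfl⟩ := Ideal.Quotient.mk_surjective u'
    obtain ⟨x', rfl⟩ := mk_surjective a'
    change mk n (comp 0 (x * x')) = mk n (comp 0 x) * mk n (comp 0 x')
    rw [comp_zero_mul, map_mul]
  δ₂_bilin u u' z z' h := by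
    obtain ⟨a, rfl⟩ := Ideal.Quotient.mk_surjective u
    obtain ⟨x, rfl⟩ := mk_surjective a
    obtain ⟨a', rfl⟩ := Ideal.Quotient.mk_surjective u'
    obtain ⟨x', rfl⟩ := mk_surjective a'
    obtain ⟨z, hz⟩ := z
    obtain ⟨y, rfl⟩ := mk_surjective z
    have hy := (mk_mem_jacobson (by omega)).1 hz
    change (z' : TruncatedPathAlgebra k V n) = mk n (comp 0 x) * mk n y * mk n (comp 0 x') at h
    change degree 1 (z' : TruncatedPathAlgebra k V n) =
      mk n (comp 0 x) * mk n (comp 1 y) * mk n (comp 0 x')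
    have h0 : ∀ x : PathAlgebra k V, comp 0 (comp 0 x) = comp 0 x := fun x => by
      have := comp_eq_zero one_pos (sub_comp_zero_mem x)
      rw [map_sub, sub_eq_zero] at this; exact this.symm
    rw [h, ← map_mul, ← map_mul, degree_mk, comp_one_mul, comp_one_mul, comp_zero_mul,
      comp_eq_zero one_pos hy, mul_zero, zero_mul, zero_add, mul_zero, add_zero, h0, h0,
      map_mul, map_mul]

/-- The vertex `v` as an idempotent of the truncated path algebra. -/
noncomputable def vertex (n : ℕ) (v : V) : TruncatedPathAlgebra k V n := mk n (nilPath v)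

/-- An arrow as an element of the truncated path algebra. -/
noncomputable def arrow (n : ℕ) {v w : V} (a : v ⟶ w) : TruncatedPathAlgebra k V n :=
  mk n (of k ⟨v, w, Quiver.Hom.toPath a⟩)

lemma quiverData_δ₁_vertex (hn : 2 ≤ n) (v : V) :
    (quiverData k V hn).δ₁ (Ideal.Quotient.mk _ (vertex n v)) = vertex n v := by
  classical
  change mk n (comp 0 (of k _)) = mk n (of k _)
  rw [comp_of, if_pos (by simp)]

lemma arrow_mem (hn : 2 ≤ n) {v w : V} (a : v ⟶ w) :
    (arrow n a : TruncatedPathAlgebra k V n) ∈ rad k (TruncatedPathAlgebra k V n) :=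
  (mk_mem_jacobson (by omega)).2 (of_mem (by simp [len]))

lemma quiverData_δ₂_arrow (hn : 2 ≤ n) {v w : V} (a : v ⟶ w) :
    (quiverData k V hn).δ₂ (Submodule.Quotient.mk ⟨arrow n a, arrow_mem hn a⟩) =
      ⟨arrow n a, arrow_mem hn a⟩ := by
  classical
  apply Subtype.ext
  change mk n (comp 1 (of k _)) = mk n (of k _)
  rw [comp_of, if_pos (by simp [len])]

end TruncatedPathAlgebra

end PathAlgebra

/-! ### Module category structures on `Vec(V)` and the dual category -/

section ModuleCategories

open MonoidalLeftAction Functor.LaxLeftLinear Functor.OplaxLeftLinear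

variable (C : Type w) [Category.{v} C] [Preadditive C] [MonoidalCategory C]
variable (k V : Type u) [Field k] [Linear k C]

/-- The category `Vec(V)` of `V`-indexed families of finite dimensional vector spaces. -/
abbrev Vec : Type _ := Discrete V ⥤ FGModuleCat.{u} k

/-- The simple object of `Vec(V)` with fibre `k` at `i` and fibre zero elsewhere. -/
def Vec.simple {k V : Type u} [Field k] (i : V) : Vec k V :=
  Discrete.functor fun j => FGModuleCat.of k (PLift (i = j) → k)

/-- A (left) `C`-module category structure on `Vec(V)`: an action of the monoidal category `C`
which is `k`-linear in both variables. -/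
structure ModStr where
  action : MonoidalLeftAction C (Vec k V)
  add_actionHomLeft : ∀ {X Y : C} (f g : X ⟶ Y) (M : Vec k V),
    (f + g) ⊵ₗ M = f ⊵ₗ M + g ⊵ₗ M
  smul_actionHomLeft : ∀ {X Y : C} (c : k) (f : X ⟶ Y) (M : Vec k V),
    (c • f) ⊵ₗ M = c • f ⊵ₗ M
  actionHomRight_add : ∀ (X : C) {M N : Vec k V} (f g : M ⟶ N),
    X ⊴ₗ (f + g) = X ⊴ₗ f + X ⊴ₗ g
  actionHomRight_smul : ∀ (X : C) {M N : Vec k V} (c : k) (f : M ⟶ N),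
    X ⊴ₗ (c • f) = c • X ⊴ₗ f

variable {C k V}

namespace ModStr

/-- The category `Vec(V)`, equipped with the module category structure `M`. -/
def Cat (_ : ModStr C k V) : Type _ := Vec k V

variable (M N P : ModStr C k V)

instance : Category M.Cat := inferInstanceAs (Category (Vec k V))

instance : Preadditive M.Cat := inferInstanceAs (Preadditive (Vec k V))

instance : Linear k M.Cat := inferInstanceAs (Linear k (Vec k V))

instance : MonoidalLeftAction C M.Cat := M.action

/-- The simple object of `Vec(V)` at the vertex `i`. -/
def simple (i : V) : M.Cat := Vec.simple (k := k) i

/-- The identity of `Vec(V)`, as a functor between two module categories. -/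
def idFunctor : M.Cat ⥤ N.Cat := 𝟭 (Vec k V)

end ModStr

/-- A `k`-linear `C`-module functor between two module categories on `Vec(V)`. -/
structure ModFunctor (M N : ModStr C k V) where
  functor : M.Cat ⥤ N.Cat
  [additive : functor.Additive]
  [linear : functor.Linear k]
  [leftLinear : functor.LeftLinear C]

namespace ModFunctor

attribute [instance] additive linear leftLinear

variable {M N P : ModStr C k V}

/-- A natural transformation of module functors. -/
@[ext]
structure Hom (F G : ModFunctor M N) where
  app : F.functor ⟶ G.functor
  comm : ∀ (X : C) (d : M.Cat),
    μₗ F.functor X d ≫ app.app (X ⊙ₗ d) = X ⊴ₗ app.app d ≫ μₗ G.functor X d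

/-- The category `Fun_C(M, N)` of `C`-module functors. -/
instance : Category (ModFunctor M N) where
  Hom := Hom
  id F := ⟨𝟙 _, by simp⟩
  comp f g := ⟨f.app ≫ g.app, by
    intro X d
    simp [reassoc_of% f.comm, g.comm]⟩

/-- The composite of module functors. -/
def comp (F : ModFunctor M N) (G : ModFunctor N P) : ModFunctor M P where
  functor := F.functor ⋙ G.functor
  leftLinear :=
    { μₗ := fun X d => μₗ G.functor X (F.functor.obj d) ≫ G.functor.map (μₗ F.functor X d)
      δₗ := fun X d => G.functor.map (δₗ F.functor X d) ≫ δₗ G.functor X (F.functor.obj d)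
      μₗ_naturality_left := fun f d => by
        simp only [Functor.comp_obj, Functor.comp_map, Category.assoc, μₗ_naturality_left_assoc,
          ← Functor.map_comp, μₗ_naturality_left]
      μₗ_naturality_right := fun c _ _ f => by
        simp only [Functor.comp_obj, Functor.comp_map, Category.assoc, μₗ_naturality_right_assoc,
          ← Functor.map_comp, μₗ_naturality_right]
      μₗ_associativity := fun c c' d => by
        simp only [Functor.comp_obj, Functor.comp_map, Category.assoc, ← Functor.map_comp,
          μₗ_associativity, actionHomRight_comp]
        simp only [Functor.map_comp, μₗ_associativity_assoc, μₗ_naturality_right_assoc]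
      μₗ_unitality := fun d => by
        simp only [Functor.comp_obj, Functor.comp_map, Category.assoc, ← Functor.map_comp,
          ← μₗ_unitality]
      δₗ_naturality_left := fun f d => by
        simp only [Functor.comp_obj, Functor.comp_map, Category.assoc, ← δₗ_naturality_left,
          ← Functor.map_comp_assoc]
      δₗ_naturality_right := fun c _ _ f => by
        simp only [Functor.comp_obj, Functor.comp_map, Category.assoc, ← δₗ_naturality_right,
          ← Functor.map_comp_assoc]
      δₗ_associativity := fun c c' d => by
        simp only [Functor.comp_obj, Functor.comp_map, Category.assoc, δₗ_associativity,
          actionHomRight_comp, ← Functor.map_comp_assoc]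
        simp only [Functor.map_comp, Category.assoc, δₗ_naturality_right_assoc]
      δₗ_unitality_inv := fun d => by
        simp only [Functor.comp_obj, Functor.comp_map, δₗ_unitality_inv, Functor.map_comp,
          Category.assoc]
      μₗ_comp_δₗ := fun c d => by
        simp [← Functor.map_comp_assoc]
      δₗ_comp_μₗ := fun c d => by
        simp [← Functor.map_comp] }

end ModFunctor

/-- The dual category `C*_M` of the module category `M`: its `C`-module endofunctors. -/
abbrev Dual (M : ModStr C k V) := ModFunctor M M

/-- The identity of `Vec(V)` as a module functor from `M` to `N`, given an isomorphism of module
category structures, i.e. a module functor structure `s` on the identity functor. -/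
def ModFunctor.ofId {M N : ModStr C k V} (s : (M.idFunctor N).LeftLinear C) : ModFunctor M N where
  functor := M.idFunctor N
  additive := ⟨rfl⟩
  linear := ⟨fun _ _ => rfl⟩

/-- The number of edges from `i` to `j` in the fusion graph of `F ∈ C*_M`: the multiplicity of the
simple object at `i` in the image under `F` of the simple object at `j`. -/
noncomputable def ModFunctor.mult {M : ModStr C k V} (F : Dual M) (i j : V) : ℕ :=
  Module.finrank k (M.simple i ⟶ F.functor.obj (M.simple j))

/-- The fusion graph of `F ∈ C*_M`: its vertices are the (simple objects indexed by the) elements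
of `V`, with `F.mult i j` edges from `i` to `j`. -/
def FusionGraph {M : ModStr C k V} (_ : Dual M) : Type u := V

instance {M : ModStr C k V} (F : Dual M) : Quiver.{0} (FusionGraph F) where
  Hom i j := Fin (F.mult (i : V) (j : V))

/-- Two quivers are isomorphic if there is a bijection of the vertices that preserves the number
of edges. -/
def QuiverIso (V W : Type*) [Quiver V] [Quiver W] : Prop :=
  ∃ σ : V ≃ W, ∀ i j, Nonempty ((i ⟶ j) ≃ (σ i ⟶ σ j))

variable (C k V)

/-- A module category structure on `Vec(V)` with an object of the dual category. -/
structure DualPair where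
  M : ModStr C k V
  F : Dual M

/-- Two pairs `(M, F)` and `(M', F')` are equivalent if there is an equivalence of module
categories `Ψ : M → M'` with `Ψ F ≅ F' Ψ` as module functors. -/
def DualPair.Equiv (x y : DualPair C k V) : Prop :=
  ∃ Ψ : ModFunctor x.M y.M, Ψ.functor.IsEquivalence ∧ Nonempty (x.F.comp Ψ ≅ Ψ.comp y.F)

/-- The pairs `(M, F)` such that the fusion graph of `F` is isomorphic to the quiver `Q` with
vertex set `V`. -/
def GraphPair [Quiver.{u} V] := {x : DualPair C k V // QuiverIso V (FusionGraph x.F)}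

/-- A pair `(M, F)` with an identification of the fusion graph of `F` with the quiver `Q` with
vertex set `V`, realizing the arrows `i ⟶ j` of `Q` as a basis of the space
`Hom(δᵢ, F δⱼ)`. -/
structure FramedPair [Quiver.{u} V] extends DualPair C k V where
  basis : ∀ i j : V, Module.Basis (i ⟶ j) k (M.simple i ⟶ F.functor.obj (M.simple j))

variable {C k V}

/-- An isomorphism of framed pairs: an isomorphism of module category structures on `Vec(V)`, and
an isomorphism of module functors which is compatible with the identifications of the fusion graphs
with `Q`. -/
def FramedPair.Iso [Quiver.{u} V] (x y : FramedPair C k V) : Prop :=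
  ∃ (s : (x.M.idFunctor y.M).LeftLinear C)
    (η : x.F.comp (ModFunctor.ofId s) ≅ (ModFunctor.ofId s).comp y.F),
    ∀ (i j : V) (a : i ⟶ j),
      (x.M.idFunctor y.M).map (x.basis i j a) ≫ η.hom.app.app (x.M.simple j) = y.basis i j a

end ModuleCategories

/-! ### Basic actions -/

section Actions

open MonoidalLeftAction Functor.LaxLeftLinear Functor.OplaxLeftLinear

variable (C : Type w) [Category.{v} C] [Preadditive C] [MonoidalCategory C]
variable {k A : Type u} [Field k] [Linear k C] [Ring A] [Algebra k A]

/-- A basic action of `C` on the algebra `A` with quiver data `D`: a linear monoidal functor from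
`C` to `BSA(A, D)`. -/
structure BasicAct (D : QuiverData k A) where
  functor : C ⥤ BSA D
  [additive : functor.Additive]
  [linear : functor.Linear k]
  [monoidal : functor.Monoidal]

namespace BasicAct

attribute [instance] additive linear monoidal

variable {C} {D : QuiverData k A} (Φ Φ' : BasicAct C D)

/-- Isomorphism of basic actions: a monoidal natural isomorphism. -/
def Iso : Prop := ∃ η : Φ.functor ≅ Φ'.functor, NatTrans.IsMonoidal η.hom

/-- The bimodule by which an object of `C` acts. -/
abbrev bim (X : C) : QBimodule D := (Φ.functor.obj X).obj

/-- The bimodule map by which a morphism of `C` acts. -/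
def map {X Y : C} (f : X ⟶ Y) : (Φ.bim X).carrier →ₗ[k] (Φ.bim Y).carrier :=
  QBimodule.Hom.lin (Φ.functor.map f).hom

/-- The monoidal structure `m ↦ n ↦ μ (m ⊗ n)` of a basic action, on elements. -/
def mul {X Y : C} (m : (Φ.bim X).carrier) (n : (Φ.bim Y).carrier) : (Φ.bim (X ⊗ Y)).carrier :=
  QBimodule.Hom.lin (Functor.LaxMonoidal.μ Φ.functor X Y).hom (Bimodule.tmk m n)

/-- The unit `A → Φ(𝟙)` of a basic action, on elements. -/
def unit (a : A) : (Φ.bim (𝟙_ C)).carrier :=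
  QBimodule.Hom.lin (Functor.LaxMonoidal.ε Φ.functor).hom a

end BasicAct

/-- An automorphism of the algebra with quiver data `(A, δ₁, δ₂)`: an algebra automorphism `τ` with
`τ δ₁ = δ₁ τ` and `τ δ₂ = δ₂ τ`. -/
structure QuiverData.Aut (D : QuiverData k A) where
  τ : A ≃ₐ[k] A
  map_δ₁ : ∀ a : A, τ (D.δ₁ (Ideal.Quotient.mk _ a)) = D.δ₁ (Ideal.Quotient.mk _ (τ a))
  map_δ₂ : ∀ z z' : rad k A, (z' : A) = τ z →
    τ (D.δ₂ (Submodule.Quotient.mk z)) = D.δ₂ (Submodule.Quotient.mk z')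

variable {C}

/-- Isomorphism of basic actions up to an automorphism `τ` of `(A, δ₁, δ₂)`: a family of
`τ`-semilinear bijections of the bimodules, compatible with `δ₁`, natural, and monoidal. -/
def BasicAct.TwistedIso {D : QuiverData k A} (Φ Φ' : BasicAct C D) : Prop :=
  ∃ (t : D.Aut) (f : ∀ X : C, (Φ.bim X).carrier ≃ₗ[k] (Φ'.bim X).carrier),
    (∀ X a m, f X ((Φ.bim X).l a m) = (Φ'.bim X).l (t.τ a) (f X m)) ∧
    (∀ X a m, f X ((Φ.bim X).r (op a) m) = (Φ'.bim X).r (op (t.τ a)) (f X m)) ∧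
    (∀ X m, f X ((Φ.bim X).δ₁ (Submodule.Quotient.mk m)) =
      (Φ'.bim X).δ₁ (Submodule.Quotient.mk (f X m))) ∧
    (∀ (X Y : C) (g : X ⟶ Y) m, f Y (Φ.map g m) = Φ'.map g (f X m)) ∧
    (∀ (X Y : C) (m : (Φ.bim X).carrier) (n : (Φ.bim Y).carrier),
      f (X ⊗ Y) (Φ.mul m n) = Φ'.mul (f X m) (f Y n)) ∧
    (∀ a, f (𝟙_ C) (Φ.unit a) = Φ'.unit (t.τ a))

/-- The subspace `e · δ₁(M / rad M) · e'` of a bimodule with quiver data, for idempotents `e` and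
`e'`. -/
def QBimodule.corner {D : QuiverData k A} (M : QBimodule D) (e e' : A) : Submodule k M.carrier where
  carrier := {m | M.δ₁ (Submodule.Quotient.mk m) = m ∧ M.l e m = m ∧ M.r (op e') m = m}
  zero_mem' := by simp
  add_mem' := by
    rintro m n ⟨h1, h2, h3⟩ ⟨h1', h2', h3'⟩
    refine ⟨?_, ?_, ?_⟩ <;> simp [*]
  smul_mem' := by
    rintro c m ⟨h1, h2, h3⟩
    refine ⟨?_, ?_, ?_⟩ <;> simp [*]

open TruncatedPathAlgebra

variable {V : Type u} [Quiver.{u} V] [Fintype V] [∀ i j : V, Fintype (i ⟶ j)] {n : ℕ} {hn : 2 ≤ n}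

/-- For a basic action `Φ` on the truncated path algebra of `Q` and vertices `i` and `j`, the space
of the edges `i → j` of the quiver connection `Φ(X)`, i.e. the part of the lifted subspace
`δ₁(Φ(X) / rad Φ(X))` between `i` and `j`. -/
noncomputable abbrev BasicAct.edges (Φ : BasicAct C (quiverData k V hn)) (X : C) (i j : V) :
    Submodule k (Φ.bim X).carrier :=
  (Φ.bim X).corner (vertex n i) (vertex n j)

/-- The relation between a basic action `Φ` on the truncated path algebra of a quiver `Q` and its
parameters `(M, F)`: the spaces of edges of the connections `Φ(X)` are the spaces
`Hom(δᵢ, X ⊙ δⱼ)` in `M`, in a way that is natural in `X`, compatible with the monoidal structure,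
and such that moving arrows of `Q` across `Φ(X)` corresponds to the module functor structure
`F(X ⊙ δⱼ) ≅ X ⊙ F δⱼ`. -/
structure Realization (Φ : BasicAct C (quiverData k V hn)) (x : FramedPair C k V) where
  θ : ∀ (X : C) (i j : V), Φ.edges X i j ≃ₗ[k] (x.M.simple i ⟶ X ⊙ₗ x.M.simple j)
  natural : ∀ {X Y : C} (f : X ⟶ Y) (i j : V) (m : Φ.edges X i j) (m' : Φ.edges Y i j),
    (m' : (Φ.bim Y).carrier) = Φ.map f m →
    θ Y i j m' = θ X i j m ≫ f ⊵ₗ x.M.simple j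
  mul : ∀ (X Y : C) (i l j : V) (m : Φ.edges X i l) (m' : Φ.edges Y l j)
    (t : Φ.edges (X ⊗ Y) i j), (t : (Φ.bim (X ⊗ Y)).carrier) = Φ.mul m.1 m'.1 →
    θ (X ⊗ Y) i j t =
      θ X i l m ≫ X ⊴ₗ θ Y l j m' ≫ (αₗ X Y (x.M.simple j)).inv
  unit : ∀ (i : V) (t : Φ.edges (𝟙_ C) i i),
    (t : (Φ.bim (𝟙_ C)).carrier) = Φ.unit (vertex n i) →
    θ (𝟙_ C) i i t = (λₗ (x.M.simple i)).inv
  arrows : ∀ (X : C) (i l j : V) (a : i ⟶ l) (m : Φ.edges X l j)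
    (m' : ∀ h : V, (h ⟶ j) → Φ.edges X i h),
    (Φ.bim X).l (arrow n a) m = ∑ h, ∑ b : h ⟶ j, (Φ.bim X).r (op (arrow n b)) (m' h b) →
    x.basis i l a ≫ x.F.functor.map (θ X l j m) ≫ δₗ x.F.functor X (x.M.simple j) =
      ∑ h, ∑ b : h ⟶ j, θ X i h (m' h b) ≫ X ⊴ₗ x.basis h j b

end Actions

end BasicAction

set_option linter.unusedSectionVars false

namespace BasicAction

/-- A relation that is total on both sides and compatible with two relations `r` and `s` exhibits
them as equivalence relations with the same classes. -/
lemma equivalence_and_quot_equiv {α : Type*} {β : Type*} {r : α → α → Prop} {s : β → β → Prop}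
    {R : α → β → Prop} (htl : ∀ a, ∃ b, R a b) (htr : ∀ b, ∃ a, R a b)
    (hr : ∀ {a a' b}, R a b → R a' b → r a a') (hs : ∀ {a b b'}, R a b → R a b' → s b b')
    (hr' : ∀ {a a' b}, r a a' → R a b → R a' b) (hs' : ∀ {a b b'}, s b b' → R a b → R a b') :
    Equivalence r ∧ Equivalence s ∧
      ∃ e : Quot r ≃ Quot s, ∀ a b, e (Quot.mk _ a) = Quot.mk _ b ↔ R a b := by
  have er : Equivalence r :=
    ⟨fun a => (htl a).elim fun b h => hr h h,
      fun {a a'} h => (htl a).elim fun b hb => hr (hr' h hb) hb,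
      fun {a a' a''} h h' => (htl a).elim fun b hb => hr hb (hr' h' (hr' h hb))⟩
  have es : Equivalence s :=
    ⟨fun b => (htr b).elim fun a h => hs h h,
      fun {b b'} h => (htr b).elim fun a ha => hs (hs' h ha) ha,
      fun {b b' b''} h h' => (htr b).elim fun a ha => hs ha (hs' h' (hs' h ha))⟩
  choose f hf using htl
  choose g hg using htr
  refine ⟨er, es, ⟨Quot.lift (fun a => Quot.mk s (f a))
      (fun a a' h => Quot.sound (hs (hr' h (hf a)) (hf a'))),
    Quot.lift (fun b => Quot.mk r (g b)) (fun b b' h => Quot.sound (hr (hs' h (hg b)) (hg b'))),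
    ?_, ?_⟩, fun a b => ⟨fun h => ?_, fun h => Quot.sound (hs (hf a) h)⟩⟩
  · rintro ⟨a⟩; exact Quot.sound (hr (hg (f a)) (hf a))
  · rintro ⟨b⟩; exact Quot.sound (hs (hf (g b)) (hg b))
  · have : s (f a) b := by
      have h2 : Quot.mk s (f a) = Quot.mk s b := h
      exact (es.eqvGen_iff).1 (Quot.eqvGen_exact h2)
    exact hs' this (hf a)

/-- The arrows of a quiver. -/
abbrev QArrow (V : Type u) [Quiver.{u} V] : Type u := Σ i j : V, (i ⟶ j)

namespace TruncatedPathAlgebra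

open PathAlgebra

variable {k V : Type u} [Field k] [Quiver.{u} V] [Fintype V] {n : ℕ}

/-- An arrow as an element of the truncated path algebra. -/
noncomputable abbrev arr (n : ℕ) (b : QArrow V) : TruncatedPathAlgebra k V n := arrow n b.2.2

lemma vertex_mul_self (v : V) : (vertex n v * vertex n v : TruncatedPathAlgebra k V n) =
    vertex n v := by
  rw [vertex, ← map_mul, nilPath, of_mul_of, pathMul_comp, Quiver.Path.nil_comp]

lemma vertex_mul_ne {v w : V} (h : v ≠ w) :
    (vertex n v * vertex n w : TruncatedPathAlgebra k V n) = 0 := by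
  rw [vertex, vertex, ← map_mul, nilPath, nilPath, of_mul_of, pathMul_ne (by exact h), map_zero]

lemma sum_vertex : ∑ v : V, (vertex n v : TruncatedPathAlgebra k V n) = 1 := by
  rw [← map_one (mk n), one_def, map_sum]; rfl

lemma vertex_mul_arrow {v w : V} (a : v ⟶ w) :
    (vertex n v * arrow n a : TruncatedPathAlgebra k V n) = arrow n a := by
  rw [vertex, arrow, ← map_mul, nilPath, of_mul_of, pathMul_comp, Quiver.Path.nil_comp]

lemma arrow_mul_vertex {v w : V} (a : v ⟶ w) :
    (arrow n a * vertex n w : TruncatedPathAlgebra k V n) = arrow n a := by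
  rw [vertex, arrow, ← map_mul, nilPath, of_mul_of, pathMul_comp, Quiver.Path.comp_nil]

lemma quiverData_p (hn : 2 ≤ n) (a : TruncatedPathAlgebra k V n) :
    (quiverData k V hn).p a = degree 0 a := rfl

lemma quiverData_p_vertex (hn : 2 ≤ n) (v : V) :
    (quiverData k V hn).p (vertex n v) = vertex n v := quiverData_δ₁_vertex hn v

lemma quiverData_p_arrow (hn : 2 ≤ n) {v w : V} (a : v ⟶ w) :
    (quiverData k V hn).p (arrow n a) = 0 := QuiverData.p_rad _ (arrow_mem hn a)

lemma quiverData_d_vertex (hn : 2 ≤ n) (v : V) :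
    (quiverData k V hn).d (vertex n v) = 0 := by
  rw [← quiverData_p_vertex hn, QuiverData.d_p]

lemma quiverData_d_arrow (hn : 2 ≤ n) {v w : V} (a : v ⟶ w) :
    (quiverData k V hn).d (arrow n a) = arrow n a := by
  rw [QuiverData.d_of_mem _ (arrow_mem hn a), quiverData_δ₂_arrow]

lemma quiverData_d (hn : 2 ≤ n) (a : TruncatedPathAlgebra k V n) :
    (quiverData k V hn).d a = degree 1 a := by
  change degree 1 (a - degree 0 a) = degree 1 a
  obtain ⟨x, rfl⟩ := mk_surjective a
  have : comp 1 (comp 0 x) = 0 := by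
    have : comp 1 ∘ₗ comp 0 = (0 : PathAlgebra k V →ₗ[k] PathAlgebra k V) := by
      classical
      refine PathAlgebra.hom_ext fun p => ?_
      rw [LinearMap.comp_apply, comp_of]
      split_ifs with h
      · rw [comp_of, if_neg (by omega)]; rfl
      · rw [map_zero]; rfl
    exact LinearMap.congr_fun this x
  rw [map_sub, degree_mk, degree_mk, degree_mk, this, map_zero, sub_zero]

/-- The coefficient of a vertex, as a character of the truncated path algebra. -/
noncomputable def vertexCoeff (hn : 2 ≤ n) (v : V) : TruncatedPathAlgebra k V n →ₐ[k] k :=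
  Ideal.Quotient.liftₐ (pathIdeal k V n)
    { coeffHom k v with
      commutes' := fun c => by
        have h : algebraMap k (PathAlgebra k V) c = c • 1 := Algebra.algebraMap_eq_smul_one c
        change coeff v (algebraMap k (PathAlgebra k V) c) = c
        rw [h, map_smul, coeff_one, smul_eq_mul, mul_one] }
    (fun a ha => coeff_eq_zero (pathIdeal_anti (by omega) ha))

lemma vertexCoeff_mk (hn : 2 ≤ n) (v : V) (x : PathAlgebra k V) :
    vertexCoeff hn v (mk n x) = coeff v x := rfl

lemma vertexCoeff_vertex [DecidableEq V] (hn : 2 ≤ n) (v w : V) :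
    vertexCoeff (k := k) hn v (vertex n w) = if w = v then 1 else 0 := by
  rw [vertex, vertexCoeff_mk, nilPath, coeff_of]
  simp

lemma vertexCoeff_rad (hn : 2 ≤ n) (v : V) {a : TruncatedPathAlgebra k V n}
    (ha : a ∈ rad k (TruncatedPathAlgebra k V n)) : vertexCoeff hn v a = 0 := by
  obtain ⟨x, rfl⟩ := mk_surjective a
  exact coeff_eq_zero ((mk_mem_jacobson (by omega)).1 ha)

lemma quiverData_p_eq (hn : 2 ≤ n) (a : TruncatedPathAlgebra k V n) :
    (quiverData k V hn).p a = ∑ v : V, vertexCoeff hn v a • vertex n v := by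
  obtain ⟨x, rfl⟩ := mk_surjective a
  rw [quiverData_p, degree_mk, comp_zero_eq, map_sum]
  rfl

lemma eq_smul_of_p (hn : 2 ≤ n) {a : TruncatedPathAlgebra k V n} {v : V}
    (h : (quiverData k V hn).p a = a) :
    a * vertex n v = vertexCoeff hn v a • vertex n v := by
  classical
  conv_lhs => rw [← h, quiverData_p_eq, Finset.sum_mul, Finset.sum_eq_single v
    (fun w _ hw => by rw [smul_mul_assoc, vertex_mul_ne hw, smul_zero]) (by simp),
    smul_mul_assoc, vertex_mul_self]

open Classical in
/-- The coefficient of an arrow. -/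
noncomputable def pathArrowCoeff (b : QArrow V) : PathAlgebra k V →ₗ[k] k :=
  lift fun p => if p = ⟨b.1, b.2.1, b.2.2.toPath⟩ then 1 else 0

lemma pathArrowCoeff_eq_zero (b : QArrow V) {x : PathAlgebra k V}
    (hx : x ∈ pathIdeal k V 2) : pathArrowCoeff b x = 0 := by
  refine le_of (S := LinearMap.ker (pathArrowCoeff b)) (fun p hp => ?_) hx
  rw [LinearMap.mem_ker, pathArrowCoeff, lift_of, if_neg]
  rintro rfl
  simp [len] at hp

/-- The coefficient of an arrow, as a linear form on the truncated path algebra. -/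
noncomputable def arrowCoeff (hn : 2 ≤ n) (b : QArrow V) : TruncatedPathAlgebra k V n →ₗ[k] k :=
  ((pathIdeal k V n).restrictScalars k).liftQ (pathArrowCoeff b)
      (fun _ ha => pathArrowCoeff_eq_zero b (pathIdeal_anti hn ha)) ∘ₗ
    (Submodule.Quotient.restrictScalarsEquiv k (pathIdeal k V n)).symm.toLinearMap

lemma arrowCoeff_mk (hn : 2 ≤ n) (b : QArrow V) (x : PathAlgebra k V) :
    arrowCoeff hn b (mk n x) = pathArrowCoeff b x := rfl

lemma arrowCoeff_arr [DecidableEq (QArrow V)] (hn : 2 ≤ n) (b c : QArrow V) :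
    arrowCoeff (k := k) hn b (arr n c) = if c = b then 1 else 0 := by
  obtain ⟨i, j, b⟩ := b
  obtain ⟨i', j', c⟩ := c
  rw [arr, arrow, arrowCoeff_mk, pathArrowCoeff, lift_of]
  congr 1
  refine propext ⟨fun h => ?_, fun h => ?_⟩
  · simp only [Sigma.mk.injEq] at h ⊢
    obtain ⟨rfl, h⟩ := h
    have h := eq_of_heq h
    simp only [Sigma.mk.injEq] at h
    obtain ⟨rfl, h⟩ := h
    have h := eq_of_heq h
    simp only [Quiver.Hom.toPath, Quiver.Path.cons.injEq, heq_eq_eq, true_and] at h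
    subst h; simp
  · cases h; rfl

section

variable [∀ i j : V, Fintype (i ⟶ j)]

lemma quiverData_d_eq (hn : 2 ≤ n) (a : TruncatedPathAlgebra k V n) :
    (quiverData k V hn).d a = ∑ b : QArrow V, arrowCoeff hn b a • arr n b := by
  classical
  obtain ⟨x, rfl⟩ := mk_surjective a
  rw [quiverData_d]
  have : degree 1 ∘ₗ (Ideal.Quotient.mkₐ k (pathIdeal k V n)).toLinearMap =
      (∑ b : QArrow V, (arrowCoeff hn b).smulRight (arr n b)) ∘ₗ
        (Ideal.Quotient.mkₐ k (pathIdeal k V n)).toLinearMap := by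
    refine PathAlgebra.hom_ext fun p => ?_
    change mk n (comp 1 (of k p)) =
      (∑ b : QArrow V, (arrowCoeff hn b).smulRight (arr n b)) (mk n (of k p))
    rw [LinearMap.sum_apply, comp_of]
    split_ifs with h
    · obtain ⟨i, j, p⟩ := p
      obtain ⟨a, rfl⟩ : ∃ a : i ⟶ j, p = a.toPath := by
        cases p with
        | nil => simp [len] at h
        | cons p e =>
          cases p with
          | nil => exact ⟨e, rfl⟩
          | cons p e' => simp [len] at h
      change (arr n ⟨i, j, a⟩ : TruncatedPathAlgebra k V n) =
        ∑ b : QArrow V, arrowCoeff (k := k) hn b (arr n ⟨i, j, a⟩) • arr n b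
      simp only [arrowCoeff_arr, ite_smul, one_smul, zero_smul]
      exact (Fintype.sum_ite_eq (⟨i, j, a⟩ : QArrow V)
        (fun b => (arr n b : TruncatedPathAlgebra k V n))).symm
    · rw [map_zero]
      refine (Finset.sum_eq_zero fun b _ => ?_).symm
      rw [LinearMap.smulRight_apply, arrowCoeff_mk, pathArrowCoeff, lift_of, if_neg, zero_smul]
      rintro rfl
      exact h (by simp [len])
  have := LinearMap.congr_fun this x
  rw [LinearMap.comp_apply, LinearMap.comp_apply, LinearMap.sum_apply] at this
  exact this

end

/-- The truncated path algebra is generated by the vertices and the arrows. -/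
lemma mul_induction (S : Submodule k (TruncatedPathAlgebra k V n)) (hv : ∀ v, vertex n v ∈ S)
    (ha : ∀ b, arr n b ∈ S) (hm : ∀ x ∈ S, ∀ y ∈ S, x * y ∈ S) (x) : x ∈ S := by
  obtain ⟨x, rfl⟩ := mk_surjective x
  refine span_of (S.comap (Ideal.Quotient.mkₐ k (pathIdeal k V n)).toLinearMap) (fun p => ?_) x
  obtain ⟨i, j, p⟩ := p
  change mk n (of k ⟨i, j, p⟩) ∈ S
  induction p with
  | nil => exact hv i
  | @cons c d p e ih =>
    have h1 : of k ⟨i, d, p.cons e⟩ = of k ⟨i, c, p⟩ * of k ⟨c, d, Quiver.Hom.toPath e⟩ := by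
      rw [of_mul_of, pathMul_comp]; rfl
    rw [h1, map_mul]
    exact hm _ ih _ (ha ⟨c, d, e⟩)

section Lift

variable {B : Type u} [Ring B] [Algebra k B]

/-- The product of the values of the arrows along a path. -/
def pathVal (E : V → B) (X : QArrow V → B) {i : V} : ∀ {j : V}, Quiver.Path i j → B
  | _, .nil => E i
  | _, .cons p e => pathVal E X p * X ⟨_, _, e⟩

/-- Values of the vertices and the arrows in an algebra that satisfy the relations of the truncated
path algebra. -/
structure IsTruncatedRep (n : ℕ) (E : V → B) (X : QArrow V → B) : Prop where
  mul_self : ∀ i, E i * E i = E i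
  mul_ne : ∀ i j, i ≠ j → E i * E j = 0
  sum : ∑ i, E i = 1
  left : ∀ b, E b.1 * X b = X b
  right : ∀ b, X b * E b.2.1 = X b
  truncated : ∀ (i j) (p : Quiver.Path i j), n ≤ p.length → pathVal E X p = 0

namespace IsTruncatedRep

variable {E : V → B} {X : QArrow V → B}

lemma pathVal_mul_right (h : IsTruncatedRep n E X) {i j : V} (p : Quiver.Path i j) : pathVal E X p * E j = pathVal E X p := by
  cases p with
  | nil => simpa [pathVal] using h.mul_self i
  | cons p e => rw [pathVal, mul_assoc, h.right ⟨_, _, e⟩]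

lemma pathVal_mul_left (h : IsTruncatedRep n E X) {i j : V} (p : Quiver.Path i j) : E i * pathVal E X p = pathVal E X p := by
  induction p with
  | nil => simpa [pathVal] using h.mul_self i
  | cons p e ih => rw [pathVal, ← mul_assoc, ih]

lemma pathVal_comp (h : IsTruncatedRep n E X) {i j l : V} (p : Quiver.Path i j) (q : Quiver.Path j l) :
    pathVal E X (p.comp q) = pathVal E X p * pathVal E X q := by
  induction q with
  | nil => simpa [pathVal] using (h.pathVal_mul_right p).symm
  | cons q e ih => rw [Quiver.Path.comp_cons, pathVal, ih, pathVal, mul_assoc]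

lemma lift_mul (h : IsTruncatedRep n E X) (x y : PathAlgebra k V) :
    PathAlgebra.lift (fun p => pathVal E X p.2.2) (x * y) =
      PathAlgebra.lift (fun p => pathVal E X p.2.2) x *
        PathAlgebra.lift (fun p => pathVal E X p.2.2) y := by
  have : mulₗ.compr₂ (PathAlgebra.lift fun p => pathVal E X p.2.2) = (LinearMap.mul k B).compl₁₂
      (PathAlgebra.lift fun p : QPath V => pathVal E X p.2.2)
      (PathAlgebra.lift fun p : QPath V => pathVal E X p.2.2) := by
    refine PathAlgebra.hom_ext fun p => PathAlgebra.hom_ext fun q => ?_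
    change PathAlgebra.lift (fun p => pathVal E X p.2.2) (of k p * of k q) =
      PathAlgebra.lift (fun p => pathVal E X p.2.2) (of k p) *
        PathAlgebra.lift (fun p => pathVal E X p.2.2) (of k q)
    rw [of_mul_of, lift_of, lift_of]
    obtain ⟨a, b, p⟩ := p
    obtain ⟨b', c, q⟩ := q
    by_cases hb : b = b'
    · subst hb
      rw [pathMul_comp, lift_of, h.pathVal_comp]
    · rw [pathMul_ne (by exact hb), map_zero, ← h.pathVal_mul_right p,
        ← h.pathVal_mul_left q, mul_assoc, ← mul_assoc (E b), h.mul_ne _ _ hb, zero_mul,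
        mul_zero]
  exact LinearMap.congr_fun (LinearMap.congr_fun this x) y

/-- The universal property of the truncated path algebra. -/
noncomputable def algHom (h : IsTruncatedRep n E X) : TruncatedPathAlgebra k V n →ₐ[k] B :=
  Ideal.Quotient.liftₐ (pathIdeal k V n)
    (AlgHom.ofLinearMap (PathAlgebra.lift fun p => pathVal E X p.2.2)
      (by
        rw [one_def, map_sum, ← h.sum]
        exact Finset.sum_congr rfl fun v _ => (lift_of _ _).trans (by simp [pathVal]))
      h.lift_mul)
    (fun a ha => by
      refine le_of (S := LinearMap.ker (PathAlgebra.lift fun p : QPath V => pathVal E X p.2.2))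
        (fun p hp => ?_) ha
      rw [LinearMap.mem_ker, lift_of]
      exact h.truncated _ _ _ hp)

@[simp] lemma algHom_vertex (h : IsTruncatedRep n E X) (v : V) : h.algHom (vertex (k := k) n v) = E v :=
  (lift_of (fun p : QPath V => pathVal E X p.2.2) _).trans (by simp [pathVal])

@[simp] lemma algHom_arr (h : IsTruncatedRep n E X) (b : QArrow V) : h.algHom (arr (k := k) n b) = X b :=
  (lift_of (fun p : QPath V => pathVal E X p.2.2) _).trans
    (by simpa [pathVal, Quiver.Hom.toPath] using h.left b)

end IsTruncatedRep

end Lift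

end TruncatedPathAlgebra

end BasicAction

namespace BasicAction

namespace QBimodule

open Bimodule

section Frames

variable {k A : Type u} [Field k] [Ring A] [Algebra k A] {D : QuiverData k A}

lemma lin_d {M N : QBimodule D} (f : M ⟶ N) (m : M.carrier) :
    Hom.lin f (M.d m) = N.d (Hom.lin f m) := by
  have h1 : M.radM ≤ LinearMap.eqLocus (Hom.lin f ∘ₗ M.d) (N.d ∘ₗ Hom.lin f) :=
    radMul_le fun a ha m _ => by
      rw [LinearMap.mem_eqLocus, LinearMap.comp_apply, LinearMap.comp_apply, M.d_l, lin_l, N.d_l,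
        D.p_rad ha, map_add, lin_l, lin_l, lin_p, map_zero]
      simp
  have h2 := h1 (M.sub_p_mem m)
  rw [LinearMap.mem_eqLocus, LinearMap.comp_apply, LinearMap.comp_apply, map_sub, M.d_p, map_sub,
    map_zero, map_sub (Hom.lin f), lin_p, map_sub, N.d_p, sub_zero, sub_zero] at h2
  exact h2

/-- A dual basis of `M` as a right module, in degree zero. -/
structure RightFrame (M : QBimodule D) where
  ι : Type
  [fintype : Fintype ι]
  x : ι → M.carrier
  ψ : ι → M.carrier →ₗ[k] A
  p_x : ∀ s, M.p (x s) = x s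
  ψ_r : ∀ s a m, ψ s (M.r (op a) m) = ψ s m * a
  ψ_p : ∀ s m, ψ s (M.p m) = D.p (ψ s m)
  ψ_d : ∀ s m, ψ s (M.d m) = D.d (ψ s m)
  sum_eq : ∀ m, ∑ s, M.r (op (ψ s m)) (x s) = m

/-- A dual basis of `M` as a left module, in degree zero. -/
structure LeftFrame (M : QBimodule D) where
  ι : Type
  [fintype : Fintype ι]
  x : ι → M.carrier
  φ : ι → M.carrier →ₗ[k] A
  p_x : ∀ s, M.p (x s) = x s
  φ_l : ∀ s a m, φ s (M.l a m) = a * φ s m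
  φ_p : ∀ s m, φ s (M.p m) = D.p (φ s m)
  φ_d : ∀ s m, φ s (M.d m) = D.d (φ s m)
  sum_eq : ∀ m, ∑ s, M.l (φ s m) (x s) = m

attribute [instance] RightFrame.fintype LeftFrame.fintype

lemma exists_sum_tmk {M N : Bimodule k A} (t : TensorSpace M N) :
    ∃ (ι : Type) (_ : Fintype ι) (x : ι → M.carrier) (y : ι → N.carrier),
      t = ∑ s, tmk (x s) (y s) := by
  refine tensor_ind (Q := fun t => ∃ (ι : Type) (_ : Fintype ι) (x : ι → M.carrier)
    (y : ι → N.carrier), t = ∑ s, tmk (x s) (y s)) (fun m n => ?_) ?_ t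
  · exact ⟨Unit, inferInstance, fun _ => m, fun _ => n, by simp⟩
  · rintro _ _ ⟨ι, _, x, y, rfl⟩ ⟨ι', _, x', y', rfl⟩
    exact ⟨ι ⊕ ι', inferInstance, Sum.elim x x', Sum.elim y y', by simp⟩

lemma exists_sum_tmk_unit {M N : QBimodule D} (f : 𝟙_ (QBimodule D) ⟶ M ⊗ N) :
    ∃ (ι : Type) (_ : Fintype ι) (x : ι → M.carrier) (y : ι → N.carrier),
      (∀ s, M.p (x s) = x s) ∧ (∀ s, N.p (y s) = y s) ∧
        (Hom.lin f (1 : A) : TensorSpace M.toBimodule N.toBimodule) = ∑ s, tmk (x s) (y s) := by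
  obtain ⟨ι, i, x, y, h⟩ := exists_sum_tmk
    (Hom.lin f (1 : A) : TensorSpace M.toBimodule N.toBimodule)
  refine ⟨ι, i, fun s => M.p (x s), fun s => N.p (y s), fun s => M.p_p _, fun s => N.p_p _, ?_⟩
  have h1 : Hom.lin f (D.p 1) = tensorP M N (Hom.lin f (1 : A)) := lin_p f (1 : A)
  rw [D.p_one] at h1
  refine h1.trans ((congrArg (tensorP M N) h).trans ?_)
  rw [map_sum]; rfl

lemma tensor_d (M N : QBimodule D) (t : (tensor M N).carrier) :
    (tensor M N).d t = tensorD M N t := by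
  have h : ∀ t, tensorD M N (tensorP M N t) = 0 := fun t =>
    tensor_ind (Q := fun t => tensorD M N (tensorP M N t) = 0)
      (fun m n => by
        rw [tensorP_tmk, tensorD_tmk, M.d_p, N.d_p, tmk_zero_left, tmk_zero_right, zero_add])
      (fun s t hs ht => by rw [map_add, map_add, hs, ht, zero_add]) t
  change tensorD M N (t - tensorP M N t) = tensorD M N t
  rw [map_sub, h, sub_zero]

lemma unit_d (D : QuiverData k A) (a : A) : (unit D).d a = D.d a := by
  change D.d (a - D.p a) = D.d a
  rw [map_sub, D.d_p, sub_zero]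

lemma tensorP_fixed_d {M N : QBimodule D} {m : M.carrier} (h : M.p m = m) (n : N.carrier) :
    tensorD M N (tmk m n) = tmk m (N.d n) := by
  rw [tensorD_tmk, h]
  have := M.d_p m
  rw [h] at this
  rw [this, tmk_zero_left, zero_add]

lemma tensorP_fixed_d' {M N : QBimodule D} (m : M.carrier) {n : N.carrier} (h : N.p n = n) :
    tensorD M N (tmk m n) = tmk (M.d m) n := by
  rw [tensorD_tmk, h]
  have := N.d_p n
  rw [h] at this
  rw [this, tmk_zero_right, add_zero]

lemma exists_rightFrame {M : QBimodule D} (hM : Nonempty (HasRightDual M)) :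
    Nonempty (RightFrame M) := by
  obtain ⟨⟨N⟩⟩ := hM
  let ev : tensor N M ⟶ unit D := ε_ M N
  obtain ⟨ι, _, x, y, hx, hy, h⟩ := exists_sum_tmk_unit (η_ M N)
  have hp : ∀ m : M.carrier, ∀ s, (Hom.lin ev (tmk (y s) (M.p m)) : A) =
      D.p (Hom.lin ev (tmk (y s) m)) := fun m s => by
    have := lin_p ev (tmk (y s) m)
    rw [tensor_p, hy] at this
    exact this
  have hd : ∀ m : M.carrier, ∀ s, (Hom.lin ev (tmk (y s) (M.d m)) : A) =
      D.d (Hom.lin ev (tmk (y s) m)) := fun m s => by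
    rw [← tensorP_fixed_d (hy s)]
    exact (congrArg (Hom.lin ev) (tensor_d N M _).symm).trans
      ((lin_d ev (tmk (y s) m)).trans (unit_d D _))
  refine ⟨⟨ι, x, fun s => Hom.lin ev ∘ₗ tmkₗ N.toBimodule M.toBimodule (y s), hx,
    fun s a m => lin_r ev a (tmk (y s) m), fun s m => hp m s, fun s m => hd m s,
    fun m => ?_⟩⟩
  have z := congrArg (fun f => Hom.lin f (tmk (M := unitBimodule k A) (1 : A) m))
    (ExactPairing.evaluation_coevaluation M N)
  have z' := congrArg (Hom.lin (rightUnit M).hom) z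
  let L : TensorSpace M.toBimodule N.toBimodule →ₗ[k] M.carrier :=
    Hom.lin (rightUnit M).hom ∘ₗ Hom.lin (tensorMap (𝟙 M) ev) ∘ₗ Hom.lin (assocHom M N M) ∘ₗ
      (tmkₗ (tensor M N).toBimodule M.toBimodule).flip m
  have e1 : L (Hom.lin (η_ M N) (1 : A)) = m := by
    refine z'.trans ?_
    change Hom.lin (rightUnit M).hom (Hom.lin (rightUnit M).inv (M.l 1 m)) = m
    rw [← lin_comp, Iso.inv_hom_id, lin_id, l_one]
  rw [h, map_sum] at e1
  exact e1

lemma exists_leftFrame {M : QBimodule D} (hM : Nonempty (HasLeftDual M)) :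
    Nonempty (LeftFrame M) := by
  obtain ⟨⟨N⟩⟩ := hM
  let ev : tensor M N ⟶ unit D := ε_ N M
  obtain ⟨ι, _, y, x, hy, hx, h⟩ := exists_sum_tmk_unit (η_ N M)
  have hp : ∀ m : M.carrier, ∀ s, (Hom.lin ev (tmk (M.p m) (y s)) : A) =
      D.p (Hom.lin ev (tmk m (y s))) := fun m s => by
    have := lin_p ev (tmk m (y s))
    rw [tensor_p, hy] at this
    exact this
  have hd : ∀ m : M.carrier, ∀ s, (Hom.lin ev (tmk (M.d m) (y s)) : A) =
      D.d (Hom.lin ev (tmk m (y s))) := fun m s => by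
    rw [← tensorP_fixed_d' _ (hy s)]
    exact (congrArg (Hom.lin ev) (tensor_d M N _).symm).trans
      ((lin_d ev (tmk m (y s))).trans (unit_d D _))
  refine ⟨⟨ι, x, fun s => Hom.lin ev ∘ₗ (tmkₗ M.toBimodule N.toBimodule).flip (y s), hx,
    fun s a m => lin_l ev a (tmk m (y s)), fun s m => hp m s, fun s m => hd m s,
    fun m => ?_⟩⟩
  have z := congrArg (fun f => Hom.lin f (tmk (N := unitBimodule k A) m (1 : A)))
    (ExactPairing.coevaluation_evaluation N M)
  have z' := congrArg (Hom.lin (leftUnit M).hom) z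
  let L : TensorSpace N.toBimodule M.toBimodule →ₗ[k] M.carrier :=
    Hom.lin (leftUnit M).hom ∘ₗ Hom.lin (tensorMap ev (𝟙 M)) ∘ₗ Hom.lin (assocInv M N M) ∘ₗ
      tmkₗ M.toBimodule (tensor N M).toBimodule m
  have e1 : L (Hom.lin (η_ N M) (1 : A)) = m := by
    refine z'.trans ?_
    change Hom.lin (leftUnit M).hom (Hom.lin (leftUnit M).inv (M.r (op 1) m)) = m
    rw [← lin_comp, Iso.inv_hom_id, lin_id, r_one]
  rw [h, map_sum] at e1
  exact e1

/-- `M` is generated in degree zero, as a right module. -/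
def IsGenerated (M : QBimodule D) : Prop :=
  ∀ S : Submodule k M.carrier, (∀ g a, M.p g = g → M.r (op a) g ∈ S) → ∀ m, m ∈ S

lemma RightFrame.isGenerated {M : QBimodule D} (R : RightFrame M) : M.IsGenerated :=
  fun S h m => by
    rw [← R.sum_eq m]
    exact S.sum_mem fun s _ => h _ _ (R.p_x s)

end Frames

section Quiver

open TruncatedPathAlgebra

variable {k V : Type u} [Field k] [Quiver.{u} V] [Fintype V] [∀ i j : V, Fintype (i ⟶ j)] {n : ℕ}
  {hn : 2 ≤ n} {M : QBimodule (quiverData k V hn)}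

namespace RightFrame

variable (R : RightFrame M)

/-- The coefficient of the arrow `b` of an element of degree one, on the right. -/
noncomputable def coeff (b : QArrow V) : M.carrier →ₗ[k] M.carrier :=
  ∑ s, (arrowCoeff hn b ∘ₗ R.ψ s).smulRight (M.r (op (vertex n b.1)) (R.x s))

lemma coeff_apply (b : QArrow V) (m : M.carrier) :
    R.coeff b m = ∑ s, arrowCoeff hn b (R.ψ s m) • M.r (op (vertex n b.1)) (R.x s) := by
  rw [coeff, LinearMap.sum_apply]; rfl

lemma p_coeff (b : QArrow V) (m : M.carrier) : M.p (R.coeff b m) = R.coeff b m := by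
  rw [coeff_apply, map_sum]
  refine Finset.sum_congr rfl fun s _ => ?_
  rw [map_smul, M.p_r, quiverData_p_vertex, R.p_x]

lemma r_coeff (b : QArrow V) (m : M.carrier) :
    M.r (op (vertex n b.1)) (R.coeff b m) = R.coeff b m := by
  rw [coeff_apply, map_sum]
  refine Finset.sum_congr rfl fun s _ => ?_
  rw [map_smul, r_r, vertex_mul_self]

lemma sum_coeff {m : M.carrier} (hm : M.d m = m) :
    ∑ b : QArrow V, M.r (op (arr n b)) (R.coeff b m) = m := by
  have h : ∀ s, R.ψ s m = ∑ b : QArrow V, arrowCoeff hn b (R.ψ s m) • arr n b := fun s => by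
    rw [← quiverData_d_eq, ← R.ψ_d, hm]
  conv_rhs => rw [← R.sum_eq m]
  simp only [coeff_apply, map_sum, map_smul, r_r, vertex_mul_arrow]
  rw [Finset.sum_comm]
  refine Finset.sum_congr rfl fun s _ => ?_
  conv_rhs => rw [h s]
  rw [Finset.op_sum, map_sum, LinearMap.sum_apply]
  refine Finset.sum_congr rfl fun b _ => ?_
  rw [op_smul, map_smul]; rfl

lemma coeff_arr [DecidableEq (QArrow V)] (b b' : QArrow V) {g : M.carrier} (hg : M.p g = g)
    (hr : M.r (op (vertex n b'.1)) g = g) :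
    R.coeff b (M.r (op (arr n b')) g) = if b' = b then g else 0 := by
  have h1 : ∀ s, (quiverData k V hn).p (R.ψ s g) = R.ψ s g := fun s => by rw [← R.ψ_p, hg]
  have h2 : ∀ s, R.ψ s (M.r (op (arr n b')) g) = vertexCoeff hn b'.1 (R.ψ s g) • arr n b' :=
    fun s => by
      rw [R.ψ_r, arr, ← vertex_mul_arrow, ← mul_assoc, eq_smul_of_p hn (h1 s), smul_mul_assoc]
  rw [coeff_apply]
  simp only [h2, map_smul, arrowCoeff_arr]
  split_ifs with h
  · subst h
    conv_rhs => rw [← hr, ← R.sum_eq g, map_sum]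
    refine Finset.sum_congr rfl fun s _ => ?_
    rw [r_r, eq_smul_of_p hn (h1 s), op_smul, map_smul, smul_eq_mul, mul_one]; rfl
  · simp

end RightFrame

namespace LeftFrame

variable (R : LeftFrame M)

/-- The coefficient of the arrow `b` of an element of degree one, on the left. -/
noncomputable def coeff (b : QArrow V) : M.carrier →ₗ[k] M.carrier :=
  ∑ s, (arrowCoeff hn b ∘ₗ R.φ s).smulRight (M.l (vertex n b.2.1) (R.x s))

lemma coeff_apply (b : QArrow V) (m : M.carrier) :
    R.coeff b m = ∑ s, arrowCoeff hn b (R.φ s m) • M.l (vertex n b.2.1) (R.x s) := by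
  rw [coeff, LinearMap.sum_apply]; rfl

lemma p_coeff (b : QArrow V) (m : M.carrier) : M.p (R.coeff b m) = R.coeff b m := by
  rw [coeff_apply, map_sum]
  refine Finset.sum_congr rfl fun s _ => ?_
  rw [map_smul, M.p_l, quiverData_p_vertex, R.p_x]

lemma l_coeff (b : QArrow V) (m : M.carrier) :
    M.l (vertex n b.2.1) (R.coeff b m) = R.coeff b m := by
  rw [coeff_apply, map_sum]
  refine Finset.sum_congr rfl fun s _ => ?_
  rw [map_smul, l_l, vertex_mul_self]

lemma sum_coeff {m : M.carrier} (hm : M.d m = m) :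
    ∑ b : QArrow V, M.l (arr n b) (R.coeff b m) = m := by
  have h : ∀ s, R.φ s m = ∑ b : QArrow V, arrowCoeff hn b (R.φ s m) • arr n b := fun s => by
    rw [← quiverData_d_eq, ← R.φ_d, hm]
  conv_rhs => rw [← R.sum_eq m]
  simp only [coeff_apply, map_sum, map_smul, l_l, arrow_mul_vertex]
  rw [Finset.sum_comm]
  refine Finset.sum_congr rfl fun s _ => ?_
  conv_rhs => rw [h s]
  rw [map_sum, LinearMap.sum_apply]
  refine Finset.sum_congr rfl fun b _ => ?_
  rw [map_smul]; rfl

end LeftFrame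

lemma d_of_p {m : M.carrier} (h : M.p m = m) : M.d m = 0 := by rw [← h, M.d_p]

lemma d_l_arr (b : QArrow V) {m : M.carrier} (h : M.p m = m) :
    M.d (M.l (arr n b) m) = M.l (arr n b) m := by
  rw [M.d_l, quiverData_d_arrow, h, d_of_p h, map_zero, zero_add]

lemma d_r_arr (b : QArrow V) {m : M.carrier} (h : M.p m = m) :
    M.d (M.r (op (arr n b)) m) = M.r (op (arr n b)) m := by
  rw [M.d_r, quiverData_d_arrow, h, d_of_p h, map_zero, zero_add]

end Quiver

end QBimodule

end BasicAction

namespace BasicAction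

open Bimodule

namespace QBimodule

variable {k A : Type u} [Field k] [Ring A] [Algebra k A] {D : QuiverData k A}

namespace RightFrame

variable {M N : QBimodule D} (R : RightFrame M)

/-- The extension of a map defined in degree zero to a map semilinear on the right. -/
def extend (t : A →ₐ[k] A) (θ : M.carrier →ₗ[k] N.carrier) : M.carrier →ₗ[k] N.carrier :=
  ∑ s, LinearMap.applyₗ (θ (R.x s)) ∘ₗ N.r.toLinearMap ∘ₗ (opLinearEquiv k).toLinearMap ∘ₗ
    t.toLinearMap ∘ₗ R.ψ s

lemma extend_apply (t : A →ₐ[k] A) (θ : M.carrier →ₗ[k] N.carrier) (m : M.carrier) :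
    R.extend t θ m = ∑ s, N.r (op (t (R.ψ s m))) (θ (R.x s)) := by
  rw [extend, LinearMap.sum_apply]; rfl

lemma extend_r (t : A →ₐ[k] A) (θ : M.carrier →ₗ[k] N.carrier) (m : M.carrier) (a : A) :
    R.extend t θ (M.r (op a) m) = N.r (op (t a)) (R.extend t θ m) := by
  simp only [extend_apply, map_sum, r_r, R.ψ_r, map_mul]

lemma extend_p {t : A →ₐ[k] A} {θ : M.carrier →ₗ[k] N.carrier}
    (h : ∀ g z, M.p g = g → D.p z = z → θ (M.r (op z) g) = N.r (op (t z)) (θ g))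
    {g : M.carrier} (hg : M.p g = g) : R.extend t θ g = θ g := by
  conv_rhs => rw [← R.sum_eq g]
  rw [extend_apply, map_sum]
  refine Finset.sum_congr rfl fun s _ => (h _ _ (R.p_x s) ?_).symm
  rw [← R.ψ_p, hg]

end RightFrame

end QBimodule

namespace QBimodule

open TruncatedPathAlgebra

variable {k V : Type u} [Field k] [Quiver.{u} V] [Fintype V] [∀ i j : V, Fintype (i ⟶ j)] {n : ℕ}
  {hn : 2 ≤ n} {M : QBimodule (quiverData k V hn)}

lemma mem_corner {e e' : TruncatedPathAlgebra k V n} {m : M.carrier} :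
    m ∈ M.corner e e' ↔ M.p m = m ∧ M.l e m = m ∧ M.r (op e') m = m := Iff.rfl

/-- The projection onto the part in degree zero between two vertices. -/
noncomputable def cut (M : QBimodule (quiverData k V hn)) (i j : V) :
    M.carrier →ₗ[k] M.corner (vertex n i) (vertex n j) :=
  (M.l (vertex n i) ∘ₗ M.r (op (vertex n j)) ∘ₗ M.p).codRestrict _ fun m => by
    refine mem_corner.2 ⟨?_, ?_, ?_⟩
    · simp only [LinearMap.comp_apply, M.p_l, M.p_r, quiverData_p_vertex, M.p_p]
    · simp only [LinearMap.comp_apply, l_l, vertex_mul_self]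
    · simp only [LinearMap.comp_apply, ← M.comm, r_r, vertex_mul_self]

lemma cut_coe (i j : V) (m : M.carrier) :
    (M.cut i j m : M.carrier) = M.l (vertex n i) (M.r (op (vertex n j)) (M.p m)) := rfl

lemma cut_self {i j : V} (m : M.corner (vertex n i) (vertex n j)) : M.cut i j m = m := by
  obtain ⟨h1, h2, h3⟩ := mem_corner.1 m.2
  apply Subtype.ext
  rw [cut_coe, h1, h3, h2]

lemma l_vertex_ne {i i' j : V} (h : i' ≠ i) (m : M.corner (vertex n i) (vertex n j)) :
    M.l (vertex n i') m = 0 := by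
  rw [← (mem_corner.1 m.2).2.1, l_l, vertex_mul_ne h, map_zero]; rfl

lemma r_vertex_ne {i j' j : V} (h : j' ≠ j) (m : M.corner (vertex n i) (vertex n j)) :
    M.r (op (vertex n j')) m = 0 := by
  rw [← (mem_corner.1 m.2).2.2, r_r, vertex_mul_ne h.symm, op_zero, map_zero]; rfl

lemma cut_ne_left {i i' j j' : V} (h : i' ≠ i) (m : M.corner (vertex n i) (vertex n j)) :
    M.cut i' j' m = 0 := by
  apply Subtype.ext
  rw [cut_coe, (mem_corner.1 m.2).1, M.comm, l_vertex_ne h, map_zero]; rfl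

lemma cut_ne_right {i i' j j' : V} (h : j' ≠ j) (m : M.corner (vertex n i) (vertex n j)) :
    M.cut i' j' m = 0 := by
  apply Subtype.ext
  rw [cut_coe, (mem_corner.1 m.2).1, r_vertex_ne h, map_zero]; rfl

lemma sum_l_vertex (m : M.carrier) : ∑ i, M.l (vertex n i) m = m := by
  rw [← LinearMap.sum_apply, ← map_sum, sum_vertex, l_one]

lemma sum_r_vertex (m : M.carrier) : ∑ i, M.r (op (vertex n i)) m = m := by
  rw [← LinearMap.sum_apply, ← map_sum, ← Finset.op_sum, sum_vertex, r_one]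

lemma sum_cut (m : M.carrier) : ∑ i, ∑ j, (M.cut i j m : M.carrier) = M.p m := by
  simp only [cut_coe]
  simp only [← map_sum, sum_r_vertex, sum_l_vertex]

lemma degree_zero_induction (S : Submodule k M.carrier)
    (h : ∀ i j, ∀ m ∈ M.corner (vertex n i) (vertex n j), m ∈ S) {m : M.carrier}
    (hm : M.p m = m) : m ∈ S := by
  rw [← hm, ← sum_cut]
  exact S.sum_mem fun i _ => S.sum_mem fun j _ => h i j _ (M.cut i j m).2

lemma sum_arrows_target {j : V} (x : QArrow V → M.carrier)
    (h : M.r (op (vertex n j)) (∑ b, M.r (op (arr n b)) (x b)) = ∑ b, M.r (op (arr n b)) (x b)) :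
    ∑ b, M.r (op (arr n b)) (x b) = ∑ i, ∑ b : i ⟶ j, M.r (op (arrow n b)) (x ⟨i, j, b⟩) := by
  classical
  rw [← h, map_sum, Fintype.sum_sigma]
  refine Finset.sum_congr rfl fun i _ => ?_
  rw [Fintype.sum_sigma, Finset.sum_eq_single j]
  · refine Finset.sum_congr rfl fun b _ => ?_
    rw [r_r, arrow_mul_vertex]
  · intro j' _ hj'
    refine Finset.sum_eq_zero fun b _ => ?_
    rw [r_r, arr, ← arrow_mul_vertex, mul_assoc, vertex_mul_ne hj', mul_zero, op_zero, map_zero]; rfl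
  · simp

lemma sum_arrows_source {i : V} (x : QArrow V → M.carrier)
    (h : M.l (vertex n i) (∑ b, M.l (arr n b) (x b)) = ∑ b, M.l (arr n b) (x b)) :
    ∑ b, M.l (arr n b) (x b) = ∑ j, ∑ b : i ⟶ j, M.l (arrow n b) (x ⟨i, j, b⟩) := by
  classical
  rw [← h, map_sum, Fintype.sum_sigma, Finset.sum_eq_single i]
  · rw [Fintype.sum_sigma]
    refine Finset.sum_congr rfl fun j _ => Finset.sum_congr rfl fun b _ => ?_
    rw [l_l, vertex_mul_arrow]
  · intro i' _ hi'
    refine Finset.sum_eq_zero fun b _ => ?_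
    rw [l_l, arr, ← vertex_mul_arrow, ← mul_assoc, vertex_mul_ne hi'.symm, zero_mul, map_zero]; rfl
  · simp

lemma RightFrame.exists_expansion (R : RightFrame M) {i j : V} {m : M.carrier} (hd : M.d m = m)
    (hi : M.l (vertex n i) m = m) (hj : M.r (op (vertex n j)) m = m) :
    ∃ x : ∀ h, (h ⟶ j) → M.corner (vertex n i) (vertex n h),
      m = ∑ h, ∑ b : h ⟶ j, M.r (op (arrow n b)) (x h b) := by
  refine ⟨fun h b => M.cut i h (R.coeff ⟨h, j, b⟩ m), ?_⟩
  have h1 := R.sum_coeff hd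
  have h2 := sum_arrows_target (M := M) (j := j) (fun b => R.coeff b m) (by rw [h1, hj])
  rw [h1] at h2
  conv_lhs => rw [← hi, h2, map_sum]
  refine Finset.sum_congr rfl fun h _ => ?_
  rw [map_sum]
  refine Finset.sum_congr rfl fun b _ => ?_
  have h3 := R.r_coeff ⟨h, j, b⟩ m
  rw [cut_coe, R.p_coeff, M.comm, h3]

lemma LeftFrame.exists_expansion (R : LeftFrame M) {i j : V} {m : M.carrier} (hd : M.d m = m)
    (hi : M.l (vertex n i) m = m) (hj : M.r (op (vertex n j)) m = m) :
    ∃ x : ∀ h, (i ⟶ h) → M.corner (vertex n h) (vertex n j),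
      m = ∑ h, ∑ b : i ⟶ h, M.l (arrow n b) (x h b) := by
  refine ⟨fun h b => M.cut h j (R.coeff ⟨i, h, b⟩ m), ?_⟩
  have h1 := R.sum_coeff hd
  have h2 := sum_arrows_source (M := M) (i := i) (fun b => R.coeff b m) (by rw [h1, hi])
  rw [h1] at h2
  conv_lhs => rw [← hj, h2, map_sum]
  refine Finset.sum_congr rfl fun h _ => ?_
  rw [map_sum]
  refine Finset.sum_congr rfl fun b _ => ?_
  have h3 := R.l_coeff ⟨i, h, b⟩ m
  rw [cut_coe, R.p_coeff, ← M.comm, M.comm (vertex n h), h3]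

lemma RightFrame.expansion_unique (R : RightFrame M) {i j : V}
    {x y : ∀ h, (h ⟶ j) → M.corner (vertex n i) (vertex n h)}
    (h : ∑ h, ∑ b : h ⟶ j, M.r (op (arrow n b)) (x h b : M.carrier) =
      ∑ h, ∑ b : h ⟶ j, M.r (op (arrow n b)) (y h b : M.carrier)) : x = y := by
  classical
  have key : ∀ (x : ∀ h, (h ⟶ j) → M.corner (vertex n i) (vertex n h)) (l : V) (c : l ⟶ j),
      R.coeff ⟨l, j, c⟩ (∑ h, ∑ b : h ⟶ j, M.r (op (arrow n b)) (x h b : M.carrier)) = x l c := by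
    intro x l c
    have h1 : ∀ (h : V) (b : h ⟶ j), R.coeff ⟨l, j, c⟩ (M.r (op (arrow n b)) (x h b)) =
        if (⟨h, j, b⟩ : QArrow V) = ⟨l, j, c⟩ then (x h b : M.carrier) else 0 := fun h b =>
      R.coeff_arr ⟨l, j, c⟩ ⟨h, j, b⟩ (mem_corner.1 (x h b).2).1 (mem_corner.1 (x h b).2).2.2
    simp only [map_sum, h1]
    rw [Finset.sum_eq_single l, Finset.sum_eq_single c, if_pos rfl]
    · intro b _ hb
      rw [if_neg]
      intro h; cases h; exact hb rfl
    · simp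
    · intro h _ hh
      refine Finset.sum_eq_zero fun b _ => if_neg ?_
      intro h; cases h; exact hh rfl
    · simp
  funext l c
  apply Subtype.ext
  rw [← key x, h, key y]

end QBimodule

namespace BasicAct

section General

variable {C : Type w} [Category.{v} C] [Preadditive C] [MonoidalCategory C]
variable {k A : Type u} [Field k] [Linear k C] [Ring A] [Algebra k A] {D : QuiverData k A}
variable (Φ Φ' : BasicAct C D)

lemma exists_rightFrame (X : C) : Nonempty (Φ.bim X).RightFrame :=
  QBimodule.exists_rightFrame (Φ.functor.obj X).property.2

lemma exists_leftFrame (X : C) : Nonempty (Φ.bim X).LeftFrame :=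
  QBimodule.exists_leftFrame (Φ.functor.obj X).property.1

lemma isGenerated (X : C) : (Φ.bim X).IsGenerated :=
  (Φ.exists_rightFrame X).some.isGenerated

section

variable {X Y Z : C}

lemma map_l (f : X ⟶ Y) (a : A) (m : (Φ.bim X).carrier) :
    Φ.map f ((Φ.bim X).l a m) = (Φ.bim Y).l a (Φ.map f m) := QBimodule.lin_l _ _ _

lemma map_r (f : X ⟶ Y) (a : A) (m : (Φ.bim X).carrier) :
    Φ.map f ((Φ.bim X).r (op a) m) = (Φ.bim Y).r (op a) (Φ.map f m) := QBimodule.lin_r _ _ _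

lemma map_p (f : X ⟶ Y) (m : (Φ.bim X).carrier) :
    Φ.map f ((Φ.bim X).p m) = (Φ.bim Y).p (Φ.map f m) := QBimodule.lin_p _ _

@[simp] lemma map_id (m : (Φ.bim X).carrier) : Φ.map (𝟙 X) m = m := by
  rw [map, Φ.functor.map_id]; rfl

@[simp] lemma map_comp (f : X ⟶ Y) (g : Y ⟶ Z) (m : (Φ.bim X).carrier) :
    Φ.map (f ≫ g) m = Φ.map g (Φ.map f m) := by
  rw [map, Φ.functor.map_comp]; rfl

lemma map_add' (f g : X ⟶ Y) (m : (Φ.bim X).carrier) :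
    Φ.map (f + g) m = Φ.map f m + Φ.map g m := by
  rw [map, Φ.functor.map_add]; rfl

lemma map_smul' (c : k) (f : X ⟶ Y) (m : (Φ.bim X).carrier) :
    Φ.map (c • f) m = c • Φ.map f m := by
  rw [map, Φ.functor.map_smul]; rfl

/-- The monoidal structure of a basic action as a bilinear map. -/
def mulₗ (X Y : C) : (Φ.bim X).carrier →ₗ[k] (Φ.bim Y).carrier →ₗ[k] (Φ.bim (X ⊗ Y)).carrier :=
  (tmkₗ (Φ.bim X).toBimodule (Φ.bim Y).toBimodule).compr₂
    (QBimodule.Hom.lin (Functor.LaxMonoidal.μ Φ.functor X Y).hom)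

lemma mulₗ_apply (m : (Φ.bim X).carrier) (n : (Φ.bim Y).carrier) :
    Φ.mulₗ X Y m n = Φ.mul m n := rfl

lemma mul_l (a : A) (m : (Φ.bim X).carrier) (n : (Φ.bim Y).carrier) :
    Φ.mul ((Φ.bim X).l a m) n = (Φ.bim (X ⊗ Y)).l a (Φ.mul m n) :=
  QBimodule.lin_l (Functor.LaxMonoidal.μ Φ.functor X Y).hom a (tmk m n)

lemma mul_r (a : A) (m : (Φ.bim X).carrier) (n : (Φ.bim Y).carrier) :
    Φ.mul m ((Φ.bim Y).r (op a) n) = (Φ.bim (X ⊗ Y)).r (op a) (Φ.mul m n) :=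
  QBimodule.lin_r (Functor.LaxMonoidal.μ Φ.functor X Y).hom a (tmk m n)

lemma mul_r_l (a : A) (m : (Φ.bim X).carrier) (n : (Φ.bim Y).carrier) :
    Φ.mul ((Φ.bim X).r (op a) m) n = Φ.mul m ((Φ.bim Y).l a n) := by
  rw [mul, tmk_r]; rfl

lemma p_mul (m : (Φ.bim X).carrier) (n : (Φ.bim Y).carrier) :
    (Φ.bim (X ⊗ Y)).p (Φ.mul m n) = Φ.mul ((Φ.bim X).p m) ((Φ.bim Y).p n) :=
  (QBimodule.lin_p (Functor.LaxMonoidal.μ Φ.functor X Y).hom (tmk m n)).symm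

lemma unit_l (a b : A) : Φ.unit (a * b) = (Φ.bim (𝟙_ C)).l a (Φ.unit b) :=
  QBimodule.lin_l (Functor.LaxMonoidal.ε Φ.functor).hom a (b : A)

lemma unit_r (a b : A) : Φ.unit (a * b) = (Φ.bim (𝟙_ C)).r (op b) (Φ.unit a) :=
  QBimodule.lin_r (Functor.LaxMonoidal.ε Φ.functor).hom b (a : A)

lemma p_unit (a : A) : (Φ.bim (𝟙_ C)).p (Φ.unit a) = Φ.unit (D.p a) :=
  (QBimodule.lin_p (Functor.LaxMonoidal.ε Φ.functor).hom (a : A)).symm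

/-- The unit of a basic action as a linear map. -/
def unitₗ : A →ₗ[k] (Φ.bim (𝟙_ C)).carrier :=
  QBimodule.Hom.lin (Functor.LaxMonoidal.ε Φ.functor).hom

lemma unitₗ_apply (a : A) : Φ.unitₗ a = Φ.unit a := rfl

variable {W X' Y' : C}

lemma map_mul (f : X ⟶ X') (g : Y ⟶ Y') (m : (Φ.bim X).carrier) (n : (Φ.bim Y).carrier) :
    Φ.map (f ⊗ₘ g) (Φ.mul m n) = Φ.mul (Φ.map f m) (Φ.map g n) := by
  have := Functor.LaxMonoidal.μ_natural Φ.functor f g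
  exact (congrArg (fun h => QBimodule.Hom.lin h.hom (tmk m n)) this).symm

lemma mul_assoc (m : (Φ.bim X).carrier) (n : (Φ.bim Y).carrier) (p : (Φ.bim Z).carrier) :
    Φ.map (α_ X Y Z).hom (Φ.mul (Φ.mul m n) p) = Φ.mul m (Φ.mul n p) := by
  have := Functor.LaxMonoidal.associativity Φ.functor X Y Z
  exact congrArg (fun h => QBimodule.Hom.lin h.hom
    (tmk (M := (QBimodule.tensor (Φ.bim X) (Φ.bim Y)).toBimodule) (tmk m n) p)) this

lemma unit_mul (a : A) (m : (Φ.bim X).carrier) :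
    Φ.map (λ_ X).hom (Φ.mul (Φ.unit a) m) = (Φ.bim X).l a m := by
  have := Functor.LaxMonoidal.left_unitality Φ.functor X
  exact (congrArg (fun h => QBimodule.Hom.lin h.hom
    (tmk (M := QBimodule.unitBimodule k A) a m)) this).symm

lemma mul_unit (a : A) (m : (Φ.bim X).carrier) :
    Φ.map (ρ_ X).hom (Φ.mul m (Φ.unit a)) = (Φ.bim X).r (op a) m := by
  have := Functor.LaxMonoidal.right_unitality Φ.functor X
  exact (congrArg (fun h => QBimodule.Hom.lin h.hom
    (tmk (N := QBimodule.unitBimodule k A) m a)) this).symm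

end

/-- A family of bijections that realizes an isomorphism of basic actions up to the automorphism
`t`. -/
structure IsTwist (t : D.Aut) (f : ∀ X : C, (Φ.bim X).carrier ≃ₗ[k] (Φ'.bim X).carrier) :
    Prop where
  map_l : ∀ X a m, f X ((Φ.bim X).l a m) = (Φ'.bim X).l (t.τ a) (f X m)
  map_r : ∀ X a m, f X ((Φ.bim X).r (op a) m) = (Φ'.bim X).r (op (t.τ a)) (f X m)
  map_p : ∀ X m, f X ((Φ.bim X).p m) = (Φ'.bim X).p (f X m)
  natural : ∀ (X Y : C) (g : X ⟶ Y) m, f Y (Φ.map g m) = Φ'.map g (f X m)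
  map_mul : ∀ (X Y : C) (m : (Φ.bim X).carrier) (n : (Φ.bim Y).carrier),
    f (X ⊗ Y) (Φ.mul m n) = Φ'.mul (f X m) (f Y n)
  map_unit : ∀ a, f (𝟙_ C) (Φ.unit a) = Φ'.unit (t.τ a)

variable {Φ Φ'}

lemma twistedIso_iff : Φ.TwistedIso Φ' ↔ ∃ t f, IsTwist Φ Φ' t f :=
  ⟨fun ⟨t, f, h1, h2, h3, h4, h5, h6⟩ => ⟨t, f, h1, h2, h3, h4, h5, h6⟩,
    fun ⟨t, f, h1, h2, h3, h4, h5, h6⟩ => ⟨t, f, h1, h2, h3, h4, h5, h6⟩⟩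

/-- The identity automorphism of an algebra with quiver data. -/
def _root_.BasicAction.QuiverData.Aut.refl (D : QuiverData k A) : D.Aut where
  τ := AlgEquiv.refl
  map_δ₁ _ := rfl
  map_δ₂ z z' h := by
    rw [show z' = z from Subtype.ext h]; rfl

lemma _root_.BasicAction.QuiverData.Aut.map_p (t : D.Aut) (a : A) :
    t.τ (D.p a) = D.p (t.τ a) := t.map_δ₁ a

lemma _root_.BasicAction.QuiverData.Aut.map_d (t : D.Aut) (a : A) :
    t.τ (D.d a) = D.d (t.τ a) := by
  rw [D.d_apply, D.d_apply]
  refine t.map_δ₂ ⟨_, D.sub_p_mem a⟩ ⟨_, D.sub_p_mem _⟩ ?_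
  change t.τ a - D.p (t.τ a) = t.τ (a - D.p a)
  rw [map_sub, t.map_p]

lemma _root_.BasicAction.QuiverData.Aut.symm_p (t : D.Aut) (a : A) :
    t.τ.symm (D.p a) = D.p (t.τ.symm a) := by
  rw [AlgEquiv.symm_apply_eq, t.map_p, AlgEquiv.apply_symm_apply]

lemma _root_.BasicAction.QuiverData.Aut.symm_d (t : D.Aut) (a : A) :
    t.τ.symm (D.d a) = D.d (t.τ.symm a) := by
  rw [AlgEquiv.symm_apply_eq, t.map_d, AlgEquiv.apply_symm_apply]

lemma Iso.exists_isTwist (h : Φ.Iso Φ') : ∃ f, IsTwist Φ Φ' (QuiverData.Aut.refl D) f := by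
  obtain ⟨η, hη⟩ := h
  have h1 : ∀ X m, QBimodule.Hom.lin (η.inv.app X).hom (QBimodule.Hom.lin (η.hom.app X).hom m) = m :=
    fun X m => congrArg (fun h => QBimodule.Hom.lin h.hom m) (η.hom_inv_id_app X)
  have h2 : ∀ X m, QBimodule.Hom.lin (η.hom.app X).hom (QBimodule.Hom.lin (η.inv.app X).hom m) = m :=
    fun X m => congrArg (fun h => QBimodule.Hom.lin h.hom m) (η.inv_hom_id_app X)
  refine ⟨fun X => { QBimodule.Hom.lin (η.hom.app X).hom with
    invFun := QBimodule.Hom.lin (η.inv.app X).hom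
    left_inv := h1 X
    right_inv := h2 X }, fun X a m => QBimodule.lin_l _ _ _, fun X a m => QBimodule.lin_r _ _ _,
    fun X m => QBimodule.lin_p _ _,
    fun X Y g m => congrArg (fun h => QBimodule.Hom.lin h.hom m) (η.hom.naturality g),
    fun X Y m n => congrArg (fun h => QBimodule.Hom.lin h.hom (tmk m n)) (hη.tensor X Y),
    fun a => congrArg (fun h => QBimodule.Hom.lin h.hom a) hη.unit⟩

lemma IsTwist.iso {f} (h : IsTwist Φ Φ' (QuiverData.Aut.refl D) f) : Φ.Iso Φ' := by
  let e : ∀ X : C, Φ.bim X ≅ Φ'.bim X := fun X =>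
    { hom := QBimodule.homMk (f X) (h.map_l X) (h.map_r X) (h.map_p X)
      inv := QBimodule.homMk (f X).symm
        (fun a m => by
          rw [LinearEquiv.coe_coe, LinearEquiv.symm_apply_eq, h.map_l,
            LinearEquiv.apply_symm_apply]; rfl)
        (fun a m => by
          rw [LinearEquiv.coe_coe, LinearEquiv.symm_apply_eq, h.map_r,
            LinearEquiv.apply_symm_apply]; rfl)
        (fun m => by
          rw [LinearEquiv.coe_coe, LinearEquiv.symm_apply_eq, h.map_p,
            LinearEquiv.apply_symm_apply])
      hom_inv_id := QBimodule.hom_ext fun m => (f X).symm_apply_apply m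
      inv_hom_id := QBimodule.hom_ext fun m => (f X).apply_symm_apply m }
  refine ⟨NatIso.ofComponents (fun X => (QBimodule.dualizable D).isoMk (e X)) fun g => ?_, ?_, ?_⟩
  · apply ObjectProperty.hom_ext
    exact QBimodule.hom_ext fun m => h.natural _ _ g m
  · apply ObjectProperty.hom_ext
    exact QBimodule.hom_ext fun a => h.map_unit a
  · intro X Y
    apply ObjectProperty.hom_ext
    exact QBimodule.tensor_ext fun m n => h.map_mul X Y m n

end General

section Quiver

open TruncatedPathAlgebra

variable {C : Type w} [Category.{v} C] [Preadditive C] [MonoidalCategory C]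
variable {k V : Type u} [Field k] [Linear k C] [Quiver.{u} V] [Fintype V]
  [∀ i j : V, Fintype (i ⟶ j)] {n : ℕ} {hn : 2 ≤ n}

lemma exists_expansion (Φ : BasicAct C (quiverData k V hn)) {X : C} {i l j : V} (a : i ⟶ l)
    (g : Φ.edges X l j) : ∃ x : ∀ h, (h ⟶ j) → Φ.edges X i h,
      (Φ.bim X).l (arrow n a) g = ∑ h, ∑ b : h ⟶ j, (Φ.bim X).r (op (arrow n b)) (x h b) := by
  refine (Φ.exists_rightFrame X).some.exists_expansion ?_ ?_ ?_
  · exact QBimodule.d_l_arr ⟨i, l, a⟩ g.2.1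
  · rw [l_l, vertex_mul_arrow]
  · rw [← (Φ.bim X).comm]; exact congrArg _ g.2.2.2

lemma exists_expansion' (Φ : BasicAct C (quiverData k V hn)) {X : C} {i l j : V} (a : l ⟶ j)
    (g : Φ.edges X i l) : ∃ x : ∀ h, (i ⟶ h) → Φ.edges X h j,
      (Φ.bim X).r (op (arrow n a)) g = ∑ h, ∑ b : i ⟶ h, (Φ.bim X).l (arrow n b) (x h b) := by
  refine (Φ.exists_leftFrame X).some.exists_expansion ?_ ?_ ?_
  · exact QBimodule.d_r_arr ⟨l, j, a⟩ g.2.1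
  · rw [(Φ.bim X).comm]; exact congrArg _ g.2.2.1
  · rw [r_r, arrow_mul_vertex]

lemma expansion_unique (Φ : BasicAct C (quiverData k V hn)) {X : C} {i j : V}
    {x y : ∀ h, (h ⟶ j) → Φ.edges X i h}
    (h : ∑ h, ∑ b : h ⟶ j, (Φ.bim X).r (op (arrow n b)) (x h b : (Φ.bim X).carrier) =
      ∑ h, ∑ b : h ⟶ j, (Φ.bim X).r (op (arrow n b)) (y h b : (Φ.bim X).carrier)) : x = y :=
  (Φ.exists_rightFrame X).some.expansion_unique h

/-- The restriction to degree zero of an isomorphism of basic actions up to an automorphism. -/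
structure DegZeroTwist (Φ Φ' : BasicAct C (quiverData k V hn)) (t : (quiverData k V hn).Aut) where
  θ : ∀ X, (Φ.bim X).carrier →ₗ[k] (Φ'.bim X).carrier
  θ' : ∀ X, (Φ'.bim X).carrier →ₗ[k] (Φ.bim X).carrier
  p_θ : ∀ X m, (Φ'.bim X).p (θ X m) = θ X m
  p_θ' : ∀ X m, (Φ.bim X).p (θ' X m) = θ' X m
  θ'_θ : ∀ X g, (Φ.bim X).p g = g → θ' X (θ X g) = g
  θ_θ' : ∀ X g, (Φ'.bim X).p g = g → θ X (θ' X g) = g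
  vertex_l : ∀ X g v, (Φ.bim X).p g = g →
    θ X ((Φ.bim X).l (vertex n v) g) = (Φ'.bim X).l (t.τ (vertex n v)) (θ X g)
  vertex_r : ∀ X g v, (Φ.bim X).p g = g →
    θ X ((Φ.bim X).r (op (vertex n v)) g) = (Φ'.bim X).r (op (t.τ (vertex n v))) (θ X g)
  swap : ∀ X (i l j : V) (a : i ⟶ l) (g : Φ.edges X l j) (x : ∀ h, (h ⟶ j) → Φ.edges X i h),
    (Φ.bim X).l (arrow n a) g = ∑ h, ∑ b : h ⟶ j, (Φ.bim X).r (op (arrow n b)) (x h b) →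
    (Φ'.bim X).l (t.τ (arrow n a)) (θ X g) =
      ∑ h, ∑ b : h ⟶ j, (Φ'.bim X).r (op (t.τ (arrow n b))) (θ X (x h b))
  natural : ∀ {X Y} (f : X ⟶ Y) g, (Φ.bim X).p g = g → θ Y (Φ.map f g) = Φ'.map f (θ X g)
  mul : ∀ {X Y} g g', (Φ.bim X).p g = g → (Φ.bim Y).p g' = g' →
    θ (X ⊗ Y) (Φ.mul g g') = Φ'.mul (θ X g) (θ Y g')
  unit : θ (𝟙_ C) (Φ.unit 1) = Φ'.unit 1

namespace DegZeroTwist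

variable {Φ Φ' : BasicAct C (quiverData k V hn)} {t : (quiverData k V hn).Aut}
  (T : DegZeroTwist Φ Φ' t)

lemma θ_r (X : C) {g z} (hg : (Φ.bim X).p g = g) (hz : (quiverData k V hn).p z = z) :
    T.θ X ((Φ.bim X).r (op z) g) = (Φ'.bim X).r (op (t.τ z)) (T.θ X g) := by
  rw [← hz, quiverData_p_eq]
  simp only [map_sum, map_smul, Finset.op_sum, op_smul, LinearMap.sum_apply, LinearMap.smul_apply]
  exact Finset.sum_congr rfl fun v _ => by rw [T.vertex_r X g v hg]

lemma θ'_r (X : C) {g z} (hg : (Φ'.bim X).p g = g) (hz : (quiverData k V hn).p z = z) :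
    T.θ' X ((Φ'.bim X).r (op z) g) = (Φ.bim X).r (op (t.τ.symm z)) (T.θ' X g) := by
  have hz' : (quiverData k V hn).p (t.τ.symm z) = t.τ.symm z := by
    rw [← t.symm_p, hz]
  have h := T.θ_r X (T.p_θ' X g) hz'
  rw [AlgEquiv.apply_symm_apply, T.θ_θ' X g hg] at h
  rw [← h, T.θ'_θ]
  rw [QBimodule.p_r, hz', T.p_θ']

/-- The bijections `Φ(X) → Φ'(X)`. -/
noncomputable def equiv (X : C) : (Φ.bim X).carrier ≃ₗ[k] (Φ'.bim X).carrier :=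
  have h1 := fun g z => T.θ_r X (g := g) (z := z)
  have h2 := fun g z => T.θ'_r X (g := g) (z := z)
  LinearEquiv.ofLinearMap ((Φ.exists_rightFrame X).some.extend t.τ (T.θ X))
    ((Φ'.exists_rightFrame X).some.extend t.τ.symm (T.θ' X))
    (LinearMap.ext fun m => Φ'.isGenerated X
      (LinearMap.eqLocus (_ ∘ₗ _) LinearMap.id) (fun g a hg => by
        rw [LinearMap.mem_eqLocus, LinearMap.comp_apply, QBimodule.RightFrame.extend_r,
          QBimodule.RightFrame.extend_r, QBimodule.RightFrame.extend_p _ h2 hg,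
          QBimodule.RightFrame.extend_p _ h1 (T.p_θ' X g), T.θ_θ' X g hg]
        simp) m)
    (LinearMap.ext fun m => Φ.isGenerated X
      (LinearMap.eqLocus (_ ∘ₗ _) LinearMap.id) (fun g a hg => by
        rw [LinearMap.mem_eqLocus, LinearMap.comp_apply, QBimodule.RightFrame.extend_r,
          QBimodule.RightFrame.extend_r, QBimodule.RightFrame.extend_p _ h1 hg,
          QBimodule.RightFrame.extend_p _ h2 (T.p_θ X g), T.θ'_θ X g hg]
        simp) m)

lemma equiv_r (X : C) (a) (m) :
    T.equiv X ((Φ.bim X).r (op a) m) = (Φ'.bim X).r (op (t.τ a)) (T.equiv X m) :=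
  QBimodule.RightFrame.extend_r _ _ _ _ _

lemma equiv_p (X : C) {g} (hg : (Φ.bim X).p g = g) : T.equiv X g = T.θ X g :=
  QBimodule.RightFrame.extend_p _ (fun _ _ => T.θ_r X) hg

lemma isTwist : IsTwist Φ Φ' t T.equiv := by
  have hl : ∀ X a m, T.equiv X ((Φ.bim X).l a m) = (Φ'.bim X).l (t.τ a) (T.equiv X m) := by
    intro X a
    have key : ∀ a, (∀ g, (Φ.bim X).p g = g →
        T.equiv X ((Φ.bim X).l a g) = (Φ'.bim X).l (t.τ a) (T.equiv X g)) →
        ∀ m, T.equiv X ((Φ.bim X).l a m) = (Φ'.bim X).l (t.τ a) (T.equiv X m) := by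
      intro a h m
      refine Φ.isGenerated X (LinearMap.eqLocus ((T.equiv X).toLinearMap ∘ₗ (Φ.bim X).l a)
        ((Φ'.bim X).l (t.τ a) ∘ₗ (T.equiv X).toLinearMap)) (fun g c hg => ?_) m
      change T.equiv X ((Φ.bim X).l a _) = (Φ'.bim X).l (t.τ a) (T.equiv X _)
      rw [(Φ.bim X).comm, equiv_r, h g hg, equiv_r, (Φ'.bim X).comm]
    let S : Submodule k (TruncatedPathAlgebra k V n) :=
      { carrier := {a | ∀ m, T.equiv X ((Φ.bim X).l a m) = (Φ'.bim X).l (t.τ a) (T.equiv X m)}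
        zero_mem' := fun m => by simp
        add_mem' := fun {a b} ha hb m => by
          rw [map_add, map_add, map_add, LinearMap.add_apply, LinearMap.add_apply, map_add,
            ha m, hb m]
        smul_mem' := fun c a ha m => by
          rw [map_smul, map_smul, map_smul, LinearMap.smul_apply, LinearMap.smul_apply, map_smul,
            ha m] }
    refine mul_induction S (fun v => ?_) (fun b => ?_) (fun x hx y hy => ?_) a
    · refine key _ fun g hg => ?_
      rw [T.equiv_p X hg, T.equiv_p, T.vertex_l X g v hg]
      rw [QBimodule.p_l, quiverData_p_vertex, hg]
    · refine key _ fun g hg => ?_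
      refine QBimodule.degree_zero_induction (LinearMap.eqLocus
        ((T.equiv X).toLinearMap ∘ₗ (Φ.bim X).l (arr n b))
        ((Φ'.bim X).l (t.τ (arr n b)) ∘ₗ (T.equiv X).toLinearMap)) (fun l j g hg => ?_) hg
      obtain ⟨i, l', b⟩ := b
      change T.equiv X ((Φ.bim X).l (arrow n b) g) = (Φ'.bim X).l (t.τ (arrow n b)) (T.equiv X g)
      by_cases hl : l' = l
      · subst hl
        obtain ⟨x, hx⟩ := Φ.exists_expansion b ⟨g, hg⟩
        have h1 := T.swap X i l' j b ⟨g, hg⟩ x hx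
        rw [T.equiv_p X hg.1, h1]
        refine (congrArg (T.equiv X) hx).trans ?_
        rw [map_sum]
        refine Finset.sum_congr rfl fun h _ => ?_
        rw [map_sum]
        refine Finset.sum_congr rfl fun c _ => ?_
        rw [equiv_r, T.equiv_p X (x h c).2.1]
      · have h1 : T.θ X g = (Φ'.bim X).l (t.τ (vertex n l)) (T.θ X g) := by
          rw [← T.vertex_l X g l hg.1, hg.2.1]
        rw [T.equiv_p X hg.1, h1, ← hg.2.1, l_l, l_l, ← _root_.map_mul, ← arrow_mul_vertex, _root_.mul_assoc,
          vertex_mul_ne hl]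
        simp
    · intro m
      rw [← l_l, hx, hy, _root_.map_mul, l_l]
  have hmul : ∀ (X Y : C) (g : (Φ.bim X).carrier) (m : (Φ.bim Y).carrier), (Φ.bim X).p g = g →
      T.equiv (X ⊗ Y) (Φ.mul g m) = Φ'.mul (T.equiv X g) (T.equiv Y m) := by
    intro X Y g m hg
    refine Φ.isGenerated Y (LinearMap.eqLocus ((T.equiv (X ⊗ Y)).toLinearMap ∘ₗ Φ.mulₗ X Y g)
        (Φ'.mulₗ X Y (T.equiv X g) ∘ₗ (T.equiv Y).toLinearMap)) (fun g' c hg' => ?_) m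
    change T.equiv (X ⊗ Y) (Φ.mul g _) = Φ'.mul (T.equiv X g) (T.equiv Y _)
    rw [mul_r, equiv_r, equiv_r, mul_r, T.equiv_p X hg, T.equiv_p Y hg', ← T.mul g g' hg hg',
      T.equiv_p]
    rw [p_mul, hg, hg']
  refine ⟨hl, T.equiv_r, fun X m => ?_, fun X Y f m => ?_, fun X Y m n => ?_, fun a => ?_⟩
  · refine Φ.isGenerated X (LinearMap.eqLocus ((T.equiv X).toLinearMap ∘ₗ (Φ.bim X).p)
      ((Φ'.bim X).p ∘ₗ (T.equiv X).toLinearMap)) (fun g c hg => ?_) m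
    change T.equiv X ((Φ.bim X).p _) = (Φ'.bim X).p (T.equiv X _)
    rw [QBimodule.p_r, equiv_r, equiv_r, QBimodule.p_r, hg, T.equiv_p X hg, T.p_θ, t.map_p]
  · refine Φ.isGenerated X (LinearMap.eqLocus ((T.equiv Y).toLinearMap ∘ₗ Φ.map f)
      (Φ'.map f ∘ₗ (T.equiv X).toLinearMap)) (fun g c hg => ?_) m
    change T.equiv Y (Φ.map f _) = Φ'.map f (T.equiv X _)
    rw [map_r, equiv_r, equiv_r, map_r, T.equiv_p X hg, ← T.natural f g hg, T.equiv_p]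
    rw [← map_p, hg]
  · refine Φ.isGenerated X (LinearMap.eqLocus
      ((T.equiv (X ⊗ Y)).toLinearMap ∘ₗ (Φ.mulₗ X Y).flip n)
      ((Φ'.mulₗ X Y).flip (T.equiv Y n) ∘ₗ (T.equiv X).toLinearMap)) (fun g c hg => ?_) m
    change T.equiv (X ⊗ Y) (Φ.mul _ n) = Φ'.mul (T.equiv X _) (T.equiv Y n)
    rw [mul_r_l, equiv_r, mul_r_l, ← hl, hmul X Y g _ hg]
  · have h := Φ.unit_r 1 a
    rw [one_mul] at h
    rw [h, equiv_r, T.equiv_p, T.unit, ← unit_r, one_mul]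
    rw [p_unit, QuiverData.p_one]

end DegZeroTwist

end Quiver

end BasicAct

end BasicAction

namespace BasicAction

open Bimodule

namespace BasicAct

open TruncatedPathAlgebra

variable {C : Type w} [Category.{v} C] [Preadditive C] [MonoidalCategory C]
variable {k V : Type u} [Field k] [Linear k C] [Quiver.{u} V] [Fintype V]
  [∀ i j : V, Fintype (i ⟶ j)] {n : ℕ} {hn : 2 ≤ n}

section Edges

variable (Φ : BasicAct C (quiverData k V hn)) {X Y : C}

lemma map_mem_edges (f : X ⟶ Y) {i j : V} (m : Φ.edges X i j) : Φ.map f m ∈ Φ.edges Y i j := by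
  obtain ⟨h1, h2, h3⟩ := QBimodule.mem_corner.1 m.2
  exact QBimodule.mem_corner.2
    ⟨by rw [← map_p, h1], by rw [← map_l, h2], by rw [← map_r, h3]⟩

lemma mul_mem_edges {i l j : V} (m : Φ.edges X i l) (m' : Φ.edges Y l j) :
    Φ.mul m.1 m'.1 ∈ Φ.edges (X ⊗ Y) i j := by
  obtain ⟨h1, h2, h3⟩ := QBimodule.mem_corner.1 m.2
  obtain ⟨h1', h2', h3'⟩ := QBimodule.mem_corner.1 m'.2
  exact QBimodule.mem_corner.2
    ⟨by rw [p_mul, h1, h1'], by rw [← mul_l, h2], by rw [← mul_r, h3']⟩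

lemma mul_eq_zero {i l l' j : V} (h : l ≠ l') (m : Φ.edges X i l) (m' : Φ.edges Y l' j) :
    Φ.mul m.1 m'.1 = 0 := by
  rw [← (QBimodule.mem_corner.1 m.2).2.2, mul_r_l, QBimodule.l_vertex_ne h, ← mulₗ_apply, map_zero]

lemma unit_mem_edges (i : V) : Φ.unit (vertex n i) ∈ Φ.edges (𝟙_ C) i i :=
  QBimodule.mem_corner.2 ⟨by rw [p_unit, quiverData_p_vertex],
    by rw [← unit_l, vertex_mul_self], by rw [← unit_r, vertex_mul_self]⟩

lemma sum_unit : ∑ i, Φ.unit (vertex n i) = Φ.unit 1 := by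
  simp only [← unitₗ_apply, ← map_sum, sum_vertex]

end Edges

/-- The components of a `DegZeroTwist` between the vertices. -/
structure CornerTwist (Φ Φ' : BasicAct C (quiverData k V hn)) (t : (quiverData k V hn).Aut)
    (τ : V ≃ V) where
  map_vertex : ∀ v, t.τ (vertex n v) = vertex n (τ v)
  θ : ∀ X i j, Φ.edges X i j ≃ₗ[k] Φ'.edges X (τ i) (τ j)
  natural : ∀ {X Y : C} (f : X ⟶ Y) (i j : V) (m : Φ.edges X i j) (m' : Φ.edges Y i j),
    (m' : (Φ.bim Y).carrier) = Φ.map f m → (θ Y i j m' : (Φ'.bim Y).carrier) = Φ'.map f (θ X i j m)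
  mul : ∀ (X Y : C) (i l j : V) (m : Φ.edges X i l) (m' : Φ.edges Y l j)
    (t : Φ.edges (X ⊗ Y) i j), (t : (Φ.bim (X ⊗ Y)).carrier) = Φ.mul m.1 m'.1 →
    (θ (X ⊗ Y) i j t : (Φ'.bim (X ⊗ Y)).carrier) = Φ'.mul (θ X i l m).1 (θ Y l j m').1
  unit : ∀ (i : V) (t : Φ.edges (𝟙_ C) i i), (t : (Φ.bim (𝟙_ C)).carrier) = Φ.unit (vertex n i) →
    (θ (𝟙_ C) i i t : (Φ'.bim (𝟙_ C)).carrier) = Φ'.unit (vertex n (τ i))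
  swap : ∀ (X : C) (i l j : V) (a : i ⟶ l) (m : Φ.edges X l j)
    (x : ∀ h : V, (h ⟶ j) → Φ.edges X i h),
    (Φ.bim X).l (arrow n a) m = ∑ h, ∑ b : h ⟶ j, (Φ.bim X).r (op (arrow n b)) (x h b) →
    (Φ'.bim X).l (t.τ (arrow n a)) (θ X l j m) =
      ∑ h, ∑ b : h ⟶ j, (Φ'.bim X).r (op (t.τ (arrow n b))) (θ X i h (x h b))

namespace CornerTwist

variable {Φ Φ' : BasicAct C (quiverData k V hn)} {t : (quiverData k V hn).Aut} {τ : V ≃ V}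
  (T : CornerTwist Φ Φ' t τ)

/-- The map in degree zero with the given components. -/
noncomputable def total (X : C) : (Φ.bim X).carrier →ₗ[k] (Φ'.bim X).carrier :=
  ∑ i, ∑ j, (Φ'.edges X (τ i) (τ j)).subtype ∘ₗ (T.θ X i j).toLinearMap ∘ₗ (Φ.bim X).cut i j

/-- The inverse map in degree zero with the given components. -/
noncomputable def totalInv (X : C) : (Φ'.bim X).carrier →ₗ[k] (Φ.bim X).carrier :=
  ∑ i, ∑ j, (Φ.edges X i j).subtype ∘ₗ (T.θ X i j).symm.toLinearMap ∘ₗ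
    (Φ'.bim X).cut (τ i) (τ j)

lemma total_apply (X : C) (m : (Φ.bim X).carrier) :
    T.total X m = ∑ i, ∑ j, (T.θ X i j ((Φ.bim X).cut i j m) : (Φ'.bim X).carrier) := by
  simp only [total, LinearMap.sum_apply]; rfl

lemma totalInv_apply (X : C) (m : (Φ'.bim X).carrier) :
    T.totalInv X m =
      ∑ i, ∑ j, ((T.θ X i j).symm ((Φ'.bim X).cut (τ i) (τ j) m) : (Φ.bim X).carrier) := by
  simp only [totalInv, LinearMap.sum_apply]; rfl

lemma total_coe {X : C} {i j : V} (m : Φ.edges X i j) : T.total X m = T.θ X i j m := by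
  classical
  rw [total_apply, Finset.sum_eq_single i, Finset.sum_eq_single j, QBimodule.cut_self]
  · intro j' _ h; rw [QBimodule.cut_ne_right h, map_zero]; rfl
  · simp
  · intro i' _ h
    refine Finset.sum_eq_zero fun j' _ => ?_
    rw [QBimodule.cut_ne_left h, map_zero]; rfl
  · simp

lemma totalInv_coe {X : C} {i j : V} (m : Φ'.edges X (τ i) (τ j)) :
    T.totalInv X m = (T.θ X i j).symm m := by
  classical
  rw [totalInv_apply, Finset.sum_eq_single i, Finset.sum_eq_single j, QBimodule.cut_self]
  · intro j' _ h; rw [QBimodule.cut_ne_right (fun e => h (τ.injective e)), map_zero]; rfl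
  · simp
  · intro i' _ h
    refine Finset.sum_eq_zero fun j' _ => ?_
    rw [QBimodule.cut_ne_left (fun e => h (τ.injective e)), map_zero]; rfl
  · simp

/-- The map in degree zero. -/
noncomputable def degZeroTwist : DegZeroTwist Φ Φ' t where
  θ := T.total
  θ' := T.totalInv
  p_θ X m := by
    rw [total_apply]
    simp only [map_sum]
    exact Finset.sum_congr rfl fun i _ => Finset.sum_congr rfl fun j _ =>
      (QBimodule.mem_corner.1 (T.θ X i j _).2).1
  p_θ' X m := by
    rw [totalInv_apply]
    simp only [map_sum]
    exact Finset.sum_congr rfl fun i _ => Finset.sum_congr rfl fun j _ =>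
      (QBimodule.mem_corner.1 ((T.θ X i j).symm _).2).1
  θ'_θ X g hg := by
    refine QBimodule.degree_zero_induction (LinearMap.eqLocus (T.totalInv X ∘ₗ T.total X)
      LinearMap.id) (fun i j m hm => ?_) hg
    change T.totalInv X (T.total X m) = m
    rw [T.total_coe ⟨m, hm⟩, totalInv_coe, LinearEquiv.symm_apply_apply]
  θ_θ' X g hg := by
    refine QBimodule.degree_zero_induction (LinearMap.eqLocus (T.total X ∘ₗ T.totalInv X)
      LinearMap.id) (fun i j m hm => ?_) hg
    obtain ⟨i, rfl⟩ := τ.surjective i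
    obtain ⟨j, rfl⟩ := τ.surjective j
    change T.total X (T.totalInv X m) = m
    rw [T.totalInv_coe ⟨m, hm⟩, total_coe, LinearEquiv.apply_symm_apply]
  vertex_l X g v hg := by
    rw [T.map_vertex]
    refine QBimodule.degree_zero_induction (LinearMap.eqLocus
      (T.total X ∘ₗ (Φ.bim X).l (vertex n v)) ((Φ'.bim X).l (vertex n (τ v)) ∘ₗ T.total X))
      (fun i j m hm => ?_) hg
    change T.total X ((Φ.bim X).l (vertex n v) m) = (Φ'.bim X).l (vertex n (τ v)) (T.total X m)
    rw [T.total_coe ⟨m, hm⟩]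
    by_cases h : v = i
    · subst h
      rw [(QBimodule.mem_corner.1 hm).2.1, T.total_coe ⟨m, hm⟩]
      exact (QBimodule.mem_corner.1 (T.θ X v j ⟨m, hm⟩).2).2.1.symm
    · rw [QBimodule.l_vertex_ne h ⟨m, hm⟩, QBimodule.l_vertex_ne (fun e => h (τ.injective e)),
        map_zero]
  vertex_r X g v hg := by
    rw [T.map_vertex]
    refine QBimodule.degree_zero_induction (LinearMap.eqLocus
      (T.total X ∘ₗ (Φ.bim X).r (op (vertex n v)))
      ((Φ'.bim X).r (op (vertex n (τ v))) ∘ₗ T.total X)) (fun i j m hm => ?_) hg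
    change T.total X ((Φ.bim X).r (op (vertex n v)) m) =
      (Φ'.bim X).r (op (vertex n (τ v))) (T.total X m)
    rw [T.total_coe ⟨m, hm⟩]
    by_cases h : v = j
    · subst h
      rw [(QBimodule.mem_corner.1 hm).2.2, T.total_coe ⟨m, hm⟩]
      exact (QBimodule.mem_corner.1 (T.θ X i v ⟨m, hm⟩).2).2.2.symm
    · rw [QBimodule.r_vertex_ne h ⟨m, hm⟩, QBimodule.r_vertex_ne (fun e => h (τ.injective e)),
        map_zero]
  swap X i l j a g x h := by
    rw [T.total_coe, T.swap X i l j a g x h]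
    simp only [T.total_coe]
  natural {X Y} f g hg := by
    refine QBimodule.degree_zero_induction (LinearMap.eqLocus
      (T.total Y ∘ₗ Φ.map f) (Φ'.map f ∘ₗ T.total X)) (fun i j m hm => ?_) hg
    change T.total Y (Φ.map f m) = Φ'.map f (T.total X m)
    rw [T.total_coe ⟨m, hm⟩, T.total_coe ⟨_, Φ.map_mem_edges f ⟨m, hm⟩⟩]
    exact T.natural f i j ⟨m, hm⟩ _ rfl
  mul {X Y} g g' hg hg' := by
    refine QBimodule.degree_zero_induction (LinearMap.eqLocus
      (T.total (X ⊗ Y) ∘ₗ (Φ.mulₗ X Y).flip g')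
      ((Φ'.mulₗ X Y).flip (T.total Y g') ∘ₗ T.total X)) (fun i l m hm => ?_) hg
    change T.total (X ⊗ Y) (Φ.mul m g') = Φ'.mul (T.total X m) (T.total Y g')
    refine QBimodule.degree_zero_induction (LinearMap.eqLocus
      (T.total (X ⊗ Y) ∘ₗ Φ.mulₗ X Y m)
      (Φ'.mulₗ X Y (T.total X m) ∘ₗ T.total Y)) (fun l' j m' hm' => ?_) hg'
    change T.total (X ⊗ Y) (Φ.mul m m') = Φ'.mul (T.total X m) (T.total Y m')
    rw [T.total_coe ⟨m, hm⟩, T.total_coe ⟨m', hm'⟩]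
    by_cases h : l = l'
    · subst h
      rw [T.total_coe ⟨_, Φ.mul_mem_edges ⟨m, hm⟩ ⟨m', hm'⟩⟩]
      exact T.mul X Y i l j ⟨m, hm⟩ ⟨m', hm'⟩ _ rfl
    · rw [Φ.mul_eq_zero h ⟨m, hm⟩ ⟨m', hm'⟩, Φ'.mul_eq_zero (fun e => h (τ.injective e)), map_zero]
  unit := by
    rw [← sum_unit, ← sum_unit, map_sum, ← Equiv.sum_comp τ (fun i => Φ'.unit (vertex n i))]
    refine Finset.sum_congr rfl fun i _ => ?_
    rw [T.total_coe ⟨_, Φ.unit_mem_edges i⟩]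
    exact T.unit i _ rfl

end CornerTwist

end BasicAct

end BasicAction

namespace BasicAction

/-- A family of connections on a quiver indexed by the objects of a monoidal category: spaces of
edges between the vertices, with a composition which is invertible when all vertices in the middle
are taken into account, and an invertible exchange of arrows of the quiver and edges. -/
structure Connection (C : Type w) [Category.{v} C] [Preadditive C] [MonoidalCategory C]
    (k V : Type u) [Field k] [Linear k C] [Quiver.{u} V] [Fintype V]
    [∀ i j : V, Fintype (i ⟶ j)] where
  Γ : C → V → V → Type u
  [addCommGroup : ∀ X i j, AddCommGroup (Γ X i j)]
  [module : ∀ X i j, Module k (Γ X i j)]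
  map {X Y : C} (f : X ⟶ Y) {i j : V} : Γ X i j →ₗ[k] Γ Y i j
  map_id {X : C} {i j : V} (x : Γ X i j) : map (𝟙 X) x = x
  map_comp {X Y Z : C} (f : X ⟶ Y) (g : Y ⟶ Z) {i j : V} (x : Γ X i j) :
    map (f ≫ g) x = map g (map f x)
  map_add {X Y : C} (f g : X ⟶ Y) {i j : V} (x : Γ X i j) : map (f + g) x = map f x + map g x
  map_smul {X Y : C} (c : k) (f : X ⟶ Y) {i j : V} (x : Γ X i j) : map (c • f) x = c • map f x
  mul {X Y : C} {i l j : V} : Γ X i l →ₗ[k] Γ Y l j →ₗ[k] Γ (X ⊗ Y) i j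
  map_mul {X X' Y Y' : C} (f : X ⟶ X') (g : Y ⟶ Y') {i l j : V} (x : Γ X i l) (y : Γ Y l j) :
    map (f ⊗ₘ g) (mul x y) = mul (map f x) (map g y)
  mul_assoc {X Y Z : C} {i l h j : V} (x : Γ X i l) (y : Γ Y l h) (z : Γ Z h j) :
    map (α_ X Y Z).hom (mul (mul x y) z) = mul x (mul y z)
  unit (i : V) : Γ (𝟙_ C) i i
  unit_mul {X : C} {i j : V} (x : Γ X i j) : map (λ_ X).hom (mul (unit i) x) = x
  mul_unit {X : C} {i j : V} (x : Γ X i j) : map (ρ_ X).hom (mul x (unit j)) = x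
  comul {X Y : C} {i j : V} (l : V) : Γ (X ⊗ Y) i j →ₗ[k] Γ X i l ⊗[k] Γ Y l j
  comul_mul {X Y : C} {i l j : V} (x : Γ X i l) (y : Γ Y l j) : comul l (mul x y) = x ⊗ₜ y
  comul_mul_ne {X Y : C} {i l j l' : V} (h : l ≠ l') (x : Γ X i l) (y : Γ Y l j) :
    comul l' (mul x y) = 0
  mul_comul {X Y : C} {i j : V} (z : Γ (X ⊗ Y) i j) :
    ∑ l, TensorProduct.lift mul (comul l z) = z
  counit (i : V) : Γ (𝟙_ C) i i →ₗ[k] k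
  counit_unit (i : V) : counit i (unit i) = 1
  counit_smul {i : V} (x : Γ (𝟙_ C) i i) : counit i x • unit i = x
  eq_zero {i j : V} (h : i ≠ j) (x : Γ (𝟙_ C) i j) : x = 0
  swap {X : C} {i l h j : V} (a : i ⟶ l) (b : h ⟶ j) : Γ X l j →ₗ[k] Γ X i h
  swap' {X : C} {i l h j : V} (a : i ⟶ l) (b : h ⟶ j) : Γ X i h →ₗ[k] Γ X l j
  swap_swap'_self [∀ i j : V, DecidableEq (i ⟶ j)] {X : C} {i h j : V} (b b' : h ⟶ j)
    (x : Γ X i h) : ∑ l, ∑ a : i ⟶ l, swap a b' (swap' a b x) = if b' = b then x else 0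
  swap_swap'_ne {X : C} {i h h' j : V} (hh : h' ≠ h) (b : h ⟶ j) (b' : h' ⟶ j) (x : Γ X i h) :
    ∑ l, ∑ a : i ⟶ l, swap a b' (swap' a b x) = 0
  swap'_swap_self [∀ i j : V, DecidableEq (i ⟶ j)] {X : C} {i l j : V} (a a' : i ⟶ l)
    (x : Γ X l j) : ∑ h, ∑ b : h ⟶ j, swap' a' b (swap a b x) = if a' = a then x else 0
  swap'_swap_ne {X : C} {i l l' j : V} (hl : l' ≠ l) (a : i ⟶ l) (a' : i ⟶ l') (x : Γ X l j) :
    ∑ h, ∑ b : h ⟶ j, swap' a' b (swap a b x) = 0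
  swap_map {X Y : C} (f : X ⟶ Y) {i l h j : V} (a : i ⟶ l) (b : h ⟶ j) (x : Γ X l j) :
    swap a b (map f x) = map f (swap a b x)
  swap_mul {X Y : C} {i i' l h j : V} (a : i ⟶ i') (c : h ⟶ j) (x : Γ X i' l) (y : Γ Y l j) :
    swap a c (mul x y) = ∑ l', ∑ b : l' ⟶ l, mul (swap a b x) (swap b c y)
  swap_unit_self [∀ i j : V, DecidableEq (i ⟶ j)] {i l : V} (a b : i ⟶ l) :
    swap a b (unit l) = if b = a then unit i else 0
  swap_unit_ne {i h l : V} (hi : h ≠ i) (a : i ⟶ l) (b : h ⟶ l) : swap a b (unit l) = 0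

namespace Connection

attribute [instance] addCommGroup module

open TruncatedPathAlgebra

variable {C : Type w} [Category.{v} C] [Preadditive C] [MonoidalCategory C]
variable {k V : Type u} [Field k] [Linear k C] [Quiver.{u} V] [Fintype V]
  [∀ i j : V, Fintype (i ⟶ j)] (G : Connection C k V) (n : ℕ) (X Y : C)

/-- The right ideal generated by a vertex. -/
noncomputable abbrev _root_.BasicAction.TruncatedPathAlgebra.vertexIdeal {k V : Type u} [Field k]
    [Quiver.{u} V] [Fintype V] (n : ℕ) (j : V) : Submodule k (TruncatedPathAlgebra k V n) :=
  LinearMap.range (LinearMap.mulLeft k (vertex n j))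

/-- The right module over the truncated path algebra generated freely by the edges. -/
def Carrier : Type u := ∀ i j, G.Γ X i j ⊗[k] (vertexIdeal n j : Submodule k _)

noncomputable instance : AddCommGroup (G.Carrier n X) :=
  inferInstanceAs (AddCommGroup (∀ i j, G.Γ X i j ⊗[k] (vertexIdeal n j : Submodule k _)))

noncomputable instance : Module k (G.Carrier n X) :=
  inferInstanceAs (Module k (∀ i j, G.Γ X i j ⊗[k] (vertexIdeal n j : Submodule k _)))

/-- The component between two vertices. -/
noncomputable def proj (n : ℕ) (X : C) (i j : V) :
    G.Carrier n X →ₗ[k] G.Γ X i j ⊗[k] (vertexIdeal n j : Submodule k _) :=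
  LinearMap.proj (φ := fun j => G.Γ X i j ⊗[k] (vertexIdeal n j : Submodule k _)) j ∘ₗ
    LinearMap.proj (φ := fun i => ∀ j, G.Γ X i j ⊗[k] (vertexIdeal n j : Submodule k _)) i

open Classical in
/-- The inclusion of a component. -/
noncomputable def incl (n : ℕ) (X : C) (i j : V) :
    G.Γ X i j ⊗[k] (vertexIdeal n j : Submodule k _) →ₗ[k] G.Carrier n X :=
  LinearMap.single k (fun i => ∀ j, G.Γ X i j ⊗[k] (vertexIdeal n j : Submodule k _)) i ∘ₗ
    LinearMap.single k (fun j => G.Γ X i j ⊗[k] (vertexIdeal n j : Submodule k _)) j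

open Classical in
lemma proj_incl (n : ℕ) (X : C) {i j : V} (x) : G.proj n X i j (G.incl n X i j x) = x :=
  (congrFun (Pi.single_eq_same (M := fun i => ∀ j, G.Γ X i j ⊗[k] (vertexIdeal n j : Submodule k _)) i _) j).trans
    (Pi.single_eq_same (M := fun j => G.Γ X i j ⊗[k] (vertexIdeal n j : Submodule k _)) j x)

open Classical in
lemma proj_incl_ne_left (n : ℕ) (X : C) {i i' j j' : V} (h : i' ≠ i) (x) :
    G.proj n X i' j' (G.incl n X i j x) = 0 :=
  congrFun (Pi.single_eq_of_ne (M := fun i => ∀ j, G.Γ X i j ⊗[k] (vertexIdeal n j : Submodule k _)) h _) j'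

open Classical in
lemma proj_incl_ne_right (n : ℕ) (X : C) {i i' j j' : V} (h : j' ≠ j) (x) :
    G.proj n X i' j' (G.incl n X i j x) = 0 := by
  by_cases h' : i' = i
  · subst h'
    exact (congrFun (Pi.single_eq_same (M := fun i => ∀ j, G.Γ X i j ⊗[k] (vertexIdeal n j : Submodule k _)) i' _) j').trans
      (Pi.single_eq_of_ne (M := fun j => G.Γ X i' j ⊗[k] (vertexIdeal n j : Submodule k _)) h x)
  · exact G.proj_incl_ne_left n X h' x

lemma sum_incl_proj (n : ℕ) (X : C) (m : G.Carrier n X) :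
    ∑ i, ∑ j, G.incl n X i j (G.proj n X i j m) = m := by
  classical
  refine (Finset.sum_congr rfl fun i _ => ?_).trans (Finset.univ_sum_single
    (M := fun i => ∀ j, G.Γ X i j ⊗[k] (vertexIdeal n j : Submodule k _)) m)
  exact ((map_sum (LinearMap.single k
    (fun i => ∀ j, G.Γ X i j ⊗[k] (vertexIdeal n j : Submodule k _)) i) _ _).symm).trans
    (congrArg _ (Finset.univ_sum_single
      (M := fun j => G.Γ X i j ⊗[k] (vertexIdeal n j : Submodule k _)) (m i)))

variable {n X Y}

/-- The product of an edge and an element of the truncated path algebra. -/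
noncomputable def gen {i j : V} :
    G.Γ X i j →ₗ[k] TruncatedPathAlgebra k V n →ₗ[k] G.Carrier n X :=
  ((TensorProduct.mk k _ _).compl₂ (LinearMap.mulLeft k (vertex n j)).rangeRestrict).compr₂
    (G.incl n X i j)

/-- The linear map on the edges starting at `i` given by its values on the products. -/
noncomputable def liftAt {W : Type*} [AddCommGroup W] [Module k W] (i : V)
    (φ : ∀ j, G.Γ X i j →ₗ[k] TruncatedPathAlgebra k V n →ₗ[k] W) : G.Carrier n X →ₗ[k] W :=
  ∑ j, TensorProduct.lift ((φ j).compl₂ (vertexIdeal n j).subtype) ∘ₗ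
    G.proj n X i j

/-- The linear map given by its values on the products. -/
noncomputable def lift {W : Type*} [AddCommGroup W] [Module k W]
    (φ : ∀ i j, G.Γ X i j →ₗ[k] TruncatedPathAlgebra k V n →ₗ[k] W) : G.Carrier n X →ₗ[k] W :=
  ∑ i, G.liftAt i (φ i)

lemma gen_eq {i j : V} (g : G.Γ X i j) (x : TruncatedPathAlgebra k V n) :
    G.gen g x = G.incl n X i j (g ⊗ₜ ⟨vertex n j * x, x, rfl⟩) := rfl

section

variable {W : Type*} [AddCommGroup W] [Module k W] {i j : V}

@[simp] lemma liftAt_gen (φ : ∀ j, G.Γ X i j →ₗ[k] TruncatedPathAlgebra k V n →ₗ[k] W)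
    (g : G.Γ X i j) (x) : G.liftAt i φ (G.gen g x) = φ j g (vertex n j * x) := by
  classical
  rw [liftAt, LinearMap.sum_apply, Finset.sum_eq_single j, gen_eq]
  · simp [proj_incl]
  · intro j' _ h
    simp [gen_eq, G.proj_incl_ne_right n X h]
  · simp

lemma liftAt_gen_ne {i' : V} (h : i' ≠ i)
    (φ : ∀ j, G.Γ X i' j →ₗ[k] TruncatedPathAlgebra k V n →ₗ[k] W)
    (g : G.Γ X i j) (x) : G.liftAt i' φ (G.gen g x) = 0 := by
  classical
  rw [liftAt, LinearMap.sum_apply]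
  exact Finset.sum_eq_zero fun j' _ => by simp [gen_eq, G.proj_incl_ne_left n X h]

@[simp] lemma lift_gen (φ : ∀ i j, G.Γ X i j →ₗ[k] TruncatedPathAlgebra k V n →ₗ[k] W)
    (g : G.Γ X i j) (x) : G.lift φ (G.gen g x) = φ i j g (vertex n j * x) := by
  classical
  rw [lift, LinearMap.sum_apply, Finset.sum_eq_single i, liftAt_gen]
  · intro i' _ h
    exact G.liftAt_gen_ne h _ g x
  · simp

end

lemma gen_vertex_mul {i j : V} (g : G.Γ X i j) (x : TruncatedPathAlgebra k V n) :
    G.gen g (vertex n j * x) = G.gen g x := by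
  classical
  simp only [gen_eq, ← _root_.mul_assoc, vertex_mul_self]

lemma gen_vertex_mul_ne {i j j' : V} (h : j ≠ j') (g : G.Γ X i j)
    (x : TruncatedPathAlgebra k V n) : G.gen g (vertex n j' * x) = 0 := by
  rw [← gen_vertex_mul, ← _root_.mul_assoc, vertex_mul_ne h, zero_mul, map_zero]

lemma induction {S : Submodule k (G.Carrier n X)} (h : ∀ i j (g : G.Γ X i j) x, G.gen g x ∈ S)
    (m : G.Carrier n X) : m ∈ S := by
  rw [← G.sum_incl_proj n X m]
  refine S.sum_mem fun i _ => S.sum_mem fun j _ => ?_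
  induction G.proj n X i j m with
  | zero => simp
  | add x y hx hy =>
    rw [_root_.map_add]; exact S.add_mem hx hy
  | tmul g y =>
    obtain ⟨y, x, rfl⟩ := y
    exact h i j g x

lemma hom_ext {W : Type*} [AddCommGroup W] [Module k W] {f f' : G.Carrier n X →ₗ[k] W}
    (h : ∀ i j (g : G.Γ X i j) x, f (G.gen g x) = f' (G.gen g x)) : f = f' :=
  LinearMap.ext (G.induction (S := LinearMap.eqLocus f f') h)

/-- The map induced by an endomorphism of the truncated path algebra. -/
noncomputable def onRight (f : TruncatedPathAlgebra k V n →ₗ[k] TruncatedPathAlgebra k V n) :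
    G.Carrier n X →ₗ[k] G.Carrier n X :=
  G.lift fun _ _ => G.gen.compl₂ f

lemma onRight_gen {f : TruncatedPathAlgebra k V n →ₗ[k] TruncatedPathAlgebra k V n}
    (hf : ∀ j x, f (vertex n j * x) = vertex n j * f x) {i j : V} (g : G.Γ X i j) (x) :
    G.onRight f (G.gen g x) = G.gen g (f x) := by
  rw [onRight, lift_gen, LinearMap.compl₂_apply, hf, gen_vertex_mul]

/-- The right action of the truncated path algebra. -/
noncomputable def rAct : (TruncatedPathAlgebra k V n)ᵐᵒᵖ →ₐ[k] Module.End k (G.Carrier n X) :=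
  AlgHom.ofLinearMap
    { toFun := fun a => G.onRight (LinearMap.mulRight k (unop a))
      map_add' := fun a b => G.hom_ext fun i j g x => by
        simp [onRight, mul_add]
      map_smul' := fun c a => G.hom_ext fun i j g x => by
        simp [onRight] }
    (G.hom_ext fun i j g x => by simp [onRight, gen_vertex_mul])
    (fun a b => G.hom_ext fun i j g x => by
      simp [onRight, _root_.mul_assoc, gen_vertex_mul])

@[simp] lemma rAct_gen {i j : V} (g : G.Γ X i j) (x a : TruncatedPathAlgebra k V n) :
    G.rAct (op a) (G.gen g x) = G.gen g (x * a) :=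
  G.onRight_gen (fun _ x => _root_.mul_assoc _ x a) g x

/-- The action of a vertex on the left. -/
noncomputable def vertexAct (v : V) : Module.End k (G.Carrier n X) := G.liftAt v fun _ => G.gen

@[simp] lemma vertexAct_gen {i j : V} (g : G.Γ X i j) (x : TruncatedPathAlgebra k V n) :
    G.vertexAct i (G.gen g x) = G.gen g x := by
  rw [vertexAct, liftAt_gen, gen_vertex_mul]

lemma vertexAct_gen_ne {v i j : V} (h : v ≠ i) (g : G.Γ X i j) (x : TruncatedPathAlgebra k V n) :
    G.vertexAct v (G.gen g x) = 0 := G.liftAt_gen_ne h _ g x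

/-- The action of an arrow on the left. -/
noncomputable def arrowAct (b : QArrow V) : Module.End k (G.Carrier n X) :=
  G.liftAt b.2.1 fun j => ∑ h, ∑ c : h ⟶ j,
    (G.gen ∘ₗ G.swap b.2.2 c).compl₂ (LinearMap.mulLeft k (arrow n c))

lemma arrowAct_gen {i l j : V} (a : i ⟶ l) (g : G.Γ X l j) (x : TruncatedPathAlgebra k V n) :
    G.arrowAct ⟨i, l, a⟩ (G.gen g x) =
      ∑ h, ∑ c : h ⟶ j, G.gen (G.swap a c g) (arrow n c * x) := by
  rw [arrowAct, liftAt_gen]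
  simp only [LinearMap.sum_apply, LinearMap.compl₂_apply, LinearMap.comp_apply,
    LinearMap.mulLeft_apply, ← _root_.mul_assoc, arrow_mul_vertex]

lemma arrowAct_gen_ne {i l l' j : V} (h : l ≠ l') (a : i ⟶ l) (g : G.Γ X l' j)
    (x : TruncatedPathAlgebra k V n) : G.arrowAct ⟨i, l, a⟩ (G.gen g x) = 0 :=
  G.liftAt_gen_ne h _ g x

/-- The span of the products of edges and elements of path length at least `m`. -/
noncomputable def filt (G : Connection C k V) (n : ℕ) (X : C) (m : ℕ) :
    Submodule k (G.Carrier n X) :=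
  Submodule.span k {z | ∃ (i j : V) (g : G.Γ X i j), ∃ x ∈ PathAlgebra.pathIdeal k V m,
    z = G.gen g (TruncatedPathAlgebra.mk n x)}

lemma arrowAct_mem {m : ℕ} (b : QArrow V) {z : G.Carrier n X} (hz : z ∈ G.filt n X m) :
    G.arrowAct b z ∈ G.filt n X (m + 1) := by
  have : G.filt n X m ≤ (G.filt n X (m + 1)).comap (G.arrowAct b) := by
    refine Submodule.span_le.2 ?_
    rintro _ ⟨l', j, g, x, hx, rfl⟩
    obtain ⟨i, l, a⟩ := b
    change G.arrowAct ⟨i, l, a⟩ (G.gen g _) ∈ G.filt n X (m + 1)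
    by_cases h : l = l'
    · subst h
      rw [arrowAct_gen]
      refine Submodule.sum_mem _ fun h _ => Submodule.sum_mem _ fun c _ => ?_
      refine Submodule.subset_span ⟨i, h, _, _, ?_, by rw [arrow, ← _root_.map_mul]⟩
      rw [add_comm]
      exact PathAlgebra.mul_mem_add (PathAlgebra.of_mem (by simp [PathAlgebra.len])) hx
    · rw [G.arrowAct_gen_ne h]; exact Submodule.zero_mem _
  exact this hz

lemma vertexAct_mem {m : ℕ} (v : V) {z : G.Carrier n X} (hz : z ∈ G.filt n X m) :
    G.vertexAct v z ∈ G.filt n X m := by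
  have : G.filt n X m ≤ (G.filt n X m).comap (G.vertexAct v) := by
    refine Submodule.span_le.2 ?_
    rintro _ ⟨i, j, g, x, hx, rfl⟩
    change G.vertexAct v (G.gen g _) ∈ G.filt n X m
    by_cases h : v = i
    · subst h
      rw [vertexAct_gen]
      exact Submodule.subset_span ⟨_, _, g, x, hx, rfl⟩
    · rw [G.vertexAct_gen_ne h]; exact Submodule.zero_mem _
  exact this hz

lemma pathVal_mem {i j : V} (p : Quiver.Path i j) : ∀ {m : ℕ} {z : G.Carrier n X},
    z ∈ G.filt n X m → pathVal G.vertexAct G.arrowAct p z ∈ G.filt n X (m + p.length) := by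
  induction p with
  | nil => exact fun hz => G.vertexAct_mem _ hz
  | cons p e ih =>
    intro m z hz
    rw [Quiver.Path.length_cons, ← add_assoc, add_right_comm]
    exact ih (G.arrowAct_mem _ hz)

lemma isTruncatedRep : IsTruncatedRep n (G.vertexAct (n := n) (X := X)) G.arrowAct where
  mul_self v := G.hom_ext fun i j g x => by
    by_cases h : v = i
    · subst h; simp
    · simp [G.vertexAct_gen_ne h]
  mul_ne v w h := G.hom_ext fun i j g x => by
    by_cases h' : w = i
    · subst h'; simp [G.vertexAct_gen_ne h]
    · simp [G.vertexAct_gen_ne h']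
  sum := G.hom_ext fun i j g x => by
    classical
    rw [LinearMap.sum_apply, Finset.sum_eq_single i, vertexAct_gen]
    · rfl
    · intro v _ h; exact G.vertexAct_gen_ne h g x
    · simp
  left b := G.hom_ext fun l' j g x => by
    obtain ⟨i, l, a⟩ := b
    by_cases h : l = l'
    · subst h; simp [arrowAct_gen]
    · simp [G.arrowAct_gen_ne h]
  right b := G.hom_ext fun l' j g x => by
    obtain ⟨i, l, a⟩ := b
    by_cases h : l = l'
    · subst h; simp [arrowAct_gen]
    · simp [G.arrowAct_gen_ne h, G.vertexAct_gen_ne h]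
  truncated i j p hp := by
    refine LinearMap.ext fun z => ?_
    have h0 : z ∈ G.filt n X 0 := by
      refine G.induction (fun i j g x => ?_) z
      obtain ⟨x, rfl⟩ := mk_surjective x
      exact Submodule.subset_span ⟨i, j, g, x, PathAlgebra.mem_zero x, rfl⟩
    have h1 := G.pathVal_mem p h0
    have h2 : G.filt n X (0 + p.length) ≤ ⊥ := by
      refine Submodule.span_le.2 ?_
      rintro _ ⟨i, j, g, x, hx, rfl⟩
      have : TruncatedPathAlgebra.mk n x = 0 := Ideal.Quotient.eq_zero_iff_mem.2
        (PathAlgebra.pathIdeal_anti (by omega) hx)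
      rw [this, map_zero]; exact Submodule.zero_mem _
    exact h2 h1

/-- The left action of the truncated path algebra. -/
noncomputable def lAct : TruncatedPathAlgebra k V n →ₐ[k] Module.End k (G.Carrier n X) :=
  G.isTruncatedRep.algHom

@[simp] lemma lAct_vertex (v : V) : G.lAct (vertex n v) = G.vertexAct (X := X) v :=
  IsTruncatedRep.algHom_vertex _ v

lemma lAct_arr (b : QArrow V) : G.lAct (arr n b) = G.arrowAct (X := X) b :=
  IsTruncatedRep.algHom_arr _ b

lemma lAct_arrow_gen {i l j : V} (a : i ⟶ l) (g : G.Γ X l j) (x : TruncatedPathAlgebra k V n) :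
    G.lAct (arrow n a) (G.gen g x) =
      ∑ h, ∑ c : h ⟶ j, G.gen (G.swap a c g) (arrow n c * x) :=
  (LinearMap.congr_fun (G.lAct_arr ⟨i, l, a⟩) _).trans (G.arrowAct_gen a g x)

lemma lAct_arrow_gen_ne {i l l' j : V} (h : l ≠ l') (a : i ⟶ l) (g : G.Γ X l' j)
    (x : TruncatedPathAlgebra k V n) : G.lAct (arrow n a) (G.gen g x) = 0 :=
  (LinearMap.congr_fun (G.lAct_arr ⟨i, l, a⟩) _).trans (G.arrowAct_gen_ne h a g x)

/-- To check that a map intertwines the left actions, it is enough to consider vertices and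
arrows. -/
lemma _root_.BasicAction.TruncatedPathAlgebra.intertwines {k V : Type u} [Field k] [Quiver.{u} V]
    [Fintype V] {n : ℕ} {M N : Type*} [AddCommGroup M] [Module k M] [AddCommGroup N] [Module k N]
    {l : TruncatedPathAlgebra k V n →ₐ[k] Module.End k M}
    {l' : TruncatedPathAlgebra k V n →ₐ[k] Module.End k N} {f : M →ₗ[k] N}
    (hv : ∀ v m, f (l (vertex n v) m) = l' (vertex n v) (f m))
    (ha : ∀ b m, f (l (arr n b) m) = l' (arr n b) (f m)) (a) (m : M) :
    f (l a m) = l' a (f m) := by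
  refine LinearMap.congr_fun (mul_induction (LinearMap.eqLocus
    (LinearMap.llcomp k M M N f ∘ₗ l.toLinearMap) ((LinearMap.lcomp k N f) ∘ₗ l'.toLinearMap))
    (fun v => LinearMap.ext (hv v)) (fun b => LinearMap.ext (ha b)) (fun x hx y hy => ?_) a) m
  refine LinearMap.ext fun m => ?_
  have hx : ∀ m, f (l x m) = l' x (f m) := LinearMap.congr_fun hx
  have hy : ∀ m, f (l y m) = l' y (f m) := LinearMap.congr_fun hy
  change f (l (x * y) m) = l' (x * y) (f m)
  rw [_root_.map_mul, _root_.map_mul, Module.End.mul_apply, Module.End.mul_apply, hx, hy]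

lemma vertexAct_onRight {f : TruncatedPathAlgebra k V n →ₗ[k] TruncatedPathAlgebra k V n}
    (hf : ∀ j x, f (vertex n j * x) = vertex n j * f x) (v : V) (m : G.Carrier n X) :
    G.vertexAct v (G.onRight f m) = G.onRight f (G.vertexAct v m) := by
  refine LinearMap.congr_fun (f := G.vertexAct v ∘ₗ G.onRight f)
    (g := G.onRight f ∘ₗ G.vertexAct v) (G.hom_ext fun i j g x => ?_) m
  change G.vertexAct v (G.onRight f (G.gen g x)) = G.onRight f (G.vertexAct v (G.gen g x))
  rw [G.onRight_gen hf]
  by_cases h : v = i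
  · subst h; rw [vertexAct_gen, vertexAct_gen, G.onRight_gen hf]
  · rw [G.vertexAct_gen_ne h, G.vertexAct_gen_ne h, map_zero]

/-- The bimodule given by a connection. -/
@[reducible] noncomputable def bimodule (G : Connection C k V) (n : ℕ) (X : C) :
    Bimodule k (TruncatedPathAlgebra k V n) where
  carrier := G.Carrier n X
  l := G.lAct
  r := G.rAct
  comm a b m := by
    refine (intertwines (l := G.lAct) (l' := G.lAct) (f := G.rAct (op b)) (fun v m => ?_)
      (fun c m => ?_) a m).symm
    · rw [lAct_vertex]
      exact (G.vertexAct_onRight (fun _ x => _root_.mul_assoc _ x b) v m).symm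
    · obtain ⟨i, l, a⟩ := c
      refine LinearMap.congr_fun (f := G.rAct (op b) ∘ₗ G.lAct (arrow n a))
        (g := G.lAct (arrow n a) ∘ₗ G.rAct (op b)) (G.hom_ext fun l' j g x => ?_) m
      change G.rAct (op b) (G.lAct (arrow n a) (G.gen g x)) =
        G.lAct (arrow n a) (G.rAct (op b) (G.gen g x))
      by_cases h : l = l'
      · subst h
        simp only [rAct_gen, lAct_arrow_gen, map_sum, _root_.mul_assoc]
      · rw [rAct_gen, G.lAct_arrow_gen_ne h, G.lAct_arrow_gen_ne h, map_zero]

end Connection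

end BasicAction

namespace BasicAction

namespace TruncatedPathAlgebra

open PathAlgebra

variable {k V : Type u} [Field k] [Quiver.{u} V] [Fintype V] {n : ℕ}

/-- The radical of a truncated path algebra is the right ideal generated by the arrows. -/
lemma rad_induction (hn : 2 ≤ n) {S : Submodule k (TruncatedPathAlgebra k V n)}
    (h : ∀ b y, arr n b * y ∈ S) {z : TruncatedPathAlgebra k V n}
    (hz : z ∈ rad k (TruncatedPathAlgebra k V n)) : z ∈ S := by
  obtain ⟨x, rfl⟩ := mk_surjective z
  have hx := (mk_mem_jacobson (by omega)).1 hz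
  refine le_of (S := S.comap (Ideal.Quotient.mkₐ k (pathIdeal k V n)).toLinearMap)
    (fun p hp => ?_) hx
  change TruncatedPathAlgebra.mk n (of k p) ∈ S
  obtain ⟨i, j, p⟩ := p
  have key : ∀ {j : V} (p : Quiver.Path i j), 1 ≤ p.length →
      ∃ b y, TruncatedPathAlgebra.mk n (of k ⟨i, j, p⟩) = arr n b * y := by
    intro j p
    induction p with
    | nil => intro h; simp at h
    | @cons c d p e ih =>
      intro _
      cases p with
      | nil => exact ⟨⟨i, d, e⟩, 1, (mul_one _).symm⟩
      | cons p e' =>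
        obtain ⟨b, y, hy⟩ := ih (by simp)
        refine ⟨b, y * arrow n e, ?_⟩
        rw [← mul_assoc, ← hy, arrow, ← map_mul, of_mul_of, pathMul_comp]
        rfl
  obtain ⟨b, y, hy⟩ := key p hp
  rw [hy]
  exact h b y

lemma quiverData_p_vertex_mul [∀ i j : V, Fintype (i ⟶ j)] (hn : 2 ≤ n) (j : V)
    (x : TruncatedPathAlgebra k V n) :
    (quiverData k V hn).p (vertex n j * x) = vertex n j * (quiverData k V hn).p x := by
  rw [QuiverData.p_mul, quiverData_p_vertex]

lemma quiverData_d_vertex_mul [∀ i j : V, Fintype (i ⟶ j)] (hn : 2 ≤ n) (j : V)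
    (x : TruncatedPathAlgebra k V n) :
    (quiverData k V hn).d (vertex n j * x) = vertex n j * (quiverData k V hn).d x := by
  rw [QuiverData.d_mul, quiverData_p_vertex, quiverData_d_vertex, zero_mul, add_zero]

lemma quiverData_p_arrow_mul (hn : 2 ≤ n) {i j : V} (a : i ⟶ j)
    (x : TruncatedPathAlgebra k V n) : (quiverData k V hn).p (arrow n a * x) = 0 := by
  rw [QuiverData.p_mul, quiverData_p_arrow, zero_mul]

lemma quiverData_d_arrow_mul (hn : 2 ≤ n) {i j : V} (a : i ⟶ j)
    (x : TruncatedPathAlgebra k V n) :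
    (quiverData k V hn).d (arrow n a * x) = arrow n a * (quiverData k V hn).p x := by
  rw [QuiverData.d_mul, quiverData_p_arrow, quiverData_d_arrow, zero_mul, zero_add]

end TruncatedPathAlgebra

namespace Connection

open TruncatedPathAlgebra Bimodule

variable {C : Type w} [Category.{v} C] [Preadditive C] [MonoidalCategory C]
variable {k V : Type u} [Field k] [Linear k C] [Quiver.{u} V] [Fintype V]
  [∀ i j : V, Fintype (i ⟶ j)] (G : Connection C k V) {n : ℕ} {X Y : C}

/-- Moving an arrow from the right of an edge to the left. -/
lemma gen_arrow_mul {i j j' : V} (g : G.Γ X i j) (c : j ⟶ j') (y : TruncatedPathAlgebra k V n) :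
    G.gen g (arrow n c * y) =
      ∑ l, ∑ a : i ⟶ l, G.lAct (arrow n a) (G.gen (G.swap' a c g) y) := by
  classical
  simp only [lAct_arrow_gen]
  have : ∀ l, ∑ a : i ⟶ l, ∑ h, ∑ b : h ⟶ j',
      G.gen (G.swap a b (G.swap' a c g)) (arrow n b * y) = ∑ h, ∑ b : h ⟶ j', ∑ a : i ⟶ l,
      G.gen (G.swap a b (G.swap' a c g)) (arrow n b * y) := fun l => by
    rw [Finset.sum_comm]
    exact Finset.sum_congr rfl fun h _ => Finset.sum_comm
  rw [Finset.sum_congr rfl fun l _ => this l, Finset.sum_comm]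
  have h2 : ∀ h, ∑ l, ∑ b : h ⟶ j', ∑ a : i ⟶ l,
      G.gen (G.swap a b (G.swap' a c g)) (arrow n b * y) =
      ∑ b : h ⟶ j', G.gen (∑ l, ∑ a : i ⟶ l, G.swap a b (G.swap' a c g)) (arrow n b * y) :=
    fun h => by
      rw [Finset.sum_comm]
      simp only [_root_.map_sum, LinearMap.sum_apply]
  rw [Finset.sum_congr rfl fun h _ => h2 h, Finset.sum_eq_single j, Finset.sum_eq_single c,
    swap_swap'_self, if_pos rfl]
  · intro b _ hb
    rw [swap_swap'_self, if_neg hb, _root_.map_zero, LinearMap.zero_apply]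
  · simp
  · intro h _ hh
    refine Finset.sum_eq_zero fun b _ => ?_
    rw [G.swap_swap'_ne hh, _root_.map_zero, LinearMap.zero_apply]
  · simp

lemma gen_mem_mulRad {i j : V} (g : G.Γ X i j) {z : TruncatedPathAlgebra k V n}
    (hz : z ∈ rad k (TruncatedPathAlgebra k V n)) :
    (G.gen g z : (G.bimodule n X).carrier) ∈ (G.bimodule n X).mulRad ⊤ :=
  Submodule.subset_span ⟨z, hz, G.gen g 1, trivial, by rw [rAct_gen, one_mul]⟩

lemma gen_mem_radM (hn : 2 ≤ n) {i j : V} (g : G.Γ X i j) {z : TruncatedPathAlgebra k V n}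
    (hz : z ∈ rad k (TruncatedPathAlgebra k V n)) :
    (G.gen g z : (G.bimodule n X).carrier) ∈ (G.bimodule n X).radM := by
  refine rad_induction hn (S := (G.bimodule n X).radM.comap (G.gen g)) (fun b y => ?_) hz
  obtain ⟨h, j', c⟩ := b
  change (G.gen g (arrow n c * y) : (G.bimodule n X).carrier) ∈ (G.bimodule n X).radM
  by_cases e : j = h
  · subst e
    rw [gen_arrow_mul]
    exact Submodule.sum_mem _ fun l _ => Submodule.sum_mem _ fun a _ =>
      l_mem_radM (M := G.bimodule n X) (arrow_mem hn a) _
  · rw [← vertex_mul_arrow, _root_.mul_assoc, G.gen_vertex_mul_ne e]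
    exact Submodule.zero_mem _

lemma radSymm (hn : 2 ≤ n) (X : C) : (G.bimodule n X).RadSymm := by
  apply le_antisymm
  · refine radMul_le fun a ha m _ => ?_
    have h1 : ∀ (b : QArrow V) (m : G.Carrier n X),
        (G.lAct (arr n b) m : (G.bimodule n X).carrier) ∈ (G.bimodule n X).mulRad ⊤ := by
      intro b m
      obtain ⟨i, l, a⟩ := b
      refine G.induction (S := ((G.bimodule n X).mulRad ⊤).comap (G.lAct (arrow n a)))
        (fun l' j g x => ?_) m
      rw [Submodule.mem_comap]
      by_cases h : l = l'
      · subst h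
        rw [lAct_arrow_gen]
        exact Submodule.sum_mem _ fun h _ => Submodule.sum_mem _ fun c _ =>
          G.gen_mem_mulRad _ (QuiverData.mul_mem_rad_right _ (arrow_mem hn c))
      · rw [G.lAct_arrow_gen_ne h]; exact Submodule.zero_mem _
    refine rad_induction hn (S := ((G.bimodule n X).mulRad ⊤).comap
      (G.lAct.toLinearMap.flip m)) (fun b y => ?_) ha
    change G.lAct (arr n b * y) m ∈ (G.bimodule n X).mulRad ⊤
    rw [_root_.map_mul]
    exact h1 b _
  · refine mulRad_le fun a ha m _ => ?_
    refine G.induction (S := ((G.bimodule n X).radMul ⊤).comap (G.rAct (op a)))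
      (fun i j g x => ?_) m
    rw [Submodule.mem_comap, rAct_gen]
    exact G.gen_mem_radM hn g (QuiverData.mul_mem_rad_left _ ha)

lemma gen_mem_radSq (hn : 2 ≤ n) {i j : V} (g : G.Γ X i j) {z : TruncatedPathAlgebra k V n}
    (hz : z ∈ (rad k (TruncatedPathAlgebra k V n)) ^ 2) :
    (G.gen g z : (G.bimodule n X).carrier) ∈ (G.bimodule n X).radSq := by
  rw [pow_two] at hz
  refine Submodule.mul_induction_on hz (fun x hx y hy => ?_) (fun x y hx hy => ?_)
  · have := r_mem_radSq (M := G.bimodule n X) (G.radSymm hn X) hy (G.gen_mem_radM hn g hx)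
    rwa [rAct_gen] at this
  · rw [_root_.map_add]; exact Submodule.add_mem _ hx hy

/-- The projection to degree zero of the truncated path algebra, as a homomorphism. -/
noncomputable def _root_.BasicAction.QuiverData.pHom {k A : Type u} [Field k] [Ring A]
    [Algebra k A] (D : QuiverData k A) : A →ₐ[k] A :=
  AlgHom.ofLinearMap D.p D.p_one D.p_mul

lemma onRight_p_gen (hn : 2 ≤ n) {i j : V} (g : G.Γ X i j) (x) :
    G.onRight (quiverData k V hn).p (G.gen g x) = G.gen g ((quiverData k V hn).p x) :=
  G.onRight_gen (quiverData_p_vertex_mul hn) g x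

lemma onRight_d_gen (hn : 2 ≤ n) {i j : V} (g : G.Γ X i j) (x) :
    G.onRight (quiverData k V hn).d (G.gen g x) = G.gen g ((quiverData k V hn).d x) :=
  G.onRight_gen (quiverData_d_vertex_mul hn) g x

lemma onRight_p_lAct (hn : 2 ≤ n) (a) (m : G.Carrier n X) :
    G.onRight (quiverData k V hn).p (G.lAct a m) =
      G.lAct ((quiverData k V hn).p a) (G.onRight (quiverData k V hn).p m) := by
  refine intertwines (l := G.lAct) (l' := G.lAct.comp (quiverData k V hn).pHom)
    (f := G.onRight (quiverData k V hn).p) (fun v m => ?_) (fun b m => ?_) a m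
  · change _ = G.lAct ((quiverData k V hn).p (vertex n v)) _
    rw [quiverData_p_vertex, lAct_vertex,
      G.vertexAct_onRight (quiverData_p_vertex_mul hn)]
  · obtain ⟨i, l, a⟩ := b
    change G.onRight (quiverData k V hn).p (G.lAct (arrow n a) m) =
      G.lAct ((quiverData k V hn).p (arrow n a)) _
    rw [quiverData_p_arrow, _root_.map_zero, LinearMap.zero_apply]
    refine G.induction (S := LinearMap.ker (G.onRight (quiverData k V hn).p ∘ₗ
      G.lAct (arrow n a))) (fun l' j g x => ?_) m
    rw [LinearMap.mem_ker, LinearMap.comp_apply]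
    by_cases h : l = l'
    · subst h
      simp only [lAct_arrow_gen, _root_.map_sum, onRight_p_gen, quiverData_p_arrow_mul,
        _root_.map_zero, Finset.sum_const_zero]
    · rw [G.lAct_arrow_gen_ne h, _root_.map_zero]

lemma onRight_d_arrow (hn : 2 ≤ n) {i l : V} (a : i ⟶ l) (m : G.Carrier n X) :
    G.onRight (quiverData k V hn).d (G.lAct (arrow n a) m) =
      G.lAct (arrow n a) (G.onRight (quiverData k V hn).p m) := by
  refine G.induction (S := LinearMap.eqLocus (G.onRight (quiverData k V hn).d ∘ₗ
    G.lAct (arrow n a)) (G.lAct (arrow n a) ∘ₗ G.onRight (quiverData k V hn).p))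
    (fun l' j g x => ?_) m
  rw [LinearMap.mem_eqLocus, LinearMap.comp_apply, LinearMap.comp_apply, onRight_p_gen]
  by_cases h : l = l'
  · subst h
    simp only [lAct_arrow_gen, _root_.map_sum, onRight_d_gen, quiverData_d_arrow_mul]
  · rw [G.lAct_arrow_gen_ne h, G.lAct_arrow_gen_ne h, _root_.map_zero]

lemma onRight_d_lAct (hn : 2 ≤ n) (a) (m : G.Carrier n X) :
    G.onRight (quiverData k V hn).d (G.lAct a m) =
      G.lAct ((quiverData k V hn).p a) (G.onRight (quiverData k V hn).d m) +
        G.lAct ((quiverData k V hn).d a) (G.onRight (quiverData k V hn).p m) := by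
  let S : Submodule k (TruncatedPathAlgebra k V n) :=
    { carrier := {a | ∀ m : G.Carrier n X, G.onRight (quiverData k V hn).d (G.lAct a m) =
        G.lAct ((quiverData k V hn).p a) (G.onRight (quiverData k V hn).d m) +
          G.lAct ((quiverData k V hn).d a) (G.onRight (quiverData k V hn).p m)}
      zero_mem' := fun m => by simp
      add_mem' := fun {a b} ha hb m => by
        simp only [_root_.map_add, LinearMap.add_apply, ha m, hb m]; abel
      smul_mem' := fun c a ha m => by
        simp only [_root_.map_smul, LinearMap.smul_apply, ha m, smul_add] }
  refine mul_induction S (fun v m => ?_) (fun b m => ?_) (fun x hx y hy m => ?_) a m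
  · rw [quiverData_p_vertex, quiverData_d_vertex, _root_.map_zero, LinearMap.zero_apply, add_zero,
      lAct_vertex, G.vertexAct_onRight (quiverData_d_vertex_mul hn)]
  · obtain ⟨i, l, a⟩ := b
    change G.onRight (quiverData k V hn).d (G.lAct (arrow n a) m) =
      G.lAct ((quiverData k V hn).p (arrow n a)) _ + G.lAct ((quiverData k V hn).d (arrow n a)) _
    rw [quiverData_p_arrow, quiverData_d_arrow, _root_.map_zero, LinearMap.zero_apply, zero_add,
      onRight_d_arrow]
  · simp only [QuiverData.p_mul, QuiverData.d_mul, _root_.map_mul, _root_.map_add,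
      Module.End.mul_apply, LinearMap.add_apply, hx _, hy _, onRight_p_lAct]
    abel

/-- The bimodule with quiver data given by a connection. -/
@[reducible] noncomputable def qbim (G : Connection C k V) (hn : 2 ≤ n) (X : C) :
    QBimodule (quiverData k V hn) :=
  QBimodule.ofProj _ (G.bimodule n X) (G.radSymm hn X) (G.onRight (quiverData k V hn).p)
    (G.onRight (quiverData k V hn).d)
    (fun m => Submodule.mem_comap.1 <| G.induction (S := (G.bimodule n X).radM.comap
      (LinearMap.id - G.onRight (quiverData k V hn).p)) (fun i j g x => by
        rw [Submodule.mem_comap, LinearMap.sub_apply, LinearMap.id_apply, onRight_p_gen,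
          ← _root_.map_sub]
        exact G.gen_mem_radM hn g (QuiverData.sub_p_mem _ _)) m)
    (fun m => G.induction (S := (G.bimodule n X).radM.comap
      (G.onRight (quiverData k V hn).d)) (fun i j g x => by
        rw [Submodule.mem_comap, onRight_d_gen]
        exact G.gen_mem_radM hn g (QuiverData.d_mem _ _)) m)
    (fun m hm => by
      rw [radM, G.radSymm hn X] at hm
      have : (G.bimodule n X).mulRad ⊤ ≤ (G.bimodule n X).radSq.comap
          (LinearMap.id - G.onRight (quiverData k V hn).d) := by
        refine mulRad_le fun a ha m _ => ?_
        refine G.induction (S := ((G.bimodule n X).radSq.comap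
          (LinearMap.id - G.onRight (quiverData k V hn).d)).comap (G.rAct (op a)))
          (fun i j g x => ?_) m
        rw [Submodule.mem_comap, Submodule.mem_comap, rAct_gen, LinearMap.sub_apply,
          LinearMap.id_apply, onRight_d_gen, ← _root_.map_sub]
        exact G.gen_mem_radSq hn g (QuiverData.sub_d_mem _ (QuiverData.mul_mem_rad_left _ ha))
      exact this hm)
    (G.onRight_p_lAct hn)
    (fun a m => LinearMap.congr_fun (f := G.onRight (quiverData k V hn).p ∘ₗ G.rAct (op a))
      (g := G.rAct (op ((quiverData k V hn).p a)) ∘ₗ G.onRight (quiverData k V hn).p)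
      (G.hom_ext fun i j g x => by
        simp only [LinearMap.comp_apply, rAct_gen, onRight_p_gen, QuiverData.p_mul]) m)
    (G.onRight_d_lAct hn)
    (fun a m => LinearMap.congr_fun (f := G.onRight (quiverData k V hn).d ∘ₗ G.rAct (op a))
      (g := G.rAct (op ((quiverData k V hn).p a)) ∘ₗ G.onRight (quiverData k V hn).d +
        G.rAct (op ((quiverData k V hn).d a)) ∘ₗ G.onRight (quiverData k V hn).p)
      (G.hom_ext fun i j g x => by
        simp only [LinearMap.comp_apply, LinearMap.add_apply, rAct_gen, onRight_p_gen,
          onRight_d_gen, QuiverData.d_mul, _root_.map_add]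
        rw [add_comm]) m)

end Connection

end BasicAction

namespace CategoryTheory

open MonoidalCategory Functor.LaxMonoidal Functor.OplaxMonoidal

/-- A monoidal functor whose values satisfy a property, as a monoidal functor to the full
subcategory. -/
def _root_.CategoryTheory.Functor.CoreMonoidal.lift {C D : Type*} [Category* C] [Category* D]
    [MonoidalCategory C] [MonoidalCategory D] {P : ObjectProperty D} [P.IsMonoidal] {F : C ⥤ D}
    (h : F.CoreMonoidal) (hP : ∀ X, P (F.obj X)) : (P.lift F hP).CoreMonoidal where
  εIso := P.isoMk h.εIso
  μIso X Y := P.isoMk (h.μIso X Y)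
  μIso_hom_natural_left f X' := P.hom_ext (h.μIso_hom_natural_left f X')
  μIso_hom_natural_right X' f := P.hom_ext (h.μIso_hom_natural_right X' f)
  associativity X Y Z := P.hom_ext (h.associativity X Y Z)
  left_unitality X := P.hom_ext (h.left_unitality X)
  right_unitality X := P.hom_ext (h.right_unitality X)

/-- A monoidal functor preserves exact pairings. -/
@[reducible] def _root_.CategoryTheory.Functor.Monoidal.mapExactPairing {C D : Type*} [Category* C] [Category* D]
    [MonoidalCategory C] [MonoidalCategory D] (F : C ⥤ D) [F.Monoidal] (X Y : C)
    [ExactPairing X Y] : ExactPairing (F.obj X) (F.obj Y) where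
  coevaluation' := ε F ≫ F.map (η_ X Y) ≫ δ F X Y
  evaluation' := μ F Y X ≫ F.map (ε_ X Y) ≫ η F
  coevaluation_evaluation' := by
    have := congrArg F.map (ExactPairing.coevaluation_evaluation X Y)
    simp only [Functor.map_comp, Functor.Monoidal.map_whiskerLeft,
      Functor.Monoidal.map_whiskerRight, Functor.Monoidal.map_associator_inv,
      Functor.Monoidal.map_rightUnitor, Functor.Monoidal.map_leftUnitor_inv, Category.assoc,
      Functor.Monoidal.μ_δ_assoc, cancel_epi] at this
    have h := F.obj Y ◁ ε F ≫= this =≫ (δ F (𝟙_ C) Y ≫ η F ▷ F.obj Y)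
    simp only [Category.assoc, Functor.Monoidal.μ_δ_assoc, Functor.Monoidal.whiskerLeft_ε_η_assoc,
      Functor.Monoidal.whiskerRight_ε_η, Category.comp_id] at h
    simpa only [MonoidalCategory.whiskerLeft_comp, comp_whiskerRight, Category.assoc] using h
  evaluation_coevaluation' := by
    have := congrArg F.map (ExactPairing.evaluation_coevaluation X Y)
    simp only [Functor.map_comp, Functor.Monoidal.map_whiskerLeft,
      Functor.Monoidal.map_whiskerRight, Functor.Monoidal.map_associator,
      Functor.Monoidal.map_rightUnitor_inv, Functor.Monoidal.map_leftUnitor, Category.assoc,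
      Functor.Monoidal.μ_δ_assoc, cancel_epi] at this
    have h := ε F ▷ F.obj X ≫= this =≫ (δ F X (𝟙_ C) ≫ F.obj X ◁ η F)
    simp only [Category.assoc, Functor.Monoidal.μ_δ_assoc, Functor.Monoidal.whiskerRight_ε_η_assoc,
      Functor.Monoidal.whiskerLeft_ε_η, Category.comp_id] at h
    simpa only [MonoidalCategory.whiskerLeft_comp, comp_whiskerRight, Category.assoc] using h

end CategoryTheory

namespace BasicAction

/-- A morphism of bimodules with quiver data with a linear inverse is an isomorphism. -/
def QBimodule.isoMk {k A : Type u} [Field k] [Ring A] [Algebra k A] {D : QuiverData k A}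
    {M N : QBimodule D} (f : M ⟶ N) (g : N.carrier →ₗ[k] M.carrier)
    (h1 : ∀ m, g (QBimodule.Hom.lin f m) = m) (h2 : ∀ m, QBimodule.Hom.lin f (g m) = m) :
    M ≅ N where
  hom := f
  inv := QBimodule.homMk g
    (fun a m => by conv_lhs => rw [← h2 m, ← QBimodule.lin_l, h1])
    (fun a m => by conv_lhs => rw [← h2 m, ← QBimodule.lin_r, h1])
    (fun m => by conv_lhs => rw [← h2 m, ← QBimodule.lin_p, h1])
  hom_inv_id := QBimodule.hom_ext h1
  inv_hom_id := QBimodule.hom_ext h2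

namespace Connection

open TruncatedPathAlgebra Bimodule

variable {C : Type w} [Category.{v} C] [Preadditive C] [MonoidalCategory C]
variable {k V : Type u} [Field k] [Linear k C] [Quiver.{u} V] [Fintype V]
  [∀ i j : V, Fintype (i ⟶ j)] (G : Connection C k V) {n : ℕ} {X Y Z : C}

/-- The map of right modules induced by a morphism. -/
noncomputable def mapLin (f : X ⟶ Y) : G.Carrier n X →ₗ[k] G.Carrier n Y :=
  G.lift fun _ _ => G.gen ∘ₗ G.map f

@[simp] lemma mapLin_gen (f : X ⟶ Y) {i j : V} (g : G.Γ X i j) (x : TruncatedPathAlgebra k V n) :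
    G.mapLin f (G.gen g x) = G.gen (G.map f g) x := by
  rw [mapLin, lift_gen, LinearMap.comp_apply, gen_vertex_mul]

lemma mapLin_lAct (f : X ⟶ Y) (a) (m : G.Carrier n X) :
    G.mapLin f (G.lAct a m) = G.lAct a (G.mapLin f m) := by
  refine intertwines (fun v m => ?_) (fun b m => ?_) a m
  · refine G.induction (S := LinearMap.eqLocus (G.mapLin f ∘ₗ G.lAct (vertex n v))
      (G.lAct (vertex n v) ∘ₗ G.mapLin f)) (fun i j g x => ?_) m
    simp only [LinearMap.mem_eqLocus, LinearMap.comp_apply, lAct_vertex, mapLin_gen]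
    by_cases h : v = i
    · subst h; simp
    · simp [G.vertexAct_gen_ne h]
  · obtain ⟨i, l, a⟩ := b
    refine G.induction (S := LinearMap.eqLocus (G.mapLin f ∘ₗ G.lAct (arrow n a))
      (G.lAct (arrow n a) ∘ₗ G.mapLin f)) (fun l' j g x => ?_) m
    simp only [LinearMap.mem_eqLocus, LinearMap.comp_apply, mapLin_gen]
    by_cases h : l = l'
    · subst h
      simp only [lAct_arrow_gen, _root_.map_sum, mapLin_gen, swap_map]
    · simp [G.lAct_arrow_gen_ne h]

/-- The morphism of bimodules induced by a morphism. -/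
noncomputable def qmap (hn : 2 ≤ n) (f : X ⟶ Y) : G.qbim hn X ⟶ G.qbim hn Y :=
  QBimodule.homMk (M := G.qbim hn X) (N := G.qbim hn Y) (G.mapLin f) (G.mapLin_lAct f)
    (fun a m => LinearMap.congr_fun (f := G.mapLin f ∘ₗ G.rAct (op a))
      (g := G.rAct (op a) ∘ₗ G.mapLin f) (G.hom_ext fun i j g x => by simp) m)
    (fun m => LinearMap.congr_fun (f := G.mapLin f ∘ₗ G.onRight (quiverData k V hn).p)
      (g := G.onRight (quiverData k V hn).p ∘ₗ G.mapLin f) (G.hom_ext fun i j g x => by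
        simp only [LinearMap.comp_apply, onRight_p_gen, mapLin_gen]) m)

lemma qmap_ext (hn : 2 ≤ n) {M : QBimodule (quiverData k V hn)} {f f' : G.qbim hn X ⟶ M}
    (h : ∀ i j (g : G.Γ X i j) x, QBimodule.Hom.lin f (G.gen g x) =
      QBimodule.Hom.lin f' (G.gen g x)) : f = f' :=
  QBimodule.hom_ext fun m => LinearMap.congr_fun (G.hom_ext h) m

lemma lin_qmap (hn : 2 ≤ n) (f : X ⟶ Y) (m : G.Carrier n X) :
    QBimodule.Hom.lin (G.qmap hn f) m = G.mapLin f m := rfl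

/-- The functor to bimodules with quiver data given by a connection. -/
noncomputable def toFunctor (hn : 2 ≤ n) : C ⥤ QBimodule (quiverData k V hn) where
  obj X := G.qbim hn X
  map f := G.qmap hn f
  map_id X := G.qmap_ext hn fun i j g x => by
    rw [lin_qmap, mapLin_gen, map_id]; rfl
  map_comp f f' := G.qmap_ext hn fun i j g x => by
    rw [lin_qmap, mapLin_gen, map_comp, QBimodule.lin_comp, lin_qmap, lin_qmap, mapLin_gen,
      mapLin_gen]

/-- Left multiplication by an edge. -/
noncomputable def leftMul {i l : V} :
    G.Γ X i l →ₗ[k] G.Carrier n Y →ₗ[k] G.Carrier n (X ⊗ Y) where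
  toFun g := G.liftAt l fun _ => G.gen ∘ₗ G.mul g
  map_add' g g' := G.hom_ext fun l' j h y => by
    by_cases e : l = l'
    · subst e; simp
    · simp [G.liftAt_gen_ne e]
  map_smul' c g := G.hom_ext fun l' j h y => by
    by_cases e : l = l'
    · subst e; simp
    · simp [G.liftAt_gen_ne e]

@[simp] lemma leftMul_gen {i l j : V} (g : G.Γ X i l) (h : G.Γ Y l j)
    (y : TruncatedPathAlgebra k V n) : G.leftMul g (G.gen h y) = G.gen (G.mul g h) y :=
  (G.liftAt_gen _ h y).trans (G.gen_vertex_mul _ y)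

lemma leftMul_gen_ne {i l l' j : V} (e : l ≠ l') (g : G.Γ X i l) (h : G.Γ Y l' j)
    (y : TruncatedPathAlgebra k V n) : G.leftMul g (G.gen h y) = 0 :=
  G.liftAt_gen_ne e _ h y

/-- Two maps `f` and `f'` agree on the products of edges starting at `l` and elements if they
agree on the generators. -/
lemma vertexAct_ext {W : Type*} [AddCommGroup W] [Module k W] {f f' : G.Carrier n X →ₗ[k] W}
    {l : V} (h : ∀ j (g : G.Γ X l j) x, f (G.gen g x) = f' (G.gen g x))
    (h0 : ∀ i j (g : G.Γ X i j) x, l ≠ i → f (G.gen g x) = 0)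
    (h0' : ∀ i j (g : G.Γ X i j) x, l ≠ i → f' (G.gen g x) = 0) : f = f' :=
  G.hom_ext fun i j g x => by
    by_cases e : l = i
    · subst e; exact h j g x
    · rw [h0 i j g x e, h0' i j g x e]

lemma leftMul_vertexAct {i l : V} (g : G.Γ X i l) (m : G.Carrier n Y) :
    G.leftMul g (G.vertexAct l m) = G.leftMul g m := by
  refine LinearMap.congr_fun (f := G.leftMul g ∘ₗ G.vertexAct l) (G.vertexAct_ext (l := l)
    (fun j h y => ?_) (fun i j h y e => ?_) (fun i j h y e => ?_)) m
  · simp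
  · simp [G.vertexAct_gen_ne e]
  · simp [G.leftMul_gen_ne e]

/-- The bilinear multiplication. -/
noncomputable def mulLin : G.Carrier n X →ₗ[k] G.Carrier n Y →ₗ[k] G.Carrier n (X ⊗ Y) :=
  G.lift fun _ _ => (LinearMap.llcomp k _ _ _ ∘ₗ G.leftMul).compl₂ G.lAct.toLinearMap

lemma mulLin_gen {i l : V} (g : G.Γ X i l) (x) (m : G.Carrier n Y) :
    G.mulLin (G.gen g x) m = G.leftMul g (G.lAct x m) := by
  rw [mulLin, lift_gen]
  change G.leftMul g (G.lAct (vertex n l * x) m) = _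
  rw [_root_.map_mul, Module.End.mul_apply, lAct_vertex, leftMul_vertexAct]

lemma leftMul_rAct {i l : V} (g : G.Γ X i l) (a) (m : G.Carrier n Y) :
    G.leftMul g (G.rAct (op a) m) = G.rAct (op a) (G.leftMul g m) := by
  refine LinearMap.congr_fun (f := G.leftMul g ∘ₗ G.rAct (op a))
    (g := G.rAct (op a) ∘ₗ G.leftMul g) (G.vertexAct_ext (l := l)
    (fun j h y => ?_) (fun i j h y e => ?_) (fun i j h y e => ?_)) m
  · simp
  · simp [G.leftMul_gen_ne e]
  · simp [G.leftMul_gen_ne e]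

lemma leftMul_p (hn : 2 ≤ n) {i l : V} (g : G.Γ X i l) (m : G.Carrier n Y) :
    G.leftMul g (G.onRight (quiverData k V hn).p m) =
      G.onRight (quiverData k V hn).p (G.leftMul g m) := by
  refine LinearMap.congr_fun (f := G.leftMul g ∘ₗ G.onRight (quiverData k V hn).p)
    (g := G.onRight (quiverData k V hn).p ∘ₗ G.leftMul g) (G.vertexAct_ext (l := l)
    (fun j h y => ?_) (fun i j h y e => ?_) (fun i j h y e => ?_)) m
  · simp only [LinearMap.comp_apply, onRight_p_gen, leftMul_gen]
  · simp only [LinearMap.comp_apply, onRight_p_gen, G.leftMul_gen_ne e]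
  · simp only [LinearMap.comp_apply, G.leftMul_gen_ne e, _root_.map_zero]

lemma vertexAct_leftMul {i l : V} (g : G.Γ X i l) (m : G.Carrier n Y) :
    G.vertexAct i (G.leftMul g m) = G.leftMul g m := by
  refine LinearMap.congr_fun (f := G.vertexAct i ∘ₗ G.leftMul g) (G.vertexAct_ext (l := l)
    (fun j h y => ?_) (fun i j h y e => ?_) (fun i j h y e => ?_)) m
  · simp
  · simp [G.leftMul_gen_ne e]
  · simp [G.leftMul_gen_ne e]

lemma vertexAct_leftMul_ne {i i' l : V} (e : i' ≠ i) (g : G.Γ X i l) (m : G.Carrier n Y) :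
    G.vertexAct i' (G.leftMul g m) = 0 := by
  rw [← vertexAct_leftMul, ← lAct_vertex, ← lAct_vertex, ← Module.End.mul_apply, ← _root_.map_mul,
    vertex_mul_ne e, _root_.map_zero, LinearMap.zero_apply]

lemma lAct_arrow_leftMul {i i' l : V} (a : i ⟶ i') (g : G.Γ X i' l) (m : G.Carrier n Y) :
    G.lAct (arrow n a) (G.leftMul g m) =
      ∑ h, ∑ b : h ⟶ l, G.leftMul (G.swap a b g) (G.lAct (arrow n b) m) := by
  have : (∑ h, ∑ b : h ⟶ l, G.leftMul (G.swap a b g) ∘ₗ G.lAct (arrow n b) :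
      G.Carrier n Y →ₗ[k] _) m =
      ∑ h, ∑ b : h ⟶ l, G.leftMul (G.swap a b g) (G.lAct (arrow n b) m) := by
    simp only [LinearMap.sum_apply, LinearMap.comp_apply]
  rw [← this]
  refine LinearMap.congr_fun (f := G.lAct (arrow n a) ∘ₗ G.leftMul g) (G.vertexAct_ext (l := l)
    (fun j h y => ?_) (fun i j h y e => ?_) (fun i j h y e => ?_)) m
  · simp only [LinearMap.sum_apply, LinearMap.comp_apply, leftMul_gen, lAct_arrow_gen,
      _root_.map_sum, swap_mul]
    simp only [Finset.sum_sigma' Finset.univ (fun _ => Finset.univ)]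
    exact Finset.sum_comm
  · simp [G.leftMul_gen_ne e]
  · simp only [LinearMap.sum_apply, LinearMap.comp_apply, G.lAct_arrow_gen_ne e, _root_.map_zero,
      Finset.sum_const_zero]

lemma lAct_arrow_leftMul_ne {i i' i'' l : V} (e : i' ≠ i'') (a : i ⟶ i') (g : G.Γ X i'' l)
    (m : G.Carrier n Y) : G.lAct (arrow n a) (G.leftMul g m) = 0 := by
  rw [← arrow_mul_vertex, _root_.map_mul, Module.End.mul_apply, lAct_vertex,
    G.vertexAct_leftMul_ne e, _root_.map_zero]

lemma mulLin_lAct (a) (m : G.Carrier n X) (m' : G.Carrier n Y) :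
    G.mulLin (G.lAct a m) m' = G.lAct a (G.mulLin m m') := by
  refine intertwines (f := G.mulLin.flip m') (fun v m => ?_) (fun b m => ?_) a m
  · refine G.induction (S := LinearMap.eqLocus (G.mulLin.flip m' ∘ₗ G.lAct (vertex n v))
      (G.lAct (vertex n v) ∘ₗ G.mulLin.flip m')) (fun i j g x => ?_) m
    simp only [LinearMap.mem_eqLocus, LinearMap.comp_apply, lAct_vertex, LinearMap.flip_apply,
      mulLin_gen]
    by_cases h : v = i
    · subst h; rw [vertexAct_gen, vertexAct_leftMul, mulLin_gen]
    · rw [G.vertexAct_gen_ne h, G.vertexAct_leftMul_ne h, _root_.map_zero, LinearMap.zero_apply]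
  · obtain ⟨i, l, a⟩ := b
    refine G.induction (S := LinearMap.eqLocus (G.mulLin.flip m' ∘ₗ G.lAct (arrow n a))
      (G.lAct (arrow n a) ∘ₗ G.mulLin.flip m')) (fun l' j g x => ?_) m
    simp only [LinearMap.mem_eqLocus, LinearMap.comp_apply, LinearMap.flip_apply, mulLin_gen]
    by_cases h : l = l'
    · subst h
      simp only [lAct_arrow_gen, lAct_arrow_leftMul, _root_.map_sum, LinearMap.sum_apply,
        mulLin_gen, _root_.map_mul, Module.End.mul_apply]
    · rw [G.lAct_arrow_gen_ne h, G.lAct_arrow_leftMul_ne h, _root_.map_zero,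
        LinearMap.zero_apply]

lemma mulLin_balanced (m : G.Carrier n X) (a) (m' : G.Carrier n Y) :
    G.mulLin (G.rAct (op a) m) m' = G.mulLin m (G.lAct a m') :=
  LinearMap.congr_fun (f := G.mulLin.flip m' ∘ₗ G.rAct (op a))
    (g := G.mulLin.flip (G.lAct a m')) (G.hom_ext fun i j g x => by
      simp only [LinearMap.comp_apply, LinearMap.flip_apply, rAct_gen, mulLin_gen, _root_.map_mul,
        Module.End.mul_apply]) m

lemma mulLin_rAct (a) (m : G.Carrier n X) (m' : G.Carrier n Y) :
    G.mulLin m (G.rAct (op a) m') = G.rAct (op a) (G.mulLin m m') :=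
  LinearMap.congr_fun (f := G.mulLin.flip (G.rAct (op a) m'))
    (g := G.rAct (op a) ∘ₗ G.mulLin.flip m') (G.hom_ext fun i j g x => by
      simp only [LinearMap.comp_apply, LinearMap.flip_apply, mulLin_gen, ← leftMul_rAct]
      rw [(G.bimodule n Y).comm]) m

lemma mulLin_p (hn : 2 ≤ n) (m : G.Carrier n X) (m' : G.Carrier n Y) :
    G.mulLin (G.onRight (quiverData k V hn).p m) (G.onRight (quiverData k V hn).p m') =
      G.onRight (quiverData k V hn).p (G.mulLin m m') :=
  LinearMap.congr_fun
    (f := G.mulLin.flip (G.onRight (quiverData k V hn).p m') ∘ₗ G.onRight (quiverData k V hn).p)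
    (g := G.onRight (quiverData k V hn).p ∘ₗ G.mulLin.flip m') (G.hom_ext fun i j g x => by
      simp only [LinearMap.comp_apply, LinearMap.flip_apply, onRight_p_gen, mulLin_gen,
        ← leftMul_p, onRight_p_lAct]) m

/-- The multiplication as a morphism of bimodules. -/
noncomputable def qmul (hn : 2 ≤ n) (X Y : C) :
    G.qbim hn X ⊗ G.qbim hn Y ⟶ G.qbim hn (X ⊗ Y) :=
  QBimodule.tensorHomMk (M := G.qbim hn X) (N := G.qbim hn Y) (P := G.qbim hn (X ⊗ Y)) G.mulLin
    G.mulLin_balanced G.mulLin_lAct (fun a m m' => G.mulLin_rAct a m m') (G.mulLin_p hn)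

/-- The element `g ⊗ h x` of the tensor product, for edges `g` and `h`. -/
noncomputable def genTensor (n : ℕ) {i l j : V} : G.Γ X i l →ₗ[k] G.Γ Y l j →ₗ[k]
    TruncatedPathAlgebra k V n →ₗ[k] Bimodule.TensorSpace (G.bimodule n X) (G.bimodule n Y) :=
  LinearMap.mk₂ k (fun g h => tmkₗ (G.bimodule n X) (G.bimodule n Y) (G.gen g 1) ∘ₗ G.gen h)
    (fun g g' h => by
      rw [_root_.map_add, LinearMap.add_apply, _root_.map_add, LinearMap.add_comp])
    (fun c g h => by simp only [_root_.map_smul, LinearMap.smul_apply, LinearMap.smul_comp])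
    (fun g h h' => by rw [_root_.map_add, LinearMap.comp_add])
    (fun c g h => by rw [_root_.map_smul, LinearMap.comp_smul])

lemma genTensor_apply {i l j : V} (g : G.Γ X i l) (h : G.Γ Y l j) (x) :
    G.genTensor n g h x = tmk (M := G.bimodule n X) (N := G.bimodule n Y) (G.gen g 1) (G.gen h x) :=
  rfl

/-- The comultiplication. -/
noncomputable def comulLin (n : ℕ) (X Y : C) :
    G.Carrier n (X ⊗ Y) →ₗ[k] Bimodule.TensorSpace (G.bimodule n X) (G.bimodule n Y) :=
  G.lift fun _ _ => ∑ l, TensorProduct.lift (G.genTensor n) ∘ₗ G.comul l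

lemma lift_genTensor_vertex_mul {i l j : V} (t : G.Γ X i l ⊗[k] G.Γ Y l j)
    (x : TruncatedPathAlgebra k V n) :
    TensorProduct.lift (G.genTensor n) t (vertex n j * x) =
      TensorProduct.lift (G.genTensor n) t x := by
  induction t with
  | zero => simp
  | add s t hs ht => rw [_root_.map_add, LinearMap.add_apply, LinearMap.add_apply, hs, ht]
  | tmul g h =>
    rw [TensorProduct.lift.tmul, genTensor_apply, genTensor_apply, gen_vertex_mul]

lemma comulLin_gen {i j : V} (z : G.Γ (X ⊗ Y) i j) (x : TruncatedPathAlgebra k V n) :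
    G.comulLin n X Y (G.gen z x) =
      ∑ l, TensorProduct.lift (G.genTensor n) (G.comul l z) x := by
  rw [comulLin, lift_gen, LinearMap.sum_apply, LinearMap.sum_apply]
  exact Finset.sum_congr rfl fun l _ => G.lift_genTensor_vertex_mul _ x

lemma lin_qmul (hn : 2 ≤ n) (m : G.Carrier n X) (m' : G.Carrier n Y) :
    QBimodule.Hom.lin (G.qmul hn X Y) (tmk (M := G.bimodule n X) (N := G.bimodule n Y) m m') =
      G.mulLin m m' := rfl

lemma comulLin_qmul (hn : 2 ≤ n) (t : Bimodule.TensorSpace (G.bimodule n X) (G.bimodule n Y)) :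
    G.comulLin n X Y (QBimodule.Hom.lin (G.qmul hn X Y) t) = t := by
  refine LinearMap.congr_fun (f := G.comulLin n X Y ∘ₗ QBimodule.Hom.lin (G.qmul hn X Y))
    (g := LinearMap.id) (text fun m m' => ?_) t
  change G.comulLin n X Y (G.mulLin m m') = tmk (M := G.bimodule n X) (N := G.bimodule n Y) m m'
  refine LinearMap.congr_fun (f := G.comulLin n X Y ∘ₗ G.mulLin.flip m')
    (g := (tmkₗ (G.bimodule n X) (G.bimodule n Y)).flip m') (G.hom_ext fun i l g x => ?_) m
  simp only [LinearMap.comp_apply, LinearMap.flip_apply, mulLin_gen]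
  have h1 : (G.gen g x : G.Carrier n X) = (G.bimodule n X).r (op x) (G.gen g 1) := by
    rw [rAct_gen, one_mul]
  rw [h1]
  refine Eq.trans ?_ (tmk_r (M := G.bimodule n X) (N := G.bimodule n Y) (G.gen g 1) x m').symm
  refine LinearMap.congr_fun (f := G.comulLin n X Y ∘ₗ G.leftMul g)
    (g := tmkₗ (G.bimodule n X) (G.bimodule n Y) (G.gen g 1)) (G.hom_ext fun l' j h y => ?_)
    (G.lAct x m')
  rw [LinearMap.comp_apply]
  by_cases e : l = l'
  · subst e
    rw [leftMul_gen, comulLin_gen, Finset.sum_eq_single l, comul_mul, TensorProduct.lift.tmul,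
      genTensor_apply]
    · rfl
    · intro l' _ e
      rw [G.comul_mul_ne e.symm, _root_.map_zero, LinearMap.zero_apply]
    · simp
  · have h2 : (G.gen g 1 : G.Carrier n X) = (G.bimodule n X).r (op (vertex n l)) (G.gen g 1) := by
      rw [rAct_gen, one_mul, ← G.gen_vertex_mul g 1, mul_one]
    have h3 : (G.bimodule n Y).l (vertex n l) (G.gen h y) = 0 := by
      rw [lAct_vertex, G.vertexAct_gen_ne e]
    rw [G.leftMul_gen_ne e, _root_.map_zero, h2]
    refine Eq.trans ?_ (tmk_r (M := G.bimodule n X) (N := G.bimodule n Y) (G.gen g 1) _ _).symm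
    rw [h3, tmk_zero_right]

lemma qmul_lift_genTensor (hn : 2 ≤ n) {i l j : V} (t : G.Γ X i l ⊗[k] G.Γ Y l j)
    (x : TruncatedPathAlgebra k V n) :
    QBimodule.Hom.lin (G.qmul hn X Y) (TensorProduct.lift (G.genTensor n) t x) =
      G.gen (TensorProduct.lift G.mul t) x := by
  induction t with
  | zero => simp
  | add s t hs ht =>
    rw [_root_.map_add, LinearMap.add_apply, _root_.map_add, hs, ht, _root_.map_add,
      _root_.map_add, LinearMap.add_apply]
  | tmul g h =>
    rw [TensorProduct.lift.tmul, genTensor_apply, lin_qmul, mulLin_gen, TensorProduct.lift.tmul,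
      map_one, Module.End.one_apply, leftMul_gen]

lemma qmul_comulLin (hn : 2 ≤ n) (t : G.Carrier n (X ⊗ Y)) :
    QBimodule.Hom.lin (G.qmul hn X Y) (G.comulLin n X Y t) = t := by
  refine LinearMap.congr_fun (f := QBimodule.Hom.lin (G.qmul hn X Y) ∘ₗ G.comulLin n X Y)
    (g := LinearMap.id) (G.hom_ext fun i j z x => ?_) t
  rw [LinearMap.comp_apply, comulLin_gen, _root_.map_sum]
  refine (Finset.sum_congr rfl fun l _ => G.qmul_lift_genTensor hn _ x).trans ?_
  rw [← LinearMap.sum_apply, ← _root_.map_sum, mul_comul]; rfl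

/-- The unit. -/
noncomputable def unitLin (n : ℕ) : TruncatedPathAlgebra k V n →ₗ[k] G.Carrier n (𝟙_ C) :=
  ∑ i, G.gen (G.unit i)

lemma unitLin_apply (x : TruncatedPathAlgebra k V n) :
    G.unitLin n x = ∑ i, G.gen (G.unit i) x := by rw [unitLin, LinearMap.sum_apply]

lemma unitLin_vertex_mul (v : V) (x : TruncatedPathAlgebra k V n) :
    G.unitLin n (vertex n v * x) = G.gen (G.unit v) x := by
  classical
  rw [unitLin_apply, Finset.sum_eq_single v, gen_vertex_mul]
  · intro i _ h; exact G.gen_vertex_mul_ne h _ x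
  · simp

lemma unitLin_mul (a x : TruncatedPathAlgebra k V n) :
    G.unitLin n (a * x) = G.lAct a (G.unitLin n x) := by
  classical
  refine intertwines (l := Algebra.lmul k (TruncatedPathAlgebra k V n)) (l' := G.lAct)
    (f := G.unitLin n) (fun v x => ?_) (fun b x => ?_) a x
  · change G.unitLin n (vertex n v * x) = _
    rw [unitLin_vertex_mul, lAct_vertex, unitLin_apply, _root_.map_sum, Finset.sum_eq_single v,
      vertexAct_gen]
    · intro i _ h; exact G.vertexAct_gen_ne h.symm _ x
    · simp
  · obtain ⟨i, l, a⟩ := b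
    change G.unitLin n (arrow n a * x) = G.lAct (arrow n a) _
    conv_lhs => rw [← vertex_mul_arrow, _root_.mul_assoc, unitLin_vertex_mul]
    rw [unitLin_apply, _root_.map_sum, Finset.sum_eq_single l, lAct_arrow_gen, Finset.sum_eq_single i,
      Finset.sum_eq_single a, swap_unit_self, if_pos rfl]
    · intro b _ h; rw [swap_unit_self, if_neg h, _root_.map_zero, LinearMap.zero_apply]
    · simp
    · intro h _ hh
      refine Finset.sum_eq_zero fun b _ => ?_
      rw [G.swap_unit_ne hh, _root_.map_zero, LinearMap.zero_apply]
    · simp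
    · intro l' _ h; exact G.lAct_arrow_gen_ne h.symm a _ x
    · simp

/-- The unit as a morphism of bimodules. -/
noncomputable def qunit (hn : 2 ≤ n) : 𝟙_ (QBimodule (quiverData k V hn)) ⟶ G.qbim hn (𝟙_ C) :=
  QBimodule.homMk (M := QBimodule.unit (quiverData k V hn)) (N := G.qbim hn (𝟙_ C)) (G.unitLin n)
    G.unitLin_mul
    (fun a x => by
      change G.unitLin n (x * a) = G.rAct (op a) (G.unitLin n x)
      simp only [unitLin_apply, _root_.map_sum, rAct_gen])
    (fun x => by
      change G.unitLin n ((quiverData k V hn).p x) =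
        G.onRight (quiverData k V hn).p (G.unitLin n x)
      simp only [unitLin_apply, _root_.map_sum, onRight_p_gen])

/-- The counit. -/
noncomputable def counitLin (n : ℕ) : G.Carrier n (𝟙_ C) →ₗ[k] TruncatedPathAlgebra k V n :=
  ∑ i, TensorProduct.lift (LinearMap.mk₂ k
    (fun g (y : (vertexIdeal n i : Submodule k _)) =>
      G.counit i g • (y : TruncatedPathAlgebra k V n))
    (fun g g' y => by rw [_root_.map_add, add_smul])
    (fun c g y => by rw [_root_.map_smul, smul_assoc])
    (fun g y y' => by rw [Submodule.coe_add, smul_add])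
    (fun c g y => by rw [Submodule.coe_smul, smul_comm])) ∘ₗ G.proj n (𝟙_ C) i i

lemma counitLin_gen {i : V} (g : G.Γ (𝟙_ C) i i) (x : TruncatedPathAlgebra k V n) :
    G.counitLin n (G.gen g x) = G.counit i g • (vertex n i * x) := by
  classical
  rw [counitLin, LinearMap.sum_apply, Finset.sum_eq_single i, gen_eq, LinearMap.comp_apply,
    proj_incl]
  · rfl
  · intro j _ h
    rw [gen_eq, LinearMap.comp_apply, G.proj_incl_ne_left n (𝟙_ C) h, _root_.map_zero]
  · simp

/-- The unit isomorphism. -/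
noncomputable def qunitIso (hn : 2 ≤ n) :
    𝟙_ (QBimodule (quiverData k V hn)) ≅ G.qbim hn (𝟙_ C) :=
  QBimodule.isoMk (M := QBimodule.unit (quiverData k V hn)) (G.qunit hn) (G.counitLin n)
    (fun x => by
      change G.counitLin n (G.unitLin n x) = x
      rw [unitLin_apply, _root_.map_sum]
      simp only [counitLin_gen, counit_unit, one_smul]
      rw [← Finset.sum_mul, sum_vertex, one_mul])
    (fun m => by
      refine LinearMap.congr_fun (f := G.unitLin n ∘ₗ G.counitLin n) (g := LinearMap.id)
        (G.hom_ext fun i j g x => ?_) m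
      rw [LinearMap.comp_apply, LinearMap.id_apply]
      by_cases h : i = j
      · subst h
        rw [counitLin_gen, _root_.map_smul, unitLin_vertex_mul, ← LinearMap.smul_apply,
          ← _root_.map_smul, counit_smul]
      · rw [G.eq_zero h g, _root_.map_zero, LinearMap.zero_apply, _root_.map_zero,
          _root_.map_zero])

/-- The multiplication isomorphism. -/
noncomputable def qmulIso (hn : 2 ≤ n) (X Y : C) :
    G.qbim hn X ⊗ G.qbim hn Y ≅ G.qbim hn (X ⊗ Y) :=
  QBimodule.isoMk (M := QBimodule.tensor (G.qbim hn X) (G.qbim hn Y)) (G.qmul hn X Y)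
    (G.comulLin n X Y) (G.comulLin_qmul hn) (G.qmul_comulLin hn)

end Connection

end BasicAction

namespace BasicAction

namespace Connection

open TruncatedPathAlgebra Bimodule

variable {C : Type w} [Category.{v} C] [Preadditive C] [MonoidalCategory C]
variable {k V : Type u} [Field k] [Linear k C] [Quiver.{u} V] [Fintype V]
  [∀ i j : V, Fintype (i ⟶ j)] (G : Connection C k V) {n : ℕ} {X Y Z : C}

lemma mapLin_leftMul {X' Y' : C} (f : X ⟶ X') (f' : Y ⟶ Y') {i l : V} (g : G.Γ X i l)
    (m : G.Carrier n Y) :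
    G.mapLin (f ⊗ₘ f') (G.leftMul g m) = G.leftMul (G.map f g) (G.mapLin f' m) := by
  refine LinearMap.congr_fun (f := G.mapLin (f ⊗ₘ f') ∘ₗ G.leftMul g)
    (g := G.leftMul (G.map f g) ∘ₗ G.mapLin f') (G.vertexAct_ext (l := l)
    (fun j h y => ?_) (fun i j h y e => ?_) (fun i j h y e => ?_)) m
  · simp [map_mul]
  · simp [G.leftMul_gen_ne e]
  · simp [G.leftMul_gen_ne e]

lemma mapLin_mulLin {X' Y' : C} (f : X ⟶ X') (f' : Y ⟶ Y') (m : G.Carrier n X)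
    (m' : G.Carrier n Y) :
    G.mapLin (f ⊗ₘ f') (G.mulLin m m') = G.mulLin (G.mapLin f m) (G.mapLin f' m') :=
  LinearMap.congr_fun (f := G.mapLin (f ⊗ₘ f') ∘ₗ G.mulLin.flip m')
    (g := G.mulLin.flip (G.mapLin f' m') ∘ₗ G.mapLin f) (G.hom_ext fun i j g x => by
      simp only [LinearMap.comp_apply, LinearMap.flip_apply, mapLin_gen, mulLin_gen,
        mapLin_leftMul, mapLin_lAct]) m

lemma mapLin_id (m : G.Carrier n X) : G.mapLin (𝟙 X) m = m :=
  LinearMap.congr_fun (f := G.mapLin (𝟙 X)) (g := LinearMap.id) (G.hom_ext fun i j g x => by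
    simp [map_id]) m

lemma leftMul_leftMul {i l j : V} (g : G.Γ X i l) (h : G.Γ Y l j) (m : G.Carrier n Z) :
    G.mapLin (α_ X Y Z).hom (G.leftMul (G.mul g h) m) = G.leftMul g (G.leftMul h m) := by
  refine LinearMap.congr_fun (f := G.mapLin (α_ X Y Z).hom ∘ₗ G.leftMul (G.mul g h))
    (g := G.leftMul g ∘ₗ G.leftMul h) (G.vertexAct_ext (l := j)
    (fun j h y => ?_) (fun i j h y e => ?_) (fun i j h y e => ?_)) m
  · simp [mul_assoc]
  · simp [G.leftMul_gen_ne e]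
  · simp [G.leftMul_gen_ne e]

lemma leftMul_mulLin {i l : V} (g : G.Γ X i l) (m : G.Carrier n Y) (m' : G.Carrier n Z) :
    G.mapLin (α_ X Y Z).hom (G.mulLin (G.leftMul g m) m') = G.leftMul g (G.mulLin m m') := by
  refine LinearMap.congr_fun
    (f := G.mapLin (α_ X Y Z).hom ∘ₗ G.mulLin.flip m' ∘ₗ G.leftMul g)
    (g := G.leftMul g ∘ₗ G.mulLin.flip m') (G.vertexAct_ext (l := l)
    (fun j h y => ?_) (fun i j h y e => ?_) (fun i j h y e => ?_)) m
  · simp only [LinearMap.comp_apply, LinearMap.flip_apply, leftMul_gen, mulLin_gen,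
      leftMul_leftMul]
  · simp [G.leftMul_gen_ne e]
  · rw [LinearMap.comp_apply, LinearMap.flip_apply, mulLin_gen, ← leftMul_vertexAct,
      G.vertexAct_leftMul_ne e, _root_.map_zero]

lemma mapLin_assoc (m : G.Carrier n X) (m' : G.Carrier n Y) (m'' : G.Carrier n Z) :
    G.mapLin (α_ X Y Z).hom (G.mulLin (G.mulLin m m') m'') = G.mulLin m (G.mulLin m' m'') :=
  LinearMap.congr_fun
    (f := G.mapLin (α_ X Y Z).hom ∘ₗ G.mulLin.flip m'' ∘ₗ G.mulLin.flip m')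
    (g := G.mulLin.flip (G.mulLin m' m'')) (G.hom_ext fun i j g x => by
      simp only [LinearMap.comp_apply, LinearMap.flip_apply, mulLin_gen, leftMul_mulLin,
        mulLin_lAct]) m

lemma mapLin_leftUnitor (a : TruncatedPathAlgebra k V n) (m : G.Carrier n X) :
    G.mapLin (λ_ X).hom (G.mulLin (G.unitLin n a) m) = G.lAct a m := by
  classical
  have : ∀ m : G.Carrier n X,
      ∑ i, G.mapLin (λ_ X).hom (G.leftMul (G.unit i) m) = m := fun m => by
    have := LinearMap.congr_fun (f := ∑ i, G.mapLin (λ_ X).hom ∘ₗ G.leftMul (G.unit i))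
      (g := LinearMap.id) (G.hom_ext fun i j g x => by
        rw [LinearMap.sum_apply, Finset.sum_eq_single i, LinearMap.comp_apply, leftMul_gen,
          mapLin_gen, unit_mul]
        · rfl
        · intro i' _ e; rw [LinearMap.comp_apply, G.leftMul_gen_ne e, _root_.map_zero]
        · simp) m
    rwa [LinearMap.sum_apply] at this
  simp only [unitLin_apply, _root_.map_sum, LinearMap.sum_apply, mulLin_gen]
  exact this _

lemma mapLin_rightUnitor (a : TruncatedPathAlgebra k V n) (m : G.Carrier n X) :
    G.mapLin (ρ_ X).hom (G.mulLin m (G.unitLin n a)) = G.rAct (op a) m := by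
  classical
  refine LinearMap.congr_fun (f := G.mapLin (ρ_ X).hom ∘ₗ G.mulLin.flip (G.unitLin n a))
    (g := G.rAct (op a)) (G.hom_ext fun i j g x => ?_) m
  rw [LinearMap.comp_apply, LinearMap.flip_apply, mulLin_gen, ← unitLin_mul, unitLin_apply,
    _root_.map_sum, Finset.sum_eq_single j, leftMul_gen, mapLin_gen, mul_unit, rAct_gen]
  · intro j' _ e; exact G.leftMul_gen_ne e.symm _ _ _
  · simp

lemma mapLin_whiskerRight {X' : C} (f : X ⟶ X') (m : G.Carrier n X) (m' : G.Carrier n Y) :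
    G.mulLin (G.mapLin f m) m' = G.mapLin (f ▷ Y) (G.mulLin m m') := by
  rw [← MonoidalCategory.tensorHom_id, mapLin_mulLin, mapLin_id]

lemma mapLin_whiskerLeft {Y' : C} (f : Y ⟶ Y') (m : G.Carrier n X) (m' : G.Carrier n Y) :
    G.mulLin m (G.mapLin f m') = G.mapLin (X ◁ f) (G.mulLin m m') := by
  rw [← MonoidalCategory.id_tensorHom, mapLin_mulLin, mapLin_id]

/-- The functor to bimodules given by a connection is monoidal. -/
noncomputable def coreMonoidal (hn : 2 ≤ n) : (G.toFunctor hn).CoreMonoidal where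
  εIso := G.qunitIso hn
  μIso := G.qmulIso hn
  μIso_hom_natural_left f _ := QBimodule.tensor_ext fun m m' => G.mapLin_whiskerRight f m m'
  μIso_hom_natural_right _ f := QBimodule.tensor_ext fun m m' => G.mapLin_whiskerLeft f m m'
  associativity _ _ _ := QBimodule.tensor_ext₃ fun m m' m'' => G.mapLin_assoc m m' m''
  left_unitality _ := QBimodule.tensor_ext fun a m => (G.mapLin_leftUnitor a m).symm
  right_unitality _ := QBimodule.tensor_ext fun m a => (G.mapLin_rightUnitor a m).symm

/-- The bimodules given by a connection are dualizable. -/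
lemma dualizable_qbim [RigidCategory C] (hn : 2 ≤ n) (X : C) :
    QBimodule.dualizable (quiverData k V hn) ((G.toFunctor hn).obj X) := by
  let := (G.coreMonoidal hn).toMonoidal
  constructor
  · let := Functor.Monoidal.mapExactPairing (G.toFunctor hn) (ᘁX) X
    exact ⟨⟨(G.toFunctor hn).obj (ᘁX)⟩⟩
  · let := Functor.Monoidal.mapExactPairing (G.toFunctor hn) X (Xᘁ)
    exact ⟨⟨(G.toFunctor hn).obj (Xᘁ)⟩⟩

/-- The basic action given by a connection. -/
noncomputable def basicAct [RigidCategory C] (hn : 2 ≤ n) : BasicAct C (quiverData k V hn) where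
  functor := (QBimodule.dualizable (quiverData k V hn)).lift (G.toFunctor hn) (G.dualizable_qbim hn)
  additive := ⟨fun {X Y f g} => ObjectProperty.hom_ext _ (G.qmap_ext hn fun i j x y => by
    change G.mapLin (f + g) (G.gen x y) = G.mapLin f (G.gen x y) + G.mapLin g (G.gen x y)
    rw [mapLin_gen, mapLin_gen, mapLin_gen, map_add, _root_.map_add, LinearMap.add_apply])⟩
  linear := ⟨fun {X Y} f c => ObjectProperty.hom_ext _ (G.qmap_ext hn fun i j x y => by
    change G.mapLin (c • f) (G.gen x y) = c • G.mapLin f (G.gen x y)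
    rw [mapLin_gen, mapLin_gen, map_smul, _root_.map_smul, LinearMap.smul_apply])⟩
  monoidal := ((G.coreMonoidal hn).lift (G.dualizable_qbim hn)).toMonoidal

variable [RigidCategory C] (hn : 2 ≤ n)

lemma basicAct_map (f : X ⟶ Y) (m : G.Carrier n X) :
    (G.basicAct hn).map f m = G.mapLin f m := rfl

lemma basicAct_mul (m : G.Carrier n X) (m' : G.Carrier n Y) :
    (G.basicAct hn).mul m m' = G.mulLin m m' := rfl

lemma basicAct_unit (a : TruncatedPathAlgebra k V n) :
    (G.basicAct hn).unit a = G.unitLin n a := rfl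

/-- The component of degree zero between two vertices. -/
noncomputable def coeff (n : ℕ) (hn : 2 ≤ n) (X : C) (i j : V) : G.Carrier n X →ₗ[k] G.Γ X i j :=
  TensorProduct.lift (LinearMap.mk₂ k
    (fun g (y : (vertexIdeal n j : Submodule k _)) =>
      vertexCoeff hn j (y : TruncatedPathAlgebra k V n) • g)
    (fun g g' y => smul_add _ _ _)
    (fun c g y => smul_comm _ _ _)
    (fun g y y' => by rw [Submodule.coe_add, _root_.map_add, add_smul])
    (fun c g y => by rw [Submodule.coe_smul, _root_.map_smul, smul_assoc])) ∘ₗ G.proj n X i j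

lemma coeff_gen {i j : V} (g : G.Γ X i j) (x : TruncatedPathAlgebra k V n) :
    G.coeff n hn X i j (G.gen g x) = vertexCoeff hn j x • g := by
  classical
  rw [gen_eq, coeff, LinearMap.comp_apply, proj_incl]
  change vertexCoeff hn j (vertex n j * x) • g = _
  rw [_root_.map_mul, vertexCoeff_vertex, if_pos rfl, one_mul]

lemma coeff_gen_ne_left {i i' j j' : V} (h : i' ≠ i) (g : G.Γ X i j)
    (x : TruncatedPathAlgebra k V n) : G.coeff n hn X i' j' (G.gen g x) = 0 := by
  rw [gen_eq, coeff, LinearMap.comp_apply, G.proj_incl_ne_left n X h, _root_.map_zero]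

lemma coeff_gen_ne_right {i i' j j' : V} (h : j' ≠ j) (g : G.Γ X i j)
    (x : TruncatedPathAlgebra k V n) : G.coeff n hn X i' j' (G.gen g x) = 0 := by
  rw [gen_eq, coeff, LinearMap.comp_apply, G.proj_incl_ne_right n X h, _root_.map_zero]

lemma gen_coeff (i j : V) (m : G.Carrier n X) :
    G.gen (G.coeff n hn X i j m) 1 = G.vertexAct i (G.rAct (op (vertex n j))
      (G.onRight (quiverData k V hn).p m)) := by
  refine LinearMap.congr_fun (f := (G.gen : G.Γ X i j →ₗ[k] _).flip 1 ∘ₗ G.coeff n hn X i j)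
    (g := G.vertexAct i ∘ₗ G.rAct (op (vertex n j)) ∘ₗ G.onRight (quiverData k V hn).p)
    (G.hom_ext fun i' j' g x => ?_) m
  simp only [LinearMap.comp_apply, LinearMap.flip_apply, onRight_p_gen, rAct_gen]
  by_cases hi : i = i'
  · subst hi
    rw [vertexAct_gen, eq_smul_of_p hn (QuiverData.p_p _ x)]
    by_cases hj : j = j'
    · subst hj
      have h1 : vertexCoeff hn j ((quiverData k V hn).p x) = vertexCoeff hn j x := by
        have := vertexCoeff_rad hn j ((quiverData k V hn).sub_p_mem x)
        rw [_root_.map_sub, sub_eq_zero] at this; exact this.symm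
      rw [coeff_gen, h1, _root_.map_smul, LinearMap.smul_apply, _root_.map_smul,
        ← G.gen_vertex_mul g 1, mul_one]
    · rw [G.coeff_gen_ne_right hn hj, _root_.map_zero, LinearMap.zero_apply, _root_.map_smul,
        ← mul_one (vertex n j), G.gen_vertex_mul_ne (Ne.symm hj), smul_zero]
  · rw [G.coeff_gen_ne_left hn hi, G.vertexAct_gen_ne hi, _root_.map_zero, LinearMap.zero_apply]

lemma gen_one_mem {i j : V} (g : G.Γ X i j) :
    (G.gen g 1 : G.Carrier n X) ∈ (G.basicAct hn).edges X i j := by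
  refine QBimodule.mem_corner.2 ⟨?_, ?_, ?_⟩
  · change G.onRight (quiverData k V hn).p (G.gen g 1) = G.gen g 1
    rw [onRight_p_gen, QuiverData.p_one]
  · change G.lAct (vertex n i) (G.gen g 1) = G.gen g 1
    rw [lAct_vertex, vertexAct_gen]
  · change G.rAct (op (vertex n j)) (G.gen g 1) = G.gen g 1
    rw [rAct_gen, one_mul, ← G.gen_vertex_mul g 1, mul_one]

lemma gen_coeff_of_mem {i j : V} {m : G.Carrier n X}
    (hm : m ∈ (G.qbim hn X).corner (vertex n i) (vertex n j)) :
    G.gen (G.coeff n hn X i j m) 1 = m := by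
  obtain ⟨h1, h2, h3⟩ := QBimodule.mem_corner.1 hm
  have h1' : G.onRight (quiverData k V hn).p m = m := h1
  have h2' : G.lAct (vertex n i) m = m := h2
  have h3' : G.rAct (op (vertex n j)) m = m := h3
  rw [G.gen_coeff hn, h1', h3', ← lAct_vertex, h2']

/-- The edges of the bimodule given by a connection. -/
noncomputable def cornerEquiv (X : C) (i j : V) :
    (G.qbim hn X).corner (vertex n i) (vertex n j) ≃ₗ[k] G.Γ X i j :=
  LinearEquiv.ofBijective ((G.coeff n hn X i j).domRestrict
      ((G.qbim hn X).corner (vertex n i) (vertex n j)))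
    ⟨fun m m' h => Subtype.ext (by
      rw [← G.gen_coeff_of_mem hn m.2, ← G.gen_coeff_of_mem hn m'.2]
      exact congrArg (fun g => G.gen g 1) h),
    fun g => ⟨⟨G.gen g 1, G.gen_one_mem hn g⟩, by
      change G.coeff n hn X i j (G.gen g 1) = g
      rw [coeff_gen, map_one, one_smul]⟩⟩

lemma gen_cornerEquiv {i j : V} (m : (G.qbim hn X).corner (vertex n i) (vertex n j)) :
    G.gen (G.cornerEquiv hn X i j m) 1 = m.1 := G.gen_coeff_of_mem hn m.2

/-- The edges of the basic action given by a connection. -/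
noncomputable def edgesEquiv (X : C) (i j : V) :
    (G.basicAct hn).edges X i j ≃ₗ[k] G.Γ X i j := G.cornerEquiv hn X i j

lemma gen_edgesEquiv {i j : V} (m : (G.basicAct hn).edges X i j) :
    G.gen (G.edgesEquiv hn X i j m) 1 = m.1 :=
  G.gen_cornerEquiv hn m

lemma edgesEquiv_eq {i j : V} {m : (G.basicAct hn).edges X i j} {g : G.Γ X i j}
    (h : m.1 = G.gen g 1) : G.edgesEquiv hn X i j m = g := by
  have h1 := (G.gen_edgesEquiv hn m).trans h
  have h2 := congrArg (G.coeff n hn X i j) h1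
  rwa [coeff_gen, coeff_gen, map_one, one_smul, one_smul] at h2

end Connection

open TruncatedPathAlgebra in
/-- The relation between a basic action on a truncated path algebra and a connection: the edges of
the basic action form the given connection. -/
structure Models {C : Type w} [Category.{v} C] [Preadditive C] [MonoidalCategory C]
    {k V : Type u} [Field k] [Linear k C] [Quiver.{u} V] [Fintype V]
    [∀ i j : V, Fintype (i ⟶ j)] {n : ℕ} {hn : 2 ≤ n} (Φ : BasicAct C (quiverData k V hn))
    (G : Connection C k V) where
  θ : ∀ (X : C) (i j : V), Φ.edges X i j ≃ₗ[k] G.Γ X i j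
  natural : ∀ {X Y : C} (f : X ⟶ Y) (i j : V) (m : Φ.edges X i j) (m' : Φ.edges Y i j),
    (m' : (Φ.bim Y).carrier) = Φ.map f m → θ Y i j m' = G.map f (θ X i j m)
  mul : ∀ (X Y : C) (i l j : V) (m : Φ.edges X i l) (m' : Φ.edges Y l j)
    (t : Φ.edges (X ⊗ Y) i j), (t : (Φ.bim (X ⊗ Y)).carrier) = Φ.mul m.1 m'.1 →
    θ (X ⊗ Y) i j t = G.mul (θ X i l m) (θ Y l j m')
  unit : ∀ (i : V) (t : Φ.edges (𝟙_ C) i i),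
    (t : (Φ.bim (𝟙_ C)).carrier) = Φ.unit (vertex n i) → θ (𝟙_ C) i i t = G.unit i
  swap : ∀ (X : C) (i l j : V) (a : i ⟶ l) (m : Φ.edges X l j)
    (m' : ∀ h : V, (h ⟶ j) → Φ.edges X i h),
    (Φ.bim X).l (arrow n a) m = ∑ h, ∑ b : h ⟶ j, (Φ.bim X).r (op (arrow n b)) (m' h b) →
    ∀ h b, θ X i h (m' h b) = G.swap a b (θ X l j m)

namespace Connection

open TruncatedPathAlgebra

variable {C : Type w} [Category.{v} C] [Preadditive C] [MonoidalCategory C]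
variable {k V : Type u} [Field k] [Linear k C] [Quiver.{u} V] [Fintype V]
  [∀ i j : V, Fintype (i ⟶ j)] (G : Connection C k V) {n : ℕ} [RigidCategory C] (hn : 2 ≤ n)

/-- The basic action given by a connection. -/
noncomputable def models : Models (G.basicAct hn) G where
  θ := G.edgesEquiv hn
  natural f i j m m' h := by
    apply G.edgesEquiv_eq
    rw [h, ← gen_edgesEquiv, basicAct_map, mapLin_gen]
  mul X Y i l j m m' t h := by
    apply G.edgesEquiv_eq
    rw [h, ← gen_edgesEquiv, ← gen_edgesEquiv, basicAct_mul, mulLin_gen, map_one,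
      Module.End.one_apply, leftMul_gen]
  unit i t h := by
    apply G.edgesEquiv_eq
    rw [h, basicAct_unit, ← mul_one (vertex n i), unitLin_vertex_mul]
  swap X i l j a m m' h := by
    have h2 := (G.basicAct hn).expansion_unique (x := m')
      (y := fun h b => ⟨_, G.gen_one_mem hn (G.swap a b (G.edgesEquiv hn X l j m))⟩) (by
        rw [← h, ← gen_edgesEquiv]
        refine (G.lAct_arrow_gen a _ 1).trans ?_
        refine Finset.sum_congr rfl fun h _ => Finset.sum_congr rfl fun b _ => ?_
        refine Eq.trans ?_ (G.rAct_gen _ 1 (arrow n b)).symm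
        rw [mul_one, one_mul])
    intro h b
    apply G.edgesEquiv_eq
    rw [h2]

end Connection

end BasicAction

namespace BasicAction

/-- A family of objects of a linear category with the properties of a complete irredundant family
of simple objects of a split semisimple category. -/
structure Skeleton (k : Type u) [Field k] {V : Type u} [Fintype V] {𝒟 : Type*} [Category.{u} 𝒟]
    [Preadditive 𝒟] [Linear k 𝒟] (S : V → 𝒟) where
  hom_eq_zero : ∀ {i j : V}, i ≠ j → ∀ f : S i ⟶ S j, f = 0
  sc : ∀ {i : V}, (S i ⟶ S i) →ₗ[k] k
  sc_id : ∀ i : V, sc (𝟙 (S i)) = 1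
  eq_smul : ∀ {i : V} (f : S i ⟶ S i), f = sc f • 𝟙 (S i)
  I : 𝒟 → V → Type
  [fintype : ∀ W l, Fintype (I W l)]
  inn : ∀ (W : 𝒟) (l : V), I W l → (S l ⟶ W)
  out : ∀ (W : 𝒟) (l : V), I W l → (W ⟶ S l)
  sum_out_inn : ∀ W : 𝒟, ∑ l, ∑ e, out W l e ≫ inn W l e = 𝟙 W

namespace Skeleton

attribute [instance] fintype

variable {k : Type u} [Field k] {V : Type u} [Fintype V] {𝒟 : Type*} [Category.{u} 𝒟]
  [Preadditive 𝒟] [Linear k 𝒟] {S : V → 𝒟} (sk : Skeleton k S)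

lemma comp_eq_smul {i : V} (f : S i ⟶ S i) {Z : 𝒟} (g : S i ⟶ Z) : f ≫ g = sk.sc f • g := by
  conv_lhs => rw [sk.eq_smul f]
  rw [Linear.smul_comp, Category.id_comp]

lemma sum_comp_eq {W : 𝒟} {i : V} (g : S i ⟶ W) {A : Type*} [AddCommMonoid A]
    (κ : ∀ l, sk.I W l → (S i ⟶ S l) → A)
    (hκ : ∀ l e, κ l e 0 = 0) :
    ∑ l, ∑ e, κ l e (g ≫ sk.out W l e) = ∑ e, κ i e (g ≫ sk.out W i e) := by
  refine Finset.sum_eq_single i (fun l _ hl => Finset.sum_eq_zero fun e _ => ?_) (by simp)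
  rw [sk.hom_eq_zero hl.symm (g ≫ sk.out W l e), hκ]

lemma sum_comp_inn {W : 𝒟} {i : V} (g : S i ⟶ W) :
    ∑ e, sk.sc (g ≫ sk.out W i e) • sk.inn W i e = g := by
  have h := congrArg (g ≫ ·) (sk.sum_out_inn W)
  simp only [Preadditive.comp_sum, Category.comp_id, ← Category.assoc] at h
  rw [sk.sum_comp_eq g (fun l e f => f ≫ sk.inn W l e)
    (fun _ _ => Limits.zero_comp)] at h
  simpa only [sk.comp_eq_smul] using h

lemma hom_ext (sk : Skeleton k S) {W Z : 𝒟} {s t : W ⟶ Z} (h : ∀ i (g : S i ⟶ W), g ≫ s = g ≫ t) : s = t := by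
  rw [← Category.id_comp s, ← Category.id_comp t, ← sk.sum_out_inn]
  simp only [Preadditive.sum_comp, Category.assoc, h]

/-- The morphism with given values on the morphisms from simple objects. -/
def desc {W Z : 𝒟} (κ : ∀ i, (S i ⟶ W) →ₗ[k] (S i ⟶ Z)) : W ⟶ Z :=
  ∑ l, ∑ e, sk.out W l e ≫ κ l (sk.inn W l e)

lemma comp_desc {W Z : 𝒟} (κ : ∀ i, (S i ⟶ W) →ₗ[k] (S i ⟶ Z)) {i : V} (g : S i ⟶ W) :
    g ≫ sk.desc κ = κ i g := by
  simp only [desc, Preadditive.comp_sum, ← Category.assoc]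
  rw [sk.sum_comp_eq g (fun l e f => f ≫ κ l (sk.inn W l e))
    (fun _ _ => Limits.zero_comp)]
  conv_rhs => rw [← sk.sum_comp_inn g]
  simp only [sk.comp_eq_smul, map_sum, map_smul]

section Dual

variable {W : 𝒟} {ι : V → Type*} (b : ∀ h, Module.Basis (ι h) k (S h ⟶ W))

/-- The projections dual to bases of the spaces of morphisms from the simple objects. -/
noncomputable def dual (h : V) (x : ι h) : W ⟶ S h :=
  ∑ e, (b h).coord x (sk.inn W h e) • sk.out W h e

lemma comp_dual_ne {i h : V} (hi : i ≠ h) (g : S i ⟶ W) (x : ι h) : g ≫ sk.dual b h x = 0 :=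
  sk.hom_eq_zero hi _

lemma comp_dual {h : V} (g : S h ⟶ W) (x : ι h) :
    g ≫ sk.dual b h x = (b h).coord x g • 𝟙 (S h) := by
  conv_rhs => rw [← sk.sum_comp_inn g]
  simp only [dual, Preadditive.comp_sum, Linear.comp_smul, map_sum, map_smul, Finset.sum_smul,
    smul_eq_mul, mul_comm (sk.sc _), mul_smul, ← sk.eq_smul]

lemma sum_dual [∀ h, Fintype (ι h)] : ∑ h, ∑ x, sk.dual b h x ≫ b h x = 𝟙 W := by
  refine sk.hom_ext fun i g => ?_
  simp only [Preadditive.comp_sum, ← Category.assoc]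
  rw [Finset.sum_eq_single i, Category.comp_id]
  · conv_rhs => rw [← (b i).sum_repr g]
    exact Finset.sum_congr rfl fun x _ => by
      rw [sk.comp_dual, Linear.smul_comp, Category.id_comp, Module.Basis.coord_apply]
  · intro l _ hl
    refine Finset.sum_eq_zero fun e _ => ?_
    rw [sk.comp_dual_ne b hl.symm, Limits.zero_comp]
  · simp

end Dual

section Lift

variable {ℰ : Type*} [Category.{u} ℰ] [Preadditive ℰ] [Linear k ℰ] {S' : V → ℰ}
  (sk' : Skeleton k S') {P : 𝒟 ⥤ ℰ} [P.Additive] [P.Linear k]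

lemma sum_map_comp {l : V} {W : 𝒟} (v : S' l ⟶ P.obj W) :
    ∑ j, ∑ e, v ≫ P.map (sk.out W j e) ≫ P.map (sk.inn W j e) = v := by
  have h := congrArg (v ≫ ·) (congrArg P.map (sk.sum_out_inn W))
  simpa only [P.map_sum, P.map_comp, P.map_id, Preadditive.comp_sum, Category.comp_id] using h

section

variable {Γ : V → V → Type*} [∀ i j, AddCommGroup (Γ i j)] [∀ i j, Module k (Γ i j)]
  (θ : ∀ i j, Γ i j ≃ₗ[k] (S' i ⟶ P.obj (S j)))

/-- A linear map on `Hom(S' l, P W)` given by its values on the products of elements of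
`Hom(S' l, P (S j))` and of `Hom(S j, W)`. -/
noncomputable def homLift {W : 𝒟} {A : Type*} [AddCommGroup A] [Module k A] {l : V}
    (κ : ∀ j, Γ l j →ₗ[k] (S j ⟶ W) →ₗ[k] A) : (S' l ⟶ P.obj W) →ₗ[k] A :=
  ∑ j, ∑ e, (κ j).flip (sk.inn W j e) ∘ₗ (θ l j).symm.toLinearMap ∘ₗ
    Linear.rightComp k (S' l) (P.map (sk.out W j e))

lemma homLift_apply {W : 𝒟} {A : Type*} [AddCommGroup A] [Module k A] {l : V}
    (κ : ∀ j, Γ l j →ₗ[k] (S j ⟶ W) →ₗ[k] A) {j : V} (g : Γ l j) (u : S j ⟶ W) :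
    sk.homLift θ κ (θ l j g ≫ P.map u) = κ j g u := by
  simp only [homLift, LinearMap.sum_apply, LinearMap.comp_apply, Linear.rightComp_apply,
    LinearMap.flip_apply, LinearEquiv.coe_coe, Category.assoc, ← P.map_comp]
  rw [sk.sum_comp_eq u (fun j' e f =>
    κ j' ((θ l j').symm (θ l j g ≫ P.map f)) (sk.inn W j' e)) (by simp)]
  conv_rhs => rw [← sk.sum_comp_inn u]
  rw [map_sum]
  refine Finset.sum_congr rfl fun e _ => ?_
  conv_lhs => rw [sk.eq_smul (u ≫ sk.out W j e)]
  rw [P.map_smul, P.map_id, Linear.comp_smul, Category.comp_id, map_smul,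
    LinearEquiv.symm_apply_apply, map_smul, map_smul, LinearMap.smul_apply]

/-- The morphism from `P W` given by its values on the products of elements of
`Hom(S' i, P (S j))` and of `Hom(S j, W)`. -/
noncomputable def lift {W : 𝒟} {Z : ℰ} (κ : ∀ i j, Γ i j →ₗ[k] (S j ⟶ W) →ₗ[k] (S' i ⟶ Z)) :
    P.obj W ⟶ Z :=
  sk'.desc fun i => sk.homLift θ (κ i)

lemma comp_lift {W : 𝒟} {Z : ℰ} (κ : ∀ i j, Γ i j →ₗ[k] (S j ⟶ W) →ₗ[k] (S' i ⟶ Z)) {i j : V}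
    (g : Γ i j) (u : S j ⟶ W) : θ i j g ≫ P.map u ≫ sk.lift sk' θ κ = κ i j g u := by
  rw [lift, ← Category.assoc, sk'.comp_desc, sk.homLift_apply]

end

lemma map_hom_ext (sk : Skeleton k S) (sk' : Skeleton k S') {Γ : V → V → Type*} (θ : ∀ i j, Γ i j ≃ (S' i ⟶ P.obj (S j)))
    {W : 𝒟} {Z : ℰ} {s t : P.obj W ⟶ Z}
    (h : ∀ i j (g : Γ i j) (u : S j ⟶ W), θ i j g ≫ P.map u ≫ s = θ i j g ≫ P.map u ≫ t) :
    s = t := by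
  refine sk'.hom_ext fun i v => ?_
  rw [← sk.sum_map_comp v]
  simp only [Preadditive.sum_comp, Category.assoc]
  refine Finset.sum_congr rfl fun j _ => Finset.sum_congr rfl fun e _ => ?_
  have := h i j ((θ i j).symm (v ≫ P.map (sk.out W j e))) (sk.inn W j e)
  simpa only [Equiv.apply_symm_apply, Category.assoc] using this

end Lift

end Skeleton

end BasicAction

namespace BasicAction

namespace Vec

variable {k V : Type u} [Field k]

/-- The linear maps between the fibres given by a morphism. -/
def lin {U W : Vec k V} (f : U ⟶ W) (v : V) : U.obj ⟨v⟩ →ₗ[k] W.obj ⟨v⟩ := (f.app ⟨v⟩).hom.hom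

/-- The morphism with given maps between the fibres. -/
def homMk {U W : Vec k V} (f : ∀ v, U.obj ⟨v⟩ →ₗ[k] W.obj ⟨v⟩) : U ⟶ W :=
  Discrete.natTrans fun v => FGModuleCat.ofHom (f v.as)

@[simp] lemma lin_homMk {U W : Vec k V} (f : ∀ v, U.obj ⟨v⟩ →ₗ[k] W.obj ⟨v⟩) (v : V) :
    lin (homMk f) v = f v := rfl

lemma hom_ext {U W : Vec k V} {f g : U ⟶ W} (h : ∀ v x, lin f v x = lin g v x) : f = g :=
  NatTrans.ext (funext fun v => FGModuleCat.hom_ext (LinearMap.ext (h v.as)))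

@[simp] lemma lin_comp {U W Z : Vec k V} (f : U ⟶ W) (g : W ⟶ Z) (v : V) :
    lin (f ≫ g) v = lin g v ∘ₗ lin f v := rfl

@[simp] lemma lin_id (U : Vec k V) (v : V) : lin (𝟙 U) v = LinearMap.id := rfl

@[simp] lemma lin_add {U W : Vec k V} (f g : U ⟶ W) (v : V) :
    lin (f + g) v = lin f v + lin g v := rfl

@[simp] lemma lin_zero {U W : Vec k V} (v : V) : lin (0 : U ⟶ W) v = 0 := rfl

@[simp] lemma lin_smul {U W : Vec k V} (c : k) (f : U ⟶ W) (v : V) :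
    lin (c • f) v = c • lin f v := rfl

/-- The fibre at a vertex, as a linear function of morphisms. -/
def linₗ (U W : Vec k V) (v : V) : (U ⟶ W) →ₗ[k] (U.obj ⟨v⟩ →ₗ[k] W.obj ⟨v⟩) where
  toFun f := lin f v
  map_add' _ _ := rfl
  map_smul' _ _ := rfl

@[simp] lemma lin_sum {ι : Type*} (s : Finset ι) {U W : Vec k V} (f : ι → (U ⟶ W)) (v : V) :
    lin (∑ i ∈ s, f i) v = ∑ i ∈ s, lin (f i) v := map_sum (linₗ U W v) f s

/-- The identification of two fibres at equal vertices. -/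
def cast (W : Vec k V) {i j : V} (h : i = j) : W.obj ⟨i⟩ →ₗ[k] W.obj ⟨j⟩ := by
  subst h; exact LinearMap.id

@[simp] lemma cast_rfl (W : Vec k V) {i : V} (h : i = i) : W.cast h = LinearMap.id := rfl

open Classical in
/-- The linear map from a fibre of a simple object given by an element of a fibre. -/
noncomputable def elemLin {W : Vec k V} {i : V} (w : W.obj ⟨i⟩) (j : V) :
    (PLift (i = j) → k) →ₗ[k] W.obj ⟨j⟩ :=
  ∑ p : PLift (i = j), (LinearMap.proj p : (PLift (i = j) → k) →ₗ[k] k).smulRight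
    (W.cast p.down w)

open Classical in
lemma elemLin_one {W : Vec k V} {i : V} (w : W.obj ⟨i⟩) : elemLin w i (fun _ => 1) = w := by
  rw [elemLin, LinearMap.sum_apply, Fintype.sum_subsingleton _ ⟨rfl⟩]
  exact one_smul k w

/-- The morphism from a simple object given by an element of a fibre. -/
noncomputable def ofElem {W : Vec k V} {i : V} (w : W.obj ⟨i⟩) : simple i ⟶ W :=
  homMk fun j => elemLin w j

/-- The morphism to a simple object given by a linear form on a fibre. -/
def ofForm {W : Vec k V} {i : V} (f : W.obj ⟨i⟩ →ₗ[k] k) : W ⟶ simple i :=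
  homMk fun j => LinearMap.pi fun p : PLift (i = j) => f ∘ₗ W.cast p.down.symm

/-- The generator of the fibre of a simple object. -/
def one (i : V) : (simple (k := k) i).obj ⟨i⟩ := fun _ => 1

lemma eq_smul_one {i : V} (x : (simple (k := k) i).obj ⟨i⟩) :
    x = (show PLift (i = i) → k from x) ⟨rfl⟩ • one i := by
  funext p
  exact (mul_one _).symm

lemma eq_zero_of_ne {i j : V} (h : i ≠ j) (x : (simple (k := k) i).obj ⟨j⟩) : x = 0 := by
  funext p
  exact absurd p.down h

@[simp] lemma lin_ofElem_one {W : Vec k V} {i : V} (w : W.obj ⟨i⟩) :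
    lin (ofElem w) i (one i) = w := elemLin_one w

lemma simple_hom_ext {W : Vec k V} {i : V} {f g : simple i ⟶ W}
    (h : lin f i (one i) = lin g i (one i)) : f = g := by
  refine hom_ext fun j x => ?_
  by_cases hj : i = j
  · subst hj
    rw [eq_smul_one x, map_smul, map_smul, h]
  · rw [eq_zero_of_ne hj x, map_zero, map_zero]

/-- The morphisms from a simple object are the elements of a fibre. -/
noncomputable def elemEquiv (W : Vec k V) (i : V) : W.obj ⟨i⟩ ≃ₗ[k] (simple i ⟶ W) where
  toFun := ofElem
  map_add' x y := simple_hom_ext (by simp)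
  map_smul' c x := simple_hom_ext (by simp)
  invFun f := lin f i (one i)
  left_inv w := lin_ofElem_one w
  right_inv f := simple_hom_ext (by simp)

lemma lin_ofForm_self {W : Vec k V} {i : V} (f : W.obj ⟨i⟩ →ₗ[k] k) (w : W.obj ⟨i⟩) :
    lin (ofForm f) i w = f w • one i := by
  funext p
  exact (mul_one _).symm

/-- The simple objects of `Vec(V)`. -/
noncomputable def skeleton [Fintype V] : Skeleton k (simple : V → Vec k V) where
  hom_eq_zero h f := simple_hom_ext (by
    rw [eq_zero_of_ne h.symm (lin f _ _), lin_zero, LinearMap.zero_apply])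
  sc {i} := (LinearMap.proj (R := k) (φ := fun _ : PLift (i = i) => k) ⟨rfl⟩) ∘ₗ
    (elemEquiv (simple i) i).symm.toLinearMap
  sc_id i := rfl
  eq_smul f := simple_hom_ext (eq_smul_one _)
  I W l := Fin (Module.finrank k (W.obj ⟨l⟩))
  inn W l e := ofElem (Module.finBasis k (W.obj ⟨l⟩) e)
  out W l e := ofForm ((Module.finBasis k (W.obj ⟨l⟩)).coord e)
  sum_out_inn W := hom_ext fun v x => by
    simp only [lin_sum, LinearMap.sum_apply, lin_comp, LinearMap.comp_apply]
    rw [Finset.sum_eq_single v]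
    · simp only [lin_ofForm_self, map_smul, lin_ofElem_one, Module.Basis.coord_apply,
        Module.Basis.sum_repr, lin_id, LinearMap.id_apply]
    · intro l _ hl
      refine Finset.sum_eq_zero fun e _ => ?_
      rw [eq_zero_of_ne hl (lin _ v x), map_zero]
    · simp

end Vec

namespace ModStr

open MonoidalLeftAction

variable {C : Type w} [Category.{v} C] [Preadditive C] [MonoidalCategory C]
variable {k V : Type u} [Field k] [Linear k C] (M : ModStr C k V)

/-- The simple objects of a module category structure on `Vec(V)`. -/
noncomputable def skeleton [Fintype V] : Skeleton k M.simple := Vec.skeleton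

/-- The functor by which an object acts on a module category. -/
def act (X : C) : M.Cat ⥤ M.Cat where
  obj W := X ⊙ₗ W
  map f := X ⊴ₗ f

instance (X : C) : (M.act X).Additive := ⟨fun {_ _ f g} => M.actionHomRight_add X f g⟩

instance (X : C) : (M.act X).Linear k := ⟨fun f c => M.actionHomRight_smul X c f⟩

/-- The action on a morphism, as a linear map. -/
def actRight (X : C) (U W : M.Cat) : (U ⟶ W) →ₗ[k] (X ⊙ₗ U ⟶ X ⊙ₗ W) := (M.act X).mapLinearMap k

@[simp] lemma actRight_apply (X : C) {U W : M.Cat} (f : U ⟶ W) : M.actRight X U W f = X ⊴ₗ f := rfl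

end ModStr

end BasicAction

namespace BasicAction

open MonoidalLeftAction Functor.LaxLeftLinear Functor.OplaxLeftLinear TruncatedPathAlgebra

variable {C : Type w} [Category.{v} C] [Preadditive C] [MonoidalCategory C]
variable {k V : Type u} [Field k] [Linear k C] [Quiver.{u} V] [Fintype V]
  [∀ i j : V, Fintype (i ⟶ j)] {n : ℕ} {hn : 2 ≤ n}

/-- The relation between a basic action and an object of the dual category, with respect to a
labelling `S` of simple objects by the vertices and morphisms `b` labelled by the arrows. -/
structure Rlz (Φ : BasicAct C (quiverData k V hn)) {M : ModStr C k V} (F : Dual M)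
    (S : V → M.Cat) (b : ∀ i j : V, (i ⟶ j) → (S i ⟶ F.functor.obj (S j))) where
  θ : ∀ (X : C) (i j : V), Φ.edges X i j ≃ₗ[k] (S i ⟶ X ⊙ₗ S j)
  natural : ∀ {X Y : C} (f : X ⟶ Y) (i j : V) (m : Φ.edges X i j) (m' : Φ.edges Y i j),
    (m' : (Φ.bim Y).carrier) = Φ.map f m → θ Y i j m' = θ X i j m ≫ f ⊵ₗ S j
  mul : ∀ (X Y : C) (i l j : V) (m : Φ.edges X i l) (m' : Φ.edges Y l j)
    (t : Φ.edges (X ⊗ Y) i j), (t : (Φ.bim (X ⊗ Y)).carrier) = Φ.mul m.1 m'.1 →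
    θ (X ⊗ Y) i j t = θ X i l m ≫ X ⊴ₗ θ Y l j m' ≫ (αₗ X Y (S j)).inv
  unit : ∀ (i : V) (t : Φ.edges (𝟙_ C) i i),
    (t : (Φ.bim (𝟙_ C)).carrier) = Φ.unit (vertex n i) → θ (𝟙_ C) i i t = (λₗ (S i)).inv
  arrows : ∀ (X : C) (i l j : V) (a : i ⟶ l) (m : Φ.edges X l j)
    (m' : ∀ h : V, (h ⟶ j) → Φ.edges X i h),
    (Φ.bim X).l (arrow n a) m = ∑ h, ∑ b : h ⟶ j, (Φ.bim X).r (op (arrow n b)) (m' h b) →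
    b i l a ≫ F.functor.map (θ X l j m) ≫ δₗ F.functor X (S j) =
      ∑ h, ∑ c : h ⟶ j, θ X i h (m' h c) ≫ X ⊴ₗ b h j c

/-- A realization of a framed pair, in terms of its simple objects and basis. -/
def Realization.rlz {Φ : BasicAct C (quiverData k V hn)} {x : FramedPair C k V}
    (R : Realization Φ x) : Rlz Φ x.F x.M.simple fun i j a => x.basis i j a where
  __ := R

/-- A realization of a framed pair from its simple objects and basis. -/
def Rlz.realization {Φ : BasicAct C (quiverData k V hn)} {x : FramedPair C k V}
    (R : Rlz Φ x.F x.M.simple fun i j a => x.basis i j a) : Realization Φ x where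
  __ := R

namespace Rlz

variable {Φ Φ' : BasicAct C (quiverData k V hn)} {M : ModStr C k V} {F : Dual M}
  {S S' : V → M.Cat}

section ChangeSimple

variable {b : ∀ i j : V, (i ⟶ j) → (S i ⟶ F.functor.obj (S j))} (R : Rlz Φ F S b)

/-- The transport of a realization along isomorphisms of the simple objects. -/
noncomputable def changeSimple (ψ : ∀ i, S i ≅ S' i) :
    Rlz Φ F S' fun i j a => (ψ i).inv ≫ b i j a ≫ F.functor.map (ψ j).hom where
  θ X i j := R.θ X i j ≪≫ₗ Linear.homCongr k (ψ i) ((M.act X).mapIso (ψ j))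
  natural f i j m m' h := by
    change (ψ i).inv ≫ (R.θ _ i j m') ≫ _ ⊴ₗ (ψ j).hom =
      ((ψ i).inv ≫ R.θ _ i j m ≫ _ ⊴ₗ (ψ j).hom) ≫ f ⊵ₗ S' j
    rw [R.natural f i j m m' h]
    simp only [Category.assoc, action_exchange]
  mul X Y i l j m m' t h := by
    change (ψ i).inv ≫ (R.θ _ i j t) ≫ _ ⊴ₗ (ψ j).hom =
      ((ψ i).inv ≫ R.θ _ i l m ≫ _ ⊴ₗ (ψ l).hom) ≫
        X ⊴ₗ ((ψ l).inv ≫ R.θ _ l j m' ≫ _ ⊴ₗ (ψ j).hom) ≫ _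
    rw [R.mul X Y i l j m m' t h]
    simp
  unit i t h := by
    change (ψ i).inv ≫ (R.θ _ i i t) ≫ _ ⊴ₗ (ψ i).hom = _
    rw [R.unit i t h]
    simp
  arrows X i l j a m m' h := by
    change ((ψ i).inv ≫ b i l a ≫ F.functor.map (ψ l).hom) ≫
      F.functor.map ((ψ l).inv ≫ R.θ _ l j m ≫ _ ⊴ₗ (ψ j).hom) ≫ _ = ∑ h, ∑ c : h ⟶ j,
        ((ψ i).inv ≫ R.θ _ i h (m' h c) ≫ _ ⊴ₗ (ψ h).hom) ≫
          X ⊴ₗ ((ψ h).inv ≫ b h j c ≫ F.functor.map (ψ j).hom)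
    have := congrArg (fun z => (ψ i).inv ≫ z ≫ X ⊴ₗ F.functor.map (ψ j).hom)
      (R.arrows X i l j a m m' h)
    simpa [Preadditive.sum_comp, Preadditive.comp_sum] using this

end ChangeSimple

variable {b' : ∀ i j : V, Module.Basis (i ⟶ j) k (S' i ⟶ F.functor.obj (S' j))}

/-- A combination of products with basis vectors determines the coefficients. -/
lemma eq_of_sum_eq (sk : Skeleton k S') (τ : V ≃ V) {W : M.Cat} {X : C} {j : V}
    {g g' : ∀ h, (τ h ⟶ j) → (W ⟶ X ⊙ₗ S' (τ h))}
    (h : ∑ h, ∑ c : τ h ⟶ j, g h c ≫ X ⊴ₗ b' (τ h) j c =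
      ∑ h, ∑ c : τ h ⟶ j, g' h c ≫ X ⊴ₗ b' (τ h) j c) : g = g' := by
  classical
  have key : ∀ (g : ∀ h, (τ h ⟶ j) → (W ⟶ X ⊙ₗ S' (τ h))) (h : V) (c : τ h ⟶ j),
      (∑ h, ∑ c : τ h ⟶ j, g h c ≫ X ⊴ₗ b' (τ h) j c) ≫
        X ⊴ₗ sk.dual (fun h => b' h j) (τ h) c = g h c := by
    intro g h c
    simp only [Preadditive.sum_comp, Category.assoc, ← actionHomRight_comp]
    rw [Finset.sum_eq_single h, Finset.sum_eq_single c]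
    · rw [sk.comp_dual, Module.Basis.coord_apply, Module.Basis.repr_self, Finsupp.single_eq_same,
        one_smul, actionHomRight_id, Category.comp_id]
    · intro c' _ hc
      rw [sk.comp_dual, Module.Basis.coord_apply, Module.Basis.repr_self,
        Finsupp.single_eq_of_ne' hc, zero_smul, ← ModStr.actRight_apply, map_zero,
        Limits.comp_zero]
    · simp
    · intro h' _ hh
      refine Finset.sum_eq_zero fun c' _ => ?_
      rw [sk.comp_dual_ne _ (τ.injective.ne hh), ← ModStr.actRight_apply, map_zero,
        Limits.comp_zero]
    · simp
  funext h' c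
  rw [← key g h' c, ← key g' h' c, h]

section CornerTwist

variable {τ : V ≃ V} {t : (quiverData k V hn).Aut}
  {b : ∀ i j : V, (i ⟶ j) → (S' (τ i) ⟶ F.functor.obj (S' (τ j)))}
  (R : Rlz Φ F (fun i => S' (τ i)) b) (R' : Rlz Φ' F S' fun i j a => b' i j a)

/-- The comparison of the edges of two basic actions that are realized by the same object. -/
noncomputable def compare (X : C) (i j : V) : Φ.edges X i j ≃ₗ[k] Φ'.edges X (τ i) (τ j) :=
  R.θ X i j ≪≫ₗ (R'.θ X (τ i) (τ j)).symm

lemma θ_compare {X : C} {i j : V} (m : Φ.edges X i j) :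
    R'.θ X (τ i) (τ j) (R.compare R' X i j m) = R.θ X i j m :=
  (R'.θ X (τ i) (τ j)).apply_symm_apply _

lemma compare_eq {X : C} {i j : V} {m : Φ.edges X i j} {m' : Φ'.edges X (τ i) (τ j)}
    (h : R'.θ X (τ i) (τ j) m' = R.θ X i j m) : R.compare R' X i j m = m' :=
  (R'.θ X (τ i) (τ j)).injective (by rw [θ_compare, h])

/-- Two basic actions that are realized by the same object, with bases related by an automorphism
of the path algebra, are isomorphic up to the automorphism. -/
noncomputable def cornerTwist (sk : Skeleton k S')
    (ht : ∀ v, t.τ (vertex n v) = vertex n (τ v))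
    (c : ∀ {i j : V}, (i ⟶ j) → (τ i ⟶ τ j) → k)
    (hc : ∀ {i j : V} (a : i ⟶ j), t.τ (arrow n a) = ∑ a', c a a' • arrow n a')
    (hb : ∀ {i j : V} (a : i ⟶ j), b i j a = ∑ a', c a a' • b' (τ i) (τ j) a') :
    BasicAct.CornerTwist Φ Φ' t τ where
  map_vertex := ht
  θ := R.compare R'
  natural f i j m m' h := by
    refine congrArg Subtype.val (R.compare_eq R'
      (m' := ⟨_, Φ'.map_mem_edges f (R.compare R' _ i j m)⟩) ?_)
    rw [R.natural f i j m m' h, R'.natural f _ _ (R.compare R' _ i j m) _ rfl, θ_compare]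
  mul X Y i l j m m' z h := by
    refine congrArg Subtype.val (R.compare_eq R'
      (m' := ⟨_, Φ'.mul_mem_edges (R.compare R' _ i l m) (R.compare R' _ l j m')⟩) ?_)
    rw [R.mul X Y i l j m m' z h, R'.mul X Y _ _ _ (R.compare R' _ i l m)
      (R.compare R' _ l j m') _ rfl, θ_compare, θ_compare]
  unit i z h := by
    refine congrArg Subtype.val (R.compare_eq R' (m' := ⟨_, Φ'.unit_mem_edges (τ i)⟩) ?_)
    rw [R.unit i z h, R'.unit (τ i) _ rfl]
  swap X i l j a m x h := by
    have h1 := R.arrows X i l j a m x h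
    choose y hy using fun a' : τ i ⟶ τ l => Φ'.exists_expansion a' (R.compare R' X l j m)
    have h2 := fun a' => R'.arrows X _ _ _ a' _ _ (hy a')
    have h3 : (fun h (c' : τ h ⟶ τ j) => R'.θ X (τ i) (τ h) (∑ a', c a a' • y a' (τ h) c')) =
        fun h (c' : τ h ⟶ τ j) => R'.θ X (τ i) (τ h)
          (R.compare R' X i h (∑ d : h ⟶ j, c d c' • x h d)) := by
      refine eq_of_sum_eq (b' := b') sk τ ?_
      rw [τ.sum_comp fun h => ∑ c' : h ⟶ τ j,
        R'.θ X (τ i) h (∑ a', c a a' • y a' h c') ≫ X ⊴ₗ b' h (τ j) c']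
      calc _ = ∑ a', c a a' • ∑ h, ∑ c' : h ⟶ τ j, R'.θ X (τ i) h (y a' h c') ≫
            X ⊴ₗ b' h (τ j) c' := by
            simp only [map_sum, map_smul, Preadditive.sum_comp, Linear.smul_comp, Finset.smul_sum]
            rw [Finset.sum_comm]
            refine Finset.sum_congr rfl fun h _ => ?_
            rw [Finset.sum_comm]
        _ = b i l a ≫ F.functor.map (R.θ X l j m) ≫ δₗ F.functor X (S' (τ j)) := by
            simp only [← h2, θ_compare, hb, Preadditive.sum_comp, Linear.smul_comp]
        _ = _ := by
            rw [h1]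
            simp only [θ_compare, map_sum, map_smul, Preadditive.sum_comp, Linear.smul_comp, hb]
            refine Finset.sum_congr rfl fun h _ => ?_
            rw [Finset.sum_comm]
            refine Finset.sum_congr rfl fun d _ => ?_
            simp only [← ModStr.actRight_apply, map_sum, map_smul, Preadditive.comp_sum,
              Linear.comp_smul]
    have h4 : ∀ h (c' : τ h ⟶ τ j), ∑ a', c a a' • y a' (τ h) c' =
        ∑ d : h ⟶ j, c d c' • R.compare R' X i h (x h d) := fun h c' => by
      rw [(R'.θ X (τ i) (τ h)).injective (congrFun (congrFun h3 h) c')]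
      simp only [map_sum, map_smul]
    have h5 : ∀ h (c' : τ h ⟶ τ j), ∑ a', c a a' • (y a' (τ h) c' : (Φ'.bim X).carrier) =
        ∑ d : h ⟶ j, c d c' • (R.compare R' X i h (x h d) : (Φ'.bim X).carrier) := fun h c' => by
      have := congrArg Subtype.val (h4 h c')
      simpa only [Submodule.coe_sum, Submodule.coe_smul] using this
    have h6 : ∀ {B : Type u} [AddCommGroup B] [Module k B]
        (f : TruncatedPathAlgebra k V n →ₗ[k] B) {i j : V} (a : i ⟶ j),
        f (t.τ (arrow n a)) = ∑ a', c a a' • f (arrow n a') := fun f _ _ a => by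
      rw [hc, map_sum]; simp only [map_smul]
    have h7 := fun z => h6 ((LinearMap.applyₗ z).comp (Φ'.bim X).l.toLinearMap) a
    have h8 := fun z {h : V} (d : h ⟶ j) => h6 ((LinearMap.applyₗ z).comp
      ((Φ'.bim X).r.toLinearMap ∘ₗ (opLinearEquiv k).toLinearMap)) d
    simp only [LinearMap.comp_apply, LinearMap.applyₗ_apply_apply, AlgHom.toLinearMap_apply,
      LinearEquiv.coe_coe, coe_opLinearEquiv] at h7 h8
    rw [h7]
    simp only [h8, hy, Finset.smul_sum]
    rw [Finset.sum_comm, ← τ.sum_comp]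
    refine Finset.sum_congr rfl fun h _ => ?_
    rw [Finset.sum_comm, Finset.sum_comm (s := Finset.univ (α := h ⟶ j))]
    refine Finset.sum_congr rfl fun c' _ => ?_
    have := congrArg ((Φ'.bim X).r (op (arrow n c'))) (h5 h c')
    simpa only [map_sum, map_smul] using this

end CornerTwist

end Rlz

end BasicAction

namespace BasicAction

namespace TruncatedPathAlgebra

open PathAlgebra

variable {k V : Type u} [Field k] [Quiver.{u} V] [Fintype V] {n : ℕ}

/-- Elements of the radical labelled by the arrows satisfy the relations of the truncated path
algebra. -/
lemma isTruncatedRep_relabel (hn : 2 ≤ n) (σ : V ≃ V) {X : QArrow V → TruncatedPathAlgebra k V n}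
    (hl : ∀ b, vertex n (σ b.1) * X b = X b) (hr : ∀ b, X b * vertex n (σ b.2.1) = X b)
    (hX : ∀ b, X b ∈ rad k (TruncatedPathAlgebra k V n)) :
    IsTruncatedRep n (fun v => vertex n (σ v)) X where
  mul_self i := vertex_mul_self _
  mul_ne i j h := vertex_mul_ne (σ.injective.ne h)
  sum := by rw [σ.sum_comp fun v => vertex n v, sum_vertex]
  left := hl
  right := hr
  truncated i j p hp := by
    have h1 : ∀ b, ∃ x ∈ pathIdeal k V 1, mk n x = X b := fun b => by
      obtain ⟨x, hx⟩ := mk_surjective (X b)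
      exact ⟨x, (mk_mem_jacobson (by omega)).1 (hx ▸ hX b), hx⟩
    have h2 : ∀ {i j : V} (p : Quiver.Path i j), ∃ x ∈ pathIdeal k V p.length,
        mk n x = pathVal (fun v => vertex n (σ v)) X p := by
      intro i j p
      induction p with
      | nil => exact ⟨_, mem_zero _, rfl⟩
      | cons p e ih =>
        obtain ⟨x, hx, h⟩ := ih
        obtain ⟨y, hy, h'⟩ := h1 ⟨_, _, e⟩
        exact ⟨x * y, mul_mem_add hx hy, by rw [map_mul, h, h', pathVal]⟩
    obtain ⟨x, hx, h⟩ := h2 p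
    rw [← h]
    exact Ideal.Quotient.eq_zero_iff_mem.2 (pathIdeal_anti hp hx)

/-- Linear combinations of the arrows between two vertices. -/
noncomputable def arrowSum (n : ℕ) (i j : V) : ((i ⟶ j) →₀ k) →ₗ[k] TruncatedPathAlgebra k V n :=
  Finsupp.linearCombination k fun a => arrow n a

@[simp] lemma arrowSum_single {i j : V} (a : i ⟶ j) :
    arrowSum n i j (Finsupp.single a (1 : k)) = arrow n a := by
  rw [arrowSum, Finsupp.linearCombination_single, one_smul]

lemma arrowSum_apply [∀ i j : V, Fintype (i ⟶ j)] {i j : V} (x : (i ⟶ j) →₀ k) :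
    arrowSum n i j x = ∑ a, x a • arrow n a := by
  rw [arrowSum, Finsupp.linearCombination_apply, Finsupp.sum_fintype _ _ (by simp)]

lemma arrowSum_induction {i j : V} (S : Submodule k (TruncatedPathAlgebra k V n))
    (h : ∀ a : i ⟶ j, arrow n a ∈ S) (x : (i ⟶ j) →₀ k) : arrowSum n i j x ∈ S := by
  rw [arrowSum, Finsupp.linearCombination_apply]
  exact Submodule.sum_mem _ fun a _ => S.smul_mem _ (h a)

lemma vertex_mul_arrowSum {i j : V} (x : (i ⟶ j) →₀ k) :
    vertex n i * arrowSum n i j x = arrowSum n i j x :=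
  arrowSum_induction (LinearMap.eqLocus (LinearMap.mulLeft k (vertex n i)) LinearMap.id)
    vertex_mul_arrow x

lemma arrowSum_mul_vertex {i j : V} (x : (i ⟶ j) →₀ k) :
    arrowSum n i j x * vertex n j = arrowSum n i j x :=
  arrowSum_induction (LinearMap.eqLocus (LinearMap.mulRight k (vertex n j)) LinearMap.id)
    arrow_mul_vertex x

lemma arrowSum_mem_rad (hn : 2 ≤ n) {i j : V} (x : (i ⟶ j) →₀ k) :
    arrowSum n i j x ∈ rad k (TruncatedPathAlgebra k V n) :=
  arrowSum_induction _ (arrow_mem hn) x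

section

variable (n) (σ : V ≃ V) (e : ∀ i j : V, ((i ⟶ j) →₀ k) ≃ₗ[k] ((σ i ⟶ σ j) →₀ k))

/-- The endomorphism given by a relabelling of the vertices and linear maps between the spaces of
arrows. -/
noncomputable def relabel (hn : 2 ≤ n) :
    TruncatedPathAlgebra k V n →ₐ[k] TruncatedPathAlgebra k V n :=
  (isTruncatedRep_relabel hn σ
    (X := fun b => arrowSum n _ _ (e b.1 b.2.1 (Finsupp.single b.2.2 1)))
    (fun _ => vertex_mul_arrowSum _) (fun _ => arrowSum_mul_vertex _)
    (fun _ => arrowSum_mem_rad hn _)).algHom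

lemma relabel_vertex (hn : 2 ≤ n) (v : V) : relabel n σ e hn (vertex n v) = vertex n (σ v) :=
  IsTruncatedRep.algHom_vertex _ v

lemma relabel_arrowSum (hn : 2 ≤ n) {i j : V} (x : (i ⟶ j) →₀ k) :
    relabel n σ e hn (arrowSum n i j x) = arrowSum n _ _ (e i j x) := by
  refine LinearMap.congr_fun (f := (relabel n σ e hn).toLinearMap ∘ₗ arrowSum n i j)
    (g := arrowSum n _ _ ∘ₗ (e i j).toLinearMap) (Finsupp.lhom_ext' fun a => LinearMap.ext_ring ?_) x
  change relabel n σ e hn (arrowSum n i j (Finsupp.single a 1)) = arrowSum n _ _ (e i j _)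
  rw [arrowSum_single]
  exact IsTruncatedRep.algHom_arr _ ⟨i, j, a⟩

lemma exists_relabel_inverse (hn : 2 ≤ n) :
    ∃ f : TruncatedPathAlgebra k V n →ₐ[k] TruncatedPathAlgebra k V n,
      (∀ v, f (vertex n (σ v)) = vertex n v) ∧
      ∀ i j (x : (σ i ⟶ σ j) →₀ k), f (arrowSum n _ _ x) = arrowSum n i j ((e i j).symm x) := by
  have h : ∀ b : QArrow V, ∃ y : TruncatedPathAlgebra k V n, ∀ i j (a : σ i ⟶ σ j),
      b = ⟨_, _, a⟩ → y = arrowSum n i j ((e i j).symm (Finsupp.single a 1)) := by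
    rintro ⟨i', j', a'⟩
    obtain ⟨i, rfl⟩ := σ.surjective i'
    obtain ⟨j, rfl⟩ := σ.surjective j'
    refine ⟨arrowSum n i j ((e i j).symm (Finsupp.single a' 1)), fun i₂ j₂ a h => ?_⟩
    obtain rfl := σ.injective (congrArg Sigma.fst h)
    have h' := eq_of_heq (Sigma.mk.inj h).2
    obtain rfl := σ.injective (congrArg Sigma.fst h')
    rw [eq_of_heq (Sigma.mk.inj h').2]
  choose X hX using h
  have hX' : ∀ {i j} (a : σ i ⟶ σ j),
      X ⟨_, _, a⟩ = arrowSum n i j ((e i j).symm (Finsupp.single a 1)) := fun a => hX _ _ _ a rfl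
  have hrep : IsTruncatedRep n (fun v => vertex n (σ.symm v)) X := by
    refine isTruncatedRep_relabel hn σ.symm ?_ ?_ ?_ <;> rintro ⟨i', j', a'⟩ <;>
      obtain ⟨i, rfl⟩ := σ.surjective i' <;> obtain ⟨j, rfl⟩ := σ.surjective j' <;>
      rw [hX']
    · rw [Equiv.symm_apply_apply, vertex_mul_arrowSum]
    · rw [Equiv.symm_apply_apply, arrowSum_mul_vertex]
    · exact arrowSum_mem_rad hn _
  refine ⟨hrep.algHom, fun v => ?_, fun i j x => ?_⟩
  · rw [hrep.algHom_vertex, Equiv.symm_apply_apply]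
  · refine LinearMap.congr_fun (f := hrep.algHom.toLinearMap ∘ₗ arrowSum n _ _)
      (g := arrowSum n i j ∘ₗ (e i j).symm.toLinearMap)
      (Finsupp.lhom_ext' fun a => LinearMap.ext_ring ?_) x
    change hrep.algHom (arrowSum n _ _ (Finsupp.single a 1)) = arrowSum n i j ((e i j).symm _)
    rw [arrowSum_single]
    exact (hrep.algHom_arr ⟨_, _, a⟩).trans (hX' a)

lemma algHom_ext {B : Type*} [Ring B] [Algebra k B] {f g : TruncatedPathAlgebra k V n →ₐ[k] B}
    (hv : ∀ v, f (vertex n v) = g (vertex n v)) (ha : ∀ b, f (arr n b) = g (arr n b)) : f = g :=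
  AlgHom.ext (mul_induction (LinearMap.eqLocus f.toLinearMap g.toLinearMap) hv ha
    fun x hx y hy => by
      change f (x * y) = g (x * y)
      rw [map_mul, map_mul]
      exact congrArg₂ _ hx hy)

variable [∀ i j : V, Fintype (i ⟶ j)]

/-- A relabelling of the vertices and isomorphisms between the spaces of arrows define an
automorphism of the truncated path algebra with its quiver data. -/
lemma exists_aut (hn : 2 ≤ n) : ∃ t : (quiverData k V hn).Aut,
    (∀ v, t.τ (vertex n v) = vertex n (σ v)) ∧
    ∀ i j x, t.τ (arrowSum n i j x) = arrowSum n _ _ (e i j x) := by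
  obtain ⟨f, hv, ha⟩ := exists_relabel_inverse n σ e hn
  let s := relabel n σ e hn
  have h1 : f.comp s = AlgHom.id k _ := algHom_ext n (fun v => by
    change f (s _) = _
    rw [relabel_vertex, hv]; rfl) (fun ⟨i, j, a⟩ => by
    change f (s (arrow n a)) = arrow n a
    rw [← arrowSum_single, relabel_arrowSum, ha, LinearEquiv.symm_apply_apply])
  have h2 : s.comp f = AlgHom.id k _ := algHom_ext n (fun v => by
    obtain ⟨v, rfl⟩ := σ.surjective v
    change s (f _) = _
    rw [hv, relabel_vertex]; rfl) (fun ⟨i, j, a⟩ => by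
    obtain ⟨i, rfl⟩ := σ.surjective i
    obtain ⟨j, rfl⟩ := σ.surjective j
    change s (f (arrow n a)) = arrow n a
    rw [← arrowSum_single, ha, relabel_arrowSum, LinearEquiv.apply_symm_apply])
  have hp : ∀ a, s ((quiverData k V hn).p a) = (quiverData k V hn).p (s a) := by
    refine mul_induction (LinearMap.eqLocus (s.toLinearMap ∘ₗ (quiverData k V hn).p)
      ((quiverData k V hn).p ∘ₗ s.toLinearMap)) (fun v => ?_) (fun b => ?_) (fun x hx y hy => ?_)
    · change s ((quiverData k V hn).p (vertex n v)) = (quiverData k V hn).p (s (vertex n v))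
      rw [quiverData_p_vertex, relabel_vertex, quiverData_p_vertex]
    · change s ((quiverData k V hn).p (arrow n b.2.2)) = (quiverData k V hn).p (s (arrow n b.2.2))
      rw [quiverData_p_arrow, map_zero, ← arrowSum_single, relabel_arrowSum,
        QuiverData.p_rad _ (arrowSum_mem_rad hn _)]
    · change s ((quiverData k V hn).p (x * y)) = (quiverData k V hn).p (s (x * y))
      rw [_root_.map_mul s, QuiverData.p_mul, QuiverData.p_mul, _root_.map_mul s]
      exact congrArg₂ _ hx hy
  have hd' : ∀ {i j : V} (x : (i ⟶ j) →₀ k),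
      (quiverData k V hn).d (arrowSum n i j x) = arrowSum n i j x := fun {i j} x =>
    arrowSum_induction (LinearMap.eqLocus (quiverData k V hn).d LinearMap.id)
      (quiverData_d_arrow hn) x
  have hd : ∀ a, s ((quiverData k V hn).d a) = (quiverData k V hn).d (s a) := by
    refine mul_induction (LinearMap.eqLocus (s.toLinearMap ∘ₗ (quiverData k V hn).d)
      ((quiverData k V hn).d ∘ₗ s.toLinearMap)) (fun v => ?_) (fun b => ?_) (fun x hx y hy => ?_)
    · change s ((quiverData k V hn).d (vertex n v)) = (quiverData k V hn).d (s (vertex n v))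
      rw [quiverData_d_vertex, relabel_vertex, quiverData_d_vertex, map_zero]
    · change s ((quiverData k V hn).d (arrow n b.2.2)) = (quiverData k V hn).d (s (arrow n b.2.2))
      rw [quiverData_d_arrow, ← arrowSum_single, relabel_arrowSum, hd']
    · change s ((quiverData k V hn).d (x * y)) = (quiverData k V hn).d (s (x * y))
      have hx : s ((quiverData k V hn).d x) = (quiverData k V hn).d (s x) := hx
      have hy : s ((quiverData k V hn).d y) = (quiverData k V hn).d (s y) := hy
      rw [_root_.map_mul s, QuiverData.d_mul, QuiverData.d_mul, map_add, _root_.map_mul s,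
        _root_.map_mul s, hp, hp, hx, hy]
  refine ⟨⟨AlgEquiv.ofAlgHom s f h2 h1, hp, fun z z' h => ?_⟩, relabel_vertex n σ e hn,
    fun i j x => relabel_arrowSum n σ e hn x⟩
  rw [← QuiverData.d_of_mem, ← QuiverData.d_of_mem]
  change s _ = _
  rw [hd, h]
  rfl

end

section Coeff

variable [∀ i j : V, Fintype (i ⟶ j)] (hn : 2 ≤ n)

/-- The coefficients of the arrows between two vertices. -/
noncomputable def arrowCoeffs (i j : V) : TruncatedPathAlgebra k V n →ₗ[k] ((i ⟶ j) →₀ k) :=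
  (Finsupp.linearEquivFunOnFinite k k (i ⟶ j)).symm.toLinearMap ∘ₗ
    LinearMap.pi fun a => arrowCoeff hn ⟨i, j, a⟩

lemma arrowCoeffs_apply {i j : V} (z : TruncatedPathAlgebra k V n) (a : i ⟶ j) :
    arrowCoeffs hn i j z a = arrowCoeff hn ⟨i, j, a⟩ z := rfl

lemma arrowCoeffs_arrowSum {i j : V} (x : (i ⟶ j) →₀ k) :
    arrowCoeffs hn i j (arrowSum n i j x) = x := by
  classical
  refine LinearMap.congr_fun (f := arrowCoeffs hn i j ∘ₗ arrowSum n i j)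
    (g := LinearMap.id) (Finsupp.lhom_ext' fun a => LinearMap.ext_ring (Finsupp.ext fun b => ?_)) x
  change arrowCoeffs hn i j (arrowSum n i j (Finsupp.single a 1)) b = Finsupp.single a 1 b
  rw [arrowSum_single, arrowCoeffs_apply]
  refine (arrowCoeff_arr hn ⟨i, j, b⟩ ⟨i, j, a⟩).trans ?_
  simp [Finsupp.single_apply]

lemma arrowSum_arrowCoeffs {i j : V} {z : TruncatedPathAlgebra k V n}
    (hd : (quiverData k V hn).d z = z) (hl : vertex n i * z = z) (hr : z * vertex n j = z) :
    arrowSum n i j (arrowCoeffs hn i j z) = z := by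
  conv_rhs => rw [← hl, ← hr, ← hd, quiverData_d_eq, Finset.sum_mul, Finset.mul_sum,
    Fintype.sum_sigma, Finset.sum_eq_single i (fun i' _ h => by
      refine Finset.sum_eq_zero fun b _ => ?_
      rw [smul_mul_assoc, mul_smul_comm, ← mul_assoc, arr, ← vertex_mul_arrow, ← mul_assoc,
        vertex_mul_ne h.symm, zero_mul, zero_mul, smul_zero]) (by simp),
    Fintype.sum_sigma, Finset.sum_eq_single j (fun j' _ h => by
      refine Finset.sum_eq_zero fun b _ => ?_
      rw [smul_mul_assoc, mul_smul_comm, arr, ← arrow_mul_vertex, mul_assoc,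
        vertex_mul_ne h, mul_zero, mul_zero, smul_zero]) (by simp)]
  rw [arrowSum_apply]
  refine Finset.sum_congr rfl fun a _ => ?_
  rw [smul_mul_assoc, arr, arrow_mul_vertex, mul_smul_comm, vertex_mul_arrow]
  rfl

end Coeff

section Aut

variable [∀ i j : V, Fintype (i ⟶ j)] {hn : 2 ≤ n} (t : (quiverData k V hn).Aut)

lemma exists_vertex_map [DecidableEq V]
    (s : TruncatedPathAlgebra k V n →ₐ[k] TruncatedPathAlgebra k V n) :
    ∃ ρ : V → V, ∀ v w, vertexCoeff hn w (s (vertex n v)) = if v = ρ w then 1 else 0 := by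
  have h : ∀ w, ∃ v₀, ∀ v, vertexCoeff hn w (s (vertex n v)) = if v = v₀ then 1 else 0 := by
    intro w
    let χ := (vertexCoeff hn w).comp s
    have h1 : ∑ v, χ (vertex n v) = 1 := by rw [← map_sum, sum_vertex, map_one]
    obtain ⟨v₀, -, h0⟩ := Finset.exists_ne_zero_of_sum_ne_zero (h1 ▸ one_ne_zero)
    have h2 : χ (vertex n v₀) = 1 := by
      refine mul_left_cancel₀ h0 ?_
      rw [← map_mul, vertex_mul_self, mul_one]
    refine ⟨v₀, fun v => ?_⟩
    split_ifs with hv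
    · rw [hv]; exact h2
    · have h3 : χ (vertex n v) * χ (vertex n v₀) = 0 := by
        rw [← map_mul, vertex_mul_ne hv, map_zero]
      rwa [h2, mul_one] at h3
  choose ρ hρ using h
  exact ⟨ρ, fun v w => hρ w v⟩

/-- An automorphism of the truncated path algebra with its quiver data is given by a relabelling of
the vertices and isomorphisms between the spaces of arrows. -/
lemma exists_of_aut : ∃ (σ : V ≃ V) (e : ∀ i j : V, ((i ⟶ j) →₀ k) ≃ₗ[k] ((σ i ⟶ σ j) →₀ k)),
    (∀ v, t.τ (vertex n v) = vertex n (σ v)) ∧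
    ∀ i j x, t.τ (arrowSum n i j x) = arrowSum n _ _ (e i j x) := by
  classical
  obtain ⟨ρ, hρ⟩ := exists_vertex_map (hn := hn) t.τ.toAlgHom
  obtain ⟨σ, hσ⟩ := exists_vertex_map (hn := hn) t.τ.symm.toAlgHom
  have key : ∀ (s : TruncatedPathAlgebra k V n →ₐ[k] TruncatedPathAlgebra k V n)
      (_ : ∀ a, s ((quiverData k V hn).p a) = (quiverData k V hn).p (s a)) (ρ : V → V)
      (_ : ∀ v w, vertexCoeff hn w (s (vertex n v)) = if v = ρ w then 1 else 0) (v : V),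
      s (vertex n v) = ∑ w, (if v = ρ w then (1 : k) else 0) • vertex n w := by
    intro s hp ρ hρ v
    rw [← quiverData_p_vertex hn v, hp, quiverData_p_eq]
    simp only [hρ]
  have key₂ : ∀ (s s' : TruncatedPathAlgebra k V n →ₐ[k] TruncatedPathAlgebra k V n)
      (_ : ∀ a, s ((quiverData k V hn).p a) = (quiverData k V hn).p (s a)) (ρ σ : V → V)
      (_ : ∀ v w, vertexCoeff hn w (s (vertex n v)) = if v = ρ w then 1 else 0)
      (_ : ∀ v w, vertexCoeff hn w (s' (vertex n v)) = if v = σ w then 1 else 0)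
      (_ : ∀ a, s' (s a) = a) (v : V), ρ (σ v) = v := by
    intro s s' hp ρ σ hρ hσ hs v
    have h1 := congrArg (fun z => vertexCoeff hn v (s' z)) (key s hp ρ hρ v)
    simp only [hs, vertexCoeff_vertex, map_sum, map_smul, hσ, smul_eq_mul, if_true, ite_mul,
      one_mul, zero_mul] at h1
    by_contra hne
    refine one_ne_zero (h1.trans (Finset.sum_eq_zero fun w _ => ?_))
    split_ifs with h h'
    · exact absurd (by rw [← h', ← h]) hne
    · rfl
    · rfl
  have h1 : ∀ v, ρ (σ v) = v := key₂ t.τ.toAlgHom t.τ.symm.toAlgHom t.map_p ρ σ hρ hσ (t.τ.symm_apply_apply)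
  have h2 : ∀ v, σ (ρ v) = v := key₂ t.τ.symm.toAlgHom t.τ.toAlgHom t.symm_p σ ρ hσ hρ (t.τ.apply_symm_apply)
  let σ' : V ≃ V := ⟨σ, ρ, h1, h2⟩
  have hv : ∀ v, t.τ (vertex n v) = vertex n (σ v) := fun v => by
    refine (key t.τ.toAlgHom t.map_p ρ hρ v).trans ?_
    rw [Finset.sum_eq_single (σ v), h1, if_pos rfl, one_smul]
    · intro w _ hw
      rw [if_neg, zero_smul]
      rintro rfl
      exact hw (h2 w).symm
    · simp
  have hv' : ∀ v, t.τ.symm (vertex n (σ v)) = vertex n v := fun v => by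
    rw [AlgEquiv.symm_apply_eq, hv]
  have hd' : ∀ {i j : V} (x : (i ⟶ j) →₀ k),
      (quiverData k V hn).d (arrowSum n i j x) = arrowSum n i j x := fun {i j} x =>
    arrowSum_induction (LinearMap.eqLocus (quiverData k V hn).d LinearMap.id)
      (quiverData_d_arrow hn) x
  have ha : ∀ i j x, arrowSum n (σ i) (σ j) (arrowCoeffs hn _ _ (t.τ (arrowSum n i j x))) =
      t.τ (arrowSum n i j x) := fun i j x => arrowSum_arrowCoeffs hn
    (by rw [← t.map_d, hd']) (by rw [← hv, ← map_mul, vertex_mul_arrowSum])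
    (by rw [← hv, ← map_mul, arrowSum_mul_vertex])
  have ha' : ∀ i j x, arrowSum n i j (arrowCoeffs hn _ _ (t.τ.symm (arrowSum n (σ i) (σ j) x))) =
      t.τ.symm (arrowSum n (σ i) (σ j) x) := fun i j x => arrowSum_arrowCoeffs hn
    (by rw [← t.symm_d, hd']) (by rw [← hv', ← map_mul, vertex_mul_arrowSum])
    (by rw [← hv', ← map_mul, arrowSum_mul_vertex])
  refine ⟨σ', fun i j => LinearEquiv.ofLinearMap
    (arrowCoeffs hn (σ i) (σ j) ∘ₗ t.τ.toLinearMap ∘ₗ arrowSum n i j)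
    (arrowCoeffs hn i j ∘ₗ t.τ.symm.toLinearMap ∘ₗ arrowSum n (σ i) (σ j))
    (LinearMap.ext fun x => ?_) (LinearMap.ext fun x => ?_), hv, fun i j x => (ha i j x).symm⟩
  · change arrowCoeffs hn (σ i) (σ j) (t.τ (arrowSum n i j (arrowCoeffs hn i j
      (t.τ.symm (arrowSum n (σ i) (σ j) x))))) = x
    rw [ha', AlgEquiv.apply_symm_apply, arrowCoeffs_arrowSum]
  · change arrowCoeffs hn i j (t.τ.symm (arrowSum n (σ i) (σ j) (arrowCoeffs hn (σ i) (σ j)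
      (t.τ (arrowSum n i j x))))) = x
    rw [ha, AlgEquiv.symm_apply_apply, arrowCoeffs_arrowSum]

end Aut

end TruncatedPathAlgebra

end BasicAction

namespace BasicAction

open MonoidalLeftAction Functor.LaxLeftLinear Functor.OplaxLeftLinear TruncatedPathAlgebra

section Symm

variable {C : Type w} [Category.{v} C] [Preadditive C] [MonoidalCategory C]
variable {k A : Type u} [Field k] [Linear k C] [Ring A] [Algebra k A] {D : QuiverData k A}

/-- The inverse of an automorphism of an algebra with quiver data. -/
def QuiverData.Aut.symm (t : D.Aut) : D.Aut where
  τ := t.τ.symm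
  map_δ₁ a := t.symm_p a
  map_δ₂ z z' h := by
    rw [← QuiverData.d_of_mem, ← QuiverData.d_of_mem, t.symm_d, ← h]

lemma BasicAct.IsTwist.symm {Φ Φ' : BasicAct C D} {t : D.Aut} {f} (h : IsTwist Φ Φ' t f) :
    IsTwist Φ' Φ t.symm fun X => (f X).symm where
  map_l X a m := by
    rw [LinearEquiv.symm_apply_eq, h.map_l, LinearEquiv.apply_symm_apply]
    exact congrArg (fun a => (Φ'.bim X).l a m) (t.τ.apply_symm_apply a).symm
  map_r X a m := by
    rw [LinearEquiv.symm_apply_eq, h.map_r, LinearEquiv.apply_symm_apply]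
    exact congrArg (fun a => (Φ'.bim X).r (op a) m) (t.τ.apply_symm_apply a).symm
  map_p X m := by rw [LinearEquiv.symm_apply_eq, h.map_p, LinearEquiv.apply_symm_apply]
  natural X Y g m := by rw [LinearEquiv.symm_apply_eq, h.natural, LinearEquiv.apply_symm_apply]
  map_mul X Y m m' := by
    rw [LinearEquiv.symm_apply_eq, h.map_mul, LinearEquiv.apply_symm_apply,
      LinearEquiv.apply_symm_apply]
  map_unit a := by
    rw [LinearEquiv.symm_apply_eq, h.map_unit]
    exact congrArg Φ'.unit (t.τ.apply_symm_apply a).symm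

end Symm

variable {C : Type w} [Category.{v} C] [Preadditive C] [MonoidalCategory C]
variable {k V : Type u} [Field k] [Linear k C] [Quiver.{u} V] [Fintype V]
  [∀ i j : V, Fintype (i ⟶ j)] {n : ℕ} {hn : 2 ≤ n}
  {Φ Φ' : BasicAct C (quiverData k V hn)}

lemma BasicAct.expansion_unique_relabel (Φ : BasicAct C (quiverData k V hn)) (σ : V ≃ V) {X : C}
    {i j : V} {x y : ∀ h, (σ h ⟶ j) → Φ.edges X i (σ h)}
    (h : ∑ h, ∑ b : σ h ⟶ j, (Φ.bim X).r (op (arrow n b)) (x h b : (Φ.bim X).carrier) =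
      ∑ h, ∑ b : σ h ⟶ j, (Φ.bim X).r (op (arrow n b)) (y h b : (Φ.bim X).carrier)) : x = y := by
  let e := Equiv.piCongrLeft (fun h => (h ⟶ j) → Φ.edges X i h) σ
  have he : ∀ x h, e x (σ h) = x h := fun x h =>
    Equiv.piCongrLeft_apply_apply (fun h => (h ⟶ j) → Φ.edges X i h) σ x h
  have hs : ∀ x, ∑ h, ∑ b : h ⟶ j, (Φ.bim X).r (op (arrow n b)) (e x h b).1 =
      ∑ h, ∑ b : σ h ⟶ j, (Φ.bim X).r (op (arrow n b)) (x h b).1 := fun x => by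
    rw [← σ.sum_comp]
    simp only [he]
  exact e.injective (Φ.expansion_unique ((hs x).trans (h.trans (hs y).symm)))

namespace BasicAct.IsTwist

variable {t : (quiverData k V hn).Aut} {f} (h : IsTwist Φ Φ' t f) {σ : V ≃ V}
  (hσ : ∀ v, t.τ (vertex n v) = vertex n (σ v))

lemma mem_edges_iff (h : IsTwist Φ Φ' t f) (hσ : ∀ v, t.τ (vertex n v) = vertex n (σ v)) {X : C} {i j : V} (m : (Φ.bim X).carrier) :
    f X m ∈ Φ'.edges X (σ i) (σ j) ↔ m ∈ Φ.edges X i j := by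
  rw [QBimodule.mem_corner, QBimodule.mem_corner, ← hσ, ← hσ, ← h.map_l, ← h.map_r, ← h.map_p,
    (f X).injective.eq_iff, (f X).injective.eq_iff, (f X).injective.eq_iff]

/-- The bijection of the edges given by an isomorphism up to an automorphism. -/
noncomputable def edgesEquiv (X : C) (i j : V) : Φ.edges X i j ≃ₗ[k] Φ'.edges X (σ i) (σ j) :=
  LinearEquiv.ofBijective
    ((f X).toLinearMap.restrict fun m hm => (h.mem_edges_iff hσ (i := i) (j := j) m).2 hm)
    ⟨fun _ _ hm => Subtype.ext ((f X).injective (congrArg Subtype.val hm)),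
      fun z => ⟨⟨(f X).symm z, (h.mem_edges_iff hσ _).1
        (by rw [LinearEquiv.apply_symm_apply]; exact z.2)⟩,
        Subtype.ext ((f X).apply_symm_apply _)⟩⟩

@[simp] lemma edgesEquiv_coe {X : C} {i j : V} (m : Φ.edges X i j) :
    (h.edgesEquiv hσ X i j m : (Φ'.bim X).carrier) = f X m := rfl

end BasicAct.IsTwist

namespace Rlz

variable {M : ModStr C k V} {F : Dual M} {S : V → M.Cat}
  {b : ∀ i j : V, (i ⟶ j) → (S i ⟶ F.functor.obj (S j))} (R : Rlz Φ' F S b)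
  {t : (quiverData k V hn).Aut} {f} (h : BasicAct.IsTwist Φ Φ' t f) {σ : V ≃ V}
  (hσ : ∀ v, t.τ (vertex n v) = vertex n (σ v))

/-- The transport of a realization along an isomorphism up to an automorphism. -/
noncomputable def twist (c : ∀ {i j : V}, (i ⟶ j) → (σ i ⟶ σ j) → k)
    (hc : ∀ {i j : V} (a : i ⟶ j), t.τ (arrow n a) = ∑ a', c a a' • arrow n a') :
    Rlz Φ F (fun i => S (σ i)) fun i j a => ∑ a', c a a' • b (σ i) (σ j) a' where
  θ X i j := h.edgesEquiv hσ X i j ≪≫ₗ R.θ X (σ i) (σ j)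
  natural g i j m m' hm :=
    R.natural g _ _ (h.edgesEquiv hσ _ i j m) (h.edgesEquiv hσ _ i j m') (by
      rw [h.edgesEquiv_coe, hm, h.natural]; rfl)
  mul X Y i l j m m' z hz :=
    R.mul X Y _ _ _ (h.edgesEquiv hσ _ i l m) (h.edgesEquiv hσ _ l j m')
      (h.edgesEquiv hσ _ i j z) (by rw [h.edgesEquiv_coe, hz, h.map_mul]; rfl)
  unit i z hz := R.unit (σ i) (h.edgesEquiv hσ _ i i z) (by rw [h.edgesEquiv_coe, hz, h.map_unit, hσ])
  arrows X i l j a m x hx := by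
    choose y hy using fun a' : σ i ⟶ σ l => Φ'.exists_expansion a' (h.edgesEquiv hσ X l j m)
    have h2 := fun a' => R.arrows X _ _ _ a' _ _ (hy a')
    have h6 : ∀ {B : Type u} [AddCommGroup B] [Module k B]
        (f : TruncatedPathAlgebra k V n →ₗ[k] B) {i j : V} (a : i ⟶ j),
        f (t.τ (arrow n a)) = ∑ a', c a a' • f (arrow n a') := fun f _ _ a => by
      rw [hc, map_sum]; simp only [map_smul]
    have h7 := fun z => h6 ((LinearMap.applyₗ z).comp (Φ'.bim X).l.toLinearMap) a
    have h8 := fun z {h : V} (d : h ⟶ j) => h6 ((LinearMap.applyₗ z).comp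
      ((Φ'.bim X).r.toLinearMap ∘ₗ (opLinearEquiv k).toLinearMap)) d
    simp only [LinearMap.comp_apply, LinearMap.applyₗ_apply_apply, AlgHom.toLinearMap_apply,
      LinearEquiv.coe_coe, coe_opLinearEquiv] at h7 h8
    have h3 := congrArg (f X) hx
    simp only [h.map_l, map_sum, h.map_r] at h3
    rw [h7] at h3
    have h4 := Φ'.expansion_unique_relabel σ
      (x := fun h' c' => ∑ a', c a a' • y a' (σ h') c')
      (y := fun h' c' => ∑ d : h' ⟶ j, c d c' • h.edgesEquiv hσ X i h' (x h' d)) (by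
        refine Eq.trans ?_ (h3.trans ?_)
        · rw [σ.sum_comp fun h' => ∑ c' : h' ⟶ σ j, (Φ'.bim X).r (op (arrow n c'))
            (∑ a', c a a' • y a' h' c' : Φ'.edges X (σ i) h').1]
          simp only [Submodule.coe_sum, Submodule.coe_smul, map_sum, map_smul]
          simp only [← h.edgesEquiv_coe hσ, hy, Finset.smul_sum]
          conv_rhs => rw [Finset.sum_comm]
          exact Finset.sum_congr rfl fun h' _ => Finset.sum_comm
        · refine Finset.sum_congr rfl fun h' _ => ?_
          simp only [h8, Submodule.coe_sum, Submodule.coe_smul, map_sum, map_smul,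
            h.edgesEquiv_coe]
          exact Finset.sum_comm)
    have h5 := fun h' c' => congrArg (R.θ X _ _) (congrFun (congrFun h4 h') c')
    simp only [map_sum, map_smul] at h5
    calc (∑ a', c a a' • b (σ i) (σ l) a') ≫
          F.functor.map (R.θ X _ _ (h.edgesEquiv hσ X l j m)) ≫ δₗ F.functor X (S (σ j))
        = ∑ h', ∑ c' : h' ⟶ σ j, (∑ a', c a a' • R.θ X _ _ (y a' h' c')) ≫
            X ⊴ₗ b h' (σ j) c' := by
          simp only [Preadditive.sum_comp, Linear.smul_comp, h2, Finset.smul_sum]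
          rw [Finset.sum_comm]
          exact Finset.sum_congr rfl fun h' _ => Finset.sum_comm
      _ = ∑ h', ∑ c' : σ h' ⟶ σ j, (∑ a', c a a' • R.θ X _ _ (y a' (σ h') c')) ≫
            X ⊴ₗ b (σ h') (σ j) c' := (σ.sum_comp fun h' => ∑ c' : h' ⟶ σ j,
              (∑ a', c a a' • R.θ X _ _ (y a' h' c')) ≫ X ⊴ₗ b h' (σ j) c').symm
      _ = ∑ h', ∑ d : h' ⟶ j, R.θ X _ _ (h.edgesEquiv hσ X i h' (x h' d)) ≫
            X ⊴ₗ ∑ c', c d c' • b (σ h') (σ j) c' := by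
          simp only [h5, Preadditive.sum_comp, Linear.smul_comp, ← ModStr.actRight_apply, map_sum,
            map_smul, Preadditive.comp_sum, Linear.comp_smul]
          exact Finset.sum_congr rfl fun h' _ => Finset.sum_comm

end Rlz

end BasicAction

namespace BasicAction

open MonoidalLeftAction Functor.LaxLeftLinear Functor.OplaxLeftLinear TruncatedPathAlgebra

variable {C : Type w} [Category.{v} C] [Preadditive C] [MonoidalCategory C]
variable {k V : Type u} [Field k] [Linear k C]

lemma ModFunctor.Hom.δ_comm {M N : ModStr C k V} {F G : ModFunctor M N} (f : F ⟶ G) (X : C)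
    (d : M.Cat) : f.app.app (X ⊙ₗ d) ≫ δₗ G.functor X d =
      δₗ F.functor X d ≫ X ⊴ₗ f.app.app d := by
  rw [← cancel_epi (μₗ F.functor X d), ← Category.assoc, f.comm]
  simp

section CompApp

variable {M M' : ModStr C k V} {F : Dual M} {F' : Dual M'} {Ψ : ModFunctor M M'}
  (η : F.comp Ψ ⟶ Ψ.comp F')

/-- The components of a morphism `Ψ F ⟶ F' Ψ`. -/
def ModFunctor.compApp (W : M.Cat) :
    Ψ.functor.obj (F.functor.obj W) ⟶ F'.functor.obj (Ψ.functor.obj W) := η.app.app W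

lemma ModFunctor.compApp_naturality {U W : M.Cat} (f : U ⟶ W) :
    Ψ.functor.map (F.functor.map f) ≫ ModFunctor.compApp η W =
      ModFunctor.compApp η U ≫ F'.functor.map (Ψ.functor.map f) := η.app.naturality f

lemma ModFunctor.compApp_δ (X : C) (W : M.Cat) :
    ModFunctor.compApp η (X ⊙ₗ W) ≫ F'.functor.map (δₗ Ψ.functor X W) ≫
        δₗ F'.functor X (Ψ.functor.obj W) =
      Ψ.functor.map (δₗ F.functor X W) ≫ δₗ Ψ.functor X (F.functor.obj W) ≫
        X ⊴ₗ ModFunctor.compApp η W :=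
  (ModFunctor.Hom.δ_comm η X W).trans (Category.assoc _ _ _)

end CompApp

namespace Rlz

variable [Quiver.{u} V] [Fintype V] [∀ i j : V, Fintype (i ⟶ j)] {n : ℕ} {hn : 2 ≤ n}
  {Φ : BasicAct C (quiverData k V hn)} {M M' : ModStr C k V} {F : Dual M} {F' : Dual M'}
  {S : V → M.Cat} {b : ∀ i j : V, (i ⟶ j) → (S i ⟶ F.functor.obj (S j))} (R : Rlz Φ F S b)
  (Ψ : ModFunctor M M') [Ψ.functor.Full] [Ψ.functor.Faithful] (η : F.comp Ψ ⟶ Ψ.comp F')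

/-- The bijection between the spaces of edges given by a fully faithful module functor. -/
noncomputable def mapEdges (X : C) (U W : M.Cat) :
    (U ⟶ X ⊙ₗ W) ≃ₗ[k] (Ψ.functor.obj U ⟶ X ⊙ₗ Ψ.functor.obj W) :=
  LinearEquiv.ofBijective
    (Linear.rightComp k _ (δₗ Ψ.functor X W) ∘ₗ Ψ.functor.mapLinearMap k)
    ⟨fun f g h => Ψ.functor.map_injective ((cancel_mono (δₗ Ψ.functor X W)).1 h),
      fun g => by
        obtain ⟨f, hf⟩ := Ψ.functor.map_surjective (g ≫ μₗ Ψ.functor X W)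
        refine ⟨f, ?_⟩
        change Ψ.functor.map f ≫ δₗ Ψ.functor X W = g
        rw [hf]
        simp⟩

lemma mapEdges_apply {X : C} {U W : M.Cat} (f : U ⟶ X ⊙ₗ W) :
    mapEdges Ψ X U W f = Ψ.functor.map f ≫ δₗ Ψ.functor X W := rfl

/-- The transport of a realization along a fully faithful module functor. -/
noncomputable def mapFunctor : Rlz Φ F' (fun i => Ψ.functor.obj (S i)) fun i j a =>
    Ψ.functor.map (b i j a) ≫ ModFunctor.compApp η (S j) where
  θ X i j := R.θ X i j ≪≫ₗ mapEdges Ψ X (S i) (S j)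
  natural f i j m m' h := by
    simp only [LinearEquiv.trans_apply, mapEdges_apply]
    rw [R.natural f i j m m' h, Functor.map_comp, Category.assoc, Category.assoc,
      ← δₗ_naturality_left]
  mul X Y i l j m m' t h := by
    simp only [LinearEquiv.trans_apply, mapEdges_apply]
    rw [R.mul X Y i l j m m' t h, ← cancel_mono (αₗ X Y (Ψ.functor.obj (S j))).hom]
    simp only [Functor.map_comp, Category.assoc, Iso.inv_hom_id, Category.comp_id,
      δₗ_associativity, actionHomRight_comp]
    simp only [← Functor.map_comp_assoc, Iso.inv_hom_id, Category.comp_id]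
    simp only [Functor.map_comp, Category.assoc, δₗ_naturality_right_assoc]
  unit i t h := by
    simp only [LinearEquiv.trans_apply, mapEdges_apply]
    rw [R.unit i t h]
    simp
  arrows X i l j a m m' h := by
    simp only [LinearEquiv.trans_apply, mapEdges_apply]
    have h1 := ModFunctor.compApp_naturality η (R.θ X l j m)
    have h2 := ModFunctor.compApp_δ η X (S j)
    have h3 := congrArg (fun z => Ψ.functor.map z ≫ δₗ Ψ.functor X (F.functor.obj (S j)) ≫
      X ⊴ₗ ModFunctor.compApp η (S j)) (R.arrows X i l j a m m' h)
    simp only [Functor.map_comp, Functor.map_sum, Preadditive.sum_comp, Category.assoc] at h3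
    simp only [Functor.map_comp, Category.assoc]
    rw [← reassoc_of% h1, h2, h3]
    refine Finset.sum_congr rfl fun h _ => Finset.sum_congr rfl fun c _ => ?_
    rw [actionHomRight_comp, δₗ_naturality_right_assoc]

end Rlz

end BasicAction

namespace BasicAction

namespace Skeleton

variable {k : Type u} [Field k] {V : Type u} [Fintype V] {𝒟 : Type*} [Category.{u} 𝒟]
  [Preadditive 𝒟] [Linear k 𝒟] {S : V → 𝒟}
  {ℰ : Type*} [Category.{u} ℰ] [Preadditive ℰ] [Linear k ℰ] {S' : V → ℰ}
  {P Q : 𝒟 ⥤ ℰ} [P.Additive] [P.Linear k] [Q.Additive] [Q.Linear k]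

lemma map_ext (sk : Skeleton k S) {W : 𝒟} {Z : ℰ} {s t : P.obj W ⟶ Z}
    (h : ∀ j (u : S j ⟶ W), P.map u ≫ s = P.map u ≫ t) : s = t := by
  have h1 := congrArg P.map (sk.sum_out_inn W)
  simp only [P.map_sum, P.map_comp, P.map_id] at h1
  rw [← Category.id_comp s, ← Category.id_comp t, ← h1]
  simp only [Preadditive.sum_comp, Category.assoc, h]

lemma map_obj_ext (sk : Skeleton k S) {T : 𝒟 ⥤ 𝒟} [T.Additive] [T.Linear k] {Γ : V → V → Type*}
    (θ : ∀ i j, Γ i j ≃ (S i ⟶ T.obj (S j))) {W : 𝒟} {Z : ℰ} {s t : P.obj (T.obj W) ⟶ Z}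
    (h : ∀ l j (g : Γ l j) (u : S j ⟶ W),
      P.map (θ l j g ≫ T.map u) ≫ s = P.map (θ l j g ≫ T.map u) ≫ t) : s = t := by
  refine sk.map_ext fun l v => ?_
  rw [← sk.sum_map_comp (P := T) v]
  simp only [P.map_sum, Preadditive.sum_comp]
  refine Finset.sum_congr rfl fun j _ => Finset.sum_congr rfl fun e _ => ?_
  have := h l j ((θ l j).symm (v ≫ T.map (sk.out W j e))) (sk.inn W j e)
  simpa only [Equiv.apply_symm_apply, Category.assoc] using this

section NatIso

variable {Γ : V → V → Type*} [∀ i j, AddCommGroup (Γ i j)] [∀ i j, Module k (Γ i j)]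
  (sk : Skeleton k S) (sk' : Skeleton k S')
  (θ : ∀ i j, Γ i j ≃ₗ[k] (S' i ⟶ P.obj (S j))) (θ' : ∀ i j, Γ i j ≃ₗ[k] (S' i ⟶ Q.obj (S j)))

/-- A morphism between the values of two functors which take the same values on the simple
objects. -/
noncomputable def natApp (W : 𝒟) : P.obj W ⟶ Q.obj W :=
  sk.lift sk' θ fun i j => LinearMap.mk₂ k (fun g u => θ' i j g ≫ Q.map u)
    (fun _ _ _ => by simp) (fun _ _ _ => by simp) (fun _ _ _ => by simp) (fun _ _ _ => by simp)

lemma comp_natApp {W : 𝒟} {i j : V} (g : Γ i j) (u : S j ⟶ W) :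
    θ i j g ≫ P.map u ≫ sk.natApp sk' θ θ' W = θ' i j g ≫ Q.map u :=
  sk.comp_lift sk' θ _ g u

lemma natApp_natApp (W : 𝒟) :
    sk.natApp sk' θ θ' W ≫ sk.natApp sk' θ' θ W = 𝟙 (P.obj W) :=
  sk.map_hom_ext sk' (fun i j => (θ i j).toEquiv) fun i j g u => by
    change θ i j g ≫ _ = θ i j g ≫ _
    have h1 := sk.comp_natApp sk' θ θ' g u
    rw [reassoc_of% h1, sk.comp_natApp, Category.comp_id]

/-- The isomorphism between two functors which take the same values on the simple objects. -/
noncomputable def natIso : P ≅ Q :=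
  NatIso.ofComponents
    (fun W => ⟨sk.natApp sk' θ θ' W, sk.natApp sk' θ' θ W, sk.natApp_natApp sk' θ θ' W,
      sk.natApp_natApp sk' θ' θ W⟩)
    (fun {W W'} f => sk.map_hom_ext sk' (fun i j => (θ i j).toEquiv) fun i j g u => by
      change θ i j g ≫ _ ≫ _ ≫ sk.natApp sk' θ θ' W' = θ i j g ≫ _ ≫ sk.natApp sk' θ θ' W ≫ _
      have h1 := sk.comp_natApp sk' θ θ' g u
      have h2 := sk.comp_natApp sk' θ θ' g (u ≫ f)
      rw [reassoc_of% h1]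
      simpa only [Functor.map_comp, Category.assoc] using h2)

lemma comp_natIso {W : 𝒟} {i j : V} (g : Γ i j) (u : S j ⟶ W) :
    θ i j g ≫ P.map u ≫ (sk.natIso sk' θ θ').hom.app W = θ' i j g ≫ Q.map u :=
  sk.comp_natApp sk' θ θ' g u

end NatIso

end Skeleton

section

open MonoidalLeftAction Functor.LaxLeftLinear Functor.OplaxLeftLinear

/-- A linear structure on a functor given by isomorphisms. -/
@[reducible] def leftLinearOfIso {C : Type*} [Category* C] [MonoidalCategory C] {D E : Type*}
    [Category* D] [Category* E] [MonoidalLeftAction C D] [MonoidalLeftAction C E] (F : D ⥤ E)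
    (e : ∀ (X : C) (d : D), F.obj (X ⊙ₗ d) ≅ X ⊙ₗ F.obj d)
    (hl : ∀ {X Y : C} (f : X ⟶ Y) (d : D),
      F.map (f ⊵ₗ d) ≫ (e Y d).hom = (e X d).hom ≫ f ⊵ₗ F.obj d)
    (hr : ∀ (X : C) {d d' : D} (f : d ⟶ d'),
      F.map (X ⊴ₗ f) ≫ (e X d').hom = (e X d).hom ≫ X ⊴ₗ F.map f)
    (ha : ∀ (X Y : C) (d : D), (e (X ⊗ Y) d).hom ≫ (αₗ X Y (F.obj d)).hom =
      F.map (αₗ X Y d).hom ≫ (e X (Y ⊙ₗ d)).hom ≫ X ⊴ₗ (e Y d).hom)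
    (hu : ∀ d : D, (λₗ (F.obj d)).inv = F.map (λₗ d).inv ≫ (e (𝟙_ C) d).hom) :
    F.LeftLinear C where
  δₗ X d := (e X d).hom
  μₗ X d := (e X d).inv
  δₗ_naturality_left := hl
  δₗ_naturality_right X _ _ f := hr X f
  δₗ_associativity := ha
  δₗ_unitality_inv d := hu d
  μₗ_naturality_left f d := by rw [Iso.comp_inv_eq, Category.assoc, hl, Iso.inv_hom_id_assoc]
  μₗ_naturality_right X _ _ f := by
    rw [Iso.comp_inv_eq, Category.assoc, hr, Iso.inv_hom_id_assoc]
  μₗ_associativity X Y d := by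
    have h : X ⊴ₗ (e Y d).hom ≫ X ⊴ₗ (e Y d).inv = 𝟙 _ := by
      rw [← actionHomRight_comp, Iso.hom_inv_id, actionHomRight_id]
    rw [Iso.inv_comp_eq, reassoc_of% (ha X Y d), reassoc_of% h, Iso.hom_inv_id, Category.comp_id]
  μₗ_unitality d := by
    rw [Iso.eq_inv_comp, ← Iso.eq_comp_inv, hu, ← F.map_comp_assoc, Iso.hom_inv_id, F.map_id,
      Category.id_comp]
  μₗ_comp_δₗ X d := (e X d).inv_hom_id
  δₗ_comp_μₗ X d := (e X d).hom_inv_id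

variable {C : Type w} [Category.{v} C] [Preadditive C] [MonoidalCategory C]
variable {k V : Type u} [Field k] [Linear k C]

/-- An isomorphism of module functors from a natural isomorphism. -/
def ModFunctor.isoMk {M N : ModStr C k V} {F G : ModFunctor M N} (e : F.functor ≅ G.functor)
    (h : ∀ (X : C) (d : M.Cat), e.hom.app (X ⊙ₗ d) ≫ δₗ G.functor X d =
      δₗ F.functor X d ≫ X ⊴ₗ e.hom.app d) : F ≅ G where
  hom := ⟨e.hom, fun X d => by
    rw [← cancel_mono (δₗ G.functor X d), Category.assoc, h]
    simp⟩
  inv := ⟨e.inv, fun X d => by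
    have h1 : X ⊴ₗ e.hom.app d ≫ X ⊴ₗ e.inv.app d = 𝟙 _ := by
      rw [← actionHomRight_comp, Iso.hom_inv_id_app, actionHomRight_id]
    rw [← cancel_epi (δₗ G.functor X d), ← cancel_epi (e.hom.app (X ⊙ₗ d)),
      Functor.LeftLinear.δₗ_comp_μₗ_assoc, Iso.hom_inv_id_app, reassoc_of% (h X d),
      reassoc_of% h1, Functor.LeftLinear.δₗ_comp_μₗ]⟩
  hom_inv_id := ModFunctor.Hom.ext e.hom_inv_id
  inv_hom_id := ModFunctor.Hom.ext e.inv_hom_id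

end

end BasicAction

namespace BasicAction

open MonoidalLeftAction Functor.LaxLeftLinear Functor.OplaxLeftLinear TruncatedPathAlgebra

variable {C : Type w} [Category.{v} C] [Preadditive C] [MonoidalCategory C]
variable {k V : Type u} [Field k] [Linear k C]

namespace ModStr

variable (M : ModStr C k V)

@[simp] lemma act_map (X : C) {U W : M.Cat} (f : U ⟶ W) : (M.act X).map f = X ⊴ₗ f := rfl

end ModStr

/-- A fully faithful linear functor as a linear equivalence on morphisms. -/
noncomputable def mapHomEquiv (k : Type u) [Field k] {𝒟 ℰ : Type*} [Category* 𝒟] [Category* ℰ]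
    [Preadditive 𝒟] [Preadditive ℰ] [Linear k 𝒟] [Linear k ℰ] (Ψ : 𝒟 ⥤ ℰ) [Ψ.Additive] [Ψ.Linear k]
    [Ψ.Full] [Ψ.Faithful] (U W : 𝒟) : (U ⟶ W) ≃ₗ[k] (Ψ.obj U ⟶ Ψ.obj W) :=
  LinearEquiv.ofBijective (Ψ.mapLinearMap k) ⟨Ψ.map_injective, Ψ.map_surjective⟩

@[simp] lemma mapHomEquiv_apply (k : Type u) [Field k] {𝒟 ℰ : Type*} [Category* 𝒟] [Category* ℰ]
    [Preadditive 𝒟] [Preadditive ℰ] [Linear k 𝒟] [Linear k ℰ] (Ψ : 𝒟 ⥤ ℰ) [Ψ.Additive] [Ψ.Linear k]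
    [Ψ.Full] [Ψ.Faithful] {U W : 𝒟} (f : U ⟶ W) : mapHomEquiv k Ψ U W f = Ψ.map f := rfl

namespace Rlz

variable [Quiver.{u} V] [Fintype V] [∀ i j : V, Fintype (i ⟶ j)] {n : ℕ} {hn : 2 ≤ n}
  {Φ : BasicAct C (quiverData k V hn)} {M M' : ModStr C k V} {F : Dual M} {F' : Dual M'}
  {S : V → M.Cat} {b : ∀ i j : V, Module.Basis (i ⟶ j) k (S i ⟶ F.functor.obj (S j))}
  (Ψ : M.Cat ⥤ M'.Cat) [Ψ.Additive] [Ψ.Linear k] [Ψ.Full] [Ψ.Faithful]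
  {b' : ∀ i j : V, Module.Basis (i ⟶ j) k (Ψ.obj (S i) ⟶ F'.functor.obj (Ψ.obj (S j)))}
  (sk : Skeleton k S) (sk' : Skeleton k fun i => Ψ.obj (S i))
  (R : Rlz Φ F S fun i j a => b i j a) (R' : Rlz Φ F' (fun i => Ψ.obj (S i)) fun i j a => b' i j a)

/-- The isomorphism `Ψ(X ⊙ W) ≅ X ⊙ Ψ W` given by two realizations of the same basic action. -/
noncomputable def δIso (X : C) : M.act X ⋙ Ψ ≅ Ψ ⋙ M'.act X :=
  sk.natIso sk' (Γ := fun i j => Φ.edges X i j)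
    (fun i j => R.θ X i j ≪≫ₗ mapHomEquiv k Ψ _ _) (fun i j => R'.θ X i j)

/-- The component of `δIso`. -/
noncomputable def δApp (X : C) (W : M.Cat) : Ψ.obj (X ⊙ₗ W) ≅ X ⊙ₗ Ψ.obj W :=
  (δIso Ψ sk sk' R R' X).app W

lemma map_δApp {X : C} {W : M.Cat} {i j : V} (g : Φ.edges X i j) (u : S j ⟶ W) :
    Ψ.map (R.θ X i j g) ≫ Ψ.map (X ⊴ₗ u) ≫ (δApp Ψ sk sk' R R' X W).hom =
      R'.θ X i j g ≫ X ⊴ₗ Ψ.map u :=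
  sk.comp_natIso sk' (Γ := fun i j => Φ.edges X i j) (P := M.act X ⋙ Ψ) (Q := Ψ ⋙ M'.act X)
    (fun i j => R.θ X i j ≪≫ₗ mapHomEquiv k Ψ _ _) (fun i j => R'.θ X i j) g u

lemma map_δApp_assoc {X : C} {W : M.Cat} {i j : V} (g : Φ.edges X i j) (u : S j ⟶ W) {Z : M'.Cat}
    (h : X ⊙ₗ Ψ.obj W ⟶ Z) :
    Ψ.map (R.θ X i j g) ≫ Ψ.map (X ⊴ₗ u) ≫ (δApp Ψ sk sk' R R' X W).hom ≫ h =
      R'.θ X i j g ≫ X ⊴ₗ Ψ.map u ≫ h := by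
  simpa only [Category.assoc] using congrArg (· ≫ h) (map_δApp Ψ sk sk' R R' g u)

lemma map_δApp' {X : C} {W : M.Cat} {i j : V} (g : Φ.edges X i j) (u : S j ⟶ W) :
    Ψ.map (R.θ X i j g ≫ X ⊴ₗ u) ≫ (δApp Ψ sk sk' R R' X W).hom =
      R'.θ X i j g ≫ X ⊴ₗ Ψ.map u := by
  rw [Ψ.map_comp, Category.assoc, map_δApp]

lemma map_δApp'_assoc {X : C} {W : M.Cat} {i j : V} (g : Φ.edges X i j) (u : S j ⟶ W) {Z : M'.Cat}
    (h : X ⊙ₗ Ψ.obj W ⟶ Z) :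
    Ψ.map (R.θ X i j g ≫ X ⊴ₗ u) ≫ (δApp Ψ sk sk' R R' X W).hom ≫ h =
      R'.θ X i j g ≫ X ⊴ₗ Ψ.map u ≫ h := by
  rw [Ψ.map_comp, Category.assoc, map_δApp_assoc]

lemma δApp_naturality (X : C) {W W' : M.Cat} (f : W ⟶ W') :
    Ψ.map (X ⊴ₗ f) ≫ (δApp Ψ sk sk' R R' X W').hom =
      (δApp Ψ sk sk' R R' X W).hom ≫ X ⊴ₗ Ψ.map f :=
  (δIso Ψ sk sk' R R' X).hom.naturality f

lemma act_ext (sk : Skeleton k S) (sk' : Skeleton k fun i => Ψ.obj (S i))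
    (R : Rlz Φ F S fun i j a => b i j a) {X : C} {W : M.Cat} {Z : M'.Cat}
    {s t : Ψ.obj (X ⊙ₗ W) ⟶ Z} (h : ∀ i j (g : Φ.edges X i j) (u : S j ⟶ W),
      Ψ.map (R.θ X i j g) ≫ Ψ.map (X ⊴ₗ u) ≫ s = Ψ.map (R.θ X i j g) ≫ Ψ.map (X ⊴ₗ u) ≫ t) :
    s = t :=
  sk.map_hom_ext sk' (P := M.act X ⋙ Ψ)
    (fun i j => (R.θ X i j ≪≫ₗ mapHomEquiv k Ψ _ _).toEquiv) h

lemma act_act_ext (sk : Skeleton k S) (sk' : Skeleton k fun i => Ψ.obj (S i))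
    (R : Rlz Φ F S fun i j a => b i j a) {X Y : C} {W : M.Cat} {Z : M'.Cat}
    {s t : Ψ.obj (X ⊙ₗ Y ⊙ₗ W) ⟶ Z}
    (h : ∀ i l j (g : Φ.edges X i l) (g' : Φ.edges Y l j) (u : S j ⟶ W),
      Ψ.map (R.θ X i l g ≫ X ⊴ₗ R.θ Y l j g' ≫ X ⊴ₗ Y ⊴ₗ u) ≫ s =
        Ψ.map (R.θ X i l g ≫ X ⊴ₗ R.θ Y l j g' ≫ X ⊴ₗ Y ⊴ₗ u) ≫ t) : s = t := by
  refine sk.map_obj_ext (P := M.act X ⋙ Ψ) (T := M.act Y) (fun i j => (R.θ Y i j).toEquiv)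
    fun l j g' u => sk'.hom_ext fun i v => ?_
  obtain ⟨g, rfl⟩ := (R.θ X i l ≪≫ₗ mapHomEquiv k Ψ _ _).surjective v
  change Ψ.map (R.θ X i l g) ≫ Ψ.map (X ⊴ₗ (R.θ Y l j g' ≫ Y ⊴ₗ u)) ≫ s =
    Ψ.map (R.θ X i l g) ≫ Ψ.map (X ⊴ₗ (R.θ Y l j g' ≫ Y ⊴ₗ u)) ≫ t
  simpa only [Ψ.map_comp, Category.assoc, actionHomRight_comp] using h i l j g g' u

/-- The module functor structure given by two realizations of the same basic action. -/
@[reducible] noncomputable def leftLinear : Ψ.LeftLinear C :=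
  leftLinearOfIso Ψ (δApp Ψ sk sk' R R')
    (fun {X Y} f W => act_ext Ψ sk sk' R fun i j g u => by
      have h1 := R.natural f i j g ⟨_, Φ.map_mem_edges f g⟩ rfl
      have h2 := R'.natural f i j g ⟨_, Φ.map_mem_edges f g⟩ rfl
      rw [map_δApp_assoc, ← Ψ.map_comp_assoc, ← Ψ.map_comp_assoc, Category.assoc, action_exchange,
        ← Category.assoc, ← h1, map_δApp', h2, Category.assoc, action_exchange])
    (δApp_naturality Ψ sk sk' R R')
    (fun X Y W => by
      rw [← cancel_epi (Ψ.map (αₗ X Y W).inv)]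
      refine act_act_ext Ψ sk sk' R fun i l j g g' u => ?_
      have h1 := R.mul X Y i l j g g' ⟨_, Φ.mul_mem_edges g g'⟩ rfl
      have h2 := R'.mul X Y i l j g g' ⟨_, Φ.mul_mem_edges g g'⟩ rfl
      have h3 : (R.θ X i l g ≫ X ⊴ₗ R.θ Y l j g' ≫ X ⊴ₗ Y ⊴ₗ u) ≫ (αₗ X Y W).inv =
          R.θ (X ⊗ Y) i j ⟨_, Φ.mul_mem_edges g g'⟩ ≫ (X ⊗ Y) ⊴ₗ u := by
        rw [h1]; simp
      have h4 : R.θ X i l g ≫ X ⊴ₗ R.θ Y l j g' ≫ X ⊴ₗ Y ⊴ₗ u =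
          R.θ X i l g ≫ X ⊴ₗ (R.θ Y l j g' ≫ Y ⊴ₗ u) := by simp
      rw [← Ψ.map_comp_assoc, h3, map_δApp'_assoc, h2, ← Ψ.map_comp_assoc (αₗ X Y W).inv,
        Iso.inv_hom_id, Ψ.map_id, Category.id_comp, h4, map_δApp'_assoc, ← actionHomRight_comp,
        map_δApp']
      simp)
    (fun W => sk.map_ext fun j u => by
      have h1 := R.unit j ⟨_, Φ.unit_mem_edges j⟩ rfl
      have h2 := R'.unit j ⟨_, Φ.unit_mem_edges j⟩ rfl
      have h3 : u ≫ (λₗ W).inv = R.θ (𝟙_ C) j j ⟨_, Φ.unit_mem_edges j⟩ ≫ 𝟙_ C ⊴ₗ u := by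
        rw [h1]; simp
      rw [← Ψ.map_comp_assoc, h3, map_δApp', h2]
      simp)

section DualIso

/-- The comparison of the functors given by two realizations of the same basic action. -/
noncomputable def dualIso (b : ∀ i j : V, Module.Basis (i ⟶ j) k (S i ⟶ F.functor.obj (S j)))
    (b' : ∀ i j : V, Module.Basis (i ⟶ j) k (Ψ.obj (S i) ⟶ F'.functor.obj (Ψ.obj (S j))))
    (sk : Skeleton k S) (sk' : Skeleton k fun i => Ψ.obj (S i)) :
    F.functor ⋙ Ψ ≅ Ψ ⋙ F'.functor :=
  sk.natIso sk' (Γ := fun i j => (i ⟶ j) →₀ k)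
    (fun i j => (b i j).repr.symm ≪≫ₗ mapHomEquiv k Ψ _ _) (fun i j => (b' i j).repr.symm)

/-- The component of `dualIso`. -/
noncomputable def dualApp (b : ∀ i j : V, Module.Basis (i ⟶ j) k (S i ⟶ F.functor.obj (S j)))
    (b' : ∀ i j : V, Module.Basis (i ⟶ j) k (Ψ.obj (S i) ⟶ F'.functor.obj (Ψ.obj (S j))))
    (sk : Skeleton k S) (sk' : Skeleton k fun i => Ψ.obj (S i)) (W : M.Cat) :
    Ψ.obj (F.functor.obj W) ⟶ F'.functor.obj (Ψ.obj W) := (dualIso Ψ b b' sk sk').hom.app W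

lemma map_dualApp {W : M.Cat} {i j : V} (a : i ⟶ j) (u : S j ⟶ W) :
    Ψ.map (b i j a ≫ F.functor.map u) ≫ dualApp Ψ b b' sk sk' W =
      b' i j a ≫ F'.functor.map (Ψ.map u) := by
  have := sk.comp_natIso sk' (Γ := fun i j => (i ⟶ j) →₀ k) (P := F.functor ⋙ Ψ)
    (Q := Ψ ⋙ F'.functor)
    (fun i j => (b i j).repr.symm ≪≫ₗ mapHomEquiv k Ψ _ _) (fun i j => (b' i j).repr.symm)
    (Finsupp.single a 1) u
  simp only [LinearEquiv.trans_apply, Module.Basis.repr_symm_single_one, mapHomEquiv_apply] at this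
  rw [Ψ.map_comp, Category.assoc]
  exact this

lemma map_dualApp_assoc {W : M.Cat} {i j : V} (a : i ⟶ j) (u : S j ⟶ W) {Z : M'.Cat}
    (h : F'.functor.obj (Ψ.obj W) ⟶ Z) :
    Ψ.map (b i j a ≫ F.functor.map u) ≫ dualApp Ψ b b' sk sk' W ≫ h =
      b' i j a ≫ F'.functor.map (Ψ.map u) ≫ h := by
  simpa only [Category.assoc] using congrArg (· ≫ h) (map_dualApp Ψ sk sk' a u)

lemma dualApp_δ (X : C) (W : M.Cat) :
    dualApp Ψ b b' sk sk' (X ⊙ₗ W) ≫ F'.functor.map (δApp Ψ sk sk' R R' X W).hom ≫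
        δₗ F'.functor X (Ψ.obj W) =
      Ψ.map (δₗ F.functor X W) ≫ (δApp Ψ sk sk' R R' X (F.functor.obj W)).hom ≫
        X ⊴ₗ dualApp Ψ b b' sk sk' W := by
  refine sk.map_obj_ext (P := F.functor ⋙ Ψ) (T := M.act X) (fun i j => (R.θ X i j).toEquiv)
    fun l j g u => sk'.hom_ext fun i v => ?_
  obtain ⟨v, rfl⟩ := Ψ.map_surjective v
  change Ψ.map v ≫ Ψ.map (F.functor.map (R.θ X l j g ≫ X ⊴ₗ u)) ≫ _ =
    Ψ.map v ≫ Ψ.map (F.functor.map (R.θ X l j g ≫ X ⊴ₗ u)) ≫ _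
  rw [← (b i l).sum_repr v]
  simp only [Ψ.map_sum, Ψ.map_smul, Preadditive.sum_comp, Linear.smul_comp]
  refine Finset.sum_congr rfl fun a _ => congrArg _ ?_
  obtain ⟨x, hx⟩ := Φ.exists_expansion a g
  have h1 := R.arrows X i l j a g x hx
  have h2 := R'.arrows X i l j a g x hx
  have h3 := congrArg (fun z => Ψ.map (z ≫ X ⊴ₗ F.functor.map u) ≫
    (δApp Ψ sk sk' R R' X (F.functor.obj W)).hom ≫ X ⊴ₗ dualApp Ψ b b' sk sk' W) h1
  have h4 := congrArg (fun z => z ≫ X ⊴ₗ F'.functor.map (Ψ.map u)) h2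
  have h5 : ∀ (h : V) (c : h ⟶ j), Ψ.map (R.θ X i h (x h c) ≫ X ⊴ₗ b h j c ≫
      X ⊴ₗ F.functor.map u) ≫ (δApp Ψ sk sk' R R' X (F.functor.obj W)).hom ≫
        X ⊴ₗ dualApp Ψ b b' sk sk' W =
      R'.θ X i h (x h c) ≫ X ⊴ₗ b' h j c ≫ X ⊴ₗ F'.functor.map (Ψ.map u) := fun h c => by
    rw [← actionHomRight_comp, map_δApp'_assoc, ← actionHomRight_comp, map_dualApp,
      actionHomRight_comp]
  simp only [Preadditive.sum_comp, Ψ.map_sum, Category.assoc, h5] at h3 h4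
  rw [← h4, ← δₗ_naturality_right, ← δₗ_naturality_right] at h3
  rw [← Ψ.map_comp_assoc, map_dualApp_assoc, ← F'.functor.map_comp_assoc, map_δApp',
    F'.functor.map_comp, Category.assoc, ← h3]
  simp only [Ψ.map_comp, F.functor.map_comp, Category.assoc]

/-- The isomorphism of module functors given by two realizations of the same basic action. -/
lemma exists_iso (sk : Skeleton k S) (sk' : Skeleton k fun i => Ψ.obj (S i))
    (R : Rlz Φ F S fun i j a => b i j a)
    (R' : Rlz Φ F' (fun i => Ψ.obj (S i)) fun i j a => b' i j a) : ∃ (_ : Ψ.LeftLinear C)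
    (η : F.comp { functor := Ψ } ≅ ModFunctor.comp { functor := Ψ } F'),
    ∀ i j a, Ψ.map (b i j a) ≫ ModFunctor.compApp η.hom (S j) = b' i j a := by
  let := leftLinear Ψ sk sk' R R'
  refine ⟨leftLinear Ψ sk sk' R R', ModFunctor.isoMk (F := F.comp { functor := Ψ })
    (G := ModFunctor.comp { functor := Ψ } F') (dualIso Ψ b b' sk sk') fun X W => ?_,
    fun i j a => ?_⟩
  · exact (dualApp_δ Ψ sk sk' R R' X W).trans (Category.assoc _ _ _).symm
  · have := map_dualApp Ψ (b := b) (b' := b') sk sk' a (𝟙 (S j))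
    rw [Ψ.map_comp, F.functor.map_id, Ψ.map_id, Ψ.map_id, F'.functor.map_id, Category.comp_id,
      Category.comp_id] at this
    exact this

end DualIso

end Rlz

end BasicAction

namespace BasicAction

open MonoidalLeftAction Functor.LaxLeftLinear Functor.OplaxLeftLinear TruncatedPathAlgebra

variable {C : Type w} [Category.{v} C] [Preadditive C] [MonoidalCategory C]
variable {k V : Type u} [Field k] [Linear k C]

namespace ModStr

lemma add_smulHom (M : ModStr C k V) {X Y : C} (f g : X ⟶ Y) (W : M.Cat) :
    (f + g) ⊵ₗ W = f ⊵ₗ W + g ⊵ₗ W := M.add_actionHomLeft f g W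

lemma smul_smulHom (M : ModStr C k V) {X Y : C} (c : k) (f : X ⟶ Y) (W : M.Cat) :
    (c • f) ⊵ₗ W = c • f ⊵ₗ W := M.smul_actionHomLeft c f W

lemma smulHom_add (M : ModStr C k V) (X : C) {U W : M.Cat} (f g : U ⟶ W) :
    X ⊴ₗ (f + g) = X ⊴ₗ f + X ⊴ₗ g := M.actionHomRight_add X f g

lemma smulHom_smul (M : ModStr C k V) (X : C) {U W : M.Cat} (c : k) (f : U ⟶ W) :
    X ⊴ₗ (c • f) = c • X ⊴ₗ f := M.actionHomRight_smul X c f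

end ModStr

section

variable {D : Type*} [Category D] [MonoidalLeftAction C D]

lemma inv_comp_inv_comp_associator (X Y Z : C) (S : D) :
    (αₗ X Y (Z ⊙ₗ S)).inv ≫ (αₗ (X ⊗ Y) Z S).inv ≫ (α_ X Y Z).hom ⊵ₗ S =
      X ⊴ₗ (αₗ Y Z S).inv ≫ (αₗ X (Y ⊗ Z) S).inv := by
  rw [← cancel_mono ((αₗ X (Y ⊗ Z) S).hom ≫ X ⊴ₗ (αₗ Y Z S).hom)]
  simp only [Category.assoc, associator_actionHom, Iso.inv_hom_id_assoc, Iso.inv_hom_id,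
    actionHomRight_inv_hom]

end

namespace Rlz

variable [Fintype V] {M : ModStr C k V} {S : V → M.Cat} (sk : Skeleton k S)

section Coeff

variable (F : Dual M) {ι : V → V → Type u} [∀ i j, Fintype (ι i j)]
  (b : ∀ i j : V, Module.Basis (ι i j) k (S i ⟶ F.functor.obj (S j)))

/-- The coefficient of a basis vector in a morphism to `F W`. -/
noncomputable def coeffF {i l : V} (a : ι i l) (W : M.Cat) :
    (S i ⟶ F.functor.obj W) →ₗ[k] (S l ⟶ W) :=
  ∑ e, (LinearMap.toSpanSingleton k _ (sk.inn W l e)) ∘ₗ (b i l).coord a ∘ₗ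
    Linear.rightComp k _ (F.functor.map (sk.out W l e))

lemma coeffF_apply {i l : V} (a : ι i l) {W : M.Cat} (y : S i ⟶ F.functor.obj W) :
    coeffF sk F b a W y =
      ∑ e, (b i l).coord a (y ≫ F.functor.map (sk.out W l e)) • sk.inn W l e := by
  simp [coeffF]

lemma sum_coeffF {i : V} {W : M.Cat} (y : S i ⟶ F.functor.obj W) :
    ∑ l, ∑ a, b i l a ≫ F.functor.map (coeffF sk F b a W y) = y := by
  conv_rhs => rw [← sk.sum_map_comp (P := F.functor) y]
  refine Finset.sum_congr rfl fun l _ => ?_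
  simp only [coeffF_apply, F.functor.map_sum, F.functor.map_smul, Preadditive.comp_sum]
  rw [Finset.sum_comm]
  refine Finset.sum_congr rfl fun e _ => ?_
  conv_rhs => rw [← Category.assoc, ← (b i l).sum_repr (y ≫ F.functor.map (sk.out W l e))]
  simp only [Preadditive.sum_comp, Linear.smul_comp, Linear.comp_smul, Module.Basis.coord_apply]

lemma coeffF_self [∀ i j, DecidableEq (ι i j)] {i l : V} (a a' : ι i l) {W : M.Cat} (u : S l ⟶ W) :
    coeffF sk F b a' W (b i l a ≫ F.functor.map u) = if a' = a then u else 0 := by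
  simp only [coeffF_apply, Category.assoc, ← F.functor.map_comp]
  have h : ∀ e, (b i l).coord a' (b i l a ≫ F.functor.map (u ≫ sk.out W l e)) =
      if a' = a then sk.sc (u ≫ sk.out W l e) else 0 := fun e => by
    conv_lhs => rw [sk.eq_smul (u ≫ sk.out W l e)]
    rw [F.functor.map_smul, F.functor.map_id, Linear.comp_smul, Category.comp_id, map_smul,
      Module.Basis.coord_apply, Module.Basis.repr_self, Finsupp.single_apply, smul_eq_mul, mul_ite,
      mul_one, mul_zero]
    simp only [eq_comm]
  simp only [h]
  split_ifs
  · exact sk.sum_comp_inn u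
  · simp

lemma coeffF_ne {i l l' : V} (hl : l' ≠ l) (a : ι i l) (a' : ι i l') {W : M.Cat} (u : S l ⟶ W) :
    coeffF sk F b a' W (b i l a ≫ F.functor.map u) = 0 := by
  simp only [coeffF_apply, Category.assoc, ← F.functor.map_comp]
  refine Finset.sum_eq_zero fun e _ => ?_
  rw [sk.hom_eq_zero hl.symm (u ≫ sk.out W l' e), F.functor.map_zero, Limits.comp_zero, map_zero,
    zero_smul]

end Coeff

variable [Quiver.{u} V] [∀ i j : V, Fintype (i ⟶ j)] (F : Dual M)
  (b : ∀ i j : V, Module.Basis (i ⟶ j) k (S i ⟶ F.functor.obj (S j)))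

/-- The composition of edges. -/
noncomputable def homMul {X Y : C} {i l j : V} :
    (S i ⟶ X ⊙ₗ S l) →ₗ[k] (S l ⟶ Y ⊙ₗ S j) →ₗ[k] (S i ⟶ (X ⊗ Y) ⊙ₗ S j) :=
  LinearMap.mk₂ k (fun g h => g ≫ X ⊴ₗ h ≫ (αₗ X Y (S j)).inv)
    (fun _ _ _ => Preadditive.add_comp _ _ _ _ _ _) (fun _ _ _ => Linear.smul_comp _ _ _ _ _ _)
    (fun g h h' => by rw [M.smulHom_add, Preadditive.add_comp, Preadditive.comp_add])
    (fun c g h => by rw [M.smulHom_smul, Linear.smul_comp, Linear.comp_smul])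

lemma homMul_apply {X Y : C} {i l j : V} (g : S i ⟶ X ⊙ₗ S l) (h : S l ⟶ Y ⊙ₗ S j) :
    homMul g h = g ≫ X ⊴ₗ h ≫ (αₗ X Y (S j)).inv := rfl

/-- The decomposition of edges. -/
noncomputable def homComul {X Y : C} {i j : V} (l : V) :
    (S i ⟶ (X ⊗ Y) ⊙ₗ S j) →ₗ[k] (S i ⟶ X ⊙ₗ S l) ⊗[k] (S l ⟶ Y ⊙ₗ S j) :=
  ∑ e, (TensorProduct.mk k _ _).flip (sk.inn (Y ⊙ₗ S j) l e) ∘ₗ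
    Linear.rightComp k (S i) ((αₗ X Y (S j)).hom ≫ X ⊴ₗ sk.out (Y ⊙ₗ S j) l e)

lemma homComul_apply {X Y : C} {i j : V} (l : V) (z : S i ⟶ (X ⊗ Y) ⊙ₗ S j) :
    homComul sk l z = ∑ e, (z ≫ (αₗ X Y (S j)).hom ≫ X ⊴ₗ sk.out (Y ⊙ₗ S j) l e) ⊗ₜ
      sk.inn (Y ⊙ₗ S j) l e := by
  simp only [homComul, LinearMap.sum_apply]; rfl

lemma homComul_homMul {X Y : C} {i l j : V} (g : S i ⟶ X ⊙ₗ S l) (h : S l ⟶ Y ⊙ₗ S j) (l' : V) :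
    homComul sk l' (homMul g h) = ∑ e, (g ≫ X ⊴ₗ (h ≫ sk.out (Y ⊙ₗ S j) l' e)) ⊗ₜ
      sk.inn (Y ⊙ₗ S j) l' e := by
  rw [homComul_apply]
  refine Finset.sum_congr rfl fun e _ => ?_
  rw [homMul_apply]
  simp only [Category.assoc, Iso.inv_hom_id_assoc, actionHomRight_comp]

lemma homComul_homMul_self {X Y : C} {i l j : V} (g : S i ⟶ X ⊙ₗ S l) (h : S l ⟶ Y ⊙ₗ S j) :
    homComul sk l (homMul g h) = g ⊗ₜ h := by
  rw [homComul_homMul]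
  conv_rhs => rw [← sk.sum_comp_inn h]
  rw [TensorProduct.tmul_sum]
  refine Finset.sum_congr rfl fun e _ => ?_
  conv_lhs => rw [sk.eq_smul (h ≫ sk.out (Y ⊙ₗ S j) l e)]
  rw [M.smulHom_smul, actionHomRight_id, Linear.comp_smul, Category.comp_id,
    TensorProduct.smul_tmul]

lemma homComul_homMul_ne {X Y : C} {i l j l' : V} (hl : l ≠ l') (g : S i ⟶ X ⊙ₗ S l)
    (h : S l ⟶ Y ⊙ₗ S j) : homComul sk l' (homMul g h) = 0 := by
  rw [homComul_homMul]
  refine Finset.sum_eq_zero fun e _ => ?_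
  rw [sk.hom_eq_zero hl (h ≫ sk.out (Y ⊙ₗ S j) l' e), ← ModStr.actRight_apply, map_zero,
    Limits.comp_zero, TensorProduct.zero_tmul]

lemma homMul_homComul {X Y : C} {i j : V} (z : S i ⟶ (X ⊗ Y) ⊙ₗ S j) :
    ∑ l, TensorProduct.lift homMul (homComul sk l z) = z := by
  simp only [homComul_apply, map_sum, TensorProduct.lift.tmul, homMul_apply, Category.assoc]
  have h := congrArg (fun u => z ≫ (αₗ X Y (S j)).hom ≫ X ⊴ₗ u ≫ (αₗ X Y (S j)).inv)
    (sk.sum_out_inn (Y ⊙ₗ S j))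
  simp only [← ModStr.actRight_apply, map_sum, Preadditive.sum_comp, Preadditive.comp_sum] at h
  simp only [ModStr.actRight_apply, actionHomRight_comp, actionHomRight_id, Category.assoc,
    Category.id_comp, Iso.hom_inv_id, Category.comp_id] at h
  exact h

/-- The exchange of arrows and edges, from left to right. -/
noncomputable def homSwap {X : C} {i l h j : V} (a : i ⟶ l) (c : h ⟶ j) :
    (S l ⟶ X ⊙ₗ S j) →ₗ[k] (S i ⟶ X ⊙ₗ S h) :=
  Linear.rightComp k (S i) (δₗ F.functor X (S j) ≫ X ⊴ₗ sk.dual (fun h => b h j) h c) ∘ₗ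
    Linear.leftComp k _ (b i l a) ∘ₗ F.functor.mapLinearMap k

lemma homSwap_apply {X : C} {i l h j : V} (a : i ⟶ l) (c : h ⟶ j) (g : S l ⟶ X ⊙ₗ S j) :
    homSwap sk F b a c g = b i l a ≫ F.functor.map g ≫ δₗ F.functor X (S j) ≫
      X ⊴ₗ sk.dual (fun h => b h j) h c := by
  simp [homSwap, Linear.rightComp, Linear.leftComp]

/-- The exchange of arrows and edges, from right to left. -/
noncomputable def homSwap' {X : C} {i l h j : V} (a : i ⟶ l) (c : h ⟶ j) :
    (S i ⟶ X ⊙ₗ S h) →ₗ[k] (S l ⟶ X ⊙ₗ S j) :=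
  coeffF sk F b a (X ⊙ₗ S j) ∘ₗ Linear.rightComp k (S i) (X ⊴ₗ b h j c ≫ μₗ F.functor X (S j))

lemma homSwap'_apply {X : C} {i l h j : V} (a : i ⟶ l) (c : h ⟶ j) (g : S i ⟶ X ⊙ₗ S h) :
    homSwap' sk F b a c g =
      coeffF sk F b a (X ⊙ₗ S j) (g ≫ X ⊴ₗ b h j c ≫ μₗ F.functor X (S j)) := rfl

lemma sum_homSwap {X : C} {i l j : V} (a : i ⟶ l) (g : S l ⟶ X ⊙ₗ S j) :
    b i l a ≫ F.functor.map g ≫ δₗ F.functor X (S j) =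
      ∑ h, ∑ c : h ⟶ j, homSwap sk F b a c g ≫ X ⊴ₗ b h j c := by
  have e := congrArg (fun u => b i l a ≫ F.functor.map g ≫ δₗ F.functor X (S j) ≫
    X ⊴ₗ u) (sk.sum_dual fun h => b h j)
  simp only [← ModStr.actRight_apply, map_sum, Preadditive.comp_sum] at e
  simp only [ModStr.actRight_apply, actionHomRight_comp, actionHomRight_id, Category.comp_id] at e
  simp only [homSwap_apply, Category.assoc]
  exact e.symm

lemma sum_homSwap_homSwap' {X : C} {i h h' j : V} (c : h ⟶ j) (c' : h' ⟶ j)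
    (x : S i ⟶ X ⊙ₗ S h) : ∑ l, ∑ a : i ⟶ l, homSwap sk F b a c' (homSwap' sk F b a c x) =
      x ≫ X ⊴ₗ (b h j c ≫ sk.dual (fun h => b h j) h' c') := by
  have h := congrArg (fun y => y ≫ δₗ F.functor X (S j) ≫ X ⊴ₗ sk.dual (fun h => b h j) h' c')
    (sum_coeffF sk F b (x ≫ X ⊴ₗ b h j c ≫ μₗ F.functor X (S j)))
  simp only [Preadditive.sum_comp, Category.assoc] at h
  simp only [homSwap_apply, homSwap'_apply]
  rw [h]
  simp

lemma sum_homSwap'_homSwap {X : C} {i l l' j : V} (a : i ⟶ l) (a' : i ⟶ l')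
    (x : S l ⟶ X ⊙ₗ S j) : ∑ h, ∑ c : h ⟶ j, homSwap' sk F b a' c (homSwap sk F b a c x) =
      coeffF sk F b a' (X ⊙ₗ S j) (b i l a ≫ F.functor.map x) := by
  simp only [homSwap'_apply, ← map_sum]
  congr 1
  have h := congrArg (fun u => b i l a ≫ F.functor.map x ≫ δₗ F.functor X (S j) ≫ X ⊴ₗ u ≫
    μₗ F.functor X (S j)) (sk.sum_dual fun h => b h j)
  simp only [← ModStr.actRight_apply, map_sum, Preadditive.sum_comp, Preadditive.comp_sum] at h
  simp only [ModStr.actRight_apply, actionHomRight_comp, actionHomRight_id, Category.assoc,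
    Category.id_comp, Functor.LeftLinear.δₗ_comp_μₗ, Category.comp_id] at h
  simpa only [homSwap_apply, Category.assoc] using h

lemma homSwap_homMul {X Y : C} {i i' l h j : V} (a : i ⟶ i') (c : h ⟶ j) (x : S i' ⟶ X ⊙ₗ S l)
    (y : S l ⟶ Y ⊙ₗ S j) : homSwap sk F b a c (homMul x y) =
      ∑ l', ∑ d : l' ⟶ l, homMul (homSwap sk F b a d x) (homSwap sk F b d c y) := by
  have h := congrArg (fun u => b i i' a ≫ F.functor.map x ≫ δₗ F.functor X (S l) ≫
    X ⊴ₗ (u ≫ F.functor.map y ≫ δₗ F.functor Y (S j) ≫ Y ⊴ₗ sk.dual (fun h => b h j) h c) ≫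
      (αₗ X Y (S h)).inv) (sk.sum_dual fun h => b h l)
  simp only [← ModStr.actRight_apply, map_sum, Preadditive.sum_comp, Preadditive.comp_sum] at h
  simp only [ModStr.actRight_apply, actionHomRight_comp, Category.assoc, Category.id_comp] at h
  simp only [homSwap_apply, homMul_apply, Category.assoc, actionHomRight_comp]
  rw [h]
  simp only [F.functor.map_comp, Category.assoc]
  rw [← δₗ_naturality_right_assoc, ← δₗ_associativity_inv_assoc]
  simp

lemma homSwap_unit {i h l : V} (a : i ⟶ l) (c : h ⟶ l) :
    homSwap sk F b a c (λₗ (S l)).inv = b i l a ≫ sk.dual (fun h => b h l) h c ≫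
      (λₗ[C] (S h)).inv := by
  rw [homSwap_apply, ← δₗ_unitality_inv_assoc]
  simp

/-- The connection given by an object of the dual category. -/
noncomputable def connection : Connection C k V where
  Γ X i j := S i ⟶ X ⊙ₗ S j
  map {X Y} f {i j} := Linear.rightComp k (S i) (f ⊵ₗ S j)
  map_id x := by simp [Linear.rightComp]
  map_comp f g _ _ x := by simp [Linear.rightComp]
  map_add {X Y} f g i j x := by
    simp [Linear.rightComp, M.add_smulHom]
  map_smul c f i j x := by
    simp [Linear.rightComp, M.smul_smulHom]
  mul := homMul
  map_mul f g i l j x y := by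
    simp [homMul_apply, Linear.rightComp]
    rw [tensorHom_def', comp_actionHomLeft, whiskerLeft_actionHomLeft, whiskerRight_actionHomLeft,
      ← action_exchange_assoc, ← action_exchange_assoc]
    simp only [Category.assoc, Iso.inv_hom_id_assoc]
  mul_assoc x y z := by
    simp [homMul_apply, Linear.rightComp]
    rw [inv_comp_inv_comp_associator]
  unit i := (λₗ (S i)).inv
  unit_mul x := by
    simp [homMul_apply, Linear.rightComp]
  mul_unit x := by
    simp [homMul_apply, Linear.rightComp]
  comul := homComul sk
  comul_mul x y := homComul_homMul_self sk x y
  comul_mul_ne h x y := homComul_homMul_ne sk h x y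
  mul_comul z := homMul_homComul sk z
  counit i := sk.sc ∘ₗ Linear.rightComp k (S i) (λₗ (S i)).hom
  counit_unit i := by simp [Linear.rightComp, sk.sc_id]
  counit_smul {i} x := by
    rw [← cancel_mono (λₗ (S i)).hom, Linear.smul_comp, Iso.inv_hom_id]
    exact (sk.eq_smul _).symm
  eq_zero {i j} h x := by
    rw [← cancel_mono (λₗ (S j)).hom, Limits.zero_comp, sk.hom_eq_zero h (x ≫ _)]
  swap := homSwap sk F b
  swap' := homSwap' sk F b
  swap_swap'_self {_ X i h j} c c' x := by
    rw [sum_homSwap_homSwap', sk.comp_dual, Module.Basis.coord_apply, Module.Basis.repr_self,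
      Finsupp.single_apply, M.smulHom_smul, actionHomRight_id, Linear.comp_smul,
      Category.comp_id, ite_smul, one_smul, zero_smul]
    simp only [eq_comm]
  swap_swap'_ne hh c c' x := by
    rw [sum_homSwap_homSwap', sk.comp_dual_ne _ hh.symm, ← ModStr.actRight_apply, map_zero,
      Limits.comp_zero]
  swap'_swap_self a a' x := by
    rw [sum_homSwap'_homSwap, coeffF_self]
  swap'_swap_ne hl a a' x := by
    rw [sum_homSwap'_homSwap, coeffF_ne _ _ _ hl]
  swap_map f i l h j a c x := by
    simp [homSwap_apply, Linear.rightComp, action_exchange]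
  swap_mul a c x y := homSwap_homMul sk F b a c x y
  swap_unit_self {_ i l} a c := by
    rw [homSwap_unit, ← Category.assoc, sk.comp_dual, Module.Basis.coord_apply,
      Module.Basis.repr_self, Finsupp.single_apply, Linear.smul_comp, Category.id_comp, ite_smul,
      one_smul, zero_smul]
    simp only [eq_comm]
  swap_unit_ne hi a c := by
    rw [homSwap_unit, ← Category.assoc, sk.comp_dual_ne _ hi.symm, Limits.zero_comp]

/-- A basic action with connection `connection sk F b` is realized by `F`. -/
noncomputable def ofModels {n : ℕ} {hn : 2 ≤ n} {Φ : BasicAct C (quiverData k V hn)}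
    (m : Models Φ (connection sk F b)) : Rlz Φ F S fun i j a => b i j a where
  θ := m.θ
  natural f i j x x' h := m.natural f i j x x' h
  mul X Y i l j x x' t h := m.mul X Y i l j x x' t h
  unit i t h := m.unit i t h
  arrows X i l j a x x' h := (sum_homSwap sk F b a _).trans
    (Finset.sum_congr rfl fun h' _ => Finset.sum_congr rfl fun c _ =>
      congrArg (· ≫ X ⊴ₗ b h' j c) (m.swap X i l j a x x' h h' c).symm)

end Rlz

end BasicAction

namespace BasicAction

open Bimodule TruncatedPathAlgebra

lemma sum_sum_comm {ι ι' E : Type*} [Fintype ι] [Fintype ι'] [AddCommMonoid E] {κ : ι → Type*}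
    {κ' : ι' → Type*} [∀ i, Fintype (κ i)] [∀ i, Fintype (κ' i)]
    (f : ∀ i, κ i → ∀ j, κ' j → E) :
    ∑ i, ∑ a, ∑ j, ∑ b, f i a j b = ∑ j, ∑ b, ∑ i, ∑ a, f i a j b :=
  calc _ = ∑ p : Σ i, κ i, ∑ q : Σ j, κ' j, f p.1 p.2 q.1 q.2 := by
        simp only [Fintype.sum_sigma]
    _ = ∑ q : Σ j, κ' j, ∑ p : Σ i, κ i, f p.1 p.2 q.1 q.2 := Finset.sum_comm
    _ = _ := by simp only [Fintype.sum_sigma]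

namespace QBimodule

variable {k V : Type u} [Field k] [Quiver.{u} V] [Fintype V] [∀ i j : V, Fintype (i ⟶ j)] {n : ℕ}
  {hn : 2 ≤ n} {M : QBimodule (quiverData k V hn)}

lemma RightFrame.sum_coeff_cut (R : RightFrame M) {i j : V}
    (x : M.corner (vertex n i) (vertex n j)) :
    ∑ s, vertexCoeff hn j (R.ψ s x) • M.cut i j (R.x s) = x := by
  have h1 : ∀ s, (quiverData k V hn).p (R.ψ s x) = R.ψ s x := fun s => by
    rw [← R.ψ_p, (mem_corner.1 x.2).1]
  conv_rhs => rw [← cut_self x, ← (mem_corner.1 x.2).2.2, ← R.sum_eq x]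
  simp only [map_sum]
  refine Finset.sum_congr rfl fun s _ => ?_
  rw [r_r, eq_smul_of_p hn (h1 s), op_smul, map_smul, LinearMap.smul_apply, map_smul]
  congr 1
  apply Subtype.ext
  rw [cut_coe, cut_coe, M.p_r, quiverData_p_vertex, r_r, vertex_mul_self]

lemma RightFrame.finite_corner (R : RightFrame M) (i j : V) :
    Module.Finite k (M.corner (vertex n i) (vertex n j)) := by
  have h : Submodule.span k (Set.range fun s => M.cut i j (R.x s)) = ⊤ := by
    refine eq_top_iff.2 fun x _ => ?_
    rw [← R.sum_coeff_cut x]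
    exact Submodule.sum_mem _ fun s _ => Submodule.smul_mem _ _ (Submodule.subset_span ⟨s, rfl⟩)
  exact ⟨⟨(Set.finite_range _).toFinset, by simpa using h⟩⟩

lemma LeftFrame.coeff_arr [DecidableEq (QArrow V)] (R : LeftFrame M) (b b' : QArrow V)
    {g : M.carrier} (hg : M.p g = g) (hl : M.l (vertex n b'.2.1) g = g) :
    R.coeff b (M.l (arr n b') g) = if b' = b then g else 0 := by
  have h1 : ∀ s, (quiverData k V hn).p (R.φ s g) = R.φ s g := fun s => by rw [← R.φ_p, hg]
  have h0 : ∀ s, vertex n b'.2.1 * R.φ s g = R.φ s g := fun s => by rw [← R.φ_l, hl]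
  have h3 : ∀ s, R.φ s g = vertexCoeff hn b'.2.1 (R.φ s g) • vertex n b'.2.1 := fun s => by
    conv_lhs => rw [← h0, ← h1, quiverData_p_eq, Finset.mul_sum,
      Finset.sum_eq_single b'.2.1
        (fun w _ hw => by rw [mul_smul_comm, vertex_mul_ne hw.symm, smul_zero]) (by simp),
      mul_smul_comm, vertex_mul_self]
  have h2 : ∀ s, R.φ s (M.l (arr n b') g) = vertexCoeff hn b'.2.1 (R.φ s g) • arr n b' :=
    fun s => by
      rw [R.φ_l]
      conv_lhs => rw [h3 s]
      rw [mul_smul_comm, arr, arrow_mul_vertex]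
  rw [coeff_apply]
  simp only [h2, map_smul, arrowCoeff_arr]
  split_ifs with h
  · subst h
    conv_rhs => rw [← R.sum_eq g]
    refine Finset.sum_congr rfl fun s _ => ?_
    conv_rhs => rw [h3 s]
    rw [map_smul, smul_eq_mul, mul_one]; rfl
  · simp

lemma LeftFrame.expansion_unique (R : LeftFrame M) {i j : V}
    {x y : ∀ h, (i ⟶ h) → M.corner (vertex n h) (vertex n j)}
    (h : ∑ h, ∑ b : i ⟶ h, M.l (arrow n b) (x h b : M.carrier) =
      ∑ h, ∑ b : i ⟶ h, M.l (arrow n b) (y h b : M.carrier)) : x = y := by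
  classical
  have key : ∀ (x : ∀ h, (i ⟶ h) → M.corner (vertex n h) (vertex n j)) (l : V) (c : i ⟶ l),
      R.coeff ⟨i, l, c⟩ (∑ h, ∑ b : i ⟶ h, M.l (arrow n b) (x h b : M.carrier)) = x l c := by
    intro x l c
    have h1 : ∀ (h : V) (b : i ⟶ h), R.coeff ⟨i, l, c⟩ (M.l (arrow n b) (x h b)) =
        if (⟨i, h, b⟩ : QArrow V) = ⟨i, l, c⟩ then (x h b : M.carrier) else 0 := fun h b =>
      R.coeff_arr ⟨i, l, c⟩ ⟨i, h, b⟩ (mem_corner.1 (x h b).2).1 (mem_corner.1 (x h b).2).2.1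
    simp only [map_sum, h1]
    rw [Finset.sum_eq_single l, Finset.sum_eq_single c, if_pos rfl]
    · intro b _ hb
      rw [if_neg]
      intro h; cases h; exact hb rfl
    · simp
    · intro h _ hh
      refine Finset.sum_eq_zero fun b _ => if_neg ?_
      intro h; cases h; exact hh rfl
    · simp
  funext l c
  apply Subtype.ext
  rw [← key x, h, key y]

end QBimodule

namespace BasicAct

variable {C : Type w} [Category.{v} C] [Preadditive C] [MonoidalCategory C]

section General

variable {k A : Type u} [Field k] [Linear k C] [Ring A] [Algebra k A] {D : QuiverData k A}
variable (Φ : BasicAct C D)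

lemma δ_mul {X Y : C} (m : (Φ.bim X).carrier) (n : (Φ.bim Y).carrier) :
    QBimodule.Hom.lin (Functor.OplaxMonoidal.δ Φ.functor X Y).hom (Φ.mul m n) = tmk m n :=
  congrArg (fun h => QBimodule.Hom.lin h.hom (tmk m n)) (Functor.Monoidal.μ_δ Φ.functor X Y)

lemma mul_span {X Y : C} (S : Submodule k (Φ.bim (X ⊗ Y)).carrier) (h : ∀ m n, Φ.mul m n ∈ S)
    (z : (Φ.bim (X ⊗ Y)).carrier) : z ∈ S := by
  have h1 : QBimodule.Hom.lin (Functor.LaxMonoidal.μ Φ.functor X Y).hom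
      (QBimodule.Hom.lin (Functor.OplaxMonoidal.δ Φ.functor X Y).hom z) = z :=
    congrArg (fun h => QBimodule.Hom.lin h.hom z) (Functor.Monoidal.δ_μ Φ.functor X Y)
  rw [← h1]
  exact tensor_span _ _ (S.comap (QBimodule.Hom.lin (Functor.LaxMonoidal.μ Φ.functor X Y).hom)) h _

/-- The inverse of the unit of a basic action, as a linear map. -/
def unitInv : (Φ.bim (𝟙_ C)).carrier →ₗ[k] A :=
  QBimodule.Hom.lin (Functor.OplaxMonoidal.η Φ.functor).hom

lemma unitInv_unit (a : A) : Φ.unitInv (Φ.unit a) = a :=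
  congrArg (fun h => QBimodule.Hom.lin h.hom a) (Functor.Monoidal.ε_η Φ.functor)

lemma unit_unitInv (m : (Φ.bim (𝟙_ C)).carrier) : Φ.unit (Φ.unitInv m) = m :=
  congrArg (fun h : Φ.functor.obj (𝟙_ C) ⟶ Φ.functor.obj (𝟙_ C) => QBimodule.Hom.lin h.hom m)
    (Functor.Monoidal.η_ε Φ.functor)

variable {Φ}

/-- The map `m n ↦ ψ(m) n` for a coefficient map `ψ` of a frame. -/
def contract {X : C} (R : (Φ.bim X).RightFrame) (Y : C) (s : R.ι) :
    (Φ.bim (X ⊗ Y)).carrier →ₗ[k] (Φ.bim Y).carrier :=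
  tlift ((Φ.bim Y).l.toLinearMap ∘ₗ R.ψ s) (fun m a n => by
    simp only [LinearMap.comp_apply, R.ψ_r, AlgHom.toLinearMap_apply, l_l]) ∘ₗ
    QBimodule.Hom.lin (Functor.OplaxMonoidal.δ Φ.functor X Y).hom

lemma contract_mul {X Y : C} (R : (Φ.bim X).RightFrame) (s : R.ι) (m : (Φ.bim X).carrier)
    (n : (Φ.bim Y).carrier) : contract R Y s (Φ.mul m n) = (Φ.bim Y).l (R.ψ s m) n := by
  rw [contract, LinearMap.comp_apply, δ_mul, tlift_tmk]; rfl

lemma sum_mul_contract {X Y : C} (R : (Φ.bim X).RightFrame) (z : (Φ.bim (X ⊗ Y)).carrier) :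
    ∑ s, Φ.mul (R.x s) (contract R Y s z) = z := by
  have := Φ.mul_span (LinearMap.eqLocus (∑ s, Φ.mulₗ X Y (R.x s) ∘ₗ contract R Y s) LinearMap.id)
    (fun m n => by
      rw [LinearMap.mem_eqLocus, LinearMap.sum_apply, LinearMap.id_apply]
      simp only [LinearMap.comp_apply, contract_mul, mulₗ_apply, ← mul_r_l]
      simp only [← mulₗ_apply]
      rw [← LinearMap.sum_apply, ← map_sum, R.sum_eq]) z
  rw [LinearMap.mem_eqLocus, LinearMap.sum_apply] at this
  exact this

end General

variable {k V : Type u} [Field k] [Linear k C] [Quiver.{u} V] [Fintype V]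
  [∀ i j : V, Fintype (i ⟶ j)] {n : ℕ} {hn : 2 ≤ n} (Φ : BasicAct C (quiverData k V hn)) {X Y : C}

lemma cut_mul (i j : V) (m : (Φ.bim X).carrier) (m' : (Φ.bim Y).carrier) :
    ((Φ.bim (X ⊗ Y)).cut i j (Φ.mul m m') : (Φ.bim (X ⊗ Y)).carrier) =
      ∑ l, Φ.mul ((Φ.bim X).cut i l m : (Φ.bim X).carrier) ((Φ.bim Y).cut l j m') := by
  have h : ∀ l, Φ.mul ((Φ.bim X).cut i l m : (Φ.bim X).carrier) ((Φ.bim Y).cut l j m') =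
      Φ.mulₗ X Y ((Φ.bim X).l (vertex n i) ((Φ.bim X).p m)) ((Φ.bim Y).l (vertex n l)
        ((Φ.bim Y).r (op (vertex n j)) ((Φ.bim Y).p m'))) := fun l => by
    rw [QBimodule.cut_coe, QBimodule.cut_coe, (Φ.bim X).comm, mul_r_l, l_l, vertex_mul_self]; rfl
  simp only [h, ← map_sum, QBimodule.sum_l_vertex]
  rw [QBimodule.cut_coe, p_mul, mulₗ_apply, mul_l, mul_r]

/-- The action of morphisms on edges. -/
noncomputable def edgeMap (f : X ⟶ Y) (i j : V) : Φ.edges X i j →ₗ[k] Φ.edges Y i j :=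
  LinearMap.restrict (Φ.map f) fun m hm => Φ.map_mem_edges f ⟨m, hm⟩

lemma edgeMap_coe (f : X ⟶ Y) {i j : V} (m : Φ.edges X i j) :
    (Φ.edgeMap f i j m : (Φ.bim Y).carrier) = Φ.map f m := rfl

/-- The composition of edges. -/
noncomputable def edgeMul (X Y : C) (i l j : V) :
    Φ.edges X i l →ₗ[k] Φ.edges Y l j →ₗ[k] Φ.edges (X ⊗ Y) i j :=
  LinearMap.mk₂ k (fun m m' => ⟨Φ.mul m.1 m'.1, Φ.mul_mem_edges m m'⟩)
    (fun _ _ _ => Subtype.ext (by simp [← mulₗ_apply]))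
    (fun _ _ _ => Subtype.ext (by simp [← mulₗ_apply]))
    (fun _ _ _ => Subtype.ext (by simp [← mulₗ_apply]))
    (fun _ _ _ => Subtype.ext (by simp [← mulₗ_apply]))

lemma edgeMul_coe {i l j : V} (m : Φ.edges X i l) (m' : Φ.edges Y l j) :
    (Φ.edgeMul X Y i l j m m' : (Φ.bim (X ⊗ Y)).carrier) = Φ.mul m.1 m'.1 := rfl

section

variable {Φ}

/-- The decomposition of edges. -/
noncomputable def edgeComul (R : (Φ.bim X).RightFrame) (Y : C) (i j l : V) :
    Φ.edges (X ⊗ Y) i j →ₗ[k] Φ.edges X i l ⊗[k] Φ.edges Y l j :=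
  ∑ s, TensorProduct.mk k _ _ ((Φ.bim X).cut i l (R.x s)) ∘ₗ (Φ.bim Y).cut l j ∘ₗ
    contract R Y s ∘ₗ Submodule.subtype _

lemma edgeComul_apply (R : (Φ.bim X).RightFrame) {i j : V} (l : V) (z : Φ.edges (X ⊗ Y) i j) :
    edgeComul R Y i j l z =
      ∑ s, (Φ.bim X).cut i l (R.x s) ⊗ₜ (Φ.bim Y).cut l j (contract R Y s z) := by
  simp only [edgeComul, LinearMap.sum_apply]; rfl

lemma contract_edgeMul (R : (Φ.bim X).RightFrame) {i l j : V} (m : Φ.edges X i l)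
    (m' : Φ.edges Y l j) (s : R.ι) : contract R Y s (Φ.edgeMul X Y i l j m m') =
      vertexCoeff hn l (R.ψ s m) • (m' : (Φ.bim Y).carrier) := by
  have h1 : (quiverData k V hn).p (R.ψ s m) = R.ψ s m := by
    rw [← R.ψ_p, (QBimodule.mem_corner.1 m.2).1]
  have h2 := (QBimodule.mem_corner.1 m'.2).2.1
  rw [edgeMul_coe, contract_mul, ← h2, l_l, eq_smul_of_p hn h1, map_smul, LinearMap.smul_apply, h2]

lemma edgeComul_edgeMul (R : (Φ.bim X).RightFrame) {i l j : V} (m : Φ.edges X i l)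
    (m' : Φ.edges Y l j) : edgeComul R Y i j l (Φ.edgeMul X Y i l j m m') = m ⊗ₜ m' := by
  conv_rhs => rw [← R.sum_coeff_cut m]
  rw [edgeComul_apply, TensorProduct.sum_tmul]
  refine Finset.sum_congr rfl fun s _ => ?_
  rw [contract_edgeMul, map_smul, QBimodule.cut_self, TensorProduct.smul_tmul]

lemma edgeComul_edgeMul_ne (R : (Φ.bim X).RightFrame) {i l j l' : V} (h : l ≠ l')
    (m : Φ.edges X i l) (m' : Φ.edges Y l j) :
    edgeComul R Y i j l' (Φ.edgeMul X Y i l j m m') = 0 := by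
  rw [edgeComul_apply]
  refine Finset.sum_eq_zero fun s _ => ?_
  rw [contract_edgeMul, map_smul, QBimodule.cut_ne_left h.symm, smul_zero, TensorProduct.tmul_zero]

lemma edgeMul_edgeComul (R : (Φ.bim X).RightFrame) {i j : V} (z : Φ.edges (X ⊗ Y) i j) :
    ∑ l, TensorProduct.lift (Φ.edgeMul X Y i l j) (edgeComul R Y i j l z) = z := by
  conv_rhs => rw [← QBimodule.cut_self z, ← sum_mul_contract R (z : (Φ.bim (X ⊗ Y)).carrier)]
  simp only [edgeComul_apply, map_sum, TensorProduct.lift.tmul]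
  rw [Finset.sum_comm]
  refine Finset.sum_congr rfl fun s _ => Subtype.ext ?_
  rw [cut_mul, Submodule.coe_sum]
  rfl

end

lemma cut_unit (i j : V) (a : TruncatedPathAlgebra k V n) :
    ((Φ.bim (𝟙_ C)).cut i j (Φ.unit a) : (Φ.bim (𝟙_ C)).carrier) =
      vertexCoeff hn j ((quiverData k V hn).p a) • Φ.unit (vertex n i * vertex n j) := by
  rw [QBimodule.cut_coe, p_unit, ← unit_r, ← unit_l,
    eq_smul_of_p hn ((quiverData k V hn).p_p a), mul_smul_comm, ← unitₗ_apply, map_smul, unitₗ_apply]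

/-- The coefficient of the unit. -/
noncomputable def edgeCounit (i : V) : Φ.edges (𝟙_ C) i i →ₗ[k] k :=
  (vertexCoeff hn i).toLinearMap ∘ₗ (quiverData k V hn).p ∘ₗ Φ.unitInv ∘ₗ Submodule.subtype _

lemma edgeCounit_apply {i : V} (x : Φ.edges (𝟙_ C) i i) :
    Φ.edgeCounit i x = vertexCoeff hn i ((quiverData k V hn).p (Φ.unitInv x)) := rfl

lemma finite_edges (X : C) (i j : V) : Module.Finite k (Φ.edges X i j) :=
  (Φ.exists_rightFrame X).some.finite_corner i j

lemma expansion_unique' {i j : V} {x y : ∀ h, (i ⟶ h) → Φ.edges X h j}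
    (h : ∑ h, ∑ b : i ⟶ h, (Φ.bim X).l (arrow n b) (x h b : (Φ.bim X).carrier) =
      ∑ h, ∑ b : i ⟶ h, (Φ.bim X).l (arrow n b) (y h b : (Φ.bim X).carrier)) : x = y :=
  (Φ.exists_leftFrame X).some.expansion_unique h

/-- The exchange of arrows and edges, from left to right. -/
noncomputable def edgeSwap (X : C) {i l h j : V} (a : i ⟶ l) (b : h ⟶ j) :
    Φ.edges X l j →ₗ[k] Φ.edges X i h where
  toFun g := (Φ.exists_expansion a g).choose h b
  map_add' g g' := by
    refine congrFun (congrFun (Φ.expansion_unique (y := fun h b =>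
      (Φ.exists_expansion a g).choose h b + (Φ.exists_expansion a g').choose h b) ?_) h) b
    rw [← (Φ.exists_expansion a (g + g')).choose_spec]
    simp only [Submodule.coe_add, map_add, Finset.sum_add_distrib,
      ← (Φ.exists_expansion a g).choose_spec, ← (Φ.exists_expansion a g').choose_spec]
  map_smul' c g := by
    refine congrFun (congrFun (Φ.expansion_unique (y := fun h b =>
      c • (Φ.exists_expansion a g).choose h b) ?_) h) b
    rw [← (Φ.exists_expansion a (c • g)).choose_spec]
    simp only [Submodule.coe_smul, map_smul, ← Finset.smul_sum,
      ← (Φ.exists_expansion a g).choose_spec]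

lemma sum_edgeSwap {i l j : V} (a : i ⟶ l) (g : Φ.edges X l j) :
    (Φ.bim X).l (arrow n a) g =
      ∑ h, ∑ b : h ⟶ j, (Φ.bim X).r (op (arrow n b)) (Φ.edgeSwap X a b g) :=
  (Φ.exists_expansion a g).choose_spec

/-- The exchange of arrows and edges, from right to left. -/
noncomputable def edgeSwap' (X : C) {i l h j : V} (a : i ⟶ l) (b : h ⟶ j) :
    Φ.edges X i h →ₗ[k] Φ.edges X l j where
  toFun g := (Φ.exists_expansion' b g).choose l a
  map_add' g g' := by
    refine congrFun (congrFun (Φ.expansion_unique' (y := fun l a =>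
      (Φ.exists_expansion' b g).choose l a + (Φ.exists_expansion' b g').choose l a) ?_) l) a
    rw [← (Φ.exists_expansion' b (g + g')).choose_spec]
    simp only [Submodule.coe_add, map_add, Finset.sum_add_distrib,
      ← (Φ.exists_expansion' b g).choose_spec, ← (Φ.exists_expansion' b g').choose_spec]
  map_smul' c g := by
    refine congrFun (congrFun (Φ.expansion_unique' (y := fun l a =>
      c • (Φ.exists_expansion' b g).choose l a) ?_) l) a
    rw [← (Φ.exists_expansion' b (c • g)).choose_spec]
    simp only [Submodule.coe_smul, map_smul, ← Finset.smul_sum,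
      ← (Φ.exists_expansion' b g).choose_spec]

lemma sum_edgeSwap' {i h j : V} (b : h ⟶ j) (g : Φ.edges X i h) :
    (Φ.bim X).r (op (arrow n b)) g =
      ∑ l, ∑ a : i ⟶ l, (Φ.bim X).l (arrow n a) (Φ.edgeSwap' X a b g) :=
  (Φ.exists_expansion' b g).choose_spec

variable {Φ}

lemma edgeSwap_eq {i l j : V} {a : i ⟶ l} {g : Φ.edges X l j} {x : ∀ h, (h ⟶ j) → Φ.edges X i h}
    (e : (Φ.bim X).l (arrow n a) g = ∑ h, ∑ b : h ⟶ j, (Φ.bim X).r (op (arrow n b)) (x h b))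
    {h : V} (b : h ⟶ j) : Φ.edgeSwap X a b g = x h b :=
  congrFun (congrFun (Φ.expansion_unique (x := fun _ b => Φ.edgeSwap X a b g) (y := x)
    ((Φ.sum_edgeSwap a g).symm.trans e)) h) b

lemma sum_edgeSwap_edgeSwap' {i j h h' : V} (b : h ⟶ j) (b' : h' ⟶ j) (g : Φ.edges X i h)
    {y : ∀ h, (h ⟶ j) → Φ.edges X i h}
    (hy : (Φ.bim X).r (op (arrow n b)) g =
      ∑ h, ∑ b : h ⟶ j, (Φ.bim X).r (op (arrow n b)) (y h b : (Φ.bim X).carrier)) :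
    ∑ l, ∑ a : i ⟶ l, Φ.edgeSwap X a b' (Φ.edgeSwap' X a b g) = y h' b' := by
  refine congrFun (congrFun (Φ.expansion_unique (x := fun h' b' =>
    ∑ l, ∑ a : i ⟶ l, Φ.edgeSwap X a b' (Φ.edgeSwap' X a b g)) (y := y) ?_) h') b'
  rw [← hy, sum_edgeSwap']
  simp only [sum_edgeSwap, Submodule.coe_sum, map_sum]
  exact sum_sum_comm _

lemma sum_edgeSwap'_edgeSwap {i l l' j : V} (a : i ⟶ l) (a' : i ⟶ l') (g : Φ.edges X l j)
    {y : ∀ l, (i ⟶ l) → Φ.edges X l j}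
    (hy : (Φ.bim X).l (arrow n a) g =
      ∑ l, ∑ a : i ⟶ l, (Φ.bim X).l (arrow n a) (y l a : (Φ.bim X).carrier)) :
    ∑ h, ∑ b : h ⟶ j, Φ.edgeSwap' X a' b (Φ.edgeSwap X a b g) = y l' a' := by
  refine congrFun (congrFun (Φ.expansion_unique' (x := fun l' a' =>
    ∑ h, ∑ b : h ⟶ j, Φ.edgeSwap' X a' b (Φ.edgeSwap X a b g)) (y := y) ?_) l') a'
  rw [← hy, sum_edgeSwap]
  simp only [sum_edgeSwap', Submodule.coe_sum, map_sum]
  exact sum_sum_comm _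

lemma sum_r_single [DecidableEq V] [∀ i j : V, DecidableEq (i ⟶ j)] {i h j : V} (b : h ⟶ j)
    (x : Φ.edges X i h) : ∑ h', ∑ b' : h' ⟶ j, (Φ.bim X).r (op (arrow n b'))
      ((Pi.single h (Pi.single b x) : ∀ h, (h ⟶ j) → Φ.edges X i h) h' b' : (Φ.bim X).carrier) =
    (Φ.bim X).r (op (arrow n b)) x := by
  rw [Finset.sum_eq_single h, Finset.sum_eq_single b, Pi.single_eq_same, Pi.single_eq_same]
  · intro b' _ hb
    rw [Pi.single_eq_same, Pi.single_eq_of_ne hb, Submodule.coe_zero, map_zero]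
  · simp
  · intro h' _ hh
    rw [Pi.single_eq_of_ne hh]
    exact Finset.sum_eq_zero fun _ _ => map_zero _
  · simp

lemma sum_l_single [DecidableEq V] [∀ i j : V, DecidableEq (i ⟶ j)] {i l j : V} (a : i ⟶ l)
    (x : Φ.edges X l j) : ∑ l', ∑ a' : i ⟶ l', (Φ.bim X).l (arrow n a')
      ((Pi.single l (Pi.single a x) : ∀ l, (i ⟶ l) → Φ.edges X l j) l' a' : (Φ.bim X).carrier) =
    (Φ.bim X).l (arrow n a) x := by
  rw [Finset.sum_eq_single l, Finset.sum_eq_single a, Pi.single_eq_same, Pi.single_eq_same]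
  · intro b' _ hb
    rw [Pi.single_eq_same, Pi.single_eq_of_ne hb, Submodule.coe_zero, map_zero]
  · simp
  · intro h' _ hh
    rw [Pi.single_eq_of_ne hh]
    exact Finset.sum_eq_zero fun _ _ => map_zero _
  · simp

variable (Φ) in
lemma l_arrow_unit [DecidableEq V] [∀ i j : V, DecidableEq (i ⟶ j)] {i l : V} (a : i ⟶ l) :
    (Φ.bim (𝟙_ C)).l (arrow n a) (⟨Φ.unit (vertex n l), Φ.unit_mem_edges l⟩ : Φ.edges (𝟙_ C) l l) =
      ∑ h', ∑ b' : h' ⟶ l, (Φ.bim (𝟙_ C)).r (op (arrow n b'))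
        ((Pi.single i (Pi.single a ⟨Φ.unit (vertex n i), Φ.unit_mem_edges i⟩) :
          ∀ h, (h ⟶ l) → Φ.edges (𝟙_ C) i h) h' b' : (Φ.bim (𝟙_ C)).carrier) := by
  rw [sum_r_single, ← unit_l, ← unit_r, arrow_mul_vertex, vertex_mul_arrow]

/-- The connection given by the edges of a basic action. -/
noncomputable def connection (Φ : BasicAct C (quiverData k V hn)) : Connection C k V where
  Γ X i j := Φ.edges X i j
  map {_ _} f {i j} := Φ.edgeMap f i j
  map_id x := Subtype.ext (Φ.map_id _)
  map_comp f g _ _ x := Subtype.ext (Φ.map_comp f g _)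
  map_add f g _ _ x := Subtype.ext (Φ.map_add' f g _)
  map_smul c f _ _ x := Subtype.ext (Φ.map_smul' c f _)
  mul {X Y i l j} := Φ.edgeMul X Y i l j
  map_mul f g _ _ _ x y := Subtype.ext (Φ.map_mul f g _ _)
  mul_assoc x y z := Subtype.ext (Φ.mul_assoc _ _ _)
  unit i := ⟨Φ.unit (vertex n i), Φ.unit_mem_edges i⟩
  unit_mul x := Subtype.ext ((Φ.unit_mul _ _).trans (QBimodule.mem_corner.1 x.2).2.1)
  mul_unit x := Subtype.ext ((Φ.mul_unit _ _).trans (QBimodule.mem_corner.1 x.2).2.2)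
  comul {X Y i j} l := edgeComul (Φ.exists_rightFrame X).some Y i j l
  comul_mul x y := edgeComul_edgeMul _ x y
  comul_mul_ne h x y := edgeComul_edgeMul_ne _ h x y
  mul_comul z := edgeMul_edgeComul _ z
  counit i := Φ.edgeCounit i
  counit_unit i := by
    classical
    rw [edgeCounit_apply, unitInv_unit, quiverData_p_vertex, vertexCoeff_vertex, if_pos rfl]
  counit_smul {i} x := by
    have h := Φ.cut_unit i i (Φ.unitInv x)
    rw [unit_unitInv, QBimodule.cut_self, vertex_mul_self] at h
    exact Subtype.ext h.symm
  eq_zero {i j} hij x := by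
    have h := Φ.cut_unit i j (Φ.unitInv x)
    rw [unit_unitInv, QBimodule.cut_self, vertex_mul_ne hij, ← unitₗ_apply, map_zero,
      smul_zero] at h
    exact Subtype.ext h
  swap {X _ _ _ _} a b := Φ.edgeSwap X a b
  swap' {X _ _ _ _} a b := Φ.edgeSwap' X a b
  swap_swap'_self {_ X i h j} b b' x := by
    classical
    rw [sum_edgeSwap_edgeSwap' b b' x (sum_r_single b x).symm, Pi.single_eq_same, Pi.single_apply]
  swap_swap'_ne {X i h h' j} hh b b' x := by
    classical
    rw [sum_edgeSwap_edgeSwap' b b' x (sum_r_single b x).symm, Pi.single_eq_of_ne hh, Pi.zero_apply]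
  swap'_swap_self {_ X i l j} a a' x := by
    classical
    rw [sum_edgeSwap'_edgeSwap a a' x (sum_l_single a x).symm, Pi.single_eq_same, Pi.single_apply]
  swap'_swap_ne {X i l l' j} hl a a' x := by
    classical
    rw [sum_edgeSwap'_edgeSwap a a' x (sum_l_single a x).symm, Pi.single_eq_of_ne hl, Pi.zero_apply]
  swap_map f _ _ _ _ a b x := by
    refine edgeSwap_eq (x := fun h b => Φ.edgeMap f _ _ (Φ.edgeSwap _ a b x)) ?_ b
    simp only [edgeMap_coe, ← map_r, ← map_sum, ← sum_edgeSwap]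
    rw [map_l]
  swap_mul {X Y i i' l h j} a c x y := by
    refine edgeSwap_eq (x := fun h c => ∑ l', ∑ b : l' ⟶ l, Φ.edgeMul X Y _ _ _
      (Φ.edgeSwap _ a b x) (Φ.edgeSwap _ b c y)) ?_ c
    simp only [Submodule.coe_sum, map_sum, edgeMul_coe, ← mul_r]
    rw [sum_sum_comm, ← mul_l, sum_edgeSwap]
    simp only [← mulₗ_apply, map_sum, LinearMap.sum_apply]
    refine Finset.sum_congr rfl fun l' _ => Finset.sum_congr rfl fun b _ => ?_
    rw [mulₗ_apply, mul_r_l, sum_edgeSwap]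
    simp only [← mulₗ_apply, map_sum]
  swap_unit_self {_ i l} a b := by
    classical
    rw [edgeSwap_eq (Φ.l_arrow_unit a), Pi.single_eq_same, Pi.single_apply]
  swap_unit_ne hi a b := by
    classical
    rw [edgeSwap_eq (Φ.l_arrow_unit a), Pi.single_eq_of_ne hi, Pi.zero_apply]

end BasicAct

end BasicAction

namespace BasicAction

open TruncatedPathAlgebra

section

variable {C : Type w} [Category.{v} C] [Preadditive C] [MonoidalCategory C]
variable {k V : Type u} [Field k] [Linear k C] [Quiver.{u} V] [Fintype V]
  [∀ i j : V, Fintype (i ⟶ j)] {n : ℕ} {hn : 2 ≤ n}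

/-- A basic action has the connection given by its edges. -/
noncomputable def BasicAct.models (Φ : BasicAct C (quiverData k V hn)) :
    Models Φ Φ.connection where
  θ _ _ _ := LinearEquiv.refl k _
  natural _ _ _ _ _ h := Subtype.ext h
  mul _ _ _ _ _ _ _ _ h := Subtype.ext h
  unit _ _ h := Subtype.ext h
  swap _ _ _ _ _ _ _ h _ b := (BasicAct.edgeSwap_eq h b).symm

end

namespace Vec

variable {k V : Type u} [Field k] [Fintype V] (B : V → V → Type u) [∀ i j, AddCommGroup (B i j)]
  [∀ i j, Module k (B i j)] [∀ i j, Module.Finite k (B i j)]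

/-- The value of the functor given by a matrix of vector spaces. -/
noncomputable def kernelObj (W : Vec k V) : Vec k V :=
  Discrete.functor fun i => FGModuleCat.of k (∀ j, B i j ⊗[k] W.obj ⟨j⟩)

/-- The functor given by a matrix of vector spaces. -/
noncomputable def kernel : Vec k V ⥤ Vec k V where
  obj W := kernelObj B W
  map {U W} f := homMk fun i => LinearMap.pi (φ := fun j => B i j ⊗[k] W.obj ⟨j⟩) fun j =>
    (lin f j).lTensor (B i j) ∘ₗ LinearMap.proj (φ := fun j => B i j ⊗[k] U.obj ⟨j⟩) j
  map_id W := hom_ext fun i (x : ∀ j, B i j ⊗[k] W.obj ⟨j⟩) => funext fun j => by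
    change (lin (𝟙 W) j).lTensor (B i j) (x j) = x j
    rw [lin_id, LinearMap.lTensor_id, LinearMap.id_apply]
  map_comp {U W Z} f g := hom_ext fun i (x : ∀ j, B i j ⊗[k] U.obj ⟨j⟩) => funext fun j => by
    change (lin (f ≫ g) j).lTensor (B i j) (x j) =
      (lin g j).lTensor (B i j) ((lin f j).lTensor (B i j) (x j))
    rw [lin_comp, LinearMap.lTensor_comp, LinearMap.comp_apply]

instance : (kernel (k := k) B).Additive := ⟨fun {U W f g} =>
  hom_ext fun i (x : ∀ j, B i j ⊗[k] U.obj ⟨j⟩) => funext fun j => by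
    change (lin (f + g) j).lTensor (B i j) (x j) =
      (lin f j).lTensor (B i j) (x j) + (lin g j).lTensor (B i j) (x j)
    rw [lin_add, LinearMap.lTensor_add, LinearMap.add_apply]⟩

instance : (kernel (k := k) B).Linear k := ⟨fun {U W} f c =>
  hom_ext fun i (x : ∀ j, B i j ⊗[k] U.obj ⟨j⟩) => funext fun j => by
    change (lin (c • f) j).lTensor (B i j) (x j) = c • (lin f j).lTensor (B i j) (x j)
    rw [lin_smul, LinearMap.lTensor_smul, LinearMap.smul_apply]⟩

/-- The fibre of a simple object is one-dimensional. -/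
noncomputable def tensorFibre (E : Type u) [AddCommGroup E] [Module k E] (j : V) :
    E ⊗[k] (simple (k := k) j).obj ⟨j⟩ →ₗ[k] E :=
  TensorProduct.lift (LinearMap.mk₂ k (fun b (x : PLift (j = j) → k) => x ⟨rfl⟩ • b)
    (fun _ _ _ => smul_add _ _ _) (fun _ _ _ => smul_comm _ _ _) (fun _ _ _ => add_smul _ _ _)
    (fun _ _ _ => mul_smul _ _ _))

lemma tensorFibre_tmul_one {E : Type u} [AddCommGroup E] [Module k E] {j : V} (b : E) :
    tensorFibre E j (b ⊗ₜ[k] one (k := k) j) = b := one_smul k b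

lemma tensorFibre_tmul {E : Type u} [AddCommGroup E] [Module k E] {j : V}
    (t : E ⊗[k] (simple (k := k) j).obj ⟨j⟩) : tensorFibre E j t ⊗ₜ one j = t := by
  induction t with
  | zero => rw [map_zero, TensorProduct.zero_tmul]
  | tmul b x =>
    rw [eq_smul_one x, TensorProduct.tmul_smul, map_smul, tensorFibre_tmul_one,
      TensorProduct.smul_tmul']
  | add s t hs ht => rw [map_add, TensorProduct.add_tmul, hs, ht]

open Classical in
/-- The value on a simple object of the functor given by a matrix of vector spaces. -/
noncomputable def kernelFibre (i j : V) :
    B i j ≃ₗ[k] ∀ l, B i l ⊗[k] (simple (k := k) j).obj ⟨l⟩ :=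
  LinearEquiv.ofLinearMap
    (LinearMap.single k (fun l => B i l ⊗[k] (simple (k := k) j).obj ⟨l⟩) j ∘ₗ
      (TensorProduct.mk k (B i j) ((simple (k := k) j).obj ⟨j⟩)).flip (one j))
    (tensorFibre (B i j) j ∘ₗ
      LinearMap.proj (φ := fun l => B i l ⊗[k] (simple (k := k) j).obj ⟨l⟩) j)
    (LinearMap.ext fun x => funext fun l => by
      by_cases h : j = l
      · subst h
        exact (Pi.single_eq_same j _).trans (tensorFibre_tmul (x j))
      · have h0 : ∀ t : B i l ⊗[k] (simple (k := k) j).obj ⟨l⟩, t = 0 := fun t => by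
          induction t with
          | zero => rfl
          | tmul b x => rw [eq_zero_of_ne h x, TensorProduct.tmul_zero]
          | add s t hs ht => rw [hs, ht, add_zero]
        exact (h0 _).trans (h0 _).symm)
    (LinearMap.ext fun b => by
      refine Eq.trans (congrArg (tensorFibre (B i j) j) (Pi.single_eq_same j _)) ?_
      exact tensorFibre_tmul_one b)

/-- The morphisms between simple objects to the functor given by a matrix of vector spaces. -/
noncomputable def kernelEquiv (i j : V) :
    B i j ≃ₗ[k] (simple (k := k) i ⟶ (kernel B).obj (simple j)) :=
  (kernelFibre B i j).trans (elemEquiv ((kernel B).obj (simple j)) i)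

end Vec

end BasicAction

namespace BasicAction

namespace Connection

variable {C : Type w} [Category.{v} C] [Preadditive C] [MonoidalCategory C]
variable {k V : Type u} [Field k] [Linear k C] [Quiver.{u} V] [Fintype V]
  [∀ i j : V, Fintype (i ⟶ j)] (G : Connection C k V)
  {𝒟 : Type*} [Category.{u} 𝒟] [Preadditive 𝒟] [Linear k 𝒟] {S : V → 𝒟} (sk : Skeleton k S)
  {T : C → 𝒟 ⥤ 𝒟} [∀ X, (T X).Additive] [∀ X, (T X).Linear k]
  (θ : ∀ X i j, G.Γ X i j ≃ₗ[k] (S i ⟶ (T X).obj (S j)))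

/-- The morphism `S i ⟶ T X W` given by an edge `i → j` and a morphism `S j ⟶ W`. -/
noncomputable def el (X : C) (W : 𝒟) (i j : V) :
    G.Γ X i j →ₗ[k] (S j ⟶ W) →ₗ[k] (S i ⟶ (T X).obj W) :=
  LinearMap.mk₂ k (fun x u => θ X i j x ≫ (T X).map u)
    (fun _ _ _ => by simp) (fun _ _ _ => by simp) (fun _ _ _ => by simp) (fun _ _ _ => by simp)

lemma el_apply {X : C} {W : 𝒟} {i j : V} (x : G.Γ X i j) (u : S j ⟶ W) :
    G.el θ X W i j x u = θ X i j x ≫ (T X).map u := rfl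

lemma el_id {X : C} {i j : V} (x : G.Γ X i j) : G.el θ X (S j) i j x (𝟙 _) = θ X i j x := by
  rw [el_apply, CategoryTheory.Functor.map_id, Category.comp_id]

lemma el_comp {X : C} {W Z : 𝒟} {i j : V} (x : G.Γ X i j) (u : S j ⟶ W) (f : W ⟶ Z) :
    G.el θ X W i j x u ≫ (T X).map f = G.el θ X Z i j x (u ≫ f) := by
  rw [el_apply, el_apply, Category.assoc, Functor.map_comp]

lemma el_comp_assoc {X : C} {W Z : 𝒟} {i j : V} (x : G.Γ X i j) (u : S j ⟶ W) (f : W ⟶ Z)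
    {Z' : 𝒟} (h : (T X).obj Z ⟶ Z') :
    G.el θ X W i j x u ≫ (T X).map f ≫ h = G.el θ X Z i j x (u ≫ f) ≫ h := by
  rw [← Category.assoc, el_comp]

lemma el_span (sk : Skeleton k S) {X : C} {W : 𝒟} {i : V}
    (E : Submodule k (S i ⟶ (T X).obj W)) (h : ∀ j x u, G.el θ X W i j x u ∈ E)
    (v : S i ⟶ (T X).obj W) : v ∈ E := by
  rw [← sk.sum_map_comp v]
  refine E.sum_mem fun j _ => E.sum_mem fun e _ => ?_
  have := h j ((θ X i j).symm (v ≫ (T X).map (sk.out W j e))) (sk.inn W j e)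
  rwa [el_apply, LinearEquiv.apply_symm_apply, Category.assoc] at this

lemma el_hom_ext (sk : Skeleton k S) {X : C} {W : 𝒟} {i : V} {A : Type*} [AddCommGroup A]
    [Module k A] {s t : (S i ⟶ (T X).obj W) →ₗ[k] A}
    (h : ∀ j x u, s (G.el θ X W i j x u) = t (G.el θ X W i j x u)) (v) : s v = t v :=
  G.el_span θ sk (LinearMap.eqLocus s t) h v

lemma ext₁ (sk : Skeleton k S) {X : C} {W Z : 𝒟} {s t : (T X).obj W ⟶ Z}
    (h : ∀ i j (x : G.Γ X i j) (u : S j ⟶ W), G.el θ X W i j x u ≫ s = G.el θ X W i j x u ≫ t) :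
    s = t :=
  sk.hom_ext fun i => G.el_hom_ext θ sk (s := Linear.rightComp k _ s) (t := Linear.rightComp k _ t)
    fun j => h i j

lemma ext₂ (sk : Skeleton k S) {X Y : C} {W Z : 𝒟} {s t : (T X).obj ((T Y).obj W) ⟶ Z}
    (h : ∀ i l j (x : G.Γ X i l) (y : G.Γ Y l j) (u : S j ⟶ W),
      G.el θ X _ i l x (G.el θ Y W l j y u) ≫ s = G.el θ X _ i l x (G.el θ Y W l j y u) ≫ t) :
    s = t :=
  G.ext₁ θ sk fun i l x => G.el_hom_ext θ sk (s := Linear.rightComp k _ s ∘ₗ G.el θ X _ i l x)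
    (t := Linear.rightComp k _ t ∘ₗ G.el θ X _ i l x) fun j y u => h i l j x y u

lemma ext₃ (sk : Skeleton k S) {X Y Y' : C} {W Z : 𝒟}
    {s t : (T X).obj ((T Y).obj ((T Y').obj W)) ⟶ Z}
    (h : ∀ i l h j (x : G.Γ X i l) (y : G.Γ Y l h) (z : G.Γ Y' h j) (u : S j ⟶ W),
      G.el θ X _ i l x (G.el θ Y _ l h y (G.el θ Y' W h j z u)) ≫ s =
        G.el θ X _ i l x (G.el θ Y _ l h y (G.el θ Y' W h j z u)) ≫ t) : s = t :=
  G.ext₂ θ sk fun i l h' x y => G.el_hom_ext θ sk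
    (s := Linear.rightComp k _ s ∘ₗ G.el θ X _ i l x ∘ₗ G.el θ Y _ l h' y)
    (t := Linear.rightComp k _ t ∘ₗ G.el θ X _ i l x ∘ₗ G.el θ Y _ l h' y)
    fun j z u => h i l h' j x y z u

/-- The action on a morphism. -/
noncomputable def actHom {X Y : C} (f : X ⟶ Y) (W : 𝒟) : (T X).obj W ⟶ (T Y).obj W :=
  sk.lift sk (θ X) fun i j => (G.el θ Y W i j) ∘ₗ G.map f

lemma el_actHom {X Y : C} (f : X ⟶ Y) {W : 𝒟} {i j : V} (x : G.Γ X i j) (u : S j ⟶ W) :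
    G.el θ X W i j x u ≫ G.actHom sk θ f W = G.el θ Y W i j (G.map f x) u := by
  rw [el_apply, Category.assoc]
  exact sk.comp_lift sk (θ X) _ x u

lemma el_actHom_assoc {X Y : C} (f : X ⟶ Y) {W : 𝒟} {i j : V} (x : G.Γ X i j) (u : S j ⟶ W)
    {Z : 𝒟} (h : (T Y).obj W ⟶ Z) :
    G.el θ X W i j x u ≫ G.actHom sk θ f W ≫ h = G.el θ Y W i j (G.map f x) u ≫ h := by
  rw [← Category.assoc, el_actHom]

lemma actHom_naturality {X Y : C} (f : X ⟶ Y) {W Z : 𝒟} (u : W ⟶ Z) :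
    (T X).map u ≫ G.actHom sk θ f Z = G.actHom sk θ f W ≫ (T Y).map u :=
  G.ext₁ θ sk fun i j x u => by
    rw [el_comp_assoc, el_actHom, el_actHom_assoc, el_comp]

lemma actHom_naturality_assoc {X Y : C} (f : X ⟶ Y) {W Z : 𝒟} (u : W ⟶ Z) {Z' : 𝒟}
    (h : (T Y).obj Z ⟶ Z') : (T X).map u ≫ G.actHom sk θ f Z ≫ h =
      G.actHom sk θ f W ≫ (T Y).map u ≫ h := by
  rw [← Category.assoc, actHom_naturality, Category.assoc]

lemma actHom_id (X : C) (W : 𝒟) : G.actHom sk θ (𝟙 X) W = 𝟙 _ :=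
  G.ext₁ θ sk fun i j x u => by rw [el_actHom, G.map_id, Category.comp_id]

lemma actHom_comp {X Y Z : C} (f : X ⟶ Y) (g : Y ⟶ Z) (W : 𝒟) :
    G.actHom sk θ (f ≫ g) W = G.actHom sk θ f W ≫ G.actHom sk θ g W :=
  G.ext₁ θ sk fun i j x u => by rw [el_actHom, G.map_comp, el_actHom_assoc, el_actHom]

lemma actHom_add {X Y : C} (f g : X ⟶ Y) (W : 𝒟) :
    G.actHom sk θ (f + g) W = G.actHom sk θ f W + G.actHom sk θ g W :=
  G.ext₁ θ sk fun i j x u => by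
    rw [el_actHom, G.map_add, _root_.map_add, LinearMap.add_apply, Preadditive.comp_add, el_actHom,
      el_actHom]

lemma actHom_smul {X Y : C} (c : k) (f : X ⟶ Y) (W : 𝒟) :
    G.actHom sk θ (c • f) W = c • G.actHom sk θ f W :=
  G.ext₁ θ sk fun i j x u => by
    rw [el_actHom, G.map_smul, _root_.map_smul, LinearMap.smul_apply, Linear.comp_smul, el_actHom]

/-- The inverse of the associativity constraint, on elements. -/
noncomputable def assocElem (X Y : C) (W : 𝒟) (i l : V) :
    G.Γ X i l →ₗ[k] (S l ⟶ (T Y).obj W) →ₗ[k] (S i ⟶ (T (X ⊗ Y)).obj W) :=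
  have key : ∀ x j y u, sk.homLift (θ Y) (fun j => G.el θ (X ⊗ Y) W i j ∘ₗ G.mul x)
      (G.el θ Y W l j y u) = G.el θ (X ⊗ Y) W i j (G.mul x y) u := fun x j y u =>
    sk.homLift_apply (θ Y) _ y u
  { toFun := fun x => sk.homLift (θ Y) fun j => G.el θ (X ⊗ Y) W i j ∘ₗ G.mul x
    map_add' := fun x x' => LinearMap.ext <| G.el_hom_ext θ sk fun j y u => by
      rw [LinearMap.add_apply, key, key, key, _root_.map_add, LinearMap.add_apply, _root_.map_add,
        LinearMap.add_apply]
    map_smul' := fun c x => LinearMap.ext <| G.el_hom_ext θ sk fun j y u => by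
      rw [LinearMap.smul_apply, key, key, _root_.map_smul, LinearMap.smul_apply, _root_.map_smul,
        LinearMap.smul_apply, RingHom.id_apply] }

/-- The inverse of the associativity constraint. -/
noncomputable def assocInv (X Y : C) (W : 𝒟) : (T X).obj ((T Y).obj W) ⟶ (T (X ⊗ Y)).obj W :=
  sk.lift sk (θ X) fun i l => G.assocElem sk θ X Y W i l

lemma el_assocInv {X Y : C} {W : 𝒟} {i l j : V} (x : G.Γ X i l) (y : G.Γ Y l j) (u : S j ⟶ W) :
    G.el θ X _ i l x (G.el θ Y W l j y u) ≫ G.assocInv sk θ X Y W =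
      G.el θ (X ⊗ Y) W i j (G.mul x y) u := by
  rw [el_apply, Category.assoc]
  exact (sk.comp_lift sk (θ X) _ x _).trans (sk.homLift_apply (θ Y) _ y u)

lemma el_assocInv_assoc {X Y : C} {W : 𝒟} {i l j : V} (x : G.Γ X i l) (y : G.Γ Y l j)
    (u : S j ⟶ W) {Z : 𝒟} (h : (T (X ⊗ Y)).obj W ⟶ Z) :
    G.el θ X _ i l x (G.el θ Y W l j y u) ≫ G.assocInv sk θ X Y W ≫ h =
      G.el θ (X ⊗ Y) W i j (G.mul x y) u ≫ h := by
  rw [← Category.assoc, el_assocInv]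

/-- The associativity constraint. -/
noncomputable def assocHom (X Y : C) (W : 𝒟) : (T (X ⊗ Y)).obj W ⟶ (T X).obj ((T Y).obj W) :=
  sk.lift sk (θ (X ⊗ Y)) fun i j => ∑ l, TensorProduct.lift
    (LinearMap.mk₂ k (fun x y => G.el θ X _ i l x ∘ₗ G.el θ Y W l j y)
      (fun _ _ _ => by ext; simp) (fun _ _ _ => by ext; simp) (fun _ _ _ => by ext; simp)
      (fun _ _ _ => by ext; simp)) ∘ₗ G.comul l

lemma el_assocHom {X Y : C} {W : 𝒟} {i j : V} (z : G.Γ (X ⊗ Y) i j) (u : S j ⟶ W)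
    {Z : 𝒟} (s : (T X).obj ((T Y).obj W) ⟶ Z) (f : ∀ l, G.Γ X i l ⊗[k] G.Γ Y l j →ₗ[k] (S i ⟶ Z))
    (hf : ∀ l x y, G.el θ X _ i l x (G.el θ Y W l j y u) ≫ s = f l (x ⊗ₜ y)) :
    G.el θ (X ⊗ Y) W i j z u ≫ G.assocHom sk θ X Y W ≫ s = ∑ l, f l (G.comul l z) := by
  have e := congrArg (· ≫ s) (sk.comp_lift sk (θ (X ⊗ Y)) (fun i j => ∑ l, TensorProduct.lift
    (LinearMap.mk₂ k (fun x y => G.el θ X _ i l x ∘ₗ G.el θ Y W l j y)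
      (fun _ _ _ => by ext; simp) (fun _ _ _ => by ext; simp) (fun _ _ _ => by ext; simp)
      (fun _ _ _ => by ext; simp)) ∘ₗ G.comul l) z u)
  simp only [Category.assoc] at e
  rw [el_apply, Category.assoc]
  refine e.trans ?_
  rw [LinearMap.sum_apply, LinearMap.sum_apply, Preadditive.sum_comp]
  refine Finset.sum_congr rfl fun l _ => ?_
  rw [LinearMap.comp_apply]
  induction G.comul l z with
  | zero => simp
  | add s t hs ht => simp [hs, ht]
  | tmul x y => exact hf l x y

lemma assocHom_assocInv (X Y : C) (W : 𝒟) :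
    G.assocHom sk θ X Y W ≫ G.assocInv sk θ X Y W = 𝟙 _ :=
  G.ext₁ θ sk fun i j z u => by
    rw [G.el_assocHom sk θ z u (G.assocInv sk θ X Y W)
      (fun l => (G.el θ (X ⊗ Y) W i j).flip u ∘ₗ TensorProduct.lift G.mul)
      (fun l x y => by rw [el_assocInv]; rfl)]
    simp only [LinearMap.comp_apply]
    rw [← map_sum, G.mul_comul, LinearMap.flip_apply, Category.comp_id]

lemma assocInv_assocHom (X Y : C) (W : 𝒟) :
    G.assocInv sk θ X Y W ≫ G.assocHom sk θ X Y W = 𝟙 _ :=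
  G.ext₂ θ sk fun i l j x y u => by
    classical
    have h := G.el_assocHom sk θ (G.mul x y) u (𝟙 _)
      (fun l => TensorProduct.lift (LinearMap.mk₂ k
        (fun x y => G.el θ X _ i l x (G.el θ Y W l j y u)) (fun _ _ _ => by simp)
        (fun _ _ _ => by simp) (fun _ _ _ => by simp) (fun _ _ _ => by simp)))
      (fun l x y => by rw [Category.comp_id]; rfl)
    rw [Category.comp_id] at h
    rw [el_assocInv_assoc, h, Finset.sum_eq_single l, comul_mul,
      TensorProduct.lift.tmul, Category.comp_id]
    · rfl
    · intro l' _ hl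
      rw [G.comul_mul_ne hl.symm, _root_.map_zero]
    · simp

/-- The unit constraint on simple objects. -/
noncomputable def unitEquiv (i j : V) : (S i ⟶ S j) ≃ₗ[k] (S i ⟶ (T (𝟙_ C)).obj (S j)) :=
  LinearEquiv.ofBijective (G.el θ (𝟙_ C) (S j) i i (G.unit i)) <| by
    classical
    have h1 : ∀ i (f : S i ⟶ S i), G.el θ (𝟙_ C) (S i) i i (G.unit i) f =
        θ _ i i (sk.sc f • G.unit i) := fun i f => by
      conv_lhs => rw [sk.eq_smul f]
      rw [_root_.map_smul, el_id, _root_.map_smul]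
    refine ⟨?_, ?_⟩
    · refine (injective_iff_map_eq_zero _).2 fun f hf => ?_
      by_cases h : i = j
      · subst h
        rw [h1] at hf
        have h2 := congrArg (G.counit i) ((LinearEquiv.map_eq_zero_iff _).1 hf)
        rw [_root_.map_smul, counit_unit, smul_eq_mul, mul_one, _root_.map_zero] at h2
        rw [sk.eq_smul f, h2, zero_smul]
      · exact sk.hom_eq_zero h f
    · intro v
      obtain ⟨x, rfl⟩ := (θ _ i j).surjective v
      by_cases h : i = j
      · subst h
        refine ⟨G.counit i x • 𝟙 _, ?_⟩
        rw [h1, _root_.map_smul sk.sc, sk.sc_id, smul_eq_mul, mul_one, G.counit_smul]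
      · exact ⟨0, by rw [G.eq_zero h x, _root_.map_zero, _root_.map_zero]⟩

/-- The unit constraint. -/
noncomputable def unitIso : 𝟭 𝒟 ≅ T (𝟙_ C) :=
  sk.natIso (P := 𝟭 𝒟) sk (fun i j => LinearEquiv.refl k (S i ⟶ S j)) (G.unitEquiv sk θ)

lemma comp_unitIso {W : 𝒟} {i : V} (u : S i ⟶ W) :
    u ≫ (G.unitIso sk θ).hom.app W = G.el θ (𝟙_ C) W i i (G.unit i) u := by
  have h := sk.comp_natIso (P := 𝟭 𝒟) sk (fun i j => LinearEquiv.refl k (S i ⟶ S j))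
    (G.unitEquiv sk θ) (𝟙 (S i)) u
  rw [LinearEquiv.refl_apply, Category.id_comp] at h
  refine h.trans ?_
  refine (G.el_comp θ (G.unit i) (𝟙 _) u).trans ?_
  rw [Category.id_comp]

lemma comp_unitIso_assoc {W : 𝒟} {i : V} (u : S i ⟶ W) {Z : 𝒟} (h : (T (𝟙_ C)).obj W ⟶ Z) :
    u ≫ (G.unitIso sk θ).hom.app W ≫ h = G.el θ (𝟙_ C) W i i (G.unit i) u ≫ h :=
  (Category.assoc _ _ _).symm.trans (congrArg (· ≫ h) (G.comp_unitIso sk θ u))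

/-- The associativity isomorphism. -/
noncomputable def assocIso (X Y : C) (W : 𝒟) : (T (X ⊗ Y)).obj W ≅ (T X).obj ((T Y).obj W) :=
  ⟨G.assocHom sk θ X Y W, G.assocInv sk θ X Y W, G.assocHom_assocInv sk θ X Y W,
    G.assocInv_assocHom sk θ X Y W⟩

lemma assocInv_naturality {X X' Y Y' : C} (f : X ⟶ X') (g : Y ⟶ Y') {W Z : 𝒟} (h : W ⟶ Z) :
    G.assocInv sk θ X Y W ≫ G.actHom sk θ (f ⊗ₘ g) W ≫ (T (X' ⊗ Y')).map h =
      (G.actHom sk θ f _ ≫ (T X').map (G.actHom sk θ g W ≫ (T Y').map h)) ≫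
        G.assocInv sk θ X' Y' Z :=
  G.ext₂ θ sk fun i l j x y u => by
    rw [el_assocInv_assoc, el_actHom_assoc, el_comp, Category.assoc, el_actHom_assoc,
      el_comp_assoc, el_actHom_assoc, el_comp, el_assocInv, G.map_mul]

lemma assocInv_whiskerLeft (X : C) {Y Y' : C} (f : Y ⟶ Y') (W : 𝒟) :
    G.assocInv sk θ X Y W ≫ G.actHom sk θ (X ◁ f) W =
      (T X).map (G.actHom sk θ f W) ≫ G.assocInv sk θ X Y' W := by
  have h := G.assocInv_naturality sk θ (𝟙 X) f (𝟙 W)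
  simpa only [CategoryTheory.Functor.map_id, Category.comp_id, actHom_id, Category.id_comp,
    id_tensorHom] using h

lemma assocInv_whiskerRight {X X' : C} (f : X ⟶ X') (Y : C) (W : 𝒟) :
    G.assocInv sk θ X Y W ≫ G.actHom sk θ (f ▷ Y) W =
      G.actHom sk θ f ((T Y).obj W) ≫ G.assocInv sk θ X' Y W := by
  have h := G.assocInv_naturality sk θ f (𝟙 Y) (𝟙 W)
  simpa only [CategoryTheory.Functor.map_id, Category.comp_id, actHom_id, Category.id_comp,
    tensorHom_id] using h

lemma assocInv_assocInv (X Y Z : C) (W : 𝒟) :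
    (T X).map (G.assocInv sk θ Y Z W) ≫ G.assocInv sk θ X (Y ⊗ Z) W =
      G.assocInv sk θ X Y ((T Z).obj W) ≫ G.assocInv sk θ (X ⊗ Y) Z W ≫
        G.actHom sk θ (α_ X Y Z).hom W :=
  G.ext₃ θ sk fun i l h j x y z u => by
    rw [el_comp_assoc, el_assocInv, el_assocInv, el_assocInv_assoc, el_assocInv_assoc, el_actHom,
      G.mul_assoc]

lemma unitIso_assocInv (X : C) (W : 𝒟) :
    (G.unitIso sk θ).hom.app ((T X).obj W) ≫ G.assocInv sk θ (𝟙_ C) X W ≫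
      G.actHom sk θ (λ_ X).hom W = 𝟙 ((T X).obj W) :=
  G.ext₁ θ sk fun i j x u => by
    have h := G.comp_unitIso_assoc sk θ (G.el θ X W i j x u) (G.assocInv sk θ (𝟙_ C) X W ≫
      G.actHom sk θ (λ_ X).hom W)
    refine h.trans ?_
    rw [el_assocInv_assoc, el_actHom, G.unit_mul, Category.comp_id]

lemma map_unitIso_assocInv (X : C) (W : 𝒟) :
    (T X).map ((G.unitIso sk θ).hom.app W) ≫ G.assocInv sk θ X (𝟙_ C) W ≫
      G.actHom sk θ (ρ_ X).hom W = 𝟙 ((T X).obj W) :=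
  G.ext₁ θ sk fun i j x u => by
    refine (G.el_comp_assoc θ x u _ _).trans ?_
    have h := G.comp_unitIso sk θ u
    refine (congrArg (fun v => G.el θ X _ i j x v ≫ G.assocInv sk θ X (𝟙_ C) W ≫
      G.actHom sk θ (ρ_ X).hom W) h).trans ?_
    refine (G.el_assocInv_assoc sk θ x (G.unit j) (W := W) u _).trans ?_
    rw [el_actHom, G.mul_unit]
    exact (Category.comp_id _).symm

/-- The action of `C` given by a connection. -/
@[reducible] noncomputable def action : MonoidalLeftAction C 𝒟 where
  actionObj X W := (T X).obj W
  actionHomLeft f W := G.actHom sk θ f W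
  actionHomRight X _ _ f := (T X).map f
  actionAssocIso X Y W := ⟨G.assocHom sk θ X Y W, G.assocInv sk θ X Y W,
    G.assocHom_assocInv sk θ X Y W, G.assocInv_assocHom sk θ X Y W⟩
  actionUnitIso W := ((G.unitIso sk θ).app W).symm
  actionHomRight_id X W := (T X).map_id W
  id_actionHomLeft X W := G.actHom_id sk θ X W
  actionHom_comp f f' g g' := by
    change G.actHom sk θ (f ≫ f') _ ≫ (T _).map (g ≫ g') =
      (G.actHom sk θ f _ ≫ (T _).map g) ≫ G.actHom sk θ f' _ ≫ (T _).map g'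
    rw [actHom_comp, Functor.map_comp, Category.assoc, Category.assoc, actHom_naturality_assoc]
  actionAssocIso_hom_naturality {X X' Y Y' W Z} f g h := by
    have e := G.assocInv_naturality sk θ f g h
    rw [← Iso.eq_comp_inv, Category.assoc, ← Iso.inv_comp_eq]
    exact e
  actionUnitIso_hom_naturality f := ((G.unitIso sk θ).inv.naturality f).symm
  whiskerLeft_actionHomLeft X Y Y' f W :=
    (Iso.inv_comp_eq (G.assocIso sk θ X Y W)).1 (G.assocInv_whiskerLeft sk θ X f W)
  whiskerRight_actionHomLeft {X X'} Y f W :=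
    (Iso.inv_comp_eq (G.assocIso sk θ X Y W)).1 (G.assocInv_whiskerRight sk θ f Y W)
  associator_actionHom X Y Z W := by
    have e := G.assocInv_assocInv sk θ X Y Z W
    change G.actHom sk θ (α_ X Y Z).hom W ≫ (G.assocIso sk θ X (Y ⊗ Z) W).hom ≫
      (T X).map (G.assocIso sk θ Y Z W).hom =
        (G.assocIso sk θ (X ⊗ Y) Z W).hom ≫ (G.assocIso sk θ X Y ((T Z).obj W)).hom
    have e' := (Iso.inv_comp_eq ((T X).mapIso (G.assocIso sk θ Y Z W))).1 e
    change (G.assocIso sk θ X (Y ⊗ Z) W).inv = (T X).map (G.assocIso sk θ Y Z W).hom ≫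
      (G.assocIso sk θ X Y ((T Z).obj W)).inv ≫ (G.assocIso sk θ (X ⊗ Y) Z W).inv ≫
        G.actHom sk θ (α_ X Y Z).hom W at e'
    have h : G.actHom sk θ (α_ X Y Z).hom W = (G.assocIso sk θ (X ⊗ Y) Z W).hom ≫
        (G.assocIso sk θ X Y ((T Z).obj W)).hom ≫ (T X).map (G.assocIso sk θ Y Z W).inv ≫
          (G.assocIso sk θ X (Y ⊗ Z) W).inv := by
      rw [e', ← Functor.map_comp_assoc, Iso.inv_hom_id, CategoryTheory.Functor.map_id,
        Category.id_comp, Iso.hom_inv_id_assoc, Iso.hom_inv_id_assoc]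
    rw [h]
    simp only [Category.assoc, Iso.inv_hom_id_assoc, ← Functor.map_comp, Iso.inv_hom_id,
      CategoryTheory.Functor.map_id, Category.comp_id]
  leftUnitor_actionHom X W := by
    have e := G.unitIso_assocInv sk θ X W
    have e' := (Iso.inv_comp_eq ((G.unitIso sk θ).symm.app ((T X).obj W))).1 e
    refine ((Iso.inv_comp_eq (G.assocIso sk θ (𝟙_ C) X W)).1 e').trans ?_
    exact congrArg (_ ≫ ·) (Category.comp_id _)
  rightUnitor_actionHom X W := by
    have e := G.map_unitIso_assocInv sk θ X W
    have e' := (Iso.inv_comp_eq ((T X).mapIso ((G.unitIso sk θ).symm.app W))).1 e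
    refine ((Iso.inv_comp_eq (G.assocIso sk θ X (𝟙_ C) W)).1 e').trans ?_
    exact congrArg (_ ≫ ·) (Category.comp_id _)

end Connection

end BasicAction

namespace BasicAction

namespace Connection

variable {C : Type w} [Category.{v} C] [Preadditive C] [MonoidalCategory C]
variable {k V : Type u} [Field k] [Linear k C] [Quiver.{u} V] [Fintype V]
  [∀ i j : V, Fintype (i ⟶ j)] (G : Connection C k V)
  {𝒟 : Type*} [Category.{u} 𝒟] [Preadditive 𝒟] [Linear k 𝒟] {S : V → 𝒟} (sk : Skeleton k S)
  {T : C → 𝒟 ⥤ 𝒟} [∀ X, (T X).Additive] [∀ X, (T X).Linear k]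
  (θ : ∀ X i j, G.Γ X i j ≃ₗ[k] (S i ⟶ (T X).obj (S j)))
  {F : 𝒟 ⥤ 𝒟} [F.Additive] [F.Linear k]
  (b : ∀ i j : V, Module.Basis (i ⟶ j) k (S i ⟶ F.obj (S j)))

section Arrows

/-- The morphism `S i ⟶ F W` given by an arrow `i ⟶ l` and a morphism `S l ⟶ W`. -/
noncomputable def arrowEl (W : 𝒟) {i l : V} (a : i ⟶ l) : (S l ⟶ W) →ₗ[k] (S i ⟶ F.obj W) where
  toFun u := b i l a ≫ F.map u
  map_add' _ _ := by simp
  map_smul' _ _ := by simp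

lemma arrowEl_apply {W : 𝒟} {i l : V} (a : i ⟶ l) (u : S l ⟶ W) :
    arrowEl b W a u = b i l a ≫ F.map u := rfl

lemma arrowEl_comp {W Z : 𝒟} {i l : V} (a : i ⟶ l) (u : S l ⟶ W) (f : W ⟶ Z) :
    arrowEl b W a u ≫ F.map f = arrowEl b Z a (u ≫ f) := by
  rw [arrowEl_apply, arrowEl_apply, Category.assoc, Functor.map_comp]

lemma arrowEl_comp_assoc {W Z : 𝒟} {i l : V} (a : i ⟶ l) (u : S l ⟶ W) (f : W ⟶ Z) {Z' : 𝒟}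
    (h : F.obj Z ⟶ Z') : arrowEl b W a u ≫ F.map f ≫ h = arrowEl b Z a (u ≫ f) ≫ h := by
  rw [← Category.assoc, arrowEl_comp]

/-- The linear map with given values on the products of arrows and morphisms. -/
noncomputable def arrowLift {W : 𝒟} {i : V} {A : Type*} [AddCommGroup A] [Module k A]
    (κ : ∀ l, (i ⟶ l) → (S l ⟶ W) →ₗ[k] A) : (S i ⟶ F.obj W) →ₗ[k] A :=
  sk.homLift (fun i j => (b i j).repr.symm) fun l => Finsupp.linearCombination k (κ l)

lemma arrowLift_apply {W : 𝒟} {i : V} {A : Type*} [AddCommGroup A] [Module k A]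
    (κ : ∀ l, (i ⟶ l) → (S l ⟶ W) →ₗ[k] A) {l : V} (a : i ⟶ l) (u : S l ⟶ W) :
    arrowLift sk b κ (arrowEl b W a u) = κ l a u := by
  have h := sk.homLift_apply (fun i j => (b i j).repr.symm)
    (fun l => Finsupp.linearCombination k (κ l)) (Finsupp.single a 1) u
  rw [Module.Basis.repr_symm_single_one, Finsupp.linearCombination_single, one_smul] at h
  exact h

lemma arrowEl_span (sk : Skeleton k S) {W : 𝒟} {i : V} (E : Submodule k (S i ⟶ F.obj W))
    (h : ∀ l a u, arrowEl b W (l := l) a u ∈ E) (v : S i ⟶ F.obj W) : v ∈ E := by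
  rw [← sk.sum_map_comp v]
  refine E.sum_mem fun j _ => E.sum_mem fun e _ => ?_
  rw [← Category.assoc]
  have key : ∀ g : S i ⟶ F.obj (S j), g ≫ F.map (sk.inn W j e) ∈ E := fun g => by
    have : g ∈ Submodule.comap (Linear.rightComp k (S i) (F.map (sk.inn W j e))) E := by
      rw [← (b i j).linearCombination_repr g]
      refine Submodule.sum_mem _ fun a _ => Submodule.smul_mem _ _ ?_
      exact h j a (sk.inn W j e)
    exact this
  exact key _

lemma arrowEl_hom_ext (sk : Skeleton k S) {W : 𝒟} {i : V} {A : Type*} [AddCommGroup A]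
    [Module k A] {s t : (S i ⟶ F.obj W) →ₗ[k] A}
    (h : ∀ l a u, s (arrowEl b W (l := l) a u) = t (arrowEl b W a u)) (v) : s v = t v :=
  arrowEl_span b sk (LinearMap.eqLocus s t) h v

lemma arrow_ext (sk : Skeleton k S) {W Z : 𝒟} {s t : F.obj W ⟶ Z}
    (h : ∀ i l (a : i ⟶ l) (u : S l ⟶ W), arrowEl b W a u ≫ s = arrowEl b W a u ≫ t) : s = t :=
  sk.hom_ext fun i => arrowEl_hom_ext b sk (s := Linear.rightComp k _ s)
    (t := Linear.rightComp k _ t) fun l => h i l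

end Arrows

lemma arrow_ext₁ (sk : Skeleton k S) {X : C} {W Z : 𝒟} {s t : F.obj ((T X).obj W) ⟶ Z}
    (h : ∀ i l j (a : i ⟶ l) (x : G.Γ X l j) (u : S j ⟶ W),
      arrowEl b _ a (G.el θ X W l j x u) ≫ s = arrowEl b _ a (G.el θ X W l j x u) ≫ t) : s = t :=
  arrow_ext b sk fun i l a => G.el_hom_ext θ sk (s := Linear.rightComp k _ s ∘ₗ arrowEl b _ a)
    (t := Linear.rightComp k _ t ∘ₗ arrowEl b _ a) fun j x u => h i l j a x u

lemma arrow_ext₂ (sk : Skeleton k S) {X Y : C} {W Z : 𝒟}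
    {s t : F.obj ((T X).obj ((T Y).obj W)) ⟶ Z}
    (h : ∀ i l h j (a : i ⟶ l) (x : G.Γ X l h) (y : G.Γ Y h j) (u : S j ⟶ W),
      arrowEl b _ a (G.el θ X _ l h x (G.el θ Y W h j y u)) ≫ s =
        arrowEl b _ a (G.el θ X _ l h x (G.el θ Y W h j y u)) ≫ t) : s = t :=
  G.arrow_ext₁ θ b sk fun i l h' a x => G.el_hom_ext θ sk
    (s := Linear.rightComp k _ s ∘ₗ arrowEl b _ a ∘ₗ G.el θ X _ l h' x)
    (t := Linear.rightComp k _ t ∘ₗ arrowEl b _ a ∘ₗ G.el θ X _ l h' x)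
    fun j y u => h i l h' j a x y u

lemma ext₁_arrow (sk : Skeleton k S) {X : C} {W Z : 𝒟} {s t : (T X).obj (F.obj W) ⟶ Z}
    (H : ∀ i h j (x : G.Γ X i h) (c : h ⟶ j) (u : S j ⟶ W),
      G.el θ X _ i h x (arrowEl b W c u) ≫ s = G.el θ X _ i h x (arrowEl b W c u) ≫ t) : s = t :=
  G.ext₁ θ sk fun i h' x => arrowEl_hom_ext b sk (s := Linear.rightComp k _ s ∘ₗ G.el θ X _ i h' x)
    (t := Linear.rightComp k _ t ∘ₗ G.el θ X _ i h' x) fun j c u => H i h' j x c u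

/-- The exchange of an arrow and an edge. -/
noncomputable def exchElem (X : C) (W : 𝒟) {i l : V} (a : i ⟶ l) :
    (S l ⟶ (T X).obj W) →ₗ[k] (S i ⟶ (T X).obj (F.obj W)) :=
  sk.homLift (θ X) fun j => ∑ h, ∑ c : h ⟶ j,
    (G.el θ X (F.obj W) i h ∘ₗ G.swap a c).compl₂ (arrowEl b W c)

/-- The exchange of arrows and edges. -/
noncomputable def exchHom (X : C) (W : 𝒟) : F.obj ((T X).obj W) ⟶ (T X).obj (F.obj W) :=
  sk.desc fun _ => arrowLift sk b fun _ a => G.exchElem sk θ b X W a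

lemma arrowEl_exchHom {X : C} {W : 𝒟} {i l j : V} (a : i ⟶ l) (x : G.Γ X l j) (u : S j ⟶ W) :
    arrowEl b _ a (G.el θ X W l j x u) ≫ G.exchHom sk θ b X W =
      ∑ h, ∑ c : h ⟶ j, G.el θ X _ i h (G.swap a c x) (arrowEl b W c u) := by
  rw [exchHom, sk.comp_desc, arrowLift_apply]
  refine (sk.homLift_apply (θ X) _ x u).trans ?_
  simp only [LinearMap.sum_apply, LinearMap.compl₂_apply, LinearMap.comp_apply]

lemma arrowEl_exchHom_assoc {X : C} {W : 𝒟} {i l j : V} (a : i ⟶ l) (x : G.Γ X l j) (u : S j ⟶ W)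
    {Z : 𝒟} (s : (T X).obj (F.obj W) ⟶ Z) :
    arrowEl b _ a (G.el θ X W l j x u) ≫ G.exchHom sk θ b X W ≫ s =
      (∑ h, ∑ c : h ⟶ j, G.el θ X _ i h (G.swap a c x) (arrowEl b W c u)) ≫ s := by
  rw [← Category.assoc, arrowEl_exchHom]

/-- The inverse exchange of arrows and edges. -/
noncomputable def exchInv (X : C) (W : 𝒟) : (T X).obj (F.obj W) ⟶ F.obj ((T X).obj W) :=
  sk.lift sk (θ X) fun i _ => LinearMap.flip <| arrowLift sk b fun j c => ∑ l, ∑ a : i ⟶ l,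
    ((G.el θ X W l j ∘ₗ G.swap' a c).compr₂ (arrowEl b _ a)).flip

lemma el_exchInv {X : C} {W : 𝒟} {i h j : V} (x : G.Γ X i h) (c : h ⟶ j) (u : S j ⟶ W) :
    G.el θ X _ i h x (arrowEl b W c u) ≫ G.exchInv sk θ b X W =
      ∑ l, ∑ a : i ⟶ l, arrowEl b _ a (G.el θ X W l j (G.swap' a c x) u) := by
  rw [el_apply, Category.assoc]
  refine (sk.comp_lift sk (θ X) _ x _).trans ?_
  rw [LinearMap.flip_apply, arrowLift_apply]
  simp only [LinearMap.sum_apply, LinearMap.flip_apply, LinearMap.compr₂_apply,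
    LinearMap.comp_apply]

lemma el_exchInv_assoc {X : C} {W : 𝒟} {i h j : V} (x : G.Γ X i h) (c : h ⟶ j) (u : S j ⟶ W)
    {Z : 𝒟} (s : F.obj ((T X).obj W) ⟶ Z) :
    G.el θ X _ i h x (arrowEl b W c u) ≫ G.exchInv sk θ b X W ≫ s =
      (∑ l, ∑ a : i ⟶ l, arrowEl b _ a (G.el θ X W l j (G.swap' a c x) u)) ≫ s := by
  rw [← Category.assoc, el_exchInv]

lemma exchHom_exchInv (X : C) (W : 𝒟) :
    G.exchHom sk θ b X W ≫ G.exchInv sk θ b X W = 𝟙 _ :=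
  G.arrow_ext₁ θ b sk fun i l j a x u => by
    classical
    rw [arrowEl_exchHom_assoc, Category.comp_id]
    simp only [Preadditive.sum_comp, el_exchInv]
    rw [sum_sum_comm]
    have h : ∀ (l' : V) (a' : i ⟶ l'), ∑ h, ∑ c : h ⟶ j,
        arrowEl b _ a' (G.el θ X W l' j (G.swap' a' c (G.swap a c x)) u) =
        arrowEl b _ a' (G.el θ X W l' j (∑ h, ∑ c : h ⟶ j, G.swap' a' c (G.swap a c x)) u) :=
      fun l' a' => by simp only [map_sum, LinearMap.sum_apply]
    simp only [h]
    rw [Finset.sum_eq_single l, Finset.sum_eq_single a]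
    · rw [swap'_swap_self, if_pos rfl]
    · intro a' _ ha
      rw [swap'_swap_self, if_neg ha]; simp
    · simp
    · intro l' _ hl
      refine Finset.sum_eq_zero fun a' _ => ?_
      rw [swap'_swap_ne _ hl]; simp
    · simp

lemma exchInv_exchHom (X : C) (W : 𝒟) :
    G.exchInv sk θ b X W ≫ G.exchHom sk θ b X W = 𝟙 _ :=
  G.ext₁_arrow θ b sk fun i h j x c u => by
    classical
    rw [el_exchInv_assoc, Category.comp_id]
    simp only [Preadditive.sum_comp, arrowEl_exchHom]
    rw [sum_sum_comm]
    have e : ∀ (h' : V) (c' : h' ⟶ j), ∑ l, ∑ a : i ⟶ l,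
        G.el θ X _ i h' (G.swap a c' (G.swap' a c x)) (arrowEl b W c' u) =
        G.el θ X _ i h' (∑ l, ∑ a : i ⟶ l, G.swap a c' (G.swap' a c x)) (arrowEl b W c' u) :=
      fun h' c' => by simp only [map_sum, LinearMap.sum_apply]
    simp only [e]
    rw [Finset.sum_eq_single h, Finset.sum_eq_single c]
    · rw [swap_swap'_self, if_pos rfl]
    · intro c' _ hc
      rw [swap_swap'_self, if_neg hc]; simp
    · simp
    · intro h' _ hh
      refine Finset.sum_eq_zero fun c' _ => ?_
      rw [swap_swap'_ne _ hh]; simp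
    · simp

/-- The exchange isomorphism. -/
noncomputable def exchIso (X : C) (W : 𝒟) : F.obj ((T X).obj W) ≅ (T X).obj (F.obj W) :=
  ⟨G.exchHom sk θ b X W, G.exchInv sk θ b X W, G.exchHom_exchInv sk θ b X W,
    G.exchInv_exchHom sk θ b X W⟩

lemma exchHom_actHom {X Y : C} (f : X ⟶ Y) (W : 𝒟) :
    F.map (G.actHom sk θ f W) ≫ G.exchHom sk θ b Y W =
      G.exchHom sk θ b X W ≫ G.actHom sk θ f (F.obj W) :=
  G.arrow_ext₁ θ b sk fun i l j a x u => by
    rw [arrowEl_comp_assoc, el_actHom, arrowEl_exchHom, arrowEl_exchHom_assoc]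
    simp only [Preadditive.sum_comp, el_actHom, swap_map]

lemma exchHom_map (X : C) {W Z : 𝒟} (f : W ⟶ Z) :
    F.map ((T X).map f) ≫ G.exchHom sk θ b X Z = G.exchHom sk θ b X W ≫ (T X).map (F.map f) :=
  G.arrow_ext₁ θ b sk fun i l j a x u => by
    rw [arrowEl_comp_assoc, el_comp, arrowEl_exchHom, arrowEl_exchHom_assoc]
    simp only [Preadditive.sum_comp, el_comp, arrowEl_comp]

lemma map_assocInv_exchHom (X Y : C) (W : 𝒟) :
    F.map (G.assocInv sk θ X Y W) ≫ G.exchHom sk θ b (X ⊗ Y) W =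
      G.exchHom sk θ b X ((T Y).obj W) ≫ (T X).map (G.exchHom sk θ b Y W) ≫
        G.assocInv sk θ X Y (F.obj W) :=
  G.arrow_ext₂ θ b sk fun i l h j a x y u => by
    rw [arrowEl_comp_assoc, el_assocInv, arrowEl_exchHom, arrowEl_exchHom_assoc]
    simp only [Preadditive.sum_comp, el_comp_assoc, arrowEl_exchHom, map_sum, el_assocInv, swap_mul,
      LinearMap.sum_apply]
    exact sum_sum_comm _

lemma map_unitIso_exchHom (W : 𝒟) :
    F.map ((G.unitIso sk θ).hom.app W) ≫ G.exchHom sk θ b (𝟙_ C) W =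
      (G.unitIso sk θ).hom.app (F.obj W) :=
  arrow_ext b sk fun i l a u => by
    classical
    refine Eq.trans ?_ (G.comp_unitIso sk θ (arrowEl b W a u)).symm
    refine (arrowEl_comp_assoc b a u _ _).trans ?_
    have h := G.comp_unitIso sk θ u
    refine (congrArg (fun v => arrowEl b _ a v ≫ G.exchHom sk θ b (𝟙_ C) W) h).trans ?_
    refine (G.arrowEl_exchHom sk θ b (W := W) a (G.unit l) u).trans ?_
    rw [Finset.sum_eq_single i, Finset.sum_eq_single a]
    · rw [swap_unit_self, if_pos rfl]
    · intro c _ hc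
      rw [swap_unit_self, if_neg hc]; simp
    · simp
    · intro h _ hh
      refine Finset.sum_eq_zero fun c _ => ?_
      rw [swap_unit_ne _ hh]; simp
    · simp

/-- The module functor structure given by a connection. -/
@[reducible] noncomputable def leftLinear :
    letI := G.action sk θ
    F.LeftLinear C :=
  letI := G.action sk θ
  leftLinearOfIso F (fun X W => G.exchIso sk θ b X W) (fun f W => G.exchHom_actHom sk θ b f W)
    (fun X _ _ f => G.exchHom_map sk θ b X f)
    (fun X Y W => by
      change (G.exchIso sk θ b (X ⊗ Y) W).hom ≫ (G.assocIso sk θ X Y (F.obj W)).hom =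
        (F.mapIso (G.assocIso sk θ X Y W)).hom ≫ (G.exchIso sk θ b X ((T Y).obj W)).hom ≫
          (T X).map (G.exchIso sk θ b Y W).hom
      rw [← Iso.eq_comp_inv, Category.assoc, Category.assoc, ← Iso.inv_comp_eq]
      exact G.map_assocInv_exchHom sk θ b X Y W)
    (fun W => (G.map_unitIso_exchHom sk θ b W).symm)

end Connection

end BasicAction

namespace BasicAction

open MonoidalLeftAction Functor.LaxLeftLinear Functor.OplaxLeftLinear TruncatedPathAlgebra

namespace Connection

variable {C : Type w} [Category.{v} C] [Preadditive C] [MonoidalCategory C]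
variable {k V : Type u} [Field k] [Linear k C] [Quiver.{u} V] [Fintype V]
  [∀ i j : V, Fintype (i ⟶ j)] (G : Connection C k V) [∀ X i j, Module.Finite k (G.Γ X i j)]

/-- The functor by which an object acts on `Vec(V)`. -/
noncomputable abbrev matFunctor (X : C) : Vec k V ⥤ Vec k V := Vec.kernel (G.Γ X)

/-- The edges as morphisms between simple objects. -/
noncomputable abbrev matEquiv (X : C) (i j : V) :
    G.Γ X i j ≃ₗ[k] (Vec.simple i ⟶ (G.matFunctor X).obj (Vec.simple (k := k) j)) :=
  Vec.kernelEquiv (G.Γ X) i j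

/-- The action on `Vec(V)` given by a connection. -/
@[reducible] noncomputable def matAction : MonoidalLeftAction C (Vec k V) :=
  G.action (T := G.matFunctor) Vec.skeleton G.matEquiv

lemma add_matActHom {X Y : C} (f g : X ⟶ Y) (W : Vec k V) :
    G.actHom (T := G.matFunctor) Vec.skeleton G.matEquiv (f + g) W =
      G.actHom (T := G.matFunctor) Vec.skeleton G.matEquiv f W +
      G.actHom (T := G.matFunctor) Vec.skeleton G.matEquiv g W :=
  G.actHom_add (T := G.matFunctor) Vec.skeleton G.matEquiv f g W

lemma smul_matActHom {X Y : C} (c : k) (f : X ⟶ Y) (W : Vec k V) :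
    G.actHom (T := G.matFunctor) Vec.skeleton G.matEquiv (c • f) W =
      c • G.actHom (T := G.matFunctor) Vec.skeleton G.matEquiv f W :=
  G.actHom_smul (T := G.matFunctor) Vec.skeleton G.matEquiv c f W

/-- The module category structure on `Vec(V)` given by a connection. -/
noncomputable def modStr : ModStr C k V where
  action := G.matAction
  add_actionHomLeft f g W := G.add_matActHom f g W
  smul_actionHomLeft c f W := G.smul_matActHom c f W
  actionHomRight_add X _ _ _ _ := (G.matFunctor X).map_add
  actionHomRight_smul X _ _ c f := (G.matFunctor X).map_smul c f

/-- The functor on `Vec(V)` given by the arrows of a quiver. -/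
noncomputable abbrev arrowFunctor (k V : Type u) [Field k] [Quiver.{u} V] [Fintype V]
    [∀ i j : V, Fintype (i ⟶ j)] : Vec k V ⥤ Vec k V :=
  Vec.kernel fun i j : V => (i ⟶ j) →₀ k

/-- The basis given by the arrows. -/
noncomputable def arrowBasis (k : Type u) {V : Type u} [Field k] [Quiver.{u} V] [Fintype V]
    [∀ i j : V, Fintype (i ⟶ j)] (i j : V) : Module.Basis (i ⟶ j) k
      (Vec.simple (k := k) i ⟶ (arrowFunctor k V).obj (Vec.simple j)) :=
  Module.Basis.ofRepr (Vec.kernelEquiv (fun i j : V => (i ⟶ j) →₀ k) i j).symm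

/-- The framed pair given by a connection. -/
noncomputable def framedPair : FramedPair C k V where
  M := G.modStr
  F :=
    { functor := arrowFunctor k V
      additive := inferInstanceAs (arrowFunctor k V).Additive
      linear := inferInstanceAs ((arrowFunctor k V).Linear k)
      leftLinear := G.leftLinear (T := G.matFunctor) Vec.skeleton G.matEquiv (arrowBasis k) }
  basis := arrowBasis k

/-- A basic action with a given connection is realized by the associated framed pair. -/
noncomputable def realization {n : ℕ} {hn : 2 ≤ n} {Φ : BasicAct C (quiverData k V hn)}
    (m : Models Φ G) : Realization Φ G.framedPair where
  θ X i j := (m.θ X i j).trans (G.matEquiv X i j)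
  natural {X Y} f i j x x' h := by
    have e := G.el_actHom (T := G.matFunctor) Vec.skeleton G.matEquiv f (m.θ X i j x) (𝟙 _)
    rw [el_id, el_id] at e
    exact (congrArg (G.matEquiv Y i j) (m.natural f i j x x' h)).trans e.symm
  mul X Y i l j x x' t h := by
    have e := G.el_assocInv (T := G.matFunctor) Vec.skeleton G.matEquiv (m.θ X i l x)
      (m.θ Y l j x') (𝟙 _)
    rw [el_id, el_id, el_apply, Category.assoc] at e
    exact (congrArg (G.matEquiv (X ⊗ Y) i j) (m.mul X Y i l j x x' t h)).trans e.symm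
  unit i t h := by
    have e := G.comp_unitIso (T := G.matFunctor) Vec.skeleton G.matEquiv (𝟙 (Vec.simple i))
    rw [el_id] at e
    exact (congrArg (G.matEquiv (𝟙_ C) i i) (m.unit i t h)).trans
      (e.symm.trans (Category.id_comp _))
  arrows X i l j a x x' h := by
    have e := G.arrowEl_exchHom (T := G.matFunctor) (F := arrowFunctor k V) Vec.skeleton G.matEquiv
      (arrowBasis k) a (m.θ X l j x) (𝟙 _)
    rw [el_id, arrowEl_apply, Category.assoc] at e
    refine e.trans ?_
    refine Finset.sum_congr rfl fun h' _ => Finset.sum_congr rfl fun c _ => ?_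
    rw [el_apply, arrowEl_apply, CategoryTheory.Functor.map_id, Category.comp_id,
      ← m.swap X i l j a x x' h h' c]
    rfl

end Connection

variable {C : Type w} [Category.{v} C] [Preadditive C] [MonoidalCategory C]
variable {k V : Type u} [Field k] [Linear k C] [Quiver.{u} V] [Fintype V]
  [∀ i j : V, Fintype (i ⟶ j)] {n : ℕ} {hn : 2 ≤ n}

/-- Every basic action realizes a framed pair. -/
lemma BasicAct.exists_realization (Φ : BasicAct C (quiverData k V hn)) :
    ∃ x : FramedPair C k V, Nonempty (Realization Φ x) :=
  haveI : ∀ X i j, Module.Finite k (Φ.connection.Γ X i j) := Φ.finite_edges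
  ⟨Φ.connection.framedPair, ⟨Φ.connection.realization Φ.models⟩⟩

/-- A pair is realized by a basic action, with respect to any labelling of the simple objects and
bases. -/
lemma Rlz.exists_basicAct [MonoidalPreadditive C] [MonoidalLinear k C] [RigidCategory C] (hn : 2 ≤ n)
    {M : ModStr C k V} {S : V → M.Cat} (sk : Skeleton k S) (F : Dual M)
    (b : ∀ i j : V, Module.Basis (i ⟶ j) k (S i ⟶ F.functor.obj (S j))) :
    ∃ Φ : BasicAct C (quiverData k V hn), Nonempty (Rlz Φ F S fun i j a => b i j a) :=
  ⟨(Rlz.connection sk F b).basicAct hn, ⟨Rlz.ofModels sk F b ((Rlz.connection sk F b).models hn)⟩⟩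

end BasicAction

namespace BasicAction

open MonoidalLeftAction Functor.LaxLeftLinear Functor.OplaxLeftLinear TruncatedPathAlgebra

variable {C : Type w} [Category.{v} C] [Preadditive C] [MonoidalCategory C]
variable {k V : Type u} [Field k] [Linear k C] [Quiver.{u} V] [Fintype V]
  [∀ i j : V, Fintype (i ⟶ j)] {n : ℕ} {hn : 2 ≤ n} {Φ Φ' : BasicAct C (quiverData k V hn)}

namespace Rlz

variable {M M' : ModStr C k V} {F : Dual M} {F' : Dual M'} {S : V → M.Cat}

/-- The replacement of the morphisms labelled by the arrows by equal ones. -/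
def copy {b b' : ∀ i j : V, (i ⟶ j) → (S i ⟶ F.functor.obj (S j))} (R : Rlz Φ F S b)
    (h : ∀ i j a, b i j a = b' i j a) : Rlz Φ F S b' :=
  (show b = b' from funext fun i => funext fun j => funext (h i j)) ▸ R

lemma iso (sk : Skeleton k S) {b : ∀ i j : V, Module.Basis (i ⟶ j) k (S i ⟶ F.functor.obj (S j))}
    (R : Rlz Φ F S fun i j a => b i j a) (R' : Rlz Φ' F S fun i j a => b i j a) : Φ.Iso Φ' := by
  classical
  exact (cornerTwist (τ := Equiv.refl V) (t := QuiverData.Aut.refl _) R R' sk (fun _ => rfl)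
    (fun a a' => if a' = a then 1 else 0) (fun {i j} a => by
      refine Eq.trans ?_ (Finset.sum_congr rfl fun a' _ => (ite_smul _ _ _ _).symm)
      simp only [one_smul, zero_smul]
      exact (Finset.sum_ite_eq' Finset.univ a fun a' : i ⟶ j => arrow n a').trans
        (if_pos (Finset.mem_univ _)) |>.symm)
    (fun {i j} a => by
      refine Eq.trans ?_ (Finset.sum_congr rfl fun a' _ => (ite_smul _ _ _ _).symm)
      simp only [one_smul, zero_smul]
      exact (Finset.sum_ite_eq' Finset.univ a fun a' : i ⟶ j => b i j a').trans
        (if_pos (Finset.mem_univ _)) |>.symm)).degZeroTwist.isTwist.iso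

/-- Isomorphic basic actions realize the same pairs. -/
lemma of_iso {b : ∀ i j : V, (i ⟶ j) → (S i ⟶ F.functor.obj (S j))} (h : Φ.Iso Φ')
    (R : Rlz Φ F S b) : Nonempty (Rlz Φ' F S b) := by
  classical
  obtain ⟨f, hf⟩ := h.exists_isTwist
  refine ⟨(twist R hf.symm (σ := Equiv.refl V) (fun _ => rfl)
    (fun a a' => if a' = a then 1 else 0) (fun {i j} a => ?_)).copy fun i j a => ?_⟩
  · refine Eq.trans ?_ (Finset.sum_congr rfl fun a' _ => (ite_smul _ _ _ _).symm)
    simp only [one_smul, zero_smul]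
    exact (Finset.sum_ite_eq' Finset.univ a fun a' : i ⟶ j => arrow n a').trans
      (if_pos (Finset.mem_univ _)) |>.symm
  · refine Eq.trans (Finset.sum_congr rfl fun a' _ => ite_smul _ _ _ _) ?_
    simp only [one_smul, zero_smul]
    exact (Finset.sum_ite_eq' Finset.univ a fun a' : i ⟶ j => b i j a').trans
      (if_pos (Finset.mem_univ _))

end Rlz

instance (M N : ModStr C k V) : (M.idFunctor N).Additive := ⟨rfl⟩

instance (M N : ModStr C k V) : (M.idFunctor N).Linear k := ⟨fun _ _ => rfl⟩

instance (M N : ModStr C k V) : (M.idFunctor N).Full := inferInstanceAs (𝟭 (Vec k V)).Full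

instance (M N : ModStr C k V) : (M.idFunctor N).Faithful := inferInstanceAs (𝟭 (Vec k V)).Faithful

instance {M N : ModStr C k V} (s : (M.idFunctor N).LeftLinear C) :
    (ModFunctor.ofId s).functor.Full := inferInstanceAs (𝟭 (Vec k V)).Full

instance {M N : ModStr C k V} (s : (M.idFunctor N).LeftLinear C) :
    (ModFunctor.ofId s).functor.Faithful := inferInstanceAs (𝟭 (Vec k V)).Faithful

namespace Realization

/-- Framed pairs that are realized by the same basic action are isomorphic. -/
lemma framedPair_iso {x y : FramedPair C k V} (R : Realization Φ x) (R' : Realization Φ y) :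
    x.Iso y := by
  obtain ⟨s, η, h⟩ := Rlz.exists_iso (x.M.idFunctor y.M) (F' := y.F) (b' := y.basis)
    x.M.skeleton y.M.skeleton R.rlz R'.rlz
  exact ⟨s, η, h⟩

/-- A basic action that realizes a framed pair realizes the isomorphic framed pairs. -/
lemma of_framedPair_iso {x y : FramedPair C k V} (h : x.Iso y) (R : Realization Φ x) :
    Nonempty (Realization Φ y) := by
  obtain ⟨s, η, h⟩ := h
  exact ⟨((R.rlz.mapFunctor (ModFunctor.ofId s) η.hom).copy
    (b' := fun i j a => y.basis i j a) h).realization⟩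

end Realization

variable (C k V) in
/-- Basic actions are classified by framed pairs. -/
theorem quot_iso_equiv_quot_framedPair [MonoidalPreadditive C] [MonoidalLinear k C]
    [RigidCategory C] (hn : 2 ≤ n) :
    Equivalence (BasicAct.Iso (C := C) (D := quiverData k V hn)) ∧
      Equivalence (FramedPair.Iso (C := C) (k := k) (V := V)) ∧
      ∃ e : Quot (BasicAct.Iso (C := C) (D := quiverData k V hn)) ≃
          Quot (FramedPair.Iso (C := C) (k := k) (V := V)),
        ∀ (Φ : BasicAct C (quiverData k V hn)) (x : FramedPair C k V),
          e (Quot.mk _ Φ) = Quot.mk _ x ↔ Nonempty (Realization Φ x) :=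
  equivalence_and_quot_equiv (fun Φ => Φ.exists_realization)
    (fun x => (Rlz.exists_basicAct hn x.M.skeleton x.F x.basis).imp fun _ ⟨R⟩ => ⟨R.realization⟩)
    (fun {_ _ x} ⟨R⟩ ⟨R'⟩ => Rlz.iso x.M.skeleton R.rlz R'.rlz)
    (fun ⟨R⟩ ⟨R'⟩ => R.framedPair_iso R')
    (fun h ⟨R⟩ => (Rlz.of_iso h R.rlz).map Rlz.realization)
    (fun h ⟨R⟩ => R.of_framedPair_iso h)

end BasicAction

namespace BasicAction

namespace Skeleton

variable {k : Type u} [Field k] {V : Type u} [Fintype V] {𝒟 : Type*} [Category.{u} 𝒟]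
  [Preadditive 𝒟] [Linear k 𝒟] {S : V → 𝒟}

/-- The transport of a skeleton along isomorphisms. -/
@[reducible] noncomputable def ofIso (sk : Skeleton k S) {S' : V → 𝒟} (ψ : ∀ i, S i ≅ S' i) :
    Skeleton k S' where
  hom_eq_zero {i j} h f := by
    rw [← cancel_epi (ψ i).hom, ← cancel_mono (ψ j).inv, sk.hom_eq_zero h (((ψ i).hom ≫ f) ≫ _)]
    simp
  sc {i} := sk.sc ∘ₗ (Linear.homCongr k (ψ i) (ψ i)).symm.toLinearMap
  sc_id i := by simp [Linear.homCongr_symm_apply, sk.sc_id]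
  eq_smul {i} f := by
    rw [← cancel_epi (ψ i).hom, ← cancel_mono (ψ i).inv,
      sk.eq_smul (((ψ i).hom ≫ f) ≫ (ψ i).inv)]
    simp [Linear.homCongr_symm_apply]
  I := sk.I
  inn W l e := (ψ l).inv ≫ sk.inn W l e
  out W l e := sk.out W l e ≫ (ψ l).hom
  sum_out_inn W := by simpa using sk.sum_out_inn W

/-- The relabelling of a skeleton. -/
@[reducible] def reindex (sk : Skeleton k S) (σ : V ≃ V) : Skeleton k fun i => S (σ i) where
  hom_eq_zero h f := sk.hom_eq_zero (σ.injective.ne h) f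
  sc := sk.sc
  sc_id i := sk.sc_id (σ i)
  eq_smul := sk.eq_smul
  I W l := sk.I W (σ l)
  inn W l := sk.inn W (σ l)
  out W l := sk.out W (σ l)
  sum_out_inn W := (σ.sum_comp fun l => ∑ e, sk.out W l e ≫ sk.inn W l e).trans (sk.sum_out_inn W)

/-- An object with one-dimensional endomorphism space is isomorphic to a member of a skeleton. -/
lemma exists_iso_of_sc (sk : Skeleton k S) {W : 𝒟} (c : (W ⟶ W) →ₗ[k] k) (h1 : c (𝟙 W) = 1)
    (hc : ∀ f, f = c f • 𝟙 W) : ∃ j, Nonempty (W ≅ S j) := by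
  have h : ∑ l, ∑ e, c (sk.out W l e ≫ sk.inn W l e) ≠ 0 := by
    have h := congrArg c (sk.sum_out_inn W)
    simp only [map_sum, h1] at h
    exact h.trans_ne one_ne_zero
  obtain ⟨l, _, hl⟩ := Finset.exists_ne_zero_of_sum_ne_zero h
  obtain ⟨e, _, he⟩ := Finset.exists_ne_zero_of_sum_ne_zero hl
  set f := sk.out W l e
  set g := sk.inn W l e
  have hfg : f ≫ g = c (f ≫ g) • 𝟙 W := hc _
  have hgf : g ≫ f = sk.sc (g ≫ f) • 𝟙 (S l) := sk.eq_smul _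
  have h0 : f ≠ 0 := fun h0 => he (by rw [h0, Limits.zero_comp, map_zero])
  have h2 : c (f ≫ g) = sk.sc (g ≫ f) := by
    have h3 : c (f ≫ g) • f = sk.sc (g ≫ f) • f := by
      calc _ = (f ≫ g) ≫ f := by conv_rhs => rw [hfg, Linear.smul_comp, Category.id_comp]
        _ = f ≫ g ≫ f := Category.assoc _ _ _
        _ = _ := by conv_lhs => rw [hgf, Linear.comp_smul, Category.comp_id]
    exact smul_left_injective k h0 h3
  refine ⟨l, ⟨⟨f, (c (f ≫ g))⁻¹ • g, ?_, ?_⟩⟩⟩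
  · rw [Linear.comp_smul]
    exact (congrArg (_ • ·) hfg).trans (by rw [smul_smul, inv_mul_cancel₀ he, one_smul])
  · rw [Linear.smul_comp]
    exact (congrArg (_ • ·) hgf).trans (by rw [h2, smul_smul, inv_mul_cancel₀ (h2 ▸ he), one_smul])

/-- A fully faithful functor permutes the members of a skeleton. -/
lemma exists_perm (sk : Skeleton k S) {ℰ : Type*} [Category.{u} ℰ] [Preadditive ℰ] [Linear k ℰ]
    {S' : V → ℰ} (sk' : Skeleton k S') (Ψ : 𝒟 ⥤ ℰ) [Ψ.Additive] [Ψ.Linear k] [Ψ.Full]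
    [Ψ.Faithful] : ∃ ρ : V ≃ V, Nonempty (∀ i, Ψ.obj (S i) ≅ S' (ρ i)) := by
  have h : ∀ i, ∃ j, Nonempty (Ψ.obj (S i) ≅ S' j) := fun i =>
    sk'.exists_iso_of_sc (sk.sc ∘ₗ (mapHomEquiv k Ψ (S i) (S i)).symm.toLinearMap)
      (by
        have : (mapHomEquiv k Ψ (S i) (S i)).symm (𝟙 _) = 𝟙 _ := by
          rw [LinearEquiv.symm_apply_eq, mapHomEquiv_apply, Ψ.map_id]
        rw [LinearMap.comp_apply, LinearEquiv.coe_coe, this, sk.sc_id])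
      (fun f => by
        obtain ⟨g, rfl⟩ := (mapHomEquiv k Ψ (S i) (S i)).surjective f
        rw [LinearMap.comp_apply, LinearEquiv.coe_coe, LinearEquiv.symm_apply_apply]
        conv_lhs => rw [sk.eq_smul g]
        rw [map_smul, mapHomEquiv_apply, Ψ.map_id])
  choose ρ hρ using h
  have hinj : Function.Injective ρ := fun i j hij => by
    by_contra hne
    let e : Ψ.obj (S i) ≅ Ψ.obj (S j) := (hρ i).some ≪≫ eqToIso (by rw [hij]) ≪≫ (hρ j).some.symm
    have h0 : e.hom = 0 := by
      rw [← Ψ.map_preimage e.hom, sk.hom_eq_zero hne (Ψ.preimage e.hom), Ψ.map_zero]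
    have h1 : Ψ.map (𝟙 (S i)) = Ψ.map 0 := by
      rw [Ψ.map_id, Ψ.map_zero, ← e.hom_inv_id, h0, Limits.zero_comp]
    have h2 := congrArg sk.sc (Ψ.map_injective h1)
    rw [sk.sc_id, map_zero] at h2
    exact one_ne_zero h2
  exact ⟨Equiv.ofBijective ρ hinj.bijective_of_finite, ⟨fun i => (hρ i).some⟩⟩

end Skeleton

namespace Vec

variable {k V : Type u} [Field k] (ρ : V ≃ V)

/-- The equivalence of `Vec(V)` given by a permutation of the vertices. -/
def permEquivalence : Vec k V ≌ Vec k V := (Discrete.equivalence ρ).symm.congrLeft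

/-- The functor given by a permutation of the vertices. -/
def perm : Vec k V ⥤ Vec k V := (permEquivalence ρ).functor

instance : (perm (k := k) ρ).IsEquivalence := inferInstanceAs (permEquivalence ρ).functor.IsEquivalence

instance : (perm (k := k) ρ).Additive := ⟨rfl⟩

instance : (perm (k := k) ρ).Linear k := ⟨fun _ _ => rfl⟩

/-- The value of a permutation on a simple object. -/
noncomputable def permSimple (i j : V) (h : j = ρ.symm i) : (perm ρ).obj (simple (k := k) i) ≅ simple j :=
  Discrete.natIso fun l => LinearEquiv.toFGModuleCatIso <|
    LinearEquiv.funCongrLeft k k (Equiv.plift.trans ((Equiv.ofIff (by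
      subst h; exact ρ.symm_apply_eq)).trans Equiv.plift.symm))

lemma finite_hom (i : V) (W : Vec k V) : Module.Finite k (simple i ⟶ W) :=
  Module.Finite.equiv (elemEquiv W i)

end Vec

end BasicAction

namespace BasicAction

open MonoidalLeftAction Functor.LaxLeftLinear Functor.OplaxLeftLinear TruncatedPathAlgebra

variable {C : Type w} [Category.{v} C] [Preadditive C] [MonoidalCategory C]
variable {k V : Type u} [Field k] [Linear k C] [Quiver.{u} V] [Fintype V]
  [∀ i j : V, Fintype (i ⟶ j)] {n : ℕ} {hn : 2 ≤ n} {Φ Φ' : BasicAct C (quiverData k V hn)}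

namespace Rlz

section Twist

variable {M : ModStr C k V} {F : Dual M} {S S' : V → M.Cat}

/-- Basic actions that are realized by the same object, up to a relabelling of the simple objects
and a change of bases, are isomorphic up to an automorphism. -/
lemma twistedIso {b : ∀ i j : V, Module.Basis (i ⟶ j) k (S i ⟶ F.functor.obj (S j))}
    {b' : ∀ i j : V, Module.Basis (i ⟶ j) k (S' i ⟶ F.functor.obj (S' j))}
    (R : Rlz Φ F S fun i j a => b i j a) (R' : Rlz Φ' F S' fun i j a => b' i j a)
    (sk : Skeleton k S') (τ : V ≃ V) (hτ : ∀ i, S i = S' (τ i)) : Φ.TwistedIso Φ' := by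
  obtain rfl : S = fun i => S' (τ i) := funext hτ
  obtain ⟨t, ht, he⟩ := exists_aut n τ (fun i j => (b i j).repr.symm ≪≫ₗ (b' (τ i) (τ j)).repr) hn
  refine BasicAct.twistedIso_iff.2 ⟨t, _, (cornerTwist R R' sk ht
    (fun {i j} a a' => (b' (τ i) (τ j)).repr (b i j a) a') (fun {i j} a => ?_)
    (fun {i j} a => ((b' (τ i) (τ j)).sum_repr (b i j a)).symm)).degZeroTwist.isTwist⟩
  rw [← arrowSum_single, he, LinearEquiv.trans_apply, Module.Basis.repr_symm_single_one,
    arrowSum_apply]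

/-- A basic action that is isomorphic, up to an automorphism, to one that is realized by an object,
is realized by the object up to a relabelling of the simple objects and a change of bases. -/
lemma of_twistedIso {b : ∀ i j : V, Module.Basis (i ⟶ j) k (S i ⟶ F.functor.obj (S j))}
    (R : Rlz Φ F S fun i j a => b i j a) (h : Φ.TwistedIso Φ') :
    ∃ (σ : V ≃ V) (b' : ∀ i j : V, Module.Basis (i ⟶ j) k (S (σ i) ⟶ F.functor.obj (S (σ j)))),
      Nonempty (Rlz Φ' F (fun i => S (σ i)) fun i j a => b' i j a) := by
  obtain ⟨t, f, hf⟩ := BasicAct.twistedIso_iff.1 h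
  obtain ⟨σ, e, hσ, he⟩ := exists_of_aut t.symm
  refine ⟨σ, fun i j => Module.Basis.ofRepr ((b (σ i) (σ j)).repr ≪≫ₗ (e i j).symm),
    ⟨(R.twist hf.symm hσ (fun {i j} a a' => e i j (Finsupp.single a 1) a') fun {i j} a => ?_).copy
      fun i j a => ?_⟩⟩
  · rw [← arrowSum_single, he, arrowSum_apply]
  · rw [← Module.Basis.repr_symm_single_one]
    change _ = (b (σ i) (σ j)).repr.symm (e i j (Finsupp.single a 1))
    rw [Module.Basis.repr_symm_apply, Finsupp.linearCombination_apply,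
      Finsupp.sum_fintype _ _ (by simp)]

end Twist

section Pairs

variable {x y : DualPair C k V}

/-- Pairs that are realized by the same basic action, up to a relabelling of the simple objects, are
equivalent. -/
lemma dualPair_equiv {σ σ' : V ≃ V}
    {b : ∀ i j : V, Module.Basis (i ⟶ j) k
      (x.M.simple (σ i) ⟶ x.F.functor.obj (x.M.simple (σ j)))}
    {b' : ∀ i j : V, Module.Basis (i ⟶ j) k
      (y.M.simple (σ' i) ⟶ y.F.functor.obj (y.M.simple (σ' j)))}
    (R : Rlz Φ x.F (fun i => x.M.simple (σ i)) fun i j a => b i j a)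
    (R' : Rlz Φ y.F (fun i => y.M.simple (σ' i)) fun i j a => b' i j a) :
    DualPair.Equiv C k V x y := by
  let Ψ : x.M.Cat ⥤ y.M.Cat := Vec.perm (σ'.symm.trans σ)
  have h1 : Ψ.IsEquivalence := inferInstanceAs (Vec.perm (k := k) (σ'.symm.trans σ)).IsEquivalence
  have h2 : Ψ.Additive := inferInstanceAs (Vec.perm (k := k) (σ'.symm.trans σ)).Additive
  have h3 : Ψ.Linear k := inferInstanceAs ((Vec.perm (k := k) (σ'.symm.trans σ)).Linear k)
  let ψ : ∀ i, y.M.simple (σ' i) ≅ Ψ.obj (x.M.simple (σ i)) := fun i =>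
    (Vec.permSimple (σ'.symm.trans σ) (σ i) (σ' i) (by simp)).symm
  obtain ⟨s, η, -⟩ := exists_iso Ψ (F := x.F) (F' := y.F) (b := b)
    (b' := fun i j => (b' i j).map (Linear.homCongr k (ψ i) (y.F.functor.mapIso (ψ j))))
    (x.M.skeleton.reindex σ) ((y.M.skeleton.reindex σ').ofIso ψ) R
    ((R'.changeSimple ψ).copy fun i j a => by
      rw [Module.Basis.map_apply, Linear.homCongr_apply]; rfl)
  exact ⟨{ functor := Ψ }, h1, ⟨η⟩⟩

/-- The components of an isomorphism of module functors. -/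
@[reducible] def _root_.BasicAction.ModFunctor.compIso {M M' : ModStr C k V} {F : Dual M}
    {F' : Dual M'} {Ψ : ModFunctor M M'} (η : F.comp Ψ ≅ Ψ.comp F') (W : M.Cat) :
    Ψ.functor.obj (F.functor.obj W) ≅ F'.functor.obj (Ψ.functor.obj W) where
  hom := ModFunctor.compApp η.hom W
  inv := η.inv.app.app W
  hom_inv_id := congrArg (fun f : F.comp Ψ ⟶ F.comp Ψ => f.app.app W) η.hom_inv_id
  inv_hom_id := congrArg (fun f : Ψ.comp F' ⟶ Ψ.comp F' => f.app.app W) η.inv_hom_id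

/-- A basic action that is realized by a pair, up to a relabelling of the simple objects, is
realized by the equivalent pairs. -/
lemma of_dualPair_equiv (h : DualPair.Equiv C k V x y) {σ : V ≃ V}
    {b : ∀ i j : V, Module.Basis (i ⟶ j) k
      (x.M.simple (σ i) ⟶ x.F.functor.obj (x.M.simple (σ j)))}
    (R : Rlz Φ x.F (fun i => x.M.simple (σ i)) fun i j a => b i j a) :
    ∃ (σ' : V ≃ V) (b' : ∀ i j : V, Module.Basis (i ⟶ j) k
      (y.M.simple (σ' i) ⟶ y.F.functor.obj (y.M.simple (σ' j)))),
      Nonempty (Rlz Φ y.F (fun i => y.M.simple (σ' i)) fun i j a => b' i j a) := by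
  obtain ⟨Ψ, hΨ, ⟨η⟩⟩ := h
  obtain ⟨ρ, ⟨ψ⟩⟩ := x.M.skeleton.exists_perm y.M.skeleton Ψ.functor
  let ψ' : ∀ i, Ψ.functor.obj (x.M.simple (σ i)) ≅ y.M.simple ((σ.trans ρ) i) := fun i => ψ (σ i)
  refine ⟨σ.trans ρ, fun i j => (b i j).map (mapHomEquiv k Ψ.functor _ _ ≪≫ₗ
    Linear.homCongr k (ψ' i) (ModFunctor.compIso η _ ≪≫ y.F.functor.mapIso (ψ' j))),
    ⟨((R.mapFunctor Ψ η.hom).changeSimple ψ').copy fun i j a => ?_⟩⟩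
  rw [Module.Basis.map_apply, LinearEquiv.trans_apply, Linear.homCongr_apply, mapHomEquiv_apply,
    Category.assoc]
  rfl

end Pairs

end Rlz

/-- The relation between basic actions and pairs, up to a relabelling of the simple objects. -/
def BasicAct.Realizes (Φ : BasicAct C (quiverData k V hn)) (p : DualPair C k V) : Prop :=
  ∃ (σ : V ≃ V) (b : ∀ i j : V, Module.Basis (i ⟶ j) k
    (p.M.simple (σ i) ⟶ p.F.functor.obj (p.M.simple (σ j)))),
    Nonempty (Rlz Φ p.F (fun i => p.M.simple (σ i)) fun i j a => b i j a)

lemma Realization.realizes {x : FramedPair C k V} (R : Realization Φ x) :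
    Φ.Realizes x.toDualPair := ⟨Equiv.refl V, x.basis, ⟨R.rlz⟩⟩

lemma FramedPair.quiverIso (x : FramedPair C k V) : QuiverIso V (FusionGraph x.F) :=
  ⟨Equiv.refl V, fun i j => ⟨Fintype.equivFinOfCardEq (Module.finrank_eq_card_basis (x.basis i j)).symm⟩⟩

lemma GraphPair.exists_basis (p : GraphPair C k V) : ∃ σ : V ≃ V, Nonempty (∀ i j : V,
    Module.Basis (i ⟶ j) k (p.1.M.simple (σ i) ⟶ p.1.F.functor.obj (p.1.M.simple (σ j)))) := by
  obtain ⟨σ, h⟩ := p.2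
  have hf : ∀ (i : V) (W : p.1.M.Cat), Module.Finite k (p.1.M.simple i ⟶ W) := fun i W => Vec.finite_hom i W
  exact ⟨σ, ⟨fun i j => haveI := hf (σ i) (p.1.F.functor.obj (p.1.M.simple (σ j)))
    (Module.finBasis k _).reindex (h i j).some.symm⟩⟩

variable (C k V) in
/-- Basic actions up to automorphisms are classified by pairs. -/
theorem quot_twistedIso_equiv_quot_graphPair [MonoidalPreadditive C] [MonoidalLinear k C]
    [RigidCategory C] (hn : 2 ≤ n) :
    Equivalence (BasicAct.TwistedIso (C := C) (D := quiverData k V hn)) ∧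
      Equivalence (fun p q : GraphPair C k V => DualPair.Equiv C k V p.1 q.1) ∧
      ∃ e : Quot (BasicAct.TwistedIso (C := C) (D := quiverData k V hn)) ≃
          Quot (fun p q : GraphPair C k V => DualPair.Equiv C k V p.1 q.1),
        ∀ (Φ : BasicAct C (quiverData k V hn)) (p : GraphPair C k V),
          e (Quot.mk _ Φ) = Quot.mk _ p ↔
            ∃ x : FramedPair C k V, Nonempty (Realization Φ x) ∧
              DualPair.Equiv C k V x.toDualPair p.1 := by
  have key : ∀ (Φ : BasicAct C (quiverData k V hn)) (p : GraphPair C k V), Φ.Realizes p.1 ↔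
      ∃ x : FramedPair C k V, Nonempty (Realization Φ x) ∧
        DualPair.Equiv C k V x.toDualPair p.1 := fun Φ p =>
    ⟨fun ⟨σ, b, ⟨R'⟩⟩ => Φ.exists_realization.imp fun x ⟨R⟩ =>
      ⟨⟨R⟩, Rlz.dualPair_equiv (σ := Equiv.refl V) (b := x.basis) R.rlz R'⟩,
      fun ⟨x, ⟨R⟩, h⟩ => Rlz.of_dualPair_equiv h (σ := Equiv.refl V) (b := x.basis) R.rlz⟩
  simp only [← key]
  refine equivalence_and_quot_equiv (fun Φ => ?_) (fun p => ?_) ?_ ?_ ?_ ?_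
  · obtain ⟨x, ⟨R⟩⟩ := Φ.exists_realization
    exact ⟨⟨x.toDualPair, x.quiverIso⟩, R.realizes⟩
  · obtain ⟨σ, ⟨b⟩⟩ := p.exists_basis
    obtain ⟨Φ, R⟩ := Rlz.exists_basicAct hn (p.1.M.skeleton.reindex σ) p.1.F b
    exact ⟨Φ, σ, b, R⟩
  · rintro Φ Φ' p ⟨σ, b, ⟨R⟩⟩ ⟨σ', b', ⟨R'⟩⟩
    exact R.twistedIso R' (p.1.M.skeleton.reindex σ') (σ.trans σ'.symm) (fun i => by simp)
  · rintro Φ p q ⟨σ, b, ⟨R⟩⟩ ⟨σ', b', ⟨R'⟩⟩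
    exact Rlz.dualPair_equiv R R'
  · rintro Φ Φ' p h ⟨σ, b, ⟨R⟩⟩
    obtain ⟨σ', b', R'⟩ := R.of_twistedIso h
    exact ⟨σ'.trans σ, b', R'⟩
  · rintro Φ p q h ⟨σ, b, ⟨R⟩⟩
    exact Rlz.of_dualPair_equiv h R

end BasicAction

open BasicAction TruncatedPathAlgebra in
theorem mainTheorem2 {C : Type w} [Category.{v} C] [Abelian C] [Linear ℂ C] [MonoidalCategory C]
    [MonoidalPreadditive C] [MonoidalLinear ℂ C] [RigidCategory C] [IsFusionCategory ℂ C]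
    {V : Type} [Fintype V] [Quiver.{0} V] [∀ i j : V, Fintype (i ⟶ j)] {n : ℕ} (hn : 2 ≤ n) :
    (Equivalence (BasicAct.Iso (C := C) (D := quiverData ℂ V hn)) ∧
      Equivalence (FramedPair.Iso (C := C) (k := ℂ) (V := V)) ∧
      ∃ e : Quot (BasicAct.Iso (C := C) (D := quiverData ℂ V hn)) ≃
          Quot (FramedPair.Iso (C := C) (k := ℂ) (V := V)),
        ∀ (Φ : BasicAct C (quiverData ℂ V hn)) (x : FramedPair C ℂ V),
          e (Quot.mk _ Φ) = Quot.mk _ x ↔ Nonempty (Realization Φ x)) ∧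
    (Equivalence (BasicAct.TwistedIso (C := C) (D := quiverData ℂ V hn)) ∧
      Equivalence (fun p q : GraphPair C ℂ V => DualPair.Equiv C ℂ V p.1 q.1) ∧
      ∃ e : Quot (BasicAct.TwistedIso (C := C) (D := quiverData ℂ V hn)) ≃
          Quot (fun p q : GraphPair C ℂ V => DualPair.Equiv C ℂ V p.1 q.1),
        ∀ (Φ : BasicAct C (quiverData ℂ V hn)) (p : GraphPair C ℂ V),
          e (Quot.mk _ Φ) = Quot.mk _ p ↔
            ∃ x : FramedPair C ℂ V, Nonempty (Realization Φ x) ∧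
              DualPair.Equiv C ℂ V x.toDualPair p.1) :=
  ⟨quot_iso_equiv_quot_framedPair C ℂ V hn, quot_twistedIso_equiv_quot_graphPair C ℂ V hn⟩
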